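/- **Setting.** A (classical, fixed-length) symmetric-key encryption scheme $\Pi=(\mathsf{KeyGen},\mathsf{Enc},\mathsf{Dec})$ consists of classical algorithms running in time polynomial in the security parameter $n$: $\mathsf{KeyGen}(1^n)$ and $\mathsf{Enc}_k(m;r)$ are probabilistic (with polynomially many uniformly random coins; $r$ denotes the coins of $\mathsf{Enc}$), $\mathsf{Dec}_k(c)$ is deterministic, messages $m$ and ciphertexts $c$ have lengths $\ell(n)$ and $\lambda(n)$ that are polynomial-time computable from $1^n$, and $\mathsf{Dec}_k(\mathsf{Enc}_k(m))=m$ except with negligible probability (for all $m$, over $k$ and the coins). A function is negligible, $\mathrm{negl}(n)$, if it vanishes faster than every inverse polynomial. A QPT is a polynomial-time uniform family of quantum circuits made of unitary gates, measurements and oracle gates; an algorithm with several rounds is split into one circuit per round and passes on its internal quantum state. A query to $\mathsf{Dec}_k$ applies $|c\rangle|y\rangle\mapsto|c\rangle|y\oplus\mathsf{Dec}_k(c)\rangle$; a query to $\mathsf{Enc}_k$ applies $|m\rangle|y\rangle\mapsto|m\rangle|y\oplus\mathsf{Enc}_k(m;r)\rangle$ with fresh uniformly random $r$. **IND-QCCA1.**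 In the game $\mathsf{IndGame}(\Pi,\mathcal A,n)$, a key $k\leftarrow\mathsf{KeyGen}(1^n)$ and a uniformly random bit $b$ are generated; $\mathcal A$ gets quantum oracle access to $\mathsf{Enc}_k$ and $\mathsf{Dec}_k$ and outputs messages $(m_0,m_1)$; then $\mathcal A$ receives $\mathsf{Enc}_k(m_b)$, gets quantum oracle access to $\mathsf{Enc}_k$ only, and outputs a bit $b'$. It wins if $b'=b$. $\Pi$ is IND-QCCA1-secure if every QPT $\mathcal A$ wins with probability at most $\tfrac12+\mathrm{negl}(n)$. **SEM-QCCA1.** In the game $\mathsf{SemGame}(\beta)$, $\beta\in\{\mathsf{real},\mathsf{sim}\}$, a key $k\leftarrow\mathsf{KeyGen}(1^n)$ is generated; $\mathcal A$ gets quantum oracle access to $\mathsf{Enc}_k$ and $\mathsf{Dec}_k$ and outputs a challenge template $(\mathsf{Samp},h,f)$ of classical Boolean circuits, where $\mathsf{Samp}$ maps uniformly random coins to a message and $h,f$ are functions of a message; a message $m\leftarrow\mathsf{Samp}$ is drawn; $\mathcal A$ receives $h(m)$ and, if $\beta=\mathsf{real}$, also $\mathsf{Enc}_k(m)$, gets quantum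 oracle access to $\mathsf{Enc}_k$ only, and outputs a string $s$. It wins if $s=f(m)$. (The sizes of the circuits in the template, including the lengths of the values of $h$ and $f$, are functions of $n$ fixed by the adversary.) $\Pi$ is SEM-QCCA1-secure if for every QPT $\mathcal A$ there is a QPT $\mathcal S$ such that the templates output by $\mathcal A$ and $\mathcal S$ are identically distributed and $$\bigl|\Pr[\mathcal A\text{ wins }\mathsf{SemGame}(\mathsf{real})]-\Pr[\mathcal S\text{ wins }\mathsf{SemGame}(\mathsf{sim})]\bigr|\le\mathrm{negl}(n).$$ **Theorem.** A classical symmetric-key encryption scheme $\Pi$ is IND-QCCA1-secure if and only if it is SEM-QCCA1-secure. -/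

import Mathlib

open scoped Matrix

noncomputable section

namespace QCCA

/-! ### Bit strings, averages, negligible functions, polynomial time -/

/-- Bit strings of length `n`. -/
abbrev Bits (n : ℕ) : Type := Fin n → Bool

/-- The average of `f` over a uniformly random element of a finite type. -/
def avg {α : Type} [Fintype α] (f : α → ℝ) : ℝ := (∑ a, f a) / Fintype.card α

/-- `ε` vanishes faster than every inverse polynomial. -/
def Negligible (ε : ℕ → ℝ) : Prop :=
  Asymptotics.SuperpolynomialDecay Filter.atTop (fun n : ℕ => (n : ℝ)) ε

/-- A list of naturals as a bit string: every entry `k` becomes `1^k 0`. -/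
def natsToBits (l : List ℕ) : List Bool :=
  l.flatMap fun k => List.replicate k true ++ [false]

/-- Self-delimiting encoding of a tuple of bit strings:
every bit `b` becomes `1 b`, and every string is closed by `0`. -/
def packStrings (l : List (List Bool)) : List Bool :=
  l.flatMap fun s => (s.flatMap fun b => [true, b]) ++ [false]

/-- `f`, with its arguments presented through the encoding `ea`, is computed in polynomial time
by a (multi-stack) Turing machine. -/
def PolyTime {α : Type} (ea : α → List Bool) (f : α → List Bool) : Prop :=
  Nonempty (Turing.TM2ComputableInPolyTime ea (id : List Bool → List Bool) f)

/-- A sequence of descriptions (lists of naturals) is polynomial-time uniform: a Turing machine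
prints the description number `n` on input `1^n` in time polynomial in `n`. -/
def PolyUniform (d : ℕ → List ℕ) : Prop :=
  PolyTime Computability.unaryEncodeNat fun n => natsToBits (d n)

/-! ### Symmetric-key encryption -/

/-- A classical fixed-length symmetric-key encryption scheme: probabilistic polynomial-time
algorithms, whose coins are explicit uniformly random bit strings. -/
structure Scheme where
  /-- lengths (as functions of the security parameter) of the coins of key generation,
  of the messages, of the ciphertexts, and of the coins of encryption -/
  keyCoins : ℕ → ℕ
  msgLen : ℕ → ℕ
  ctLen : ℕ → ℕ
  encCoins : ℕ → ℕ
  keyGen : (n : ℕ) → Bits (keyCoins n) → List Bool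
  enc : (n : ℕ) → (k : List Bool) → (r : Bits (encCoins n)) → Bits (msgLen n) → Bits (ctLen n)
  dec : (n : ℕ) → (k : List Bool) → Bits (ctLen n) → Bits (msgLen n)
  keyCoins_poly : ∃ p : Polynomial ℕ, ∀ n, keyCoins n ≤ p.eval n
  encCoins_poly : ∃ p : Polynomial ℕ, ∀ n, encCoins n ≤ p.eval n
  msgLen_poly : PolyUniform fun n => [msgLen n]
  ctLen_poly : PolyUniform fun n => [ctLen n]
  keyGen_poly : PolyTime
    (fun x : (n : ℕ) × Bits (keyCoins n) =>
      packStrings [List.replicate x.1 true, List.ofFn x.2])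
    (fun x => keyGen x.1 x.2)
  enc_poly : PolyTime
    (fun x : (n : ℕ) × (List Bool × Bits (encCoins n) × Bits (msgLen n)) =>
      packStrings [List.replicate x.1 true, x.2.1, List.ofFn x.2.2.1, List.ofFn x.2.2.2])
    (fun x => List.ofFn (enc x.1 x.2.1 x.2.2.1 x.2.2.2))
  dec_poly : PolyTime
    (fun x : (n : ℕ) × (List Bool × Bits (ctLen n)) =>
      packStrings [List.replicate x.1 true, x.2.1, List.ofFn x.2.2])
    (fun x => List.ofFn (dec x.1 x.2.1 x.2.2))
  /-- Decryption inverts encryption except with negligible probability. -/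
  correct : ∃ ε : ℕ → ℝ, Negligible ε ∧ ∀ (n : ℕ) (m : Bits (msgLen n)),
    avg (fun s : Bits (keyCoins n) => avg fun r : Bits (encCoins n) =>
      if dec n (keyGen n s) (enc n (keyGen n s) r m) = m then 0 else 1) ≤ ε n

/-! ### Quantum circuits with oracle gates

The qubits of a register are labelled by a finite type `W`; computational basis states are the
functions `W → Bool`; states are density matrices. -/

/-- Operators on the register with qubits `W` (in particular density matrices). -/
abbrev Op (W : Type) : Type := Matrix (W → Bool) (W → Bool) ℂ

/-- Unitary gates (a universal set), computational basis measurement, and oracle gates. The wires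
of an oracle gate are its query register (left summand) and its response register (right summand);
`ℓ` and `c` are the lengths of messages and ciphertexts. -/
inductive Gate (ℓ c : ℕ) (W : Type) : Type where
  | hadamard (i : W)
  | tgate (i : W)
  | not (i : W)
  | cnot (e : Fin 2 ↪ W)
  | toffoli (e : Fin 3 ↪ W)
  | measure (i : W)
  | encrypt (e : Fin ℓ ⊕ Fin c ↪ W)
  | decrypt (e : Fin c ⊕ Fin ℓ ↪ W)

/-- The gate is a decryption query. -/
def Gate.IsDecrypt {ℓ c : ℕ} {W : Type} : Gate ℓ c W → Prop
  | .decrypt _ => True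
  | _ => False

section Semantics

variable {W : Type} [Fintype W] [DecidableEq W]

/-- The operator `u` on qubit `i`, tensored with the identity on the other qubits. -/
def onQubit (i : W) (u : Matrix Bool Bool ℂ) : Op W :=
  fun x y => if ∀ j, j ≠ i → x j = y j then u (x i) (y i) else 0

/-- The operator `|y⟩ ↦ |g y⟩`. -/
def basisMap (g : (W → Bool) → (W → Bool)) : Op W :=
  fun x y => if x = g y then 1 else 0

/-- The Hadamard matrix. -/
def hadamardMatrix : Matrix Bool Bool ℂ :=
  fun a b => ((Real.sqrt 2 : ℝ) : ℂ)⁻¹ * (if a && b then -1 else 1)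

/-- The matrix `diag (1, exp (iπ/4))`. -/
def tMatrix : Matrix Bool Bool ℂ :=
  Matrix.diagonal fun b => if b then Complex.exp (Complex.I * Real.pi / 4) else 1

/-- The oracle unitary `|x⟩|y⟩ ↦ |x⟩|y ⊕ F x⟩`, on the query wires `e (inl _)` and the response
wires `e (inr _)`. -/
def oracleUnitary {a b : ℕ} (F : Bits a → Bits b) (e : Fin a ⊕ Fin b ↪ W) : Op W :=
  basisMap fun y w =>
    y w ^^ decide (∃ j : Fin b, e (Sum.inr j) = w ∧ F (fun i => y (e (Sum.inl i))) j = true)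

/-- The action `ρ ↦ U ρ U*`. -/
def conj (U ρ : Op W) : Op W := U * ρ * Uᴴ

/-- The action of a gate on density matrices. The encryption oracle `E` takes coins and a
message; every encryption query applies the oracle unitary for fresh uniform coins. -/
def Gate.apply {ℓ c R : ℕ} (E : Bits R → Bits ℓ → Bits c) (D : Bits c → Bits ℓ) :
    Gate ℓ c W → Op W → Op W
  | .hadamard i, ρ => conj (onQubit i hadamardMatrix) ρ
  | .tgate i, ρ => conj (onQubit i tMatrix) ρ
  | .not i, ρ => conj (basisMap fun y => Function.update y i (!y i)) ρ
  | .cnot e, ρ => conj (basisMap fun y => Function.update y (e 1) (y (e 1) ^^ y (e 0))) ρ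
  | .toffoli e, ρ =>
      conj (basisMap fun y => Function.update y (e 2) (y (e 2) ^^ (y (e 0) && y (e 1)))) ρ
  | .measure i, ρ => fun x y => if x i = y i then ρ x y else 0
  | .encrypt e, ρ =>
      (Fintype.card (Bits R) : ℂ)⁻¹ • ∑ r : Bits R, conj (oracleUnitary (E r) e) ρ
  | .decrypt e, ρ => conj (oracleUnitary D e) ρ

/-- The action of a circuit; the head of the list is applied first. -/
def run {ℓ c R : ℕ} (E : Bits R → Bits ℓ → Bits c) (D : Bits c → Bits ℓ)
    (C : List (Gate ℓ c W)) (ρ : Op W) : Op W :=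
  C.foldl (fun σ g => g.apply E D σ) ρ

/-- The pure basis state `|v⟩⟨v|`. -/
def ket (v : W → Bool) : Op W := fun x y => if x = v ∧ y = v then 1 else 0

/-- The probability that measuring the wires `out` yields the string `s`. -/
def outcomeProb {o : ℕ} (out : Fin o ↪ W) (s : Bits o) (ρ : Op W) : ℝ :=
  ∑ x : W → Bool, if (fun i => x (out i)) = s then (ρ x x).re else 0

/-- The total probability of a subnormalized state. -/
def mass (ρ : Op W) : ℝ := ∑ x : W → Bool, (ρ x x).re

end Semantics

/-- The subnormalized state of the register `M` after measuring the register `O` with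
outcome `t`; its trace is the probability of this outcome. -/
def postState {O M : Type} (t : O → Bool) (ρ : Op (O ⊕ M)) : Op M :=
  fun x y => ρ (Sum.elim t x) (Sum.elim t y)

/-- The product state of `ρ` and `σ`. -/
def tensor {A B : Type} (ρ : Op A) (σ : Op B) : Op (A ⊕ B) :=
  fun x y => ρ (x ∘ Sum.inl) (y ∘ Sum.inl) * σ (x ∘ Sum.inr) (y ∘ Sum.inr)

/-! ### Two-stage oracle algorithms -/

/-- The circuits, for one security parameter, of an algorithm that acts in two stages. In the
first stage, `pre` acts on the all-zero state of a register `O` and `mem` memory qubits; `O` is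
then measured and output. In the second stage, `post` acts on the memory, on an input register
`I` and on `anc` qubits in the state zero, and the wires `out` are measured and output.
Only the first stage may query decryption. -/
structure TwoStage (ℓ c : ℕ) (O I : Type) (o : ℕ) where
  mem : ℕ
  anc : ℕ
  pre : List (Gate ℓ c (O ⊕ Fin mem))
  post : List (Gate ℓ c ((Fin mem ⊕ I) ⊕ Fin anc))
  out : Fin o ↪ ((Fin mem ⊕ I) ⊕ Fin anc)
  post_noDecrypt : ∀ g ∈ post, ¬ g.IsDecrypt

namespace TwoStage

variable {ℓ c R o : ℕ} {O I : Type} [Fintype O] [DecidableEq O] [Fintype I] [DecidableEq I]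

/-- The subnormalized memory state after the first stage has output `t`. -/
def firstStage (A : TwoStage ℓ c O I o) (E : Bits R → Bits ℓ → Bits c) (D : Bits c → Bits ℓ)
    (t : O → Bool) : Op (Fin A.mem) :=
  postState t (run E D A.pre (ket fun _ => false))

/-- The probability that the first stage outputs `t`. -/
def firstProb (A : TwoStage ℓ c O I o) (E : Bits R → Bits ℓ → Bits c) (D : Bits c → Bits ℓ)
    (t : O → Bool) : ℝ :=
  mass (A.firstStage E D t)

/-- The probability that the first stage outputs `t` and then the second stage, on input `v`,
outputs `s`. -/
def prob (A : TwoStage ℓ c O I o) (E : Bits R → Bits ℓ → Bits c) (D : Bits c → Bits ℓ)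
    (t : O → Bool) (v : I → Bool) (s : Bits o) : ℝ :=
  outcomeProb A.out s
    (run E D A.post (tensor (tensor (A.firstStage E D t) (ket v)) (ket fun _ => false)))

end TwoStage

/-! ### Descriptions of circuits -/

/-- Names of wires as lists of naturals. -/
class WireName (W : Type) where
  name : W → List ℕ

instance (n : ℕ) : WireName (Fin n) := ⟨fun i => [i.val]⟩

instance (A B : Type) [WireName A] [WireName B] : WireName (A ⊕ B) :=
  ⟨Sum.elim (fun a => 0 :: WireName.name a) (fun b => 1 :: WireName.name b)⟩

instance (A B : Type) [WireName A] [WireName B] : WireName (A × B) :=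
  ⟨fun p => WireName.name p.1 ++ WireName.name p.2⟩

/-- The names of the wires in the range of `e`, in order. -/
def wireList {a : ℕ} {W : Type} [WireName W] (e : Fin a → W) : List ℕ :=
  (List.ofFn e).flatMap WireName.name

/-- The description of a gate: a nonzero operation code and the wires. -/
def Gate.describe {ℓ c : ℕ} {W : Type} [WireName W] : Gate ℓ c W → List ℕ
  | .hadamard i => 1 :: WireName.name i
  | .tgate i => 2 :: WireName.name i
  | .not i => 3 :: WireName.name i
  | .cnot e => 4 :: wireList e
  | .toffoli e => 5 :: wireList e
  | .measure i => 6 :: WireName.name i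
  | .encrypt e => 7 :: (wireList (fun i => e (Sum.inl i)) ++ wireList (fun j => e (Sum.inr j)))
  | .decrypt e => 8 :: (wireList (fun i => e (Sum.inl i)) ++ wireList (fun j => e (Sum.inr j)))

/-- The description of a two-stage algorithm; each circuit is closed by the code `0`. -/
def TwoStage.describe {ℓ c o : ℕ} {O I : Type} [WireName O] [WireName I]
    (A : TwoStage ℓ c O I o) : List ℕ :=
  [A.mem, A.anc] ++ A.pre.flatMap Gate.describe ++ [0] ++ A.post.flatMap Gate.describe ++ [0]
    ++ wireList A.out

/-! ### Classical circuits and challenge templates -/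

/-- Positions in the adjacency matrix of a Boolean circuit with `a` inputs, `g` internal gates and
`b` output gates. -/
abbrev CircuitIdx (a g b : ℕ) : Type := Fin (g + b) × Fin (a + (g + b))

/-- Boolean circuits of NAND gates of arbitrary fan-in, given by their adjacency matrix. The wires
are the `a` inputs, followed by the gates in topological order, the last `b` of which are the
outputs; gate `t` computes the NAND of those earlier wires `j` for which the bit `(t, j)` is set
(bits for wires that are not earlier are ignored). -/
abbrev BoolCircuit (a g b : ℕ) : Type := CircuitIdx a g b → Bool

/-- Evaluation of gate `t`, given the values of the earlier wires. -/
def BoolCircuit.step {a g b : ℕ} (C : BoolCircuit a g b) (w : Bits (a + (g + b)))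
    (t : Fin (g + b)) : Bits (a + (g + b)) :=
  Function.update w (Fin.natAdd a t)
    (!decide (∀ j, j < Fin.natAdd a t → C (t, j) = true → w j = true))

/-- Evaluation of a circuit. -/
def BoolCircuit.eval {a g b : ℕ} (C : BoolCircuit a g b) (x : Bits a) : Bits b :=
  fun i => (List.finRange (g + b)).foldl C.step (Fin.append x fun _ => false)
    (Fin.natAdd a (Fin.natAdd g i))

/-- The sizes of the circuits in a challenge template: the number of coins of the sampler, the
lengths of the values of `h` and `f`, and the numbers of internal gates. -/
structure TemplateFormat where
  coins : ℕ
  hLen : ℕ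
  fLen : ℕ
  sampGates : ℕ
  hGates : ℕ
  fGates : ℕ

/-- The positions of the bits of a challenge template. -/
abbrev TemplateFormat.Idx (φ : TemplateFormat) (ℓ : ℕ) : Type :=
  (CircuitIdx φ.coins φ.sampGates ℓ ⊕ CircuitIdx ℓ φ.hGates φ.hLen) ⊕
    CircuitIdx ℓ φ.fGates φ.fLen

/-- A challenge template: circuits for a plaintext sampler and for the functions `h` and `f`. -/
abbrev Template (φ : TemplateFormat) (ℓ : ℕ) : Type := φ.Idx ℓ → Bool

namespace Template

variable {φ : TemplateFormat} {ℓ : ℕ}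

/-- The plaintext sampler, as a function of its uniformly random coins. -/
def samp (t : Template φ ℓ) (u : Bits φ.coins) : Bits ℓ :=
  BoolCircuit.eval (fun i => t (Sum.inl (Sum.inl i))) u

/-- The side information about the plaintext. -/
def h (t : Template φ ℓ) (m : Bits ℓ) : Bits φ.hLen :=
  BoolCircuit.eval (fun i => t (Sum.inl (Sum.inr i))) m

/-- The target function. -/
def f (t : Template φ ℓ) (m : Bits ℓ) : Bits φ.fLen :=
  BoolCircuit.eval (fun i => t (Sum.inr i)) m

end Template

/-- The description of a template format. -/
def TemplateFormat.describe (φ : TemplateFormat) : List ℕ :=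
  [φ.coins, φ.hLen, φ.fLen, φ.sampGates, φ.hGates, φ.fGates]

/-! ### The security notions -/

namespace Scheme

variable (S : Scheme) {n : ℕ}

/-- An adversary in the indistinguishability game for security parameter `n`: it outputs two
messages, receives a ciphertext and outputs a bit. -/
abbrev IndAdversary (n : ℕ) : Type :=
  TwoStage (S.msgLen n) (S.ctLen n) (Fin (S.msgLen n) ⊕ Fin (S.msgLen n)) (Fin (S.ctLen n)) 1

/-- An adversary in the semantic security game: it outputs a template, receives `h m` and a
ciphertext, and outputs a string. -/
abbrev SemAdversary (n : ℕ) (φ : TemplateFormat) : Type :=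
  TwoStage (S.msgLen n) (S.ctLen n) (φ.Idx (S.msgLen n)) (Fin φ.hLen ⊕ Fin (S.ctLen n)) φ.fLen

/-- A simulator: the same without the ciphertext. -/
abbrev Simulator (n : ℕ) (φ : TemplateFormat) : Type :=
  TwoStage (S.msgLen n) (S.ctLen n) (φ.Idx (S.msgLen n)) (Fin φ.hLen) φ.fLen

/-- The probability that `A` wins the indistinguishability game. -/
def indWinProb (A : S.IndAdversary n) : ℝ :=
  avg fun z : Bits (S.keyCoins n) =>
    let k := S.keyGen n z
    avg fun b : Bool => ∑ t : Fin (S.msgLen n) ⊕ Fin (S.msgLen n) → Bool,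
      let m : Bits (S.msgLen n) := if b then t ∘ Sum.inr else t ∘ Sum.inl
      avg fun r : Bits (S.encCoins n) =>
        A.prob (S.enc n k) (S.dec n k) t (S.enc n k r m) (fun _ => b)

/-- The probability that `A` wins the semantic security game with parameter `real`. -/
def semRealWinProb {φ : TemplateFormat} (A : S.SemAdversary n φ) : ℝ :=
  avg fun z : Bits (S.keyCoins n) =>
    let k := S.keyGen n z
    ∑ t : Template φ (S.msgLen n), avg fun u : Bits φ.coins =>
      let m := t.samp u
      avg fun r : Bits (S.encCoins n) =>
        A.prob (S.enc n k) (S.dec n k) t (Sum.elim (t.h m) (S.enc n k r m)) (t.f m)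

/-- The probability that `B` wins the semantic security game with parameter `sim`. -/
def semSimWinProb {φ : TemplateFormat} (B : S.Simulator n φ) : ℝ :=
  avg fun z : Bits (S.keyCoins n) =>
    let k := S.keyGen n z
    ∑ t : Template φ (S.msgLen n), avg fun u : Bits φ.coins =>
      let m := t.samp u
      B.prob (S.enc n k) (S.dec n k) t (t.h m) (t.f m)

/-- The probability that the first stage of `A`, interacting with the scheme, outputs `t`. -/
def outputProb {O I : Type} [Fintype O] [DecidableEq O] {o : ℕ}
    (A : TwoStage (S.msgLen n) (S.ctLen n) O I o) (t : O → Bool) : ℝ :=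
  avg fun z : Bits (S.keyCoins n) =>
    A.firstProb (S.enc n (S.keyGen n z)) (S.dec n (S.keyGen n z)) t

/-- Indistinguishability under non-adaptive quantum chosen ciphertext attack. -/
def IND_QCCA1 : Prop :=
  ∀ A : (n : ℕ) → S.IndAdversary n, PolyUniform (fun n => (A n).describe) →
    ∃ ε : ℕ → ℝ, Negligible ε ∧ ∀ n, S.indWinProb (A n) ≤ 1 / 2 + ε n

/-- Semantic security under non-adaptive quantum chosen ciphertext attack. -/
def SEM_QCCA1 : Prop :=
  ∀ (φ : ℕ → TemplateFormat) (A : (n : ℕ) → S.SemAdversary n (φ n)),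
    PolyUniform (fun n => (φ n).describe ++ (A n).describe) →
    ∃ B : (n : ℕ) → S.Simulator n (φ n),
      PolyUniform (fun n => (φ n).describe ++ (B n).describe) ∧
      (∀ (n : ℕ) (t : Template (φ n) (S.msgLen n)), S.outputProb (A n) t = S.outputProb (B n) t) ∧
      Negligible fun n => |S.semRealWinProb (A n) - S.semSimWinProb (B n)|

end Scheme

end QCCA

end

/-! Both directions are reductions that run the given adversary once, as a subroutine, and both rest
on an exact identity between winning probabilities. Most of the work is to carry the reductions out
gate by gate and to see that they stay polynomial-time uniform.

Indistinguishability gives semantic security by encrypting zero. The simulator runs the adversary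
`A` but makes the ciphertext itself, by one query for the zero message. Its first stage is that of
`A`, so the templates are identically distributed (`firstProb_simulator`, `prob_simulator`). The
indistinguishability adversary samples `m` from the template of `A`, submits the messages `0` and
`m`, hands `h m` and the challenge to `A`, and answers 1 iff `A` outputs `f m`. It wins with
probability `1/2 + (real - sim)/2`. The adversary with the opposite answer wins with probability
`1/2 - (real - sim)/2`, and the two together bound the absolute value (`indWinProb_adversary`,
`sem_of_ind`).

Conversely, an indistinguishability adversary that outputs two messages becomes a semantic one: its
template samples one of the two by a coin, gives no side information, and asks for the complement of
the message; its answer is the complement of the message its guess points to. A simulator learns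
nothing about the coin. Given the template it succeeds with probability at most 1/2 if the messages
differ, and at most 1 if they agree. These bounds depend on the template alone, whose distribution
the simulator must reproduce; subtracting their mean from the real success probability leaves
exactly the original advantage (`sim_le_pairWeight`, `ind_eq_real`, `ind_of_sem`).

On the quantum side, `inject` places a state on some wires of a register whose other wires are in a
basis state. A relocated circuit acts on its own factor only (`run_map_inject`). Once the output of
the first stage of `A` has been measured (`run_measureAll_inject`), all that the reductions add is
classical computation beside an untouched quantum memory. It is done by single-assignment programs
with instructions `a ∧ ¬b`, whose final state satisfies all instructions at once
(`Straight.evalProg`, `eval_of_circProg`, `secondProb_prog`).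

For uniformity, polynomial-time machines are shown to be closed under composition, pairing and
bounded iteration (`PolyTime.comp`, `PolyTime.pair`, `PolyTime.iterate`), which yields the calculus
`PolyFun`. A parser cuts the description of an adversary into its parts (`PolyFun.pieces`), and the
description of each new adversary is a polynomial-time function of these parts. -/

noncomputable section

namespace QCCA

/-! ### Structured programs for multi-stack Turing machines -/

section Fragments

open Turing TM2

variable {K : Type} {Γ : K → Type} {σ Λ Λ' X Y : Type}

/-- Renaming the labels of a statement. -/
def mapLabel (f : Λ → Λ') : Stmt Γ Λ σ → Stmt Γ Λ' σ
  | .push k g q => .push k g (mapLabel f q)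
  | .peek k g q => .peek k g (mapLabel f q)
  | .pop k g q => .pop k g (mapLabel f q)
  | .load g q => .load g (mapLabel f q)
  | .branch g q₁ q₂ => .branch g (mapLabel f q₁) (mapLabel f q₂)
  | .goto g => .goto fun v => f (g v)
  | .halt => .halt

/-- Labels matter only where a statement ends, so renaming them does not affect state and stacks.
Composed fragments are simulated through this. -/
theorem stepAux_mapLabel [DecidableEq K] (f : Λ → Λ') (q : Stmt Γ Λ σ) (v : σ)
    (S : ∀ k, List (Γ k)) :
    stepAux (mapLabel f q) v S =
      ⟨(stepAux q v S).l.map f, (stepAux q v S).var, (stepAux q v S).stk⟩ := by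
  induction q generalizing v S with
  | branch g q₁ q₂ h₁ h₂ =>
    simp only [mapLabel, stepAux]
    cases g v <;> simp [h₁, h₂]
  | goto => simp [mapLabel]
  | halt => simp [mapLabel]
  | _ => simp_all [mapLabel]

/-- A program fragment: a piece of code that is left through exits in `X`. -/
structure Frag (Γ : K → Type) (σ X : Type) where
  Λ : Type
  fin : Fintype Λ
  entry : Λ
  code : Λ → Stmt Γ (Λ ⊕ X) σ

/-- From label `l`, the code reaches an exit in the given number of steps. -/
inductive Exec [DecidableEq K] (code : Λ → Stmt Γ (Λ ⊕ X) σ) :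
    Λ → σ → (∀ k, List (Γ k)) → ℕ → X → σ → (∀ k, List (Γ k)) → Prop
  | exit {l v S x v' S'} : stepAux (code l) v S = ⟨some (.inr x), v', S'⟩ →
      Exec code l v S 1 x v' S'
  | step {l v S l' v' S' t x v'' S''} : stepAux (code l) v S = ⟨some (.inl l'), v', S'⟩ →
      Exec code l' v' S' t x v'' S'' → Exec code l v S (t + 1) x v'' S''

namespace Frag

/-- Leave through the exit `x`. -/
def ret (x : X) : Frag Γ σ X := ⟨Unit, inferInstance, (), fun _ => .goto fun _ => .inr x⟩

/-- Sequential composition. -/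
def bind [Fintype X] (F : Frag Γ σ X) (G : X → Frag Γ σ Y) : Frag Γ σ Y where
  Λ := F.Λ ⊕ (x : X) × (G x).Λ
  fin := by
    haveI := F.fin
    haveI := fun x => (G x).fin
    infer_instance
  entry := .inl F.entry
  code := Sum.elim
    (fun l => mapLabel (Sum.elim (fun l' => .inl (.inl l')) fun x => .inl (.inr ⟨x, (G x).entry⟩))
      (F.code l))
    (fun p => mapLabel (Sum.elim (fun l' => .inl (.inr ⟨p.1, l'⟩)) .inr) ((G p.1).code p.2))

/-- Repetition until the fragment leaves through `some x`. -/
def loop (F : Frag Γ σ (Option X)) : Frag Γ σ X where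
  Λ := F.Λ
  fin := F.fin
  entry := F.entry
  code l := mapLabel (Sum.elim .inl fun o => o.elim (.inl F.entry) .inr) (F.code l)

variable [DecidableEq K]

/-- The seam costs nothing: the step that would leave `F` is the step that enters `G x`, so the
running times add exactly. -/
theorem exec_bind_left [Fintype X] {F : Frag Γ σ X} {G : X → Frag Γ σ Y} {l v S t x v' S' t' y v''
    S''} (h : Exec F.code l v S t x v' S')
    (h' : Exec (F.bind G).code (.inr ⟨x, (G x).entry⟩) v' S' t' y v'' S'') :
    Exec (F.bind G).code (.inl l) v S (t + t') y v'' S'' := by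
  induction h with
  | exit e =>
    rw [add_comm]
    exact .step (by simp [bind, stepAux_mapLabel, e]) h'
  | step e _ ih =>
    rw [add_right_comm]
    exact .step (by simp [bind, stepAux_mapLabel, e]) (ih h')

theorem exec_bind_right [Fintype X] {F : Frag Γ σ X} {G : X → Frag Γ σ Y} {x l v S t y v' S'}
    (h : Exec (G x).code l v S t y v' S') :
    Exec (F.bind G).code (.inr ⟨x, l⟩) v S t y v' S' := by
  induction h with
  | exit e => exact .exit (by simp [bind, stepAux_mapLabel, e])
  | step e _ ih => exact .step (by simp [bind, stepAux_mapLabel, e]) ih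

theorem exec_loop_exit {F : Frag Γ σ (Option X)} {l v S t x v' S'}
    (h : Exec F.code l v S t (some x) v' S') : Exec F.loop.code l v S t x v' S' := by
  generalize hx : some x = o at h
  induction h with
  | exit e => subst hx; exact .exit (by simp [loop, stepAux_mapLabel, e])
  | step e _ ih => exact .step (by simp [loop, stepAux_mapLabel, e]) (ih hx)

/-- The exit `none` is rerouted to the entry, so a further round costs no extra step either. -/
theorem exec_loop_step {F : Frag Γ σ (Option X)} {l v S t v' S' t' x v'' S''}
    (h : Exec F.code l v S t none v' S') (h' : Exec F.loop.code F.entry v' S' t' x v'' S'') :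
    Exec F.loop.code l v S (t + t') x v'' S'' := by
  generalize hx : none = o at h
  induction h with
  | exit e => subst hx; rw [add_comm]; exact .step (by simp [loop, stepAux_mapLabel, e]) h'
  | step e _ ih =>
    rw [add_right_comm]
    exact .step (by simp [loop, stepAux_mapLabel, e]) (ih h' hx)

end Frag

/-- The number of pushes in a statement. -/
def pushes : Stmt Γ Λ σ → ℕ
  | .push _ _ q => pushes q + 1
  | .peek _ _ q => pushes q
  | .pop _ _ q => pushes q
  | .load _ q => pushes q
  | .branch _ q₁ q₂ => pushes q₁ + pushes q₂
  | .goto _ => 0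
  | .halt => 0

/-- A statement contains no jumps back, so each of its pushes is executed at most once; adding up
both branches is crude but does not depend on the state. -/
theorem length_stepAux_le [DecidableEq K] (q : Stmt Γ Λ σ) (v : σ) (S : ∀ k, List (Γ k)) (k : K) :
    ((stepAux q v S).stk k).length ≤ (S k).length + pushes q := by
  induction q generalizing v S with
  | push k' f q ih =>
    refine (ih _ _).trans ?_
    by_cases h : k = k'
    · subst h; simp [pushes]; omega
    · simp only [pushes, ne_eq, h, not_false_eq_true, Function.update_of_ne]; omega
  | peek k' f q ih => exact ih _ _
  | pop k' f q ih =>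
    refine (ih _ _).trans ?_
    by_cases h : k = k'
    · subst h; simp [pushes]
    · simp [pushes, h]
  | load f q ih => exact ih _ _
  | branch f q₁ q₂ h₁ h₂ =>
    simp only [stepAux, pushes]
    cases f v
    · exact (h₂ _ _).trans (by omega)
    · exact (h₁ _ _).trans (by omega)
  | goto => simp [pushes]
  | halt => simp [pushes]

end Fragments

/-! ### The output length of a polynomial-time machine -/

theorem polyEval_mono (p : Polynomial ℕ) {m n : ℕ} (h : m ≤ n) :
    p.eval m ≤ p.eval n := by
  simp only [Polynomial.eval_eq_sum]
  exact Finset.sum_le_sum fun i _ => Nat.mul_le_mul_left _ (Nat.pow_le_pow_left h i)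

section Iterate

variable {α : Type*} (f : α → Option α)

theorem iterate_flip_bind_none (n : ℕ) : (flip bind f)^[n] none = none := by
  induction n with
  | zero => rfl
  | succ n ih => rw [Function.iterate_succ_apply]; exact ih

theorem iterate_flip_bind_succ (n : ℕ) (a : α) :
    (flip bind f)^[n + 1] (some a) = (flip bind f)^[n] (f a) := by
  rw [Function.iterate_succ_apply]; rfl

end Iterate

open Turing in
/-- The output of a polynomial-time computation has polynomial length. -/
theorem PolyTime.length_le {α : Type} {i o : α → List Bool} (h : PolyTime i o) :
    ∃ p : Polynomial ℕ, ∀ a, (o a).length ≤ p.eval (i a).length := by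
  obtain ⟨M⟩ := h
  -- The number of pushes in the whole program: no step lengthens a stack by more than this.
  let c : ℕ := by
    haveI := M.tm.ΛFin
    exact ∑ l, pushes (M.tm.m l)
  have step_le (l : M.tm.Λ) : pushes (M.tm.m l) ≤ c := by
    exact Finset.single_le_sum (f := fun l => pushes (M.tm.m l)) (fun _ _ => Nat.zero_le _)
      (@Finset.mem_univ _ M.tm.ΛFin l)
  have key (n : ℕ) (x y : M.tm.Cfg) (h : (flip bind M.tm.step)^[n] (some x) = some y) (k) :
      (y.stk k).length ≤ (x.stk k).length + n * c := by
    induction n generalizing x with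
    | zero => simp only [Function.iterate_zero, id, Option.some.injEq] at h; simp [h]
    | succ n ih =>
      rw [iterate_flip_bind_succ] at h
      obtain ⟨l, v, S⟩ := x
      cases l with
      | none =>
        rw [show M.tm.step ⟨none, v, S⟩ = none from rfl, iterate_flip_bind_none] at h
        cases h
      | some l =>
        refine (ih _ h).trans ?_
        have := length_stepAux_le (M.tm.m l) v S k
        have := step_le l
        simp only [Nat.add_mul]
        change _ ≤ (S k).length + _
        omega
  -- The output stack starts with at most the input and gains at most `c` symbols per step.
  refine ⟨Polynomial.X + M.time * Polynomial.C c, fun a => ?_⟩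
  have h₁ := M.outputsFun a
  have := key _ _ _ h₁.evals_in_steps M.tm.k₁
  have h₂ : ((haltList M.tm (List.map M.outputAlphabet.invFun (o a))).stk M.tm.k₁).length
      = (o a).length := by simp [haltList]
  have h₃ : ((initList M.tm (List.map M.inputAlphabet.invFun (i a))).stk M.tm.k₁).length
      ≤ (i a).length := by
    simp only [initList]
    -- Input and output may share a stack; otherwise the output stack starts empty.
    split_ifs with h
    · have : ∀ (k k') (h : k = k') (s : List (M.tm.Γ k')),
          (Eq.mpr (congrArg (fun k => List (M.tm.Γ k)) h) s).length = s.length := by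
        rintro k k' rfl s; rfl
      exact (this _ _ h _).le.trans (by simp)
    · simp
  have h₄ := Nat.mul_le_mul_right c h₁.steps_le_m
  simp only [id] at this
  rw [h₂] at this
  simp only [Polynomial.eval_add, Polynomial.eval_X, Polynomial.eval_mul, Polynomial.eval_C]
  omega

/-! ### Programs on four stacks of bits that call Turing machines -/

section Control

open Turing TM2 Function

variable {ι : Type} [DecidableEq ι] (M : ι → FinTM2)

/-- Stacks: four stacks of bits, and the stacks of the machines. -/
abbrev CtrlStack : Type := Fin 4 ⊕ (i : ι) × (M i).K

/-- The stack alphabets. -/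
abbrev CtrlAlphabet : CtrlStack M → Type
  | .inl _ => Bool
  | .inr p => (M p.1).Γ p.2

/-- Internal states: the last bit popped, and the states of the machines. -/
abbrev CtrlState : Type := Option Bool × ∀ i, (M i).σ

/-- Program fragments that use the four stacks and call the machines. -/
abbrev CtrlFrag (X : Type) : Type 1 := Frag (CtrlAlphabet M) (CtrlState M) X

variable {M}

/-- The stacks of the machines are empty. -/
def idleStacks (S : Fin 4 → List Bool) : ∀ k, List (CtrlAlphabet M k)
  | .inl a => S a
  | .inr _ => []

/-- The stacks of the machines other than `i` are empty. -/
def activeStacks (i : ι) (S : Fin 4 → List Bool) (T : ∀ k, List ((M i).Γ k)) :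
    ∀ k, List (CtrlAlphabet M k)
  | .inl a => S a
  | .inr ⟨j, k⟩ => if h : i = j then (by subst h; exact T k) else []

theorem activeStacks_inr (i : ι) (S : Fin 4 → List Bool) (T : ∀ k, List ((M i).Γ k)) (k) :
    activeStacks i S T (.inr ⟨i, k⟩) = T k := by
  simp [activeStacks]

theorem activeStacks_nil (i : ι) (S : Fin 4 → List Bool) :
    activeStacks (M := M) i S (fun _ => []) = idleStacks S := by
  funext k
  rcases k with a | ⟨j, k⟩
  · rfl
  · by_cases h : i = j
    · subst h; simp [activeStacks, idleStacks]
    · simp [activeStacks, idleStacks, h]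

theorem update_activeStacks_inr (i : ι) (S : Fin 4 → List Bool) (T : ∀ k, List ((M i).Γ k)) (k w) :
    update (activeStacks i S T) (.inr ⟨i, k⟩) w = activeStacks i S (update T k w) := by
  funext x
  rcases x with a | ⟨j, x⟩
  · simp [activeStacks]
  · by_cases h : i = j
    · subst h
      by_cases h' : x = k
      · subst h'; simp [activeStacks]
      · rw [update_of_ne (by simpa using h')]
        simp [activeStacks, h']
    · have : (Sum.inr ⟨j, x⟩ : CtrlStack M) ≠ .inr ⟨i, k⟩ := by
        intro e; simp only [Sum.inr.injEq, Sigma.mk.injEq] at e; exact h e.1.symm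
      rw [update_of_ne this]
      simp [activeStacks, h]

theorem update_activeStacks_inl (i : ι) (S : Fin 4 → List Bool) (T : ∀ k, List ((M i).Γ k)) (a w) :
    update (activeStacks i S T) (.inl a) w = activeStacks i (update S a w) T := by
  funext x
  rcases x with b | ⟨j, x⟩
  · by_cases h : b = a
    · subst h; simp [activeStacks]
    · rw [update_of_ne (by simpa using h)]
      simp [activeStacks, h]
  · rw [update_of_ne (by simp)]
    simp [activeStacks]

theorem update_idleStacks (S : Fin 4 → List Bool) (a w) :
    update (idleStacks (M := M) S) (.inl a) w = idleStacks (update S a w) := by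
  funext x
  rcases x with b | ⟨j, x⟩
  · by_cases h : b = a
    · subst h; simp [idleStacks]
    · rw [update_of_ne (by simpa using h)]
      simp [idleStacks, h]
  · rw [update_of_ne (by simp)]
    simp [idleStacks]

/-- A statement of machine `i`, as a statement of the controlling machine. -/
def callStmt (i : ι) : Stmt (M i).Γ (M i).Λ (M i).σ →
    Stmt (CtrlAlphabet M) ((M i).Λ ⊕ Unit) (CtrlState M)
  | .push k f q => .push (.inr ⟨i, k⟩) (fun v => f (v.2 i)) (callStmt i q)
  | .peek k f q =>
      .peek (.inr ⟨i, k⟩) (fun v o => (v.1, update v.2 i (f (v.2 i) o))) (callStmt i q)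
  | .pop k f q =>
      .pop (.inr ⟨i, k⟩) (fun v o => (v.1, update v.2 i (f (v.2 i) o))) (callStmt i q)
  | .load f q => .load (fun v => (v.1, update v.2 i (f (v.2 i)))) (callStmt i q)
  | .branch f q₁ q₂ => .branch (fun v => f (v.2 i)) (callStmt i q₁) (callStmt i q₂)
  | .goto f => .goto fun v => .inl (f (v.2 i))
  | .halt => .goto fun _ => .inr ()

/-- The called machine runs unchanged on its own stacks and its own component of the state; halting
turns into the only exit. -/
theorem stepAux_callStmt (i : ι) (q : Stmt (M i).Γ (M i).Λ (M i).σ) (b : Option Bool)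
    (v : ∀ i, (M i).σ) (S : Fin 4 → List Bool) (T : ∀ k, List ((M i).Γ k)) :
    stepAux (callStmt i q) (b, v) (activeStacks i S T) =
      ⟨some ((stepAux q (v i) T).l.elim (.inr ()) .inl),
        (b, update v i (stepAux q (v i) T).var), activeStacks i S (stepAux q (v i) T).stk⟩ := by
  induction q generalizing v T with
  | push k f q ih =>
    simp only [callStmt, stepAux, activeStacks_inr, update_activeStacks_inr, ih]
  | peek k f q ih =>
    simp only [callStmt, stepAux, activeStacks_inr, ih, update_self, update_idem]
  | pop k f q ih =>
    simp only [callStmt, stepAux, activeStacks_inr, update_activeStacks_inr, ih, update_self,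
      update_idem]
  | load f q ih => simp only [callStmt, stepAux, ih, update_self, update_idem]
  | branch f q₁ q₂ h₁ h₂ =>
    simp only [callStmt, stepAux]
    cases f (v i) <;> simp [h₁, h₂]
  | goto f => simp [callStmt]
  | halt => simp [callStmt]

/-- The code of machine `i` as a fragment. -/
def callCode (i : ι) : CtrlFrag M Unit where
  Λ := (M i).Λ
  fin := (M i).ΛFin
  entry := (M i).main
  code l := callStmt i ((M i).m l)

/-- A configuration without label has no successor, so a run that arrives at `c` halts only at its
very end, and the halting step is the one that takes the exit. -/
theorem exec_callCode (i : ι) (n : ℕ) (l v T) (c : (M i).Cfg) (hc : c.l = none)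
    (h : (flip bind (M i).step)^[n] (some ⟨some l, v, T⟩) = some c)
    (b : Option Bool) (w : ∀ i, (M i).σ) (hw : w i = v) (S : Fin 4 → List Bool) :
    ∃ t ≤ n, Exec (callCode i).code l (b, w) (activeStacks i S T) t () (b, update w i c.var)
      (activeStacks i S c.stk) := by
  induction n generalizing l v T w with
  | zero =>
    cases Option.some.inj h; cases hc
  | succ n ih =>
    replace h : (flip bind (M i).step)^[n] (some (stepAux ((M i).m l) v T)) = some c :=
      (iterate_flip_bind_succ (M i).step n ⟨some l, v, T⟩).symm.trans h
    subst hw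
    have e := stepAux_callStmt i ((M i).m l) b w S T
    generalize stepAux ((M i).m l) (w i) T = c₁ at h e
    obtain ⟨l₁, v₁, T₁⟩ := c₁
    cases l₁ with
    | none =>
      cases n with
      | zero =>
        cases Option.some.inj h
        exact ⟨1, le_rfl, .exit e⟩
      | succ n =>
        replace h : (flip bind (M i).step)^[n] none = some c :=
          (iterate_flip_bind_succ (M i).step n ⟨none, v₁, T₁⟩).symm.trans h
        rw [iterate_flip_bind_none] at h
        cases h
    | some l₁ =>
      obtain ⟨t, ht, h'⟩ := ih l₁ v₁ T₁ h (update w i v₁) (by simp)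
      rw [update_idem] at h'
      exact ⟨t + 1, by omega, .step e h'⟩

theorem initList_stk (N : FinTM2) (s : List (N.Γ N.k₀)) :
    (initList N s).stk = update (fun _ => []) N.k₀ s := by
  funext k
  by_cases h : k = N.k₀
  · subst h; simp [initList]
  · simp [initList, h]

theorem haltList_stk (N : FinTM2) (s : List (N.Γ N.k₁)) :
    (haltList N s).stk = update (fun _ => []) N.k₁ s := by
  funext k
  by_cases h : k = N.k₁
  · subst h; simp [haltList]
  · simp [haltList, h]

variable (M) in
/-- The initial states of the machines. -/
def initStates : ∀ i, (M i).σ := fun i => (M i).initialState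

/-- The fragment `F` leads from `S` to `S'` and to the exit `x`, in at most `t` steps. -/
def Runs {X : Type} (F : CtrlFrag M X) (S : Fin 4 → List Bool) (t : ℕ) (x : X)
    (S' : Fin 4 → List Bool) : Prop :=
  ∀ b, ∃ b', ∃ t' ≤ t, Exec F.code F.entry (b, initStates M) (idleStacks S) t' x
    (b', initStates M) (idleStacks S')

theorem Runs.mono {X : Type} {F : CtrlFrag M X} {S t t' x S'} (h : Runs F S t x S')
    (ht : t ≤ t') : Runs F S t' x S' := fun b => by
  obtain ⟨b', n, hn, h⟩ := h b
  exact ⟨b', n, hn.trans ht, h⟩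

theorem Runs.ret {X : Type} (x : X) (S) : Runs (M := M) (Frag.ret x) S 1 x S :=
  fun b => ⟨b, 1, le_rfl, .exit (by simp [Frag.ret])⟩

theorem Runs.bind {X Y : Type} [Fintype X] {F : CtrlFrag M X} {G : X → CtrlFrag M Y}
    {S t x S' t' y S''} (h : Runs F S t x S') (h' : Runs (G x) S' t' y S'') :
    Runs (F.bind G) S (t + t') y S'' := fun b => by
  obtain ⟨b', n, hn, h⟩ := h b
  obtain ⟨b'', n', hn', h'⟩ := h' b'
  exact ⟨b'', n + n', by omega, Frag.exec_bind_left h (Frag.exec_bind_right h')⟩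

theorem Runs.loop_exit {X : Type} {F : CtrlFrag M (Option X)} {S t x S'}
    (h : Runs F S t (some x) S') : Runs F.loop S t x S' := fun b => by
  obtain ⟨b', n, hn, h⟩ := h b
  exact ⟨b', n, hn, Frag.exec_loop_exit h⟩

theorem Runs.loop_step {X : Type} {F : CtrlFrag M (Option X)} {S t S' t' x S''}
    (h : Runs F S t none S') (h' : Runs F.loop S' t' x S'') :
    Runs F.loop S (t + t') x S'' := fun b => by
  obtain ⟨b', n, hn, h⟩ := h b
  obtain ⟨b'', n', hn', h'⟩ := h' b'
  exact ⟨b'', n + n', by omega, Frag.exec_loop_step h h'⟩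

/-- Push a bit. -/
def pushBit (a : Fin 4) (x : Bool) : CtrlFrag M Unit :=
  ⟨Unit, inferInstance, (), fun _ => .push (.inl a) (fun _ => x) (.goto fun _ => .inr ())⟩

theorem runs_pushBit (a : Fin 4) (x : Bool) (S) :
    Runs (M := M) (pushBit a x) S 1 () (update S a (x :: S a)) := fun b =>
  ⟨b, 1, le_rfl, .exit (by
    simp only [QCCA.pushBit, stepAux, ← update_idleStacks]; rfl)⟩

/-- Pop a bit. -/
def popBit (a : Fin 4) : CtrlFrag M (Option Bool) :=
  ⟨Unit, inferInstance, (), fun _ => .pop (.inl a) (fun v x => (x, v.2)) (.goto fun v => .inr v.1)⟩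

theorem runs_popBit (a : Fin 4) (S) :
    Runs (M := M) (popBit a) S 1 (S a).head? (update S a (S a).tail) := fun _ =>
  ⟨(S a).head?, 1, le_rfl, .exit (by
    simp only [QCCA.popBit, stepAux, ← update_idleStacks]; rfl)⟩

/-- Move the (reversed) content of a stack to the input stack of machine `i`. -/
def feed (i : ι) (e : (M i).Γ (M i).k₀ ≃ Bool) (a : Fin 4) : CtrlFrag M Unit :=
  ⟨Unit, inferInstance, (), fun _ => .pop (.inl a) (fun v x => (x, v.2))
    (.branch (fun v => v.1.isSome)
      (.push (.inr ⟨i, (M i).k₀⟩) (fun v => e.symm (v.1.getD false)) (.goto fun _ => .inl ()))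
      (.goto fun _ => .inr ()))⟩

theorem exec_feed (i : ι) (e : (M i).Γ (M i).k₀ ≃ Bool) (a : Fin 4) (b w)
    (l : List Bool) (S : Fin 4 → List Bool) (hS : S a = l) (T : ∀ k, List ((M i).Γ k)) :
    Exec (feed i e a).code () (b, w) (activeStacks i S T) (l.length + 1) () (none, w)
      (activeStacks i (update S a [])
        (update T (M i).k₀ ((l.map e.symm).reverse ++ T (M i).k₀))) := by
  induction l generalizing b S T with
  | nil =>
    refine .exit ?_
    simp only [feed, stepAux]
    rw [show activeStacks i S T (.inl a) = S a from rfl, hS]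
    simp [update_activeStacks_inl]
  | cons x l ih =>
    have h₁ := ih (some x) (update S a l) (by simp)
      (update T (M i).k₀ (e.symm x :: T (M i).k₀))
    rw [update_idem, update_idem, update_self] at h₁
    refine .step (l' := ()) (v' := (some x, w)) (S' := activeStacks i (update S a l)
      (update T (M i).k₀ (e.symm x :: T (M i).k₀))) ?_ ?_
    · simp only [feed, stepAux]
      rw [show activeStacks i S T (.inl a) = S a from rfl, hS]
      simp [update_activeStacks_inl, activeStacks_inr, update_activeStacks_inr]
    · simp only [List.map_cons, List.reverse_cons, List.append_assoc, List.cons_append, List.nil_append]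
      exact h₁

/-- Move the (reversed) content of the output stack of machine `i` to a stack. -/
def fetch (i : ι) (e : (M i).Γ (M i).k₁ ≃ Bool) (a : Fin 4) : CtrlFrag M Unit :=
  ⟨Unit, inferInstance, (), fun _ => .pop (.inr ⟨i, (M i).k₁⟩) (fun v x => (x.map e, v.2))
    (.branch (fun v => v.1.isSome)
      (.push (.inl a) (fun v => v.1.getD false) (.goto fun _ => .inl ()))
      (.goto fun _ => .inr ()))⟩

theorem exec_fetch (i : ι) (e : (M i).Γ (M i).k₁ ≃ Bool) (a : Fin 4) (b w)
    (l : List Bool) (S : Fin 4 → List Bool) (T : ∀ k, List ((M i).Γ k))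
    (hT : T (M i).k₁ = l.map e.symm) :
    Exec (fetch i e a).code () (b, w) (activeStacks i S T) (l.length + 1) () (none, w)
      (activeStacks i (update S a (l.reverse ++ S a)) (update T (M i).k₁ [])) := by
  induction l generalizing b S T with
  | nil =>
    refine .exit ?_
    simp only [fetch, stepAux]
    rw [activeStacks_inr, hT]
    simp [update_activeStacks_inr]
  | cons x l ih =>
    have h₁ := ih (some x) (update S a (x :: S a)) (update T (M i).k₁ (l.map e.symm)) (by simp)
    rw [update_idem, update_idem, update_self] at h₁
    refine .step (l' := ()) (v' := (some x, w)) (S' := activeStacks i (update S a (x :: S a))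
      (update T (M i).k₁ (l.map e.symm))) ?_ ?_
    · simp only [fetch, stepAux]
      rw [activeStacks_inr, hT]
      simp only [List.map_cons, List.head?_cons, Option.map_some, Equiv.apply_symm_apply,
        Option.isSome_some, Option.getD_some, cond_true, List.tail_cons, update_activeStacks_inr,
        update_activeStacks_inl]
      rfl
    · simp only [List.reverse_cons, List.append_assoc, List.cons_append, List.nil_append]
      exact h₁

/-- Run machine `i` on the (reversed) content of a stack, which the (reversed) output replaces. -/
def callRev (i : ι) (e₀ : (M i).Γ (M i).k₀ ≃ Bool) (e₁ : (M i).Γ (M i).k₁ ≃ Bool)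
    (a b : Fin 4) : CtrlFrag M Unit :=
  (feed i e₀ a).bind fun _ => (callCode i).bind fun _ => fetch i e₁ b

/-- `haltList` demands the initial internal state and empty stacks apart from the output. Once the
output has been fetched the machine is therefore idle again and may be called any number of times.
`feed` and `fetch` each reverse the string and take one step more than its length. -/
theorem runs_callRev (i : ι) (e₀ : (M i).Γ (M i).k₀ ≃ Bool) (e₁ : (M i).Γ (M i).k₁ ≃ Bool)
    (a b : Fin 4) {x y : List Bool} {n : ℕ}
    (h : Nonempty (TM2OutputsInTime (M i) (x.map e₀.invFun) (some (y.map e₁.invFun)) n))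
    {S : Fin 4 → List Bool} (hS : S a = x.reverse) :
    Runs (callRev i e₀ e₁ a b) S (x.length + n + y.length + 2) ()
      (update (update S a []) b (y.reverse ++ update S a [] b)) := fun bit => by
  obtain ⟨h⟩ := h
  obtain ⟨t, ht, h₂⟩ := exec_callCode i h.steps _ _ _ (haltList (M i) (y.map e₁.invFun)) rfl
    (by
      have := h.evals_in_steps
      simp only [initList, Option.map_some] at this
      exact this) none (initStates M) rfl (update S a [])
  have h₁ := exec_feed i e₀ a bit (initStates M) _ S hS (fun _ => [])
  rw [activeStacks_nil] at h₁
  have e₁' : update (fun _ => []) (M i).k₀ ((List.map e₀.symm x.reverse).reverse ++ []) =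
      (initList (M i) (x.map e₀.invFun)).stk := by
    rw [initList_stk]; simp
  rw [e₁'] at h₁
  have h₃ := exec_fetch i e₁ b none (update (initStates M) i (M i).initialState) y (update S a [])
    (haltList (M i) (y.map e₁.invFun)).stk (by rw [haltList_stk]; simp)
  rw [show update (initStates M) i (M i).initialState = initStates M by simp [initStates]] at h₃
  have h₂' : Exec (callCode i).code (callCode i).entry (none, initStates M)
      (activeStacks i (update S a []) (initList (M i) (x.map e₀.invFun)).stk) t ()
      (none, initStates M)
      (activeStacks i (update S a []) (haltList (M i) (y.map e₁.invFun)).stk) := by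
    have e : update (initStates M) i (M i).initialState = initStates M := by simp [initStates]
    have h₂'' := h₂
    rw [show (haltList (M i) (y.map e₁.invFun)).var = (M i).initialState from rfl, e] at h₂''
    exact h₂''
  have e₃ : activeStacks i (update (update S a []) b (y.reverse ++ update S a [] b))
      (update (haltList (M i) (y.map e₁.invFun)).stk (M i).k₁ []) =
      idleStacks (update (update S a []) b (y.reverse ++ update S a [] b)) := by
    rw [haltList_stk, update_idem, ← activeStacks_nil i]
    congr 1; simp
  rw [e₃] at h₃
  refine ⟨none, _, ?_, Frag.exec_bind_left h₁ (Frag.exec_bind_right (Frag.exec_bind_left h₂'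
    (Frag.exec_bind_right h₃)))⟩
  have := h.steps_le_m
  simp only [List.length_reverse]
  omega

variable (M) in
/-- The Turing machine of a program: input and output are on the first of the four stacks. -/
def ctrlMachine [Fintype ι] (F : CtrlFrag M Unit) : FinTM2 where
  K := CtrlStack M
  kFin := by
    haveI := fun i => (M i).kFin
    infer_instance
  k₀ := .inl 0
  k₁ := .inl 0
  Γ := CtrlAlphabet M
  Λ := F.Λ ⊕ Unit
  main := .inl F.entry
  ΛFin := by
    haveI := F.fin
    infer_instance
  σ := CtrlState M
  initialState := (none, initStates M)
  σFin := by
    haveI := fun i => (M i).σFin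
    infer_instance
  Γk₀Fin := inferInstanceAs (Fintype Bool)
  m := Sum.elim (fun l => mapLabel id (F.code l))
    fun _ => .load (fun _ => (none, initStates M)) .halt

/-- The extra step resets the internal state, which still holds the last bit popped: a halting
configuration must be in the initial state. -/
theorem iterate_ctrlMachine [Fintype ι] {F : CtrlFrag M Unit} {l v S t x v' S'}
    (h : Exec F.code l v S t x v' S') :
    (flip bind (ctrlMachine M F).step)^[t + 1] (some ⟨some (.inl l), v, S⟩) =
      some ⟨none, (none, initStates M), S'⟩ := by
  have succ (n : ℕ) (c : (ctrlMachine M F).Cfg) (d) (h : (ctrlMachine M F).step c = some d) :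
      (flip bind (ctrlMachine M F).step)^[n + 1] (some c) =
        (flip bind (ctrlMachine M F).step)^[n] (some d) := by
    rw [iterate_flip_bind_succ, h]
  induction h with
  | @exit l v S x v' S' e =>
    refine (succ 1 _ ⟨some (.inr x), v', S'⟩ ?_).trans (succ 0 _ _ rfl)
    change some (stepAux (mapLabel id (F.code l)) v S) = _
    rw [stepAux_mapLabel, e]; rfl
  | @step l v S l' v' S' t x v'' S'' e _ ih =>
    refine (succ _ _ ⟨some (.inl l'), v', S'⟩ ?_).trans ih
    change some (stepAux (mapLabel id (F.code l)) v S) = _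
    rw [stepAux_mapLabel, e]; rfl

/-- Programs with polynomial running time show that functions are computable in polynomial
time. -/
theorem PolyTime.of_runs [Fintype ι] {α : Type} {i o : α → List Bool} (F : CtrlFrag M Unit)
    (p : Polynomial ℕ)
    (h : ∀ a, Runs F ![i a, [], [], []] (p.eval (i a).length) () ![o a, [], [], []]) :
    PolyTime i o := by
  refine ⟨{ tm := ctrlMachine M F, inputAlphabet := Equiv.refl Bool,
            outputAlphabet := Equiv.refl Bool, time := p + 1, outputsFun := fun a => ?_ }⟩
  have key : ∃ t ≤ p.eval (i a).length + 1, (flip bind (ctrlMachine M F).step)^[t]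
      (some (initList (ctrlMachine M F) (i a))) =
      some (haltList (ctrlMachine M F) (o a)) := by
    obtain ⟨b', t, ht, h⟩ := h a none
    refine ⟨t + 1, by omega, ?_⟩
    have := iterate_ctrlMachine h
    have e (w : List Bool) : idleStacks (M := M) ![w, [], [], []] =
        update (β := fun k => List (CtrlAlphabet M k)) (fun _ => []) (.inl 0) w := by
      funext k
      rcases k with k | k
      · by_cases hk : k = 0
        · subst hk; simp [idleStacks]
        · rw [update_of_ne (by simpa using hk)]
          fin_cases k <;> first | exact absurd rfl hk | rfl
      · rfl
    have e₀ : initList (ctrlMachine M F) (i a) =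
        ⟨some (.inl F.entry), (none, initStates M), idleStacks ![i a, [], [], []]⟩ := by
      rw [e]
      exact congrArg (fun S => (⟨some (.inl F.entry), (none, initStates M), S⟩ :
        (ctrlMachine M F).Cfg)) (initList_stk (ctrlMachine M F) (i a))
    have e₁ : haltList (ctrlMachine M F) (o a) =
        ⟨none, (none, initStates M), idleStacks ![o a, [], [], []]⟩ := by
      rw [e]
      exact congrArg (fun S => (⟨none, (none, initStates M), S⟩ :
        (ctrlMachine M F).Cfg)) (haltList_stk (ctrlMachine M F) (o a))
    rw [e₀, e₁]
    exact this
  choose t ht h' using key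
  have e (w : List Bool) : List.map (Equiv.refl Bool).invFun w = w := List.map_id w
  refine ⟨⟨t, ?_⟩, by simpa using ht⟩
  exact (congrArg (fun w => (flip bind (ctrlMachine M F).step)^[t]
    (some (initList (ctrlMachine M F) w))) (e (i a))).trans
      (h'.trans (congrArg (fun w => some (haltList (ctrlMachine M F) w)) (e (o a)).symm))

end Control

/-! ### Closure properties of polynomial-time computability -/

/-- Pairing of bit strings: the first string is closed by `0` after every bit `b` of it has become
`1 b`. -/
def pairStr (a b : List Bool) : List Bool := (a.flatMap fun x => [true, x]) ++ false :: b

theorem length_pairStr (a b : List Bool) :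
    (pairStr a b).length = 2 * a.length + b.length + 1 := by
  simp [pairStr, List.length_flatMap]; omega

section Programs

open Turing TM2 Function

/-- The machine maps `x` to `y` in at most `t` steps. -/
def Computes (M : TM2ComputableAux Bool Bool) (x : List Bool) (t : ℕ) (y : List Bool) : Prop :=
  Nonempty (TM2OutputsInTime M.tm (x.map M.inputAlphabet.invFun)
    (some (y.map M.outputAlphabet.invFun)) t)

theorem PolyTime.exists_computes {α : Type} {i o : α → List Bool} (h : PolyTime i o) :
    ∃ (M : TM2ComputableAux Bool Bool) (p : Polynomial ℕ),
      ∀ a, Computes M (i a) (p.eval (i a).length) (o a) := by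
  obtain ⟨h⟩ := h
  exact ⟨h.toTM2ComputableAux, h.time, fun a => ⟨h.outputsFun a⟩⟩

variable {ι : Type} [DecidableEq ι] {M : ι → TM2ComputableAux Bool Bool}

variable (M) in
/-- Programs that call the machines `M`. -/
abbrev CallFrag (X : Type) : Type 1 := CtrlFrag (fun i => (M i).tm) X

/-- Pop the bits of a stack one by one and run `body` on each. -/
def eachBit (a : Fin 4) (body : Bool → CallFrag M Unit) : CallFrag M Unit :=
  ((popBit a).bind fun o => o.elim (.ret (some ())) fun x =>
    (body x).bind fun _ => .ret none).loop

theorem update_of_eq {S : Fin 4 → List Bool} {a l} (h : S a = l) : update S a l = S := by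
  rw [← h, update_eq_self]

theorem Runs.cast {X : Type} {N : ι → FinTM2} {F : CtrlFrag N X} {S t t' x S' T}
    (h : Runs F S t x S') (hT : S' = T) (ht : t ≤ t') : Runs F S t' x T := hT ▸ h.mono ht

theorem Runs.of_eq {X : Type} {N : ι → FinTM2} {F : CtrlFrag N X} {S t x S' T}
    (h : Runs F S t x S') (hS : S = T) : Runs F T t x S' := hS ▸ h

theorem Runs.seq {X : Type} {N : ι → FinTM2} {F : CtrlFrag N Unit} {G : CtrlFrag N X}
    {S t S' t' x S''} (h : Runs F S t () S') (h' : Runs G S' t' x S'') :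
    Runs (F.bind fun _ => G) S (t + t') x S'' := h.bind (G := fun _ => G) h'

theorem Runs.eachBit_nil {a : Fin 4} {body : Bool → CallFrag M Unit} {S : Fin 4 → List Bool}
    (h : S a = []) : Runs (eachBit a body) S 2 () S := by
  refine .loop_exit ((runs_popBit a S).bind (t' := 1) ?_)
  rw [h]
  exact (Runs.ret (some ()) _).cast (update_of_eq h) le_rfl

theorem Runs.eachBit_cons {a : Fin 4} {body : Bool → CallFrag M Unit} {S S' S'' : Fin 4 → List Bool}
    {x l t t'} (h : S a = x :: l) (h₁ : Runs (body x) (update S a l) t () S')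
    (h₂ : Runs (eachBit a body) S' t' () S'') : Runs (eachBit a body) S (t + t' + 2) () S'' := by
  have h₃ := (runs_popBit a S).bind
    (G := fun o => o.elim (.ret (some ())) fun x => (body x).bind fun _ => .ret none)
    (t' := t + 1) (S'' := S') (y := none) (by
      rw [h]
      exact h₁.bind (Runs.ret none S'))
  exact (Runs.loop_step h₃ h₂).mono (by omega)

/-- Move a stack to another one; the order is reversed. -/
def moveRev (a b : Fin 4) : CallFrag M Unit := eachBit a fun x => pushBit b x

theorem runs_moveRev {a b : Fin 4} (hab : a ≠ b) {l} {S : Fin 4 → List Bool} (h : S a = l) :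
    Runs (M := fun i => (M i).tm) (moveRev a b) S (3 * l.length + 2) ()
      (update (update S a []) b (l.reverse ++ S b)) := by
  induction l generalizing S with
  | nil =>
    exact (Runs.eachBit_nil h).cast (by simp [update_of_eq h]) le_rfl
  | cons x l ih =>
    have h₁ := Runs.eachBit_cons (body := fun x => QCCA.pushBit b x) h (runs_pushBit b x _)
      (ih (S := update (update S a l) b (x :: update S a l b)) (by simp [hab]))
    exact h₁.cast (by simp [hab.symm, update_comm hab]) (by simp; omega)

/-- Run machine `i` on the content of stack `a`; the output is moved to stack `b`. -/
def call (i : ι) (a b : Fin 4) : CallFrag M Unit :=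
  (moveRev a b).bind fun _ =>
    (callRev i (M i).inputAlphabet (M i).outputAlphabet b a).bind fun _ => moveRev a b

/-- Four reversals cancel in pairs: `feed` undoes the first `moveRev`, and the last `moveRev` undoes
`fetch`. -/
theorem runs_call (i : ι) {a b : Fin 4} (hab : a ≠ b) {x y : List Bool} {n : ℕ}
    (h : Computes (M i) x n y) {S : Fin 4 → List Bool} (ha : S a = x) (hb : S b = []) :
    Runs (call (M := M) i a b) S (4 * x.length + 4 * y.length + n + 6) ()
      (update (update S a []) b y) := by
  have h₁ := runs_moveRev (M := M) hab ha
  have h₂ := runs_callRev (M := fun i => (M i).tm) i (M i).inputAlphabet (M i).outputAlphabet b a h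
    (S := update (update S a []) b (x.reverse ++ S b)) (by simp [hb])
  have h₃ := runs_moveRev (M := M) hab (l := y.reverse)
    (S := update (update (update (update S a []) b (x.reverse ++ S b)) b []) a
      (y.reverse ++ update (update (update S a []) b (x.reverse ++ S b)) b [] a)) (by simp [hab])
  exact (h₁.seq (h₂.seq h₃)).cast (by simp [hab, hab.symm, update_comm hab])
    (by simp only [List.length_reverse]; omega)

/-- Remove the content of a stack. -/
def clear (a : Fin 4) : CallFrag M Unit := eachBit a fun _ => .ret ()

theorem runs_clear (a : Fin 4) {l} {S : Fin 4 → List Bool} (h : S a = l) :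
    Runs (clear (M := M) a) S (3 * l.length + 2) () (update S a []) := by
  induction l generalizing S with
  | nil =>
    exact (Runs.eachBit_nil h).cast (update_of_eq h).symm le_rfl
  | cons x l ih =>
    have h₁ := Runs.eachBit_cons (body := fun _ => Frag.ret ()) h (Runs.ret () _)
      (ih (S := update S a l) (by simp))
    exact h₁.cast (by simp) (by simp; omega)

/-- Push a string. -/
def pushStr (a : Fin 4) : List Bool → CallFrag M Unit
  | [] => .ret ()
  | x :: l => (pushStr a l).bind fun _ => pushBit a x

theorem runs_pushStr (a : Fin 4) (l) (S : Fin 4 → List Bool) :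
    Runs (pushStr (M := M) a l) S (l.length + 1) () (update S a (l ++ S a)) := by
  induction l with
  | nil => exact (Runs.ret () S).cast (by simp) le_rfl
  | cons x l ih => exact (ih.seq (runs_pushBit a x _)).cast (by simp) (by simp)

theorem update_vec4 (a b c d x : List Bool) :
    update ![a, b, c, d] 0 x = ![x, b, c, d] ∧ update ![a, b, c, d] 1 x = ![a, x, c, d] ∧
    update ![a, b, c, d] 2 x = ![a, b, x, d] ∧ update ![a, b, c, d] 3 x = ![a, b, c, x] := by
  refine ⟨?_, ?_, ?_, ?_⟩ <;> funext i <;> fin_cases i <;> rfl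

theorem runs_popBit_bind {X : Type} {N : ι → FinTM2} {G : Option Bool → CtrlFrag N X}
    {x y z w : List Bool} {t r S} (h : Runs (G x.head?) ![x.tail, y, z, w] t r S) :
    Runs ((popBit 0).bind G) ![x, y, z, w] (1 + t) r S := by
  have h₁ := runs_popBit (M := N) 0 ![x, y, z, w]
  rw [(update_vec4 _ _ _ _ _).1] at h₁
  exact h₁.bind h

theorem runs_pushBit_bind {X : Type} {N : ι → FinTM2} {G : CtrlFrag N X} {a b}
    {S t r S'} (h : Runs G (update S a (b :: S a)) t r S') :
    Runs ((pushBit a b).bind fun _ => G) S (1 + t) r S' :=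
  (runs_pushBit a b S).seq h

end Programs

section Closure

open Turing TM2 Function

variable {α β : Type} {i o : α → List Bool}

/-- `PolyTime` is a statement about a family of inputs, so it can be restricted along any map of the
index types, computable or not. -/
theorem PolyTime.comp_index (h : PolyTime i o) (g : β → α) :
    PolyTime (fun b => i (g b)) (fun b => o (g b)) := by
  obtain ⟨h⟩ := h
  exact ⟨{ h with outputsFun := fun b => h.outputsFun (g b) }⟩

theorem PolyTime.refl (i : α → List Bool) : PolyTime i i := by
  have h := idComputableInPolyTime i
  exact ⟨{ idComputableInPolyTime i with }⟩

/-- The second machine works on `o a`, whose length is at most `q`, so its bounds for time and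
output are composed with `q`. -/
theorem PolyTime.comp {o' : α → List Bool} (h : PolyTime i o) (h' : PolyTime o o') :
    PolyTime i o' := by
  obtain ⟨M, p, hM⟩ := h.exists_computes
  obtain ⟨M', p', hM'⟩ := h'.exists_computes
  obtain ⟨q, hq⟩ := h.length_le
  obtain ⟨q', hq'⟩ := h'.length_le
  refine PolyTime.of_runs (M := fun b : Bool => (bif b then M' else M).tm)
    ((call (M := fun b : Bool => bif b then M' else M) false 0 1).bind fun _ => call true 1 0)
    (4 * Polynomial.X + 8 * q + p + 4 * q'.comp q + p'.comp q + 12) fun a => ?_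
  have h₁ := runs_call (M := fun b : Bool => bif b then M' else M) false (a := 0) (b := 1)
    (by decide) (hM a) (S := ![i a, [], [], []]) rfl rfl
  have h₂ := runs_call (M := fun b : Bool => bif b then M' else M) true (a := 1) (b := 0)
    (by decide) (hM' a) (S := ![[], o a, [], []]) rfl rfl
  simp only [update_vec4] at h₁ h₂
  refine (h₁.seq h₂).mono ?_
  have e₁ := polyEval_mono q' (hq a)
  have e₂ := polyEval_mono p' (hq a)
  have := hq a
  have := hq' a
  simp
  omega

/-- A program that calls no machines. -/
theorem PolyTime.of_runs_empty (F : CallFrag (fun e : Empty => e.elim) Unit) (p : Polynomial ℕ)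
    (h : ∀ a, Runs F ![i a, [], [], []] (p.eval (i a).length) () ![o a, [], [], []]) :
    PolyTime i o :=
  PolyTime.of_runs F p h

theorem PolyTime.const (i : α → List Bool) (w : List Bool) : PolyTime i fun _ => w := by
  refine PolyTime.of_runs_empty ((clear 0).bind fun _ => pushStr 0 w)
    (3 * Polynomial.X + Polynomial.C (w.length + 3)) fun a => ?_
  have h₁ := runs_clear (M := fun e : Empty => e.elim) 0 (S := ![i a, [], [], []]) rfl
  have h₂ := runs_pushStr (M := fun e : Empty => e.elim) 0 w ![[], [], [], []]
  simp only [update_vec4] at h₁ h₂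
  exact (h₁.seq h₂).cast (by simp) (by simp; omega)

theorem runs_copy {ι : Type} [DecidableEq ι] {M : ι → TM2ComputableAux Bool Bool}
    (x y z w : List Bool) :
    Runs (eachBit (M := M) 1 fun b => (pushBit 0 b).bind fun _ => pushBit 2 b)
      ![y, x, z, w] (4 * x.length + 2) () ![x.reverse ++ y, [], x.reverse ++ z, w] := by
  induction x generalizing y z with
  | nil => exact Runs.eachBit_nil rfl
  | cons b x ih =>
    refine Runs.cast (Runs.eachBit_cons (x := b) (l := x) rfl
      (runs_pushBit_bind (runs_pushBit _ _ _))
      (Runs.of_eq (ih (b :: y) (b :: z)) ?_)) ?_ ?_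
    · simp [update_vec4]
    · simp
    · simp; omega

theorem runs_double {ι : Type} [DecidableEq ι] {M : ι → TM2ComputableAux Bool Bool}
    (x y z w : List Bool) :
    Runs (eachBit (M := M) 0 fun b => (pushBit 3 b).bind fun _ => pushBit 3 true)
      ![x, y, z, w] (4 * x.length + 2) ()
      ![[], y, z, (x.reverse.flatMap fun b => [true, b]) ++ w] := by
  induction x generalizing w with
  | nil => exact Runs.eachBit_nil rfl
  | cons b x ih =>
    refine Runs.cast (Runs.eachBit_cons (x := b) (l := x) rfl
      (runs_pushBit_bind (runs_pushBit _ _ _))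
      (Runs.of_eq (ih (true :: b :: w)) ?_)) ?_ ?_
    · simp [update_vec4]
    · simp
    · simp; omega

/-- The input is duplicated so that each machine has a copy of its own. The pair is then built on
top of the second output: a separating `false`, and above it the bits of the first output from last
to first, each preceded by `true`. -/
theorem PolyTime.pair {o' : α → List Bool} (h : PolyTime i o) (h' : PolyTime i o') :
    PolyTime i fun a => pairStr (o a) (o' a) := by
  obtain ⟨M, p, hM⟩ := h.exists_computes
  obtain ⟨M', p', hM'⟩ := h'.exists_computes
  obtain ⟨q, hq⟩ := h.length_le
  obtain ⟨q', hq'⟩ := h'.length_le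
  let N : Bool → TM2ComputableAux Bool Bool := fun b => bif b then M' else M
  refine PolyTime.of_runs (M := fun b : Bool => (N b).tm)
    ((moveRev (M := N) 0 1).bind fun _ =>
      (eachBit (M := N) 1 fun b => (pushBit 0 b).bind fun _ => pushBit 2 b).bind fun _ =>
      (call false 0 1).bind fun _ => (call true 2 3).bind fun _ =>
      (moveRev (M := N) 1 0).bind fun _ => (pushBit 3 false).bind fun _ =>
      (eachBit (M := N) 0 fun b => (pushBit 3 b).bind fun _ => pushBit 3 true).bind fun _ =>
      (moveRev (M := N) 3 1).bind fun _ => moveRev (M := N) 1 0)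
    (15 * Polynomial.X + 23 * q + 10 * q' + p + p' + 40) fun a => ?_
  have h₁ := runs_moveRev (M := N) (a := 0) (b := 1) (by decide) (S := ![i a, [], [], []]) rfl
  have h₂ := runs_copy (M := N) (i a).reverse [] [] []
  have h₃ := runs_call (M := N) false (a := 0) (b := 1)
    (by decide) (hM a) (S := ![i a, [], i a, []]) rfl rfl
  have h₄ := runs_call (M := N) true (a := 2) (b := 3)
    (by decide) (hM' a) (S := ![[], o a, i a, []]) rfl rfl
  have h₅ := runs_moveRev (M := N) (a := 1) (b := 0) (by decide) (S := ![[], o a, [], o' a]) rfl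
  have h₆ := runs_pushBit (M := fun i => (N i).tm) 3 false ![(o a).reverse, [], [], o' a]
  have h₇ := runs_double (M := N) (o a).reverse [] [] (false :: o' a)
  have h₈ := runs_moveRev (M := N) (a := 3) (b := 1) (by decide)
    (S := ![[], [], [], pairStr (o a) (o' a)]) rfl
  have h₉ := runs_moveRev (M := N) (a := 1) (b := 0) (by decide)
    (S := ![[], (pairStr (o a) (o' a)).reverse, [], []]) rfl
  simp only [update_vec4, Matrix.cons_val, List.append_nil, List.reverse_reverse,
    List.length_reverse, length_pairStr] at h₁ h₂ h₃ h₄ h₅ h₆ h₇ h₈ h₉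
  refine (h₁.seq (h₂.seq (h₃.seq (h₄.seq (h₅.seq (h₆.seq (h₇.seq (h₈.seq h₉)))))))).mono ?_
  have := hq a
  have := hq' a
  simp
  omega

/-- Decode the first component of a pair. -/
def decodeFst {ι : Type} {M : ι → TM2ComputableAux Bool Bool} : CallFrag M Unit :=
  ((popBit 0).bind fun x => bif x.getD false then
    (popBit 0).bind fun x => (pushBit 1 (x.getD false)).bind fun _ => .ret none
    else .ret (some ())).loop

theorem runs_decodeFst {ι : Type} [DecidableEq ι] {M : ι → TM2ComputableAux Bool Bool}
    (a b y z w : List Bool) :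
    Runs (decodeFst (M := M)) ![pairStr a b, y, z, w] (4 * a.length + 2) ()
      ![b, a.reverse ++ y, z, w] := by
  induction a generalizing y with
  | nil => exact .loop_exit (Runs.mono (runs_popBit_bind (Runs.ret (some ()) _)) (by simp))
  | cons x a ih =>
    refine Runs.cast (Runs.loop_step (t := 4) (S' := ![pairStr a b, x :: y, z, w])
      (Runs.mono (runs_popBit_bind (runs_popBit_bind (runs_pushBit_bind
        ((Runs.ret none _).cast (update_vec4 _ _ _ _ _).2.1 le_rfl)))) le_rfl) (ih _)) ?_ ?_
    · simp
    · simp; omega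

/-- Skip the first component of a pair. -/
def skipFst {ι : Type} {M : ι → TM2ComputableAux Bool Bool} : CallFrag M Unit :=
  ((popBit 0).bind fun x => bif x.getD false then
    (popBit 0).bind fun _ => .ret none else .ret (some ())).loop

theorem runs_skipFst {ι : Type} [DecidableEq ι] {M : ι → TM2ComputableAux Bool Bool}
    (a b y z w : List Bool) :
    Runs (skipFst (M := M)) ![pairStr a b, y, z, w] (3 * a.length + 2) () ![b, y, z, w] := by
  induction a with
  | nil => exact .loop_exit (Runs.mono (runs_popBit_bind (Runs.ret (some ()) _)) (by simp))
  | cons x a ih =>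
    exact Runs.mono (Runs.loop_step (t := 3) (S' := ![pairStr a b, y, z, w])
      (Runs.mono (runs_popBit_bind (runs_popBit_bind (Runs.ret none _))) le_rfl) ih) (by simp; omega)

theorem PolyTime.fst (a b : α → List Bool) : PolyTime (fun x => pairStr (a x) (b x)) a := by
  refine PolyTime.of_runs_empty (decodeFst.bind fun _ => (clear 0).bind fun _ => moveRev 1 0)
    (7 * Polynomial.X + 6) fun x => ?_
  have h₁ := runs_decodeFst (M := fun e : Empty => e.elim) (a x) (b x) [] [] []
  have h₂ := runs_clear (M := fun e : Empty => e.elim) 0 (S := ![b x, (a x).reverse, [], []]) rfl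
  have h₃ := runs_moveRev (M := fun e : Empty => e.elim) (a := 1) (b := 0) (by decide)
    (S := ![[], (a x).reverse, [], []]) rfl
  simp only [update_vec4, Matrix.cons_val, List.append_nil, List.reverse_reverse,
    List.length_reverse] at h₁ h₂ h₃
  refine (h₁.seq (h₂.seq h₃)).mono ?_
  simp [length_pairStr]
  omega

theorem PolyTime.snd (a b : α → List Bool) : PolyTime (fun x => pairStr (a x) (b x)) b :=
  PolyTime.of_runs_empty skipFst (3 * Polynomial.X + 2) fun x =>
    (runs_skipFst (a x) (b x) [] [] []).mono (by simp [length_pairStr]; omega)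

/-- Repetition as long as the first bit is `1`. -/
theorem PolyTime.iterate {γ : Type} {e : γ → List Bool} {G : γ → γ}
    (hG : PolyTime (fun g : {g // (e g).head? = some true} => e g) fun g => e (G g))
    (s : α → γ) (N : α → ℕ) (p q : Polynomial ℕ)
    (hN : ∀ a, N a ≤ q.eval (e (s a)).length)
    (hp : ∀ a, ∀ k ≤ N a, (e (G^[k] (s a))).length ≤ p.eval (e (s a)).length)
    (h_step : ∀ a, ∀ k < N a, (e (G^[k] (s a))).head? = some true)
    (h_exit : ∀ a, (e (G^[N a] (s a))).head? ≠ some true) :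
    PolyTime (fun a => e (s a)) fun a => e (G^[N a] (s a)) := by
  obtain ⟨M', T, hM⟩ := hG.exists_computes
  let M : Unit → TM2ComputableAux Bool Bool := fun _ => M'
  -- The first bit is popped only to be tested, and `pushStr` puts it back.
  refine PolyTime.of_runs (M := fun i => (M i).tm) (((popBit 0).bind fun x =>
    (pushStr 0 x.toList).bind fun _ => bif x.getD false then
      (call (M := M) () 0 1).bind fun _ => (moveRev (M := M) 1 2).bind fun _ =>
        (moveRev (M := M) 2 0).bind fun _ => .ret none else .ret (some ())).loop)
    ((14 * p + T.comp p + 30) * q + 6) fun a => ?_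
  -- Bounds one round: a call and two moves of strings of length at most `p`, and the running time
  -- `T` of the machine on such a string.
  set C := 14 * p.eval (e (s a)).length + T.eval (p.eval (e (s a)).length) + 30 with hC
  suffices h : ∀ k m, k + m = N a → Runs _ ![e (G^[k] (s a)), [], [], []] (C * m + 6) ()
      ![e (G^[N a] (s a)), [], [], []] from
    (h 0 (N a) (by omega)).mono (by
      have := Nat.mul_le_mul_left C (hN a)
      simp [← hC]; omega)
  -- Induction on the number `m` of rounds still to come after the first `k`.
  intro k m hkm
  induction m generalizing k with
  | zero =>
    obtain rfl : k = N a := by omega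
    have h := h_exit a
    generalize e (G^[N a] (s a)) = l at h
    rcases l with _ | ⟨b, l⟩
    · exact Runs.loop_exit (Runs.mono (runs_popBit_bind ((runs_pushStr 0 [] _).seq
        ((Runs.ret (some ()) _).cast (update_vec4 _ _ _ _ _).1 le_rfl))) (by simp))
    · obtain rfl : b = false := by simpa using h
      exact Runs.loop_exit (Runs.mono (runs_popBit_bind ((runs_pushStr 0 [false] _).seq
        ((Runs.ret (some ()) _).cast (update_vec4 _ _ _ _ _).1 le_rfl))) (by simp))
  | succ m ih =>
    have h := h_step a k (by omega)
    have h₀ := ih (k + 1) (by omega)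
    have h₂ := runs_call (M := M) () (a := 0) (b := 1) (by decide) (hM ⟨_, h⟩)
      (S := ![e (G^[k] (s a)), [], [], []]) rfl rfl
    have h₃ := runs_moveRev (M := M) (a := 1) (b := 2) (by decide)
      (S := ![[], e (G (G^[k] (s a))), [], []]) rfl
    have h₄ := runs_moveRev (M := M) (a := 2) (b := 0) (by decide)
      (S := ![[], [], (e (G (G^[k] (s a)))).reverse, []]) rfl
    have hp₁ := hp a k (by omega)
    have hp₂ := hp a (k + 1) (by omega)
    rw [Function.iterate_succ_apply'] at h₀ hp₂
    have hT := polyEval_mono T hp₁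
    simp only [update_vec4, Matrix.cons_val, List.append_nil, List.reverse_reverse,
      List.length_reverse] at h₂ h₃ h₄
    have h₅ := h₂.seq (h₃.seq (h₄.seq (Runs.ret (none : Option Unit) _)))
    obtain ⟨l, hl⟩ : ∃ l, e (G^[k] (s a)) = true :: l := by
      revert h
      rcases e (G^[k] (s a)) with _ | ⟨b, l⟩ <;> simp
    rw [hl] at h₅ ⊢
    refine Runs.mono (Runs.loop_step (runs_popBit_bind ((runs_pushStr 0 [true] _).seq
      (Runs.of_eq h₅ (update_vec4 _ _ _ _ _).1.symm))) h₀) ?_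
    rw [← hl, Nat.mul_add]
    simp only [List.length_cons, List.length_nil]
    omega

/-- Replace a first bit by a string. -/
theorem PolyTime.headRewrite (w : Bool → List Bool) (b : α → Bool) (l : α → List Bool) :
    PolyTime (fun a => b a :: l a) fun a => w (b a) ++ l a := by
  refine PolyTime.of_runs_empty ((popBit 0).bind fun x => pushStr 0 (w (x.getD false)))
    (Polynomial.C ((w true).length + (w false).length + 3)) fun a => ?_
  refine Runs.mono (runs_popBit_bind ((runs_pushStr _ _ _).cast (update_vec4 _ _ _ _ _).1 le_rfl)) ?_
  simp only [List.head?_cons, Option.getD_some, Polynomial.eval_C]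
  cases b a <;> omega

/-- Replace the prefix `0` by `v` and the prefix `100` by `w`. -/
theorem PolyTime.prefixRewrite (v w : List Bool) (b : α → Bool) (l : α → List Bool) :
    PolyTime (fun a => (bif b a then [true, false, false] else [false]) ++ l a)
      fun a => (bif b a then w else v) ++ l a := by
  refine PolyTime.of_runs_empty ((popBit 0).bind fun x => bif x.getD false then
    (popBit 0).bind fun _ => (popBit 0).bind fun _ => pushStr 0 w else pushStr 0 v)
    (Polynomial.C (w.length + v.length + 4)) fun a => ?_
  cases b a
  · exact Runs.mono (runs_popBit_bind
      ((runs_pushStr _ _ _).cast (update_vec4 _ _ _ _ _).1 le_rfl)) (by simp; omega)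
  · exact Runs.mono (runs_popBit_bind (runs_popBit_bind (runs_popBit_bind
      ((runs_pushStr _ _ _).cast (update_vec4 _ _ _ _ _).1 le_rfl)))) (by simp; omega)

end Closure

/-! ### Polynomial-time functions between encoded types -/

/-- Types with an encoding by bit strings. -/
class Enc (α : Type) where
  enc : α → List Bool

open Enc (enc)

section Encodings

variable {α β : Type} [Enc α] [Enc β]

/-- The codes are chosen to coincide: the unit, zero, `false` and the empty list all have the empty
code; the number `n` has the code of a list of `n` units, and a bit that of a list of at most one
unit. Changing between these views needs no computation. -/
instance : Enc Unit := ⟨fun _ => []⟩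
instance : Enc ℕ := ⟨fun n => List.replicate n false⟩
instance : Enc Bool := ⟨fun b => bif b then [false] else []⟩
instance : Enc (α × β) := ⟨fun p => pairStr (enc p.1) (enc p.2)⟩
instance : Enc (List α) := ⟨List.foldr (fun x l => pairStr (enc x) l) []⟩

theorem enc_cons (a : α) (l : List α) : enc (a :: l) = pairStr (enc a) (enc l) := rfl
theorem enc_succ (n : ℕ) : enc (n + 1) = false :: enc n := rfl

/-- The length of the encoding. -/
def sz (a : α) : ℕ := (enc a).length

@[simp] theorem sz_nat (n : ℕ) : sz n = n := by simp [sz, enc]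
@[simp] theorem sz_prod (p : α × β) : sz p = 2 * sz p.1 + sz p.2 + 1 := length_pairStr _ _
@[simp] theorem sz_nil : sz ([] : List α) = 0 := rfl
@[simp] theorem sz_cons (a : α) (l : List α) : sz (a :: l) = 2 * sz a + sz l + 1 :=
  length_pairStr _ _
@[simp] theorem sz_append (l l' : List α) : sz (l ++ l') = sz l + sz l' := by
  induction l with
  | nil => simp
  | cons x l ih => simp [ih]; omega
theorem sz_le_of_mem {x : α} {l : List α} (h : x ∈ l) : sz x ≤ sz l := by
  induction l with
  | nil => cases h
  | cons y l ih =>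
    rcases List.mem_cons.1 h with rfl | h
    · simp; omega
    · have := ih h; simp; omega
theorem length_le_sz (l : List α) : l.length ≤ sz l := by
  induction l with
  | nil => simp
  | cons y l ih => simp; omega
theorem sz_bool_le (b : Bool) : sz b ≤ 1 := by cases b <;> simp [sz, enc]

end Encodings

/-- Functions that are computable in polynomial time. -/
@[fun_prop]
def PolyFun {α β : Type} [Enc α] [Enc β] (f : α → β) : Prop := PolyTime enc fun a => enc (f a)

section

variable {α β γ : Type}

/-- The steps of a fold, with the rest of the list and the context kept in the state. -/
def foldStep (step : α → γ → β → γ) : List β × γ × α → List β × γ × α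
  | ([], p) => ([], p)
  | (x :: l, s, a) => (l, step a s x, a)

theorem iterate_foldStep (step : α → γ → β → γ) (a : α) (s : γ) (l : List β) (k : ℕ)
    (hk : k ≤ l.length) :
    (foldStep step)^[k] (l, s, a) = (l.drop k, (l.take k).foldl (step a) s, a) := by
  induction k generalizing l s with
  | zero => simp
  | succ k ih =>
    cases l with
    | nil => simp at hk
    | cons x l =>
      rw [Function.iterate_succ_apply]
      simp only [foldStep]
      rw [ih _ _ (by simpa using hk)]
      simp

end

namespace PolyFun

variable {α β γ δ : Type} [Enc α] [Enc β] [Enc γ] [Enc δ]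

@[fun_prop]
theorem id : PolyFun fun a : α => a := PolyTime.refl _

@[fun_prop]
theorem const (b : β) : PolyFun fun _ : α => b := PolyTime.const _ _

@[fun_prop]
theorem comp {g : β → γ} {f : α → β} (hg : PolyFun g) (hf : PolyFun f) :
    PolyFun fun a => g (f a) := PolyTime.comp hf (PolyTime.comp_index hg f)

@[fun_prop]
theorem mk {f : α → β} {g : α → γ} (hf : PolyFun f) (hg : PolyFun g) :
    PolyFun fun a => (f a, g a) := PolyTime.pair hf hg

@[fun_prop]
theorem fst {f : α → β × γ} (hf : PolyFun f) : PolyFun fun a => (f a).1 :=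
  PolyTime.comp hf (PolyTime.fst _ _)

@[fun_prop]
theorem snd {f : α → β × γ} (hf : PolyFun f) : PolyFun fun a => (f a).2 :=
  PolyTime.comp hf (PolyTime.snd _ _)

@[fun_prop]
theorem cons {f : α → β} {g : α → List β} (hf : PolyFun f) (hg : PolyFun g) :
    PolyFun fun a => f a :: g a := PolyTime.pair hf hg

/-- Functions with the same encoded values. -/
theorem recode {f : α → β} {g : α → γ} (hf : PolyFun f) (h : ∀ a, enc (f a) = enc (g a)) :
    PolyFun g := by
  unfold PolyFun
  simp only [← h]
  exact hf

theorem congr {f g : α → β} (hf : PolyFun f) (h : ∀ a, f a = g a) : PolyFun g :=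
  (funext h : f = g) ▸ hf

theorem sz_le {f : α → β} (hf : PolyFun f) : ∃ p : Polynomial ℕ, ∀ a, sz (f a) ≤ p.eval (sz a) :=
  PolyTime.length_le hf

/-- The loop test of `PolyTime.iterate`: the code of a pair begins with `1` exactly as long as its
first component, the part of the input still to be processed, has a nonempty code. -/
theorem head_pairStr (x y : List Bool) : (pairStr x y).head? = some true ↔ x ≠ [] := by
  cases x <;> simp [pairStr]

/-- The code of a nonempty list is the pair of the codes of its head and its tail, so every part of
the state is reached by projections. The loop has stopped before the list is empty, hence the
restriction to a subtype. -/
theorem foldStep_polyTime {step : α → γ → β → γ}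
    (hstep : PolyFun fun p : α × γ × β => step p.1 p.2.1 p.2.2) :
    PolyTime (fun g : {g : List β × γ × α // (enc g).head? = some true} => enc g.1)
      fun g => enc (foldStep step g.1) := by
  have h (g : {g : List β × γ × α // (enc g).head? = some true}) :
      ∃ x l, g.1.1 = x :: l := by
    obtain ⟨⟨l, s, a⟩, hg⟩ := g
    have := (head_pairStr _ _).1 hg
    cases l with
    | nil => exact absurd rfl this
    | cons x l => exact ⟨x, l, rfl⟩
  choose x l hx using h
  have h₁ : PolyTime (fun g : {g : List β × γ × α // (enc g).head? = some true} => enc g.1)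
      fun g => pairStr (enc (x g)) (enc (l g)) := by
    have h₀ := PolyTime.fst
      (fun g : {g : List β × γ × α // (enc g).head? = some true} => enc g.1.1)
      (fun g => enc g.1.2)
    have e : (fun g : {g : List β × γ × α // (enc g).head? = some true} =>
        pairStr (enc (x g)) (enc (l g))) = fun g => enc g.1.1 := by
      funext g; rw [hx g]; rfl
    rw [e]
    exact h₀
  have h₂ := h₁.comp (PolyTime.fst _ _)
  have h₃ := h₁.comp (PolyTime.snd _ _)
  have h₄ := PolyTime.snd
    (fun g : {g : List β × γ × α // (enc g).head? = some true} => enc g.1.1) (fun g => enc g.1.2)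
  have h₅ := h₄.comp (PolyTime.fst _ _)
  have h₆ := h₄.comp (PolyTime.snd _ _)
  have h₇ := (h₆.pair (h₅.pair h₂)).comp
    (hstep.comp_index fun g : {g : List β × γ × α // (enc g).head? = some true} =>
      (g.1.2.2, g.1.2.1, x g))
  have h₈ := h₃.pair (h₇.pair h₆)
  have e : (fun g : {g : List β × γ × α // (enc g).head? = some true} =>
      enc (foldStep step g.1)) = fun g => pairStr (enc (l g))
        (pairStr (enc (step g.1.2.2 g.1.2.1 (x g))) (enc g.1.2.2)) := by
    funext g
    have h₉ := hx g
    obtain ⟨⟨l', s, a⟩, hg⟩ := g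
    dsimp only at h₉
    generalize x ⟨(l', s, a), hg⟩ = x' at *
    generalize l ⟨(l', s, a), hg⟩ = l'' at *
    subst h₉
    rfl
  rw [e]
  exact h₈

/-- Bounded recursion: a polynomial-time step may be iterated provided that the intermediate states,
which are the folds over prefixes, stay of polynomial size. Without this bound the size could double
in every step. -/
theorem foldl_of_le {l : α → List β} {s : α → γ} {step : α → γ → β → γ} (hl : PolyFun l)
    (hs : PolyFun s) (hstep : PolyFun fun p : α × γ × β => step p.1 p.2.1 p.2.2)
    (hb : ∃ q : Polynomial ℕ, ∀ a, ∀ l', l' <+: l a →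
      sz (l'.foldl (step a) (s a)) ≤ q.eval (sz a)) :
    PolyFun fun a => (l a).foldl (step a) (s a) := by
  obtain ⟨q, hq⟩ := hb
  have h₁ : PolyFun fun a => (l a, s a, a) := by fun_prop
  have sz_le_start (a : α) : sz a ≤ sz (l a, s a, a) := by simp; omega
  -- The size of a nested pair: twice the remaining list, twice a fold over a prefix, the context
  -- and two separators, all measured by the size of the starting state, which is at least `sz a`.
  have h₂ := PolyTime.iterate (foldStep_polyTime hstep) (fun a => (l a, s a, a))
    (fun a => (l a).length) (2 * Polynomial.X + 2 * q + Polynomial.X + 2) Polynomial.X ?_ ?_ ?_ ?_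
  · refine PolyTime.comp h₁ (PolyTime.comp h₂ ?_)
    have h₃ (a : α) : (foldStep step)^[(l a).length] (l a, s a, a) =
        ([], (l a).foldl (step a) (s a), a) := by
      rw [iterate_foldStep _ _ _ _ _ le_rfl]; simp
    simp only [h₃]
    exact (PolyTime.snd _ _).comp (PolyTime.fst _ _)
  · intro a
    have := length_le_sz (l a)
    simp only [Polynomial.eval_X]
    change _ ≤ sz (l a, s a, a)
    simp
    omega
  · intro a k hk
    rw [iterate_foldStep _ _ _ _ _ hk]
    have h₃ := hq a _ (List.take_prefix k (l a))
    have h₄ : sz ((l a).drop k) ≤ sz (l a) := by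
      have := sz_append ((l a).take k) ((l a).drop k)
      rw [List.take_append_drop] at this
      omega
    have h₅ := polyEval_mono q (sz_le_start a)
    simp only [Polynomial.eval_add, Polynomial.eval_mul, Polynomial.eval_X, Polynomial.eval_ofNat]
    change sz _ ≤ 2 * sz _ + 2 * q.eval (sz _) + sz _ + 2
    have h₆ : sz (l a) ≤ sz (l a, s a, a) := by simp; omega
    simp only [sz_prod] at *
    omega
  · intro a k hk
    rw [iterate_foldStep _ _ _ _ _ hk.le]
    refine (head_pairStr _ _).2 ?_
    rw [List.drop_eq_getElem_cons hk]
    intro h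
    have h₀ : sz ((l a)[k] :: (l a).drop (k + 1)) = 0 := congrArg List.length h
    rw [sz_cons] at h₀
    omega
  · intro a
    rw [iterate_foldStep _ _ _ _ _ le_rfl]
    intro h
    exact (head_pairStr _ _).1 h (by simp; rfl)

theorem sz_le_of_mem {l : α → List β} {f : α → β → γ} (hl : PolyFun l)
    (hf : PolyFun fun p : α × β => f p.1 p.2) :
    ∃ q : Polynomial ℕ, ∀ a, ∀ x ∈ l a, sz (f a x) ≤ q.eval (sz a) := by
  obtain ⟨p, hp⟩ := hl.sz_le
  obtain ⟨q, hq⟩ := hf.sz_le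
  refine ⟨q.comp (2 * Polynomial.X + p + 1), fun a x hx => (hq (a, x)).trans ?_⟩
  rw [Polynomial.eval_comp]
  refine polyEval_mono q ?_
  have := (QCCA.sz_le_of_mem hx).trans (hp a)
  simp
  omega

/-- Folds whose state grows by a bounded amount in every step. -/
theorem foldl {l : α → List β} {s : α → γ} {step : α → γ → β → γ} (hl : PolyFun l)
    (hs : PolyFun s) (hstep : PolyFun fun p : α × γ × β => step p.1 p.2.1 p.2.2)
    (hb : ∃ q : Polynomial ℕ, ∀ a s, ∀ x ∈ l a, sz (step a s x) ≤ sz s + q.eval (sz a)) :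
    PolyFun fun a => (l a).foldl (step a) (s a) := by
  obtain ⟨q, hq⟩ := hb
  obtain ⟨pl, hpl⟩ := hl.sz_le
  obtain ⟨ps, hps⟩ := hs.sz_le
  refine foldl_of_le hl hs hstep ⟨ps + pl * q, fun a l' hl' => ?_⟩
  have key : sz (l'.foldl (step a) (s a)) ≤ sz (s a) + l'.length * q.eval (sz a) := by
    have hmem : ∀ x ∈ l', x ∈ l a := fun x hx => hl'.subset hx
    clear hl'
    generalize s a = s₀
    induction l' generalizing s₀ with
    | nil => simp
    | cons x l' ih =>
      have h₁ := ih (fun y hy => hmem y (List.mem_cons_of_mem _ hy)) (step a s₀ x)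
      have h₂ := hq a s₀ x (hmem x List.mem_cons_self)
      simp only [List.foldl_cons, List.length_cons, Nat.add_mul]
      omega
  have h₁ := hps a
  have h₂ := Nat.mul_le_mul_right (q.eval (sz a))
    ((hl'.length_le.trans (length_le_sz _)).trans (hpl a))
  simp only [Polynomial.eval_add, Polynomial.eval_mul]
  omega

@[fun_prop]
theorem reverse {l : α → List β} (hl : PolyFun l) : PolyFun fun a => (l a).reverse := by
  obtain ⟨p, hp⟩ := hl.sz_le
  refine (foldl (s := fun _ => []) (step := fun _ s x => x :: s) hl (const _) (by fun_prop)
    ⟨2 * p + 1, fun a s x hx => ?_⟩).congr fun a => by simp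
  have := (QCCA.sz_le_of_mem hx).trans (hp a)
  simp
  omega

@[fun_prop]
theorem append {l l' : α → List β} (hl : PolyFun l) (hl' : PolyFun l') :
    PolyFun fun a => l a ++ l' a := by
  obtain ⟨p, hp⟩ := hl.reverse.sz_le
  refine (foldl (s := l') (step := fun _ s x => x :: s) hl.reverse hl' (by fun_prop)
    ⟨2 * p + 1, fun a s x hx => ?_⟩).congr fun a => by simp
  have := (QCCA.sz_le_of_mem hx).trans (hp a)
  simp
  omega

theorem flatMap {l : α → List β} {f : α → β → List γ} (hl : PolyFun l)
    (hf : PolyFun fun p : α × β => f p.1 p.2) : PolyFun fun a => (l a).flatMap (f a) := by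
  obtain ⟨q, hq⟩ := sz_le_of_mem hl hf
  refine (foldl (s := fun _ => []) (step := fun a s x => s ++ f a x) hl (const _) (by fun_prop)
    ⟨q, fun a s x hx => ?_⟩).congr fun a => ?_
  · have := hq a x hx
    simp
    omega
  · have (l : List β) (s : List γ) : l.foldl (fun s x => s ++ f a x) s = s ++ l.flatMap (f a) := by
      induction l generalizing s with
      | nil => simp
      | cons x l ih => simp [ih]
    simp [this]

theorem map {l : α → List β} {f : α → β → γ} (hl : PolyFun l)
    (hf : PolyFun fun p : α × β => f p.1 p.2) : PolyFun fun a => (l a).map (f a) :=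
  (flatMap (f := fun a x => [f a x]) hl (by fun_prop)).congr fun a => by
    induction l a <;> simp_all

@[fun_prop]
theorem succ {f : α → ℕ} (hf : PolyFun f) : PolyFun fun a => f a + 1 := by
  -- Pairing with the unit puts a single `false` in front of the code, which is the successor in
  -- unary.
  have : PolyFun fun a => ((), f a) := by fun_prop
  exact this.recode fun a => rfl

/-- A natural number as a list. -/
@[fun_prop]
theorem replicate_unit {f : α → ℕ} (hf : PolyFun f) :
    PolyFun fun a => List.replicate (f a) () :=
  -- A unit has the empty code, so each entry contributes just its separator.
  hf.recode fun a => by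
    generalize f a = n
    induction n with
    | zero => rfl
    | succ n ih => rw [List.replicate_succ, enc_succ, ih, enc_cons]; rfl

@[fun_prop]
theorem length {l : α → List β} (hl : PolyFun l) : PolyFun fun a => (l a).length :=
  (foldl (s := fun _ => 0) (step := fun _ s _ => s + 1) hl (const _) (by fun_prop)
    ⟨1, fun a s x _ => by simp⟩).congr fun a => by simp

/-- A fold over `n a` units that ignores the units. -/
theorem iterate {n : α → ℕ} {s : α → β} {step : α → β → β} (hn : PolyFun n) (hs : PolyFun s)
    (hstep : PolyFun fun p : α × β => step p.1 p.2)
    (hb : ∃ q : Polynomial ℕ, ∀ a, ∀ k ≤ n a, sz ((step a)^[k] (s a)) ≤ q.eval (sz a)) :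
    PolyFun fun a => (step a)^[n a] (s a) := by
  have key (a : α) (k : ℕ) (s : β) :
      (List.replicate k ()).foldl (fun s _ => step a s) s = (step a)^[k] s := by
    induction k generalizing s with
    | zero => rfl
    | succ k ih => rw [List.replicate_succ, List.foldl_cons, ih, Function.iterate_succ_apply]
  obtain ⟨q, hq⟩ := hb
  refine (foldl_of_le (step := fun a s _ => step a s) hn.replicate_unit hs (by fun_prop)
    ⟨q, fun a l' hl' => ?_⟩).congr fun a => key a _ _
  have : l' = List.replicate l'.length () := List.eq_replicate_of_mem fun _ _ => rfl
  rw [this, key]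
  exact hq a _ (by simpa using hl'.length_le)

@[fun_prop]
theorem add {f g : α → ℕ} (hf : PolyFun f) (hg : PolyFun g) : PolyFun fun a => f a + g a := by
  obtain ⟨p, hp⟩ := hf.sz_le
  obtain ⟨q, hq⟩ := hg.sz_le
  refine (iterate (n := g) (step := fun _ s => s + 1) hg hf (by fun_prop)
    ⟨p + q, fun a k hk => ?_⟩).congr fun a => by simp
  have := hp a
  have := hq a
  simp at *
  omega

@[fun_prop]
theorem mul {f g : α → ℕ} (hf : PolyFun f) (hg : PolyFun g) : PolyFun fun a => f a * g a := by
  obtain ⟨p, hp⟩ := hf.sz_le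
  obtain ⟨q, hq⟩ := hg.sz_le
  have key (a : α) (k : ℕ) : (fun s => s + f a)^[k] 0 = f a * k := by
    induction k with
    | zero => simp
    | succ k ih => rw [Function.iterate_succ_apply', ih]; ring
  refine (iterate (n := g) (step := fun a s => s + f a) hg (const 0) (by fun_prop)
    ⟨p * q, fun a k hk => ?_⟩).congr fun a => key a _
  rw [key]
  have h₁ := hp a
  have h₂ := hq a
  simp at *
  exact Nat.mul_le_mul h₁ (hk.trans h₂)

@[fun_prop]
theorem range {n : α → ℕ} (hn : PolyFun n) : PolyFun fun a => List.range (n a) := by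
  obtain ⟨p, hp⟩ := hn.sz_le
  have key (k : ℕ) : (fun s : List ℕ × ℕ => (s.1 ++ [s.2], s.2 + 1))^[k] ([], 0) =
      (List.range k, k) := by
    induction k with
    | zero => simp
    | succ k ih => rw [Function.iterate_succ_apply', ih, List.range_succ]
  have hsz (k : ℕ) : sz (List.range k) ≤ k * (2 * k + 1) := by
    induction k with
    | zero => simp
    | succ k ih => rw [List.range_succ]; simp; nlinarith
  refine ((iterate (n := n) (s := fun _ => (([] : List ℕ), 0))
    (step := fun _ s => (s.1 ++ [s.2], s.2 + 1)) hn (const _) (by fun_prop)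
    ⟨2 * (p * (2 * p + 1)) + p + 1, fun a k hk => ?_⟩).congr fun a => key _).fst
  have h₁ := hp a
  have h₂ := hsz k
  have h₃ : k ≤ p.eval (sz a) := by simp at h₁; omega
  have h₄ : k * (2 * k + 1) ≤ p.eval (sz a) * (2 * p.eval (sz a) + 1) :=
    Nat.mul_le_mul h₃ (by omega)
  rw [key]
  simp
  omega

-- Branching is a fold: a bit has the code of a list of at most one unit, and folding over that list
-- either replaces `g a` by `f a` or leaves it alone.
@[fun_prop]
theorem cond {c : α → Bool} {f g : α → β} (hc : PolyFun c) (hf : PolyFun f) (hg : PolyFun g) :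
    PolyFun fun a => bif c a then f a else g a := by
  have h₁ : PolyFun fun a => bif c a then [()] else [] := hc.recode fun a => by
    cases c a <;> simp [enc, pairStr]
  obtain ⟨p, hp⟩ := hf.sz_le
  refine (foldl (step := fun a _ _ => f a) h₁ hg (by fun_prop)
    ⟨p, fun a s _ _ => (hp a).trans (by omega)⟩).congr fun a => by
    cases c a <;> simp

theorem ite {c : α → Prop} [DecidablePred c] {f g : α → β} (hc : PolyFun fun a => decide (c a))
    (hf : PolyFun f) (hg : PolyFun g) : PolyFun fun a => if c a then f a else g a :=
  (cond hc hf hg).congr fun a => by by_cases h : c a <;> simp [h]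

@[fun_prop]
theorem not {c : α → Bool} (hc : PolyFun c) : PolyFun fun a => !c a :=
  (cond hc (const false) (const true)).congr fun a => by cases c a <;> rfl

@[fun_prop]
theorem and {c d : α → Bool} (hc : PolyFun c) (hd : PolyFun d) : PolyFun fun a => c a && d a :=
  (cond hc hd (const false)).congr fun a => by cases c a <;> rfl

@[fun_prop]
theorem headD {l : α → List β} (hl : PolyFun l) (d : β) : PolyFun fun a => (l a).headD d := by
  obtain ⟨p, hp⟩ := hl.reverse.sz_le
  refine (foldl (s := fun _ => d) (step := fun _ _ x => x) hl.reverse (const _) (by fun_prop)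
    ⟨p, fun a s x hx => ((QCCA.sz_le_of_mem hx).trans (hp a)).trans (by omega)⟩).congr fun a => ?_
  cases l a <;> simp

-- As for Kleene's predecessor, the list built so far is carried along together with its previous
-- value. On an arbitrary state the step copies the first component, so its growth is not bounded
-- and `foldl` does not apply; the states that really occur are bounded directly.
@[fun_prop]
theorem tail {l : α → List β} (hl : PolyFun l) : PolyFun fun a => (l a).tail := by
  obtain ⟨p, hp⟩ := hl.sz_le
  have key (l : List β) : l.reverse.foldl (fun s x => (x :: s.1, s.1)) (([], []) : List β × List β) =
      (l, l.tail) := by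
    induction l with
    | nil => rfl
    | cons x l ih => simp [ih]
  refine ((foldl_of_le (s := fun _ => (([], []) : List β × List β))
    (step := fun _ s x => (x :: s.1, s.1)) hl.reverse (const _) (by fun_prop)
    ⟨3 * p + 1, fun a l' hl' => ?_⟩).congr fun a => key _).snd
  obtain ⟨t, ht⟩ := hl'
  have h₁ : l a = t.reverse ++ l'.reverse := by
    rw [← List.reverse_append, ht, List.reverse_reverse]
  have h₂ := hp a
  have h₃ := key l'.reverse
  rw [List.reverse_reverse] at h₃
  rw [h₁] at h₂
  rw [h₃]
  have h₄ : sz l'.reverse.tail ≤ sz l'.reverse := by cases l'.reverse <;> simp; omega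
  simp at *
  omega

@[fun_prop]
theorem pred {f : α → ℕ} (hf : PolyFun f) : PolyFun fun a => f a - 1 :=
  (hf.replicate_unit.tail).length.congr fun a => by simp

@[fun_prop]
theorem sub {f g : α → ℕ} (hf : PolyFun f) (hg : PolyFun g) : PolyFun fun a => f a - g a := by
  obtain ⟨p, hp⟩ := hf.sz_le
  have key (a : α) (k : ℕ) : (fun s => s - 1)^[k] (f a) = f a - k := by
    induction k with
    | zero => simp
    | succ k ih => rw [Function.iterate_succ_apply', ih]; omega
  refine (iterate (n := g) (step := fun a s => s - 1) hg hf (by fun_prop)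
    ⟨p, fun a k hk => ?_⟩).congr fun a => key a _
  rw [key]
  have := hp a
  simp at *
  omega

theorem isZero {f : α → ℕ} (hf : PolyFun f) : PolyFun fun a => decide (f a = 0) := by
  refine (foldl (s := fun _ => true) (step := fun _ _ _ => false) hf.replicate_unit (const _)
    (by fun_prop) ⟨1, fun a s x _ => (sz_bool_le _).trans (by simp)⟩).congr fun a => ?_
  cases f a with
  | zero => rfl
  | succ n =>
    rw [List.replicate_succ]
    have (l : List Unit) : l.foldl (fun _ _ => false) false = false := by
      induction l <;> simp_all
    simp [this]

@[fun_prop]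
theorem decide_le {f g : α → ℕ} (hf : PolyFun f) (hg : PolyFun g) :
    PolyFun fun a => decide (f a ≤ g a) :=
  (isZero (hf.sub hg)).congr fun a => by simp [Nat.sub_eq_zero_iff_le]

@[fun_prop]
theorem decide_lt {f g : α → ℕ} (hf : PolyFun f) (hg : PolyFun g) :
    PolyFun fun a => decide (f a < g a) := decide_le hf.succ hg

@[fun_prop]
theorem decide_eq {f g : α → ℕ} (hf : PolyFun f) (hg : PolyFun g) :
    PolyFun fun a => decide (f a = g a) :=
  (and (decide_le hf hg) (decide_le hg hf)).congr fun a => by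
    simp only [← Bool.decide_and, le_antisymm_iff]

end PolyFun

/-! ### Uniform descriptions -/

/-- Bit strings that are encoded by themselves. -/
structure Raw : Type where
  bits : List Bool

instance : Enc Raw := ⟨Raw.bits⟩

/-- Add a bit to a string. -/
def Raw.cons (b : Bool) (r : Raw) : Raw := ⟨b :: r.bits⟩

theorem Raw.sz_cons (b : Bool) (r : Raw) : sz (Raw.cons b r) = sz r + 1 := rfl

theorem sz_raw (r : Raw) : sz r = r.bits.length := rfl

namespace PolyFun

theorem enc_bool_raw (b : Bool) (r : Raw) :
    enc (b, r) = (bif b then [true, false, false] else [false]) ++ enc r := by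
  cases b <;> rfl

-- The code of the pair starts with `100` for the bit `1` and with `0` for the bit `0`; only this
-- prefix has to be replaced by the bit.
@[fun_prop]
theorem rawCons : PolyFun fun p : Bool × Raw => Raw.cons p.1 p.2 := by
  have h := PolyTime.prefixRewrite (α := Bool × Raw) [false] [true] (fun p => p.1)
    (fun p => enc p.2)
  have e : (fun p : Bool × Raw =>
      (bif p.1 then [true, false, false] else [false]) ++ enc p.2) = enc :=
    funext fun p => (enc_bool_raw _ _).symm
  have e' : (fun p : Bool × Raw => (bif p.1 then [true] else [false]) ++ enc p.2) =
      fun p => enc (Raw.cons p.1 p.2) := by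
    funext p
    rcases p with ⟨_ | _, r⟩ <;> rfl
  rw [e, e'] at h
  exact h

theorem toRaw : PolyFun Raw.mk := by
  have h : PolyFun fun l : List Bool => l.reverse.foldl (fun s x => Raw.cons x s) ⟨[]⟩ := by
    refine foldl (l := fun l : List Bool => l.reverse) (s := fun _ => ⟨[]⟩) (step := fun _ s x => Raw.cons x s)
      (by fun_prop) (const _) ?_ ⟨1, fun a s x _ => ?_⟩
    · exact rawCons.comp (by fun_prop : PolyFun fun p : List Bool × Raw × Bool => (p.2.2, p.2.1))
    · rw [Raw.sz_cons]; simp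
  refine h.congr fun l => ?_
  rw [List.foldl_reverse]
  induction l with
  | nil => rfl
  | cons x l ih => rw [List.foldr_cons, ih]; rfl

/-- Move a bit from a string to a list. -/
def unrawStep : Raw × List Bool → Raw × List Bool
  | (⟨[]⟩, l) => (⟨[]⟩, l)
  | (⟨b :: r⟩, l) => (⟨r⟩, b :: l)

theorem iterate_unrawStep (r : List Bool) (k : ℕ) (hk : k ≤ r.length) (l : List Bool) :
    unrawStep^[k] (⟨r⟩, l) = (⟨r.drop k⟩, (r.take k).reverse ++ l) := by
  induction k generalizing r l with
  | zero => simp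
  | succ k ih =>
    cases r with
    | nil => simp at hk
    | cons b r =>
      rw [Function.iterate_succ_apply]
      refine (ih r (by simpa using hk) (b :: l)).trans ?_
      simp

theorem unrawStep_polyTime :
    PolyTime (fun g : {g : Raw × List Bool // (enc g).head? = some true} => enc g.1)
      fun g => enc (unrawStep g.1) := by
  have h (g : {g : Raw × List Bool // (enc g).head? = some true}) :
      ∃ (b : Bool) (r : Raw), g.1.1 = Raw.cons b r := by
    obtain ⟨⟨⟨r⟩, l⟩, hg⟩ := g
    have := (head_pairStr _ _).1 hg
    cases r with
    | nil => exact absurd rfl this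
    | cons x l => exact ⟨x, ⟨l⟩, rfl⟩
  choose b r hx using h
  have h₁ := PolyTime.fst
    (fun g : {g : Raw × List Bool // (enc g).head? = some true} => enc g.1.1)
    (fun g => enc g.1.2)
  have h₂ := PolyTime.snd
    (fun g : {g : Raw × List Bool // (enc g).head? = some true} => enc g.1.1)
    (fun g => enc g.1.2)
  have h₃ := PolyTime.headRewrite (fun b => bif b then [true, false, false] else [false]) b
    (fun g => enc (r g))
  have e : (fun g : {g : Raw × List Bool // (enc g).head? = some true} => enc g.1.1) =
      fun g => b g :: enc (r g) := by
    funext g; rw [hx g]; rfl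
  have e' : (fun g => (bif b g then [true, false, false] else [false]) ++ enc (r g)) =
      fun g => pairStr (enc (b g)) (enc (r g)) := funext fun g => (enc_bool_raw _ _).symm
  rw [e'] at h₃
  have h₄ := (e ▸ h₁ :).comp h₃
  have h₅ := (h₄.comp (PolyTime.snd _ _)).pair ((h₄.comp (PolyTime.fst _ _)).pair h₂)
  have e'' : (fun g : {g : Raw × List Bool // (enc g).head? = some true} =>
      enc (unrawStep g.1)) = fun g => pairStr (enc (r g)) (pairStr (enc (b g)) (enc g.1.2)) := by
    funext g
    have h₉ := hx g
    obtain ⟨⟨r', l⟩, hg⟩ := g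
    dsimp only at h₉
    generalize r ⟨(r', l), hg⟩ = r'' at *
    generalize b ⟨(r', l), hg⟩ = b' at *
    subst h₉
    rfl
  rw [e'']
  exact h₅

theorem ofRaw : PolyFun Raw.bits := by
  have h₁ : PolyFun fun r : Raw => (r, ([] : List Bool)) := by fun_prop
  have hsz (l : List Bool) : sz l ≤ 3 * l.length := by
    induction l with
    | nil => simp
    | cons b l ih => have := sz_bool_le b; simp; omega
  -- A bit takes at most three symbols in the list, and two in the raw string, which counts twice as
  -- the first component of a pair. The bound is generous.
  have h₂ := PolyTime.iterate unrawStep_polyTime (fun r : Raw => (r, ([] : List Bool)))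
    (fun r => r.bits.length) (5 * Polynomial.X + 1) Polynomial.X ?_ ?_ ?_ ?_
  · have h₃ (r : Raw) : unrawStep^[r.bits.length] (r, []) = (⟨[]⟩, r.bits.reverse) := by
      rw [iterate_unrawStep r.bits _ le_rfl]; simp
    simp only [h₃] at h₂
    have h₄ := PolyTime.comp h₁ (h₂.comp (PolyTime.snd _ _))
    exact (reverse (l := fun r : Raw => r.bits.reverse) h₄).congr fun r =>
      List.reverse_reverse r.bits
  · intro r
    change _ ≤ Polynomial.X.eval (sz (r, []))
    simp [sz_raw]
    omega
  · intro r k hk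
    rw [iterate_unrawStep r.bits _ hk]
    have h₃ := hsz ((r.bits.take k).reverse ++ [])
    change sz _ ≤ (5 * Polynomial.X + 1 : Polynomial ℕ).eval (sz (r, []))
    simp [sz_raw] at h₃ ⊢
    omega
  · intro r k hk
    rw [iterate_unrawStep r.bits _ hk.le]
    refine (head_pairStr _ _).2 fun h => ?_
    have h₄ : (r.bits.drop k).length = 0 := congrArg List.length h
    rw [List.length_drop] at h₄
    omega
  · intro r
    rw [iterate_unrawStep r.bits _ le_rfl]
    intro h
    exact (head_pairStr _ _).1 h (by simp; rfl)

/-- Read a unary digit. -/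
def natsStep (s : ℕ × List ℕ) (b : Bool) : ℕ × List ℕ :=
  bif b then (s.1 + 1, s.2) else (0, s.1 :: s.2)

theorem foldl_natsStep (l acc : List ℕ) :
    (natsToBits l).foldl natsStep (0, acc) = (0, l.reverse ++ acc) := by
  have key (k j : ℕ) (acc : List ℕ) (r : List Bool) :
      (List.replicate k true ++ r).foldl natsStep (j, acc) = r.foldl natsStep (j + k, acc) := by
    induction k generalizing j with
    | zero => rfl
    | succ k ih =>
      rw [List.replicate_succ, List.cons_append, List.foldl_cons]
      simp only [natsStep, cond_true]
      rw [ih]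
      congr 2
      omega
  induction l generalizing acc with
  | nil => rfl
  | cons k l ih =>
    have : natsToBits (k :: l) = List.replicate k true ++ (false :: natsToBits l) := by
      simp [natsToBits]
    rw [this, key, List.foldl_cons]
    simp only [natsStep, cond_false, zero_add]
    rw [ih]
    simp

theorem decodeNats : PolyFun fun l : List Bool => (l.foldl natsStep (0, [])).2.reverse := by
  refine reverse (snd (foldl (l := fun l : List Bool => l) (s := fun _ => (0, ([] : List ℕ)))
    (step := fun _ s x => natsStep s x)
    (by fun_prop) (const _) (by unfold natsStep; fun_prop) ⟨2, fun a s x _ => ?_⟩))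
  cases x
  · simp [natsStep]
  · simp [natsStep]; omega

theorem encodeNats : PolyFun natsToBits :=
  flatMap (l := fun l : List ℕ => l) (by fun_prop)
    ((map (f := fun _ _ => true) (replicate_unit (snd id)) (by fun_prop)).append (const [false])
      |>.congr fun a => by simp)

end PolyFun

open Computability in
theorem unaryEncodeNat_eq (n : ℕ) : unaryEncodeNat n = List.replicate n true := by
  induction n with
  | zero => rfl
  | succ n ih => rw [List.replicate_succ, ← ih]; rfl

/-- Only the encodings differ: the input is `1^n` instead of a string of `n` zeros, and the output
is `natsToBits` instead of nested pairs. Raw strings mediate between the two, and all conversions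
are polynomial-time. From here on uniformity is treated in the calculus `PolyFun`. -/
theorem PolyUniform.iff_polyFun {d : ℕ → List ℕ} : PolyUniform d ↔ PolyFun d := by
  constructor
  · intro h
    have h₁ : PolyFun fun n : ℕ => Raw.mk (Computability.unaryEncodeNat n) :=
      PolyFun.congr (PolyFun.toRaw.comp (PolyFun.map (f := fun (_ : ℕ) _ => true)
        (PolyFun.replicate_unit PolyFun.id) (by fun_prop))) fun n => by
          rw [unaryEncodeNat_eq]; simp
    have h₂ : PolyFun fun n : ℕ => Raw.mk (natsToBits (d n)) := PolyTime.comp h₁ h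
    exact (PolyFun.decodeNats.comp (PolyFun.ofRaw.comp h₂)).congr fun n => by
      rw [PolyFun.foldl_natsStep]; simp
  · intro h
    -- Only the length of the raw input is used, so the program may in particular be run on `1^n`.
    have h₁ : PolyFun fun l : Raw => d l.bits.length := h.comp (PolyFun.length PolyFun.ofRaw)
    have h₂ := PolyFun.toRaw.comp (PolyFun.encodeNats.comp h₁)
    have h₃ := PolyTime.comp_index h₂ fun n => Raw.mk (Computability.unaryEncodeNat n)
    simp only [unaryEncodeNat_eq, List.length_replicate] at h₃
    have e : Computability.unaryEncodeNat = fun n => List.replicate n true :=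
      funext unaryEncodeNat_eq
    unfold PolyUniform
    rw [e]
    exact h₃

/-! ### States of a subregister -/

set_option linter.unusedSectionVars false

section Put

variable {V W : Type}

open Classical in
/-- The basis state `z`, overwritten by `p` on the range of `e`. -/
def put (e : V ↪ W) (z : W → Bool) (p : V → Bool) : W → Bool :=
  fun w => if h : ∃ v, e v = w then p h.choose else z w

@[simp] theorem put_apply (e : V ↪ W) (z : W → Bool) (p : V → Bool) (v : V) :
    put e z p (e v) = p v := by
  have h : ∃ v', e v' = e v := ⟨v, rfl⟩
  rw [put, dif_pos h]
  exact congrArg p (e.injective h.choose_spec)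

theorem put_of_forall_ne {e : V ↪ W} {z : W → Bool} {p : V → Bool} {w : W} (h : ∀ v, e v ≠ w) :
    put e z p w = z w := by
  rw [put, dif_neg]
  rintro ⟨v, hv⟩
  exact h v hv

@[simp] theorem put_comp (e : V ↪ W) (z : W → Bool) (p : V → Bool) : put e z p ∘ e = p :=
  funext fun v => put_apply e z p v

theorem put_inj {e : V ↪ W} {z : W → Bool} {p q : V → Bool} : put e z p = put e z q ↔ p = q :=
  ⟨fun h => by simpa using congrArg (· ∘ e) h, fun h => by rw [h]⟩

theorem eq_put_iff {e : V ↪ W} {x z : W → Bool} {p : V → Bool} :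
    x = put e z p ↔ x ∘ e = p ∧ ∀ w, (∀ v, e v ≠ w) → x w = z w := by
  constructor
  · rintro rfl
    exact ⟨put_comp e z p, fun w hw => put_of_forall_ne hw⟩
  · rintro ⟨rfl, h⟩
    funext w
    by_cases hw : ∃ v, e v = w
    · obtain ⟨v, rfl⟩ := hw; simp
    · rw [put_of_forall_ne (by simpa using hw), h w (by simpa using hw)]

theorem eq_put_self_iff {e : V ↪ W} {x z : W → Bool} :
    x = put e z (x ∘ e) ↔ ∀ w, (∀ v, e v ≠ w) → x w = z w := by
  rw [eq_put_iff]; simp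

theorem put_self (e : V ↪ W) (z : W → Bool) : put e z (z ∘ e) = z :=
  (eq_put_self_iff.2 fun _ _ => rfl).symm

theorem sum_put [Fintype V] [DecidableEq V] [Fintype W] [DecidableEq W] {R : Type*}
    [AddCommMonoid R] (e : V ↪ W) (z : W → Bool)
    (f : (W → Bool) → R) :
    (∑ x, if x = put e z (x ∘ e) then f x else 0) = ∑ p : V → Bool, f (put e z p) := by
  rw [← Finset.sum_filter]
  refine Finset.sum_bij' (fun x _ => x ∘ e) (fun p _ => put e z p) ?_ ?_ ?_ ?_ ?_
  · simp
  · simp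
  · intro x hx; simpa using (Finset.mem_filter.1 hx).2.symm
  · simp
  · intro x hx; rw [← (Finset.mem_filter.1 hx).2]

end Put

section Inject

variable {V W : Type} [Fintype V] [DecidableEq V] [Fintype W] [DecidableEq W]

/-- The state `σ` on the wires in the range of `e` and the basis state `z` on the other wires. -/
def inject (e : V ↪ W) (z : W → Bool) (σ : Op V) : Op W :=
  fun x y => if x = put e z (x ∘ e) then if y = put e z (y ∘ e) then σ (x ∘ e) (y ∘ e) else 0 else 0

/-- The operator `u'` acts as `u` on the range of `e` and maps `z` to `z'` elsewhere. -/
def Extends (e : V ↪ W) (z z' : W → Bool) (u' : Op W) (u : Op V) : Prop :=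
  ∀ x p, u' x (put e z p) = if x = put e z' (x ∘ e) then u (x ∘ e) p else 0

/-- The injected state is supported on the basis states `put e z p`, so only these columns of `u'`
matter, and there `u'` is `u` beside the map `z ↦ z'`. Gates on the range of `e` and reversible
programs off it both enter through this lemma. -/
theorem conj_inject {e : V ↪ W} {z z' : W → Bool} {u' : Op W} {u : Op V}
    (h : Extends e z z' u' u) (σ : Op V) : conj u' (inject e z σ) = inject e z' (conj u σ) := by
  funext x y
  have h₁ (x b) : (u' * inject e z σ) x b =
      if x = put e z' (x ∘ e) then if b = put e z (b ∘ e) then (u * σ) (x ∘ e) (b ∘ e) else 0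
      else 0 := by
    rw [Matrix.mul_apply]
    have : ∀ a, u' x a * inject e z σ a b = if a = put e z (a ∘ e) then
        (if x = put e z' (x ∘ e) then if b = put e z (b ∘ e) then
          u (x ∘ e) (a ∘ e) * σ (a ∘ e) (b ∘ e) else 0 else 0) else 0 := by
      intro a
      by_cases ha : a = put e z (a ∘ e)
      · rw [if_pos ha, inject, if_pos ha]
        nth_rw 1 [ha]
        rw [h]
        split_ifs <;> simp
      · rw [if_neg ha, inject, if_neg ha, mul_zero]
    rw [Finset.sum_congr rfl fun a _ => this a, sum_put]
    simp only [put_comp]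
    split_ifs <;> simp [Matrix.mul_apply]
  rw [conj, Matrix.mul_apply]
  have : ∀ b, (u' * inject e z σ) x b * u'ᴴ b y = if b = put e z (b ∘ e) then
      (if x = put e z' (x ∘ e) then if y = put e z' (y ∘ e) then
        (u * σ) (x ∘ e) (b ∘ e) * uᴴ (b ∘ e) (y ∘ e) else 0 else 0) else 0 := by
    intro b
    rw [h₁]
    by_cases hb : b = put e z (b ∘ e)
    · rw [if_pos hb, if_pos hb, Matrix.conjTranspose_apply]
      nth_rw 2 [hb]
      rw [h, Matrix.conjTranspose_apply]
      split_ifs <;> simp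
    · simp [hb]
  rw [Finset.sum_congr rfl fun a _ => this a, sum_put]
  simp only [put_comp, inject, conj]
  split_ifs <;> simp [Matrix.mul_apply]

theorem Extends.basisMap {e : V ↪ W} {z z' : W → Bool} {g' : (W → Bool) → (W → Bool)}
    {g : (V → Bool) → (V → Bool)} (h : ∀ p, g' (put e z p) = put e z' (g p)) :
    Extends e z z' (basisMap g') (basisMap g) := by
  intro x p
  simp only [QCCA.basisMap, h]
  by_cases hx : x = put e z' (x ∘ e)
  · rw [if_pos hx]
    have : x = put e z' (g p) ↔ x ∘ e = g p := by
      conv_lhs => rw [hx]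
      exact put_inj
    simp only [this]
  · rw [if_neg hx, if_neg]
    rintro rfl
    exact hx (by simp)

theorem Extends.onQubit (e : V ↪ W) (z : W → Bool) (i : V) (u : Matrix Bool Bool ℂ) :
    Extends e z z (onQubit (e i) u) (onQubit i u) := by
  intro x p
  simp only [QCCA.onQubit, put_apply, Function.comp_apply]
  by_cases hx : x = put e z (x ∘ e)
  · rw [if_pos hx]
    have h₁ := eq_put_self_iff.1 hx
    congr 1
    refine propext ⟨fun h j hj => by simpa using h (e j) (by simpa using hj), fun h w hw => ?_⟩
    by_cases hw' : ∃ v, e v = w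
    · obtain ⟨v, rfl⟩ := hw'
      rw [put_apply]
      exact h v fun hv => hw (hv ▸ rfl)
    · rw [put_of_forall_ne (by simpa using hw'), h₁ w (by simpa using hw')]
  · rw [if_neg hx, if_neg]
    intro h
    refine hx (eq_put_self_iff.2 fun w hw => ?_)
    rw [h w fun h => hw i h.symm, put_of_forall_ne hw]

theorem put_update (e : V ↪ W) (z : W → Bool) (p : V → Bool) (i : V) (b : Bool) :
    Function.update (put e z p) (e i) b = put e z (Function.update p i b) := by
  refine eq_put_iff.2 ⟨?_, fun w hw => ?_⟩
  · funext v
    by_cases h : v = i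
    · subst h; simp
    · simp [h]
  · rw [Function.update_of_ne (hw i).symm, put_of_forall_ne hw]

theorem Extends.oracleUnitary {a b : ℕ} (F : Bits a → Bits b) (f : Fin a ⊕ Fin b ↪ V) (e : V ↪ W)
    (z : W → Bool) : Extends e z z (oracleUnitary F (f.trans e)) (oracleUnitary F f) := by
  refine Extends.basisMap fun p => eq_put_iff.2 ⟨?_, fun w hw => ?_⟩
  · funext v
    simp
  · rw [put_of_forall_ne hw]
    have : ¬ ∃ j : Fin b, (f.trans e) (Sum.inr j) = w ∧
      F (fun i => put e z p ((f.trans e) (Sum.inl i))) j = true := by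
      rintro ⟨j, hj, -⟩; exact hw _ hj
    rw [decide_eq_false this, Bool.xor_false]

/-- The gate on the images of its wires. -/
def Gate.map {ℓ c : ℕ} (e : V ↪ W) : Gate ℓ c V → Gate ℓ c W
  | .hadamard i => .hadamard (e i)
  | .tgate i => .tgate (e i)
  | .not i => .not (e i)
  | .cnot f => .cnot (f.trans e)
  | .toffoli f => .toffoli (f.trans e)
  | .measure i => .measure (e i)
  | .encrypt f => .encrypt (f.trans e)
  | .decrypt f => .decrypt (f.trans e)

theorem Gate.map_isDecrypt {ℓ c : ℕ} {V W : Type} (e : V ↪ W) (g : Gate ℓ c V) :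
    (g.map e).IsDecrypt ↔ g.IsDecrypt := by cases g <;> rfl

theorem inject_smul (e : V ↪ W) (z : W → Bool) (a : ℂ) (σ : Op V) :
    inject e z (a • σ) = a • inject e z σ := by
  funext x y; simp [inject]

theorem inject_sum {ι : Type*} (s : Finset ι) (e : V ↪ W) (z : W → Bool) (σ : ι → Op V) :
    inject e z (∑ i ∈ s, σ i) = ∑ i ∈ s, inject e z (σ i) := by
  funext x y
  simp only [inject, Matrix.sum_apply]
  split_ifs <;> simp

variable {ℓ c R : ℕ} (E : Bits R → Bits ℓ → Bits c) (D : Bits c → Bits ℓ)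

theorem Gate.apply_map_inject (e : V ↪ W) (z : W → Bool) (g : Gate ℓ c V) (σ : Op V) :
    (g.map e).apply E D (inject e z σ) = inject e z (g.apply E D σ) := by
  cases g with
  | hadamard i => exact conj_inject (Extends.onQubit e z i _) σ
  | tgate i => exact conj_inject (Extends.onQubit e z i _) σ
  | not i => exact conj_inject (Extends.basisMap fun p => by rw [put_apply, put_update]) σ
  | cnot f => exact conj_inject (Extends.basisMap fun p => by
      simp only [Function.Embedding.trans_apply, put_apply, put_update]) σ
  | toffoli f => exact conj_inject (Extends.basisMap fun p => by
      simp only [Function.Embedding.trans_apply, put_apply, put_update]) σ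
  | measure i =>
    funext x y
    simp only [map, apply, inject, Function.comp_apply]
    split_ifs <;> rfl
  | encrypt f =>
    simp only [map, apply, conj_inject (Extends.oracleUnitary _ f e z), inject_smul, inject_sum]
  | decrypt f => exact conj_inject (Extends.oracleUnitary D f e z) σ

theorem run_append {W : Type} [Fintype W] [DecidableEq W] (C C' : List (Gate ℓ c W)) (ρ : Op W) :
    run E D (C ++ C') ρ = run E D C' (run E D C ρ) := List.foldl_append

/-- Locality: a relocated circuit sees only its own factor. This is how a reduction runs the given
adversary inside a larger register. -/
theorem run_map_inject (e : V ↪ W) (z : W → Bool) (C : List (Gate ℓ c V)) (σ : Op V) :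
    run E D (C.map (Gate.map e)) (inject e z σ) = inject e z (run E D C σ) := by
  induction C generalizing σ with
  | nil => rfl
  | cons g C ih =>
    change run E D (C.map _) ((g.map e).apply E D (inject e z σ)) = _
    rw [Gate.apply_map_inject, ih]
    rfl

end Inject

section States

variable {V V' W O M : Type} [Fintype V] [DecidableEq V] [Fintype V'] [DecidableEq V'] [Fintype W]
  [DecidableEq W] [Fintype O] [DecidableEq O] [Fintype M] [DecidableEq M]

theorem inject_trans (e : V ↪ V') (e' : V' ↪ W) (z : W → Bool) (σ : Op V) :
    inject (e.trans e') z σ = inject e' z (inject e (z ∘ e') σ) := by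
  have key (x : W → Bool) : x = put (e.trans e') z (x ∘ e.trans e') ↔
      x = put e' z (x ∘ e') ∧ x ∘ e' = put e (z ∘ e') ((x ∘ e') ∘ e) := by
    simp only [eq_put_self_iff, Function.Embedding.trans_apply, Function.comp_apply]
    constructor
    · intro h
      exact ⟨fun w hw => h w fun v => hw _, fun v' hv' => h _ fun v hv => hv' v (e'.injective hv)⟩
    · rintro ⟨h₁, h₂⟩ w hw
      by_cases hw' : ∃ v', e' v' = w
      · obtain ⟨v', rfl⟩ := hw'
        exact h₂ v' fun v hv => hw v (by rw [hv])
      · exact h₁ w (by simpa using hw')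
  funext x y
  simp only [inject, key]
  split_ifs <;> first | rfl | tauto

theorem ket_eq_inject (e : V ↪ W) (z : W → Bool) : ket z = inject e z (ket (z ∘ e)) := by
  have key (x : W → Bool) : x = z ↔ x = put e z (x ∘ e) ∧ x ∘ e = z ∘ e := by
    constructor
    · rintro rfl; simp [put_self]
    · rintro ⟨h₁, h₂⟩; rw [h₁, h₂, put_self]
  funext x y
  simp only [ket, inject, key x, key y]
  split_ifs <;> first | rfl | tauto

/-- The state on the range of `e` passes through untouched. The programs at the end of a first stage
are of this kind: they never use the memory of the simulated adversary. -/
theorem conj_basisMap_inject {e : V ↪ W} {z z' : W → Bool} {g : (W → Bool) → (W → Bool)}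
    (h : ∀ p, g (put e z p) = put e z' p) (σ : Op V) :
    conj (basisMap g) (inject e z σ) = inject e z' σ := by
  rw [conj_inject (Extends.basisMap (g := id) h)]
  have : (basisMap id : Op V) = 1 := by
    funext x y; simp [basisMap, Matrix.one_apply]
  rw [this, conj]
  simp

/-- Reads the product states in the definition of the games as injected states. The bits `a` are
arbitrary because `inject` overwrites them. -/
theorem tensor_ket_ket (A I B : Type) [Fintype A] [DecidableEq A] [Fintype I] [DecidableEq I]
    [Fintype B] [DecidableEq B] (σ : Op A) (v : I → Bool) (z : B → Bool) (a : A → Bool) :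
    tensor (tensor σ (ket v)) (ket z) =
      inject (Function.Embedding.inl.trans Function.Embedding.inl)
        (Sum.elim (Sum.elim a v) z) σ := by
  have key (x : (A ⊕ I) ⊕ B → Bool) :
      x = put (Function.Embedding.inl.trans Function.Embedding.inl) (Sum.elim (Sum.elim a v) z)
        (x ∘ (Function.Embedding.inl.trans Function.Embedding.inl)) ↔
      (x ∘ Sum.inl) ∘ Sum.inr = v ∧ x ∘ Sum.inr = z := by
    rw [eq_put_self_iff]
    constructor
    · intro h
      exact ⟨funext fun i => h (.inl (.inr i)) (by simp), funext fun i => h (.inr i) (by simp)⟩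
    · rintro ⟨rfl, rfl⟩ ((w | w) | w) hw
      · exact absurd rfl (hw w)
      · rfl
      · rfl
  funext x y
  simp only [inject, key, tensor, ket]
  split_ifs <;> first | rfl | tauto | skip
  all_goals simp_all
  rfl

/-- Measurement of a list of wires. -/
def measureAll {ℓ c : ℕ} {W : Type} (l : List W) : List (Gate ℓ c W) := l.map .measure

variable {ℓ c R : ℕ} (E : Bits R → Bits ℓ → Bits c) (D : Bits c → Bits ℓ)

theorem run_measureAll (l : List W) (ρ : Op W) :
    run E D (measureAll l) ρ = fun x y => if ∀ w ∈ l, x w = y w then ρ x y else 0 := by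
  induction l generalizing ρ with
  | nil => simp [measureAll, run]
  | cons w l ih =>
    change run E D (measureAll l) (Gate.apply E D (.measure w) ρ) = _
    rw [ih]
    funext x y
    simp only [Gate.apply, List.forall_mem_cons]
    split_ifs <;> first | rfl | tauto

/-- Measuring `O` removes the coherence between different outcomes, so a mixture over the outcomes
`t` remains, each with its conditional memory state. Off the range of `e` the register is in a basis
state, so further wires in `l` are measured without effect. -/
theorem run_measureAll_inject (e : O ⊕ M ↪ W) (z : W → Bool) (l : List W)
    (hl : ∀ o, e (.inl o) ∈ l) (hl' : ∀ m, e (.inr m) ∉ l) (σ : Op (O ⊕ M)) :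
    run E D (measureAll l) (inject e z σ) = ∑ t : O → Bool,
      inject (Function.Embedding.inr.trans e) (put (Function.Embedding.inl.trans e) z t)
        (postState t σ) := by
  have hl₂ (x y : W → Bool) (hx : x = put e z (x ∘ e)) (hy : y = put e z (y ∘ e)) :
      (∀ w ∈ l, x w = y w) ↔ ∀ o, x (e (.inl o)) = y (e (.inl o)) := by
    refine ⟨fun h o => h _ (hl o), fun h w hw => ?_⟩
    by_cases hw' : ∃ v, e v = w
    · obtain ⟨o | m, rfl⟩ := hw'
      · exact h o
      · exact absurd hw (hl' m)
    · rw [eq_put_self_iff.1 hx w (by simpa using hw'), eq_put_self_iff.1 hy w (by simpa using hw')]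
  have key (x : W → Bool) (t : O → Bool) : x = put (Function.Embedding.inr.trans e)
      (put (Function.Embedding.inl.trans e) z t) (x ∘ Function.Embedding.inr.trans e) ↔
      x = put e z (x ∘ e) ∧ t = fun o => x (e (.inl o)) := by
    simp only [eq_put_self_iff]
    constructor
    · intro h
      refine ⟨fun w hw => ?_, ?_⟩
      · rw [h w fun v => hw _,
          put_of_forall_ne (e := Function.Embedding.inl.trans e) fun v => hw _]
      · funext o
        rw [h (e (.inl o)) (by simp)]
        exact (put_apply (Function.Embedding.inl.trans e) z t o).symm
    · rintro ⟨h, rfl⟩ w hw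
      by_cases hw' : ∃ o, e (.inl o) = w
      · obtain ⟨o, rfl⟩ := hw'
        exact (put_apply (Function.Embedding.inl.trans e) z (fun o => x (e (.inl o))) o).symm
      · rw [put_of_forall_ne (by simpa using hw'), h]
        rintro (v | v) hv
        · exact hw' ⟨v, hv⟩
        · exact hw v hv
  rw [run_measureAll]
  funext x y
  rw [Matrix.sum_apply]
  have hl₃ : (if ∀ w ∈ l, x w = y w then inject e z σ x y else 0) =
      if ∀ o, x (e (.inl o)) = y (e (.inl o)) then inject e z σ x y else 0 := by
    simp only [inject]
    by_cases hx : x = put e z (x ∘ e)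
    · by_cases hy : y = put e z (y ∘ e)
      · simp only [hl₂ x y hx hy]
      · simp [hy]
    · simp [hx]
  rw [hl₃]
  simp only [inject, key]
  by_cases hxy : ∀ o, x (e (.inl o)) = y (e (.inl o))
  · have hxy' : (fun o => x (e (.inl o))) = fun o => y (e (.inl o)) := funext hxy
    rw [if_pos hxy]
    have h₁ (t : O → Bool) : (if x = put e z (x ∘ e) ∧ t = fun o => x (e (.inl o)) then
        if y = put e z (y ∘ e) ∧ t = fun o => y (e (.inl o)) then
          postState t σ (x ∘ Function.Embedding.inr.trans e) (y ∘ Function.Embedding.inr.trans e)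
        else 0 else 0) = if t = (fun o => x (e (.inl o))) then
          (if x = put e z (x ∘ e) then if y = put e z (y ∘ e) then σ (x ∘ e) (y ∘ e) else 0 else 0)
          else 0 := by
      rw [← hxy']
      by_cases ht : t = fun o => x (e (.inl o))
      · simp only [ht, and_true, if_true]
        have hx : Sum.elim (fun o => x (e (.inl o))) (x ∘ Function.Embedding.inr.trans e)
            = x ∘ e := by funext w; cases w <;> rfl
        have hy : Sum.elim (fun o => x (e (.inl o))) (y ∘ Function.Embedding.inr.trans e)
            = y ∘ e := by rw [hxy']; funext w; cases w <;> rfl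
        simp only [postState, hx, hy]
      · simp [ht]
    rw [Finset.sum_congr rfl fun t _ => h₁ t, Finset.sum_ite_eq' Finset.univ]
    simp
  · rw [if_neg hxy]
    refine (Finset.sum_eq_zero fun t _ => ?_).symm
    by_cases h₁ : t = fun o => x (e (.inl o))
    · by_cases h₂ : t = fun o => y (e (.inl o))
      · exact absurd (fun o => congrFun (h₁.symm.trans h₂) o) hxy
      · simp [h₂]
    · simp [h₁]

theorem mass_inject (e : V ↪ W) (z : W → Bool) (σ : Op V) : mass (inject e z σ) = mass σ := by
  have h (x : W → Bool) : (inject e z σ x x).re =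
      if x = put e z (x ∘ e) then (σ (x ∘ e) (x ∘ e)).re else 0 := by
    simp only [inject]; split_ifs <;> rfl
  simp only [mass, h]
  rw [sum_put]
  simp

theorem postState_inject (e : V ↪ M) (t : O → Bool) (z : O ⊕ M → Bool) (σ : Op V) :
    postState t (inject (e.trans Function.Embedding.inr) z σ) =
      if t = z ∘ Sum.inl then inject e (z ∘ Sum.inr) σ else 0 := by
  have key (x : M → Bool) : Sum.elim t x = put (e.trans Function.Embedding.inr) z
      (Sum.elim t x ∘ (e.trans Function.Embedding.inr)) ↔
      t = z ∘ Sum.inl ∧ x = put e (z ∘ Sum.inr) (x ∘ e) := by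
    simp only [eq_put_self_iff]
    constructor
    · intro h
      exact ⟨funext fun o => h (.inl o) (by simp),
        fun w hw => h (.inr w) fun v hv => hw v (Sum.inr_injective hv)⟩
    · rintro ⟨rfl, h⟩ (w | w) hw
      · rfl
      · exact h w fun v hv => hw v (by rw [← hv]; rfl)
  funext x y
  simp only [postState, inject, key]
  by_cases ht : t = z ∘ Sum.inl
  · simp only [ht, true_and, if_true]
    rfl
  · simp [ht]

/-- Tossing the coin on a wire: a Hadamard gate and a measurement. -/
def tossCoin {ℓ c : ℕ} {W : Type} (i : W) : List (Gate ℓ c W) := [.hadamard i, .measure i]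

/-- The Hadamard gate turns `|0⟩` into a state whose density matrix has all entries `1/2`; the
measurement deletes the two off the diagonal and leaves a fair coin. -/
theorem run_tossCoin (e : V ↪ W) (z : W → Bool) (i : W) (hi : ∀ v, e v ≠ i) (hz : z i = false)
    (σ : Op V) :
    run E D (tossCoin i) (inject e z σ) =
      (2 : ℂ)⁻¹ • ∑ b : Bool, inject e (Function.update z i b) σ := by
  -- As wire `i` holds `false`, only the column of the Hadamard matrix without a sign occurs.
  have h₁ (x p) : onQubit i hadamardMatrix x (put e z p) =
      if x = put e (Function.update z i (x i)) p then ((Real.sqrt 2 : ℝ) : ℂ)⁻¹ else 0 := by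
    have : (∀ j, j ≠ i → x j = put e z p j) ↔ x = put e (Function.update z i (x i)) p := by
      constructor
      · intro h
        funext j
        by_cases hj : j = i
        · subst hj
          rw [put_of_forall_ne hi]; simp
        · rw [h j hj]
          by_cases hw : ∃ v, e v = j
          · obtain ⟨v, rfl⟩ := hw; simp
          · rw [put_of_forall_ne (by simpa using hw), put_of_forall_ne (by simpa using hw),
              Function.update_of_ne hj]
      · intro h j hj
        rw [h]
        by_cases hw : ∃ v, e v = j
        · obtain ⟨v, rfl⟩ := hw; simp
        · rw [put_of_forall_ne (by simpa using hw), put_of_forall_ne (by simpa using hw),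
            Function.update_of_ne hj]
    have h₂ : hadamardMatrix (x i) false = ((Real.sqrt 2 : ℝ) : ℂ)⁻¹ := by
      simp [hadamardMatrix]
    simp only [onQubit, this, put_of_forall_ne hi, hz, h₂]
  have h₃ (x p) : (x = put e (Function.update z i (x i)) p) ↔
      x = put e (Function.update z i (x i)) (x ∘ e) ∧ x ∘ e = p := by
    constructor
    · intro h
      have : x ∘ e = p := by
        rw [h]; exact put_comp _ _ _
      exact ⟨this ▸ h, this⟩
    · rintro ⟨h, rfl⟩; exact h
  have h₄ (x b) : (onQubit i hadamardMatrix * inject e z σ) x b =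
      if x = put e (Function.update z i (x i)) (x ∘ e) then
        if b = put e z (b ∘ e) then ((Real.sqrt 2 : ℝ) : ℂ)⁻¹ * σ (x ∘ e) (b ∘ e) else 0 else 0 := by
    rw [Matrix.mul_apply]
    have this (a) : onQubit i hadamardMatrix x a * inject e z σ a b = if a = put e z (a ∘ e) then
        (if a ∘ e = x ∘ e then if x = put e (Function.update z i (x i)) (x ∘ e) then
          if b = put e z (b ∘ e) then
          ((Real.sqrt 2 : ℝ) : ℂ)⁻¹ * σ (x ∘ e) (b ∘ e) else 0 else 0 else 0) else 0 := by
      by_cases ha : a = put e z (a ∘ e)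
      · rw [if_pos ha, inject, if_pos ha]
        nth_rw 1 [ha]
        rw [h₁]
        simp only [h₃ x (a ∘ e), eq_comm (a := a ∘ e)]
        by_cases hax : x ∘ e = a ∘ e
        · simp only [hax, and_true, if_true]
          split_ifs <;> simp
        · simp [hax]
      · rw [if_neg ha, inject, if_neg ha, mul_zero]
    rw [Finset.sum_congr rfl fun a _ => this a, sum_put]
    simp only [put_comp]
    rw [Finset.sum_ite_eq']
    simp
  -- Two factors `1 / √2` give `1 / 2`, for all four pairs of values of wire `i`.
  have h₅ (x y) : conj (onQubit i hadamardMatrix) (inject e z σ) x y =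
      if x = put e (Function.update z i (x i)) (x ∘ e) then
        if y = put e (Function.update z i (y i)) (y ∘ e) then (2 : ℂ)⁻¹ * σ (x ∘ e) (y ∘ e)
        else 0 else 0 := by
    rw [conj, Matrix.mul_apply]
    have this (b) : (onQubit i hadamardMatrix * inject e z σ) x b * (onQubit i hadamardMatrix)ᴴ b y =
        if b = put e z (b ∘ e) then
        (if b ∘ e = y ∘ e then if x = put e (Function.update z i (x i)) (x ∘ e) then
          if y = put e (Function.update z i (y i)) (y ∘ e) then
          (2 : ℂ)⁻¹ * σ (x ∘ e) (y ∘ e) else 0 else 0 else 0) else 0 := by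
      rw [h₄]
      by_cases hb : b = put e z (b ∘ e)
      · rw [if_pos hb, if_pos hb, Matrix.conjTranspose_apply]
        nth_rw 2 [hb]
        rw [h₁]
        simp only [h₃ y (b ∘ e), eq_comm (a := b ∘ e)]
        have h2 : ((Real.sqrt 2 : ℝ) : ℂ)⁻¹ * ((Real.sqrt 2 : ℝ) : ℂ)⁻¹ = 2⁻¹ := by
          rw [← mul_inv, ← Complex.ofReal_mul, Real.mul_self_sqrt (by norm_num)]; simp
        by_cases hby : y ∘ e = b ∘ e
        · simp only [hby, and_true, if_true]
          split_ifs
          · rw [star_inv₀, show star ((Real.sqrt 2 : ℝ) : ℂ) = _ from Complex.conj_ofReal _,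
              mul_right_comm, h2]
          all_goals simp
        · simp [hby]
      · simp [hb]
    rw [Finset.sum_congr rfl fun a _ => this a, sum_put]
    simp only [put_comp]
    rw [Finset.sum_ite_eq']
    simp
  have h₆ (x : W → Bool) (b : Bool) : x = put e (Function.update z i b) (x ∘ e) ↔
      x = put e (Function.update z i (x i)) (x ∘ e) ∧ b = x i := by
    constructor
    · intro h
      have : x i = b := by rw [h, put_of_forall_ne hi]; simp
      exact ⟨this ▸ h, this.symm⟩
    · rintro ⟨h, rfl⟩; exact h
  funext x y
  change (if x i = y i then conj (onQubit i hadamardMatrix) (inject e z σ) x y else 0) = _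
  rw [h₅, Matrix.smul_apply, Matrix.sum_apply]
  have h₇ (b : Bool) : inject e (Function.update z i b) σ x y =
      if x = put e (Function.update z i (x i)) (x ∘ e) ∧ b = x i then
        if y = put e (Function.update z i (y i)) (y ∘ e) ∧ b = y i then σ (x ∘ e) (y ∘ e) else 0
      else 0 := by
    rw [inject]
    exact if_congr (h₆ x b) (if_congr (h₆ y b) rfl rfl) rfl
  rw [Finset.sum_congr rfl fun b _ => h₇ b]
  have key (P Q : Prop) [Decidable P] [Decidable Q] (a b : Bool) (w : ℂ) :
      (if a = b then if P then if Q then (2 : ℂ)⁻¹ * w else 0 else 0 else 0) = (2 : ℂ)⁻¹ •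
        ∑ d : Bool, if P ∧ d = a then if Q ∧ d = b then w else 0 else 0 := by
    rw [Fintype.sum_bool]
    by_cases hP : P <;> by_cases hQ : Q <;> cases a <;> cases b <;> simp [hP, hQ]
  exact key _ _ _ _ _

end States

/-! ### Linearity, positivity and preservation of the trace -/

section Linear

open scoped ComplexOrder

variable {W : Type} [Fintype W] [DecidableEq W]

theorem isLinearMap_conj (U : Op W) : IsLinearMap ℂ (conj U) where
  map_add ρ σ := by simp [conj, Matrix.mul_add, Matrix.add_mul]
  map_smul a ρ := by simp [conj]

variable {ℓ c R : ℕ} (E : Bits R → Bits ℓ → Bits c) (D : Bits c → Bits ℓ)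

theorem Gate.isLinearMap_apply (g : Gate ℓ c W) : IsLinearMap ℂ (g.apply E D) := by
  cases g with
  | measure i =>
    constructor
    · intro ρ σ
      refine Matrix.ext fun x y => ?_
      change (if x i = y i then ρ x y + σ x y else 0) =
        (if x i = y i then ρ x y else 0) + (if x i = y i then σ x y else 0)
      split_ifs <;> simp
    · intro a ρ
      refine Matrix.ext fun x y => ?_
      change (if x i = y i then a * ρ x y else 0) = a * (if x i = y i then ρ x y else 0)
      split_ifs <;> simp
  | encrypt e =>
    constructor
    · intro ρ σ
      simp only [Gate.apply, (isLinearMap_conj _).map_add, Finset.sum_add_distrib, smul_add]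
    · intro a ρ
      simp only [Gate.apply, (isLinearMap_conj _).map_smul, ← Finset.smul_sum]
      rw [smul_comm]
  | _ => exact isLinearMap_conj _

theorem isLinearMap_run (C : List (Gate ℓ c W)) : IsLinearMap ℂ (run E D C) := by
  induction C with
  | nil => exact ⟨fun _ _ => rfl, fun _ _ => rfl⟩
  | cons g C ih =>
    have h := g.isLinearMap_apply E D
    constructor
    · intro ρ σ
      change run E D C (g.apply E D (ρ + σ)) = _
      rw [h.map_add, ih.map_add]; rfl
    · intro a ρ
      change run E D C (g.apply E D (a • ρ)) = _
      rw [h.map_smul, ih.map_smul]; rfl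

theorem run_sum {ι : Type*} (C : List (Gate ℓ c W)) (s : Finset ι) (ρ : ι → Op W) :
    run E D C (∑ i ∈ s, ρ i) = ∑ i ∈ s, run E D C (ρ i) :=
  map_sum (isLinearMap_run E D C).mk' ρ s

theorem run_smul (C : List (Gate ℓ c W)) (a : ℂ) (ρ : Op W) :
    run E D C (a • ρ) = a • run E D C ρ := (isLinearMap_run E D C).map_smul a ρ

theorem outcomeProb_sum {ι : Type*} {o : ℕ} (out : Fin o ↪ W) (s : Bits o) (t : Finset ι)
    (ρ : ι → Op W) : outcomeProb out s (∑ i ∈ t, ρ i) = ∑ i ∈ t, outcomeProb out s (ρ i) := by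
  simp only [outcomeProb, Matrix.sum_apply]
  rw [Finset.sum_comm]
  refine Finset.sum_congr rfl fun x _ => ?_
  split_ifs <;> simp

theorem outcomeProb_smul {o : ℕ} (out : Fin o ↪ W) (s : Bits o) (a : ℝ) (ρ : Op W) :
    outcomeProb out s ((a : ℂ) • ρ) = a * outcomeProb out s ρ := by
  simp only [outcomeProb, Finset.mul_sum]
  refine Finset.sum_congr rfl fun x _ => ?_
  split_ifs <;> simp

theorem mass_sum {ι : Type*} (t : Finset ι) (ρ : ι → Op W) :
    mass (∑ i ∈ t, ρ i) = ∑ i ∈ t, mass (ρ i) := by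
  simp only [mass, Matrix.sum_apply, Complex.re_sum]
  exact Finset.sum_comm

theorem mass_smul (a : ℝ) (ρ : Op W) : mass ((a : ℂ) • ρ) = a * mass ρ := by
  simp [mass, Finset.mul_sum]

theorem mass_eq_trace (ρ : Op W) : mass ρ = (Matrix.trace ρ).re := by
  simp [mass, Matrix.trace]

theorem mass_conj {U : Op W} (hU : Uᴴ * U = 1) (ρ : Op W) : mass (conj U ρ) = mass ρ := by
  rw [mass_eq_trace, mass_eq_trace, conj, Matrix.trace_mul_comm, ← Matrix.mul_assoc, hU,
    Matrix.one_mul]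

theorem basisMap_unitary {g : (W → Bool) → (W → Bool)} (hg : Function.Injective g) :
    (basisMap g)ᴴ * basisMap g = 1 := by
  funext x y
  simp [Matrix.mul_apply, basisMap, Matrix.one_apply, hg.eq_iff, eq_comm]

/-- An intermediate basis state contributes only if it agrees with `x` off qubit `i`, so `sum_put`
for the embedding of this one wire reduces the sum to the two values of the qubit. -/
theorem onQubit_mul (i : W) (u v : Matrix Bool Bool ℂ) :
    onQubit i u * onQubit i v = onQubit i (u * v) := by
  funext x y
  rw [Matrix.mul_apply]
  have h (a : W → Bool) : onQubit i u x a * onQubit i v a y =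
      if a = put (⟨fun _ : Unit => i, fun _ _ _ => rfl⟩ : Unit ↪ W) x (a ∘ (fun _ => i)) then
        (if ∀ j, j ≠ i → x j = y j then u (x i) (a i) * v (a i) (y i) else 0) else 0 := by
    have h₁ : a = put (⟨fun _ : Unit => i, fun _ _ _ => rfl⟩ : Unit ↪ W) x (a ∘ (fun _ => i)) ↔
        ∀ j, j ≠ i → x j = a j := by
      refine (eq_put_self_iff (e := (⟨fun _ : Unit => i, fun _ _ _ => rfl⟩ : Unit ↪ W))).trans ?_
      exact ⟨fun h j hj => (h j fun _ => Ne.symm hj).symm,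
        fun h j hj => (h j (Ne.symm (hj ()))).symm⟩
    simp only [h₁, onQubit]
    by_cases h₂ : ∀ j, j ≠ i → x j = a j
    · have : (∀ j, j ≠ i → a j = y j) ↔ ∀ j, j ≠ i → x j = y j :=
        forall₂_congr fun j hj => by rw [h₂ j hj]
      simp only [if_pos h₂, this]
      split_ifs <;> simp
    · simp [h₂]
  rw [Finset.sum_congr rfl fun a _ => h a]
  refine (sum_put (⟨fun _ : Unit => i, fun _ _ _ => rfl⟩ : Unit ↪ W) x _).trans ?_
  have h₂ (p : Unit → Bool) : put (⟨fun _ : Unit => i, fun _ _ _ => rfl⟩ : Unit ↪ W) x p i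
      = p () := put_apply (⟨fun _ : Unit => i, fun _ _ _ => rfl⟩ : Unit ↪ W) x p ()
  simp only [h₂, onQubit, Matrix.mul_apply]
  rw [← (Equiv.funUnique Unit Bool).symm.sum_comp]
  split_ifs <;> simp

theorem onQubit_one (i : W) : onQubit i (1 : Matrix Bool Bool ℂ) = 1 := by
  funext x y
  simp only [onQubit, Matrix.one_apply]
  by_cases h : x = y
  · simp [h]
  · rw [if_neg h]
    split_ifs with h₁ h₂
    · refine absurd (funext fun j => ?_) h
      by_cases hj : j = i
      · rw [hj, h₂]
      · exact h₁ j hj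
    all_goals rfl

theorem onQubit_conjTranspose (i : W) (u : Matrix Bool Bool ℂ) :
    (onQubit i u)ᴴ = onQubit i uᴴ := by
  funext x y
  simp only [Matrix.conjTranspose_apply, onQubit, eq_comm (a := y _)]
  split_ifs <;> simp

theorem onQubit_unitary (i : W) {u : Matrix Bool Bool ℂ} (hu : uᴴ * u = 1) :
    (onQubit i u)ᴴ * onQubit i u = 1 := by
  rw [onQubit_conjTranspose, onQubit_mul, hu, onQubit_one]

theorem hadamardMatrix_unitary : hadamardMatrixᴴ * hadamardMatrix = 1 := by
  have h2 : ((Real.sqrt 2 : ℝ) : ℂ)⁻¹ * ((Real.sqrt 2 : ℝ) : ℂ)⁻¹ = 2⁻¹ := by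
    rw [← mul_inv, ← Complex.ofReal_mul, Real.mul_self_sqrt (by norm_num)]; simp
  have h3 : (starRingEnd ℂ) ((Real.sqrt 2 : ℝ) : ℂ) = (Real.sqrt 2 : ℝ) := Complex.conj_ofReal _
  funext x y
  cases x <;> cases y <;>
    simp [Matrix.mul_apply, hadamardMatrix, h2, h3] <;> norm_num

theorem tMatrix_unitary : tMatrixᴴ * tMatrix = 1 := by
  rw [tMatrix, Matrix.diagonal_conjTranspose, Matrix.diagonal_mul_diagonal, ← Matrix.diagonal_one]
  congr 1
  funext b
  cases b
  · simp
  · have : (starRingEnd ℂ) (Complex.I * Real.pi / 4) = -(Complex.I * Real.pi / 4) := by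
      rw [map_div₀, map_mul, Complex.conj_I, Complex.conj_ofReal, map_ofNat]; ring
    simp only [if_true, Pi.star_apply, Complex.star_def]
    rw [← Complex.exp_conj, this, ← Complex.exp_add, neg_add_cancel, Complex.exp_zero]

/-- Adding to bit `i` a value that does not depend on bit `i` is an involution. This covers the
classical gates and the instructions of programs. -/
theorem injective_of_involutive_update {i : W} {f : (W → Bool) → Bool}
    (hf : ∀ y b, f (Function.update y i b) = f y) :
    Function.Injective fun y : W → Bool => Function.update y i (y i ^^ f y) := by
  refine Function.Involutive.injective fun y => ?_
  funext j
  by_cases hj : j = i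
  · subst hj; simp [hf]
  · simp [hj]

theorem oracleUnitary_unitary {a b : ℕ} (F : Bits a → Bits b) (e : Fin a ⊕ Fin b ↪ W) :
    (oracleUnitary F e)ᴴ * oracleUnitary F e = 1 := by
  refine basisMap_unitary (Function.Involutive.injective fun y => ?_)
  funext w
  simp

theorem Gate.mass_apply (g : Gate ℓ c W) (ρ : Op W) : mass (g.apply E D ρ) = mass ρ := by
  cases g with
  | hadamard i => exact mass_conj (onQubit_unitary i hadamardMatrix_unitary) ρ
  | tgate i => exact mass_conj (onQubit_unitary i tMatrix_unitary) ρ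
  | not i =>
    refine mass_conj (basisMap_unitary ?_) ρ
    simpa using injective_of_involutive_update (i := i) (f := fun _ => true) fun _ _ => rfl
  | cnot e =>
    refine mass_conj (basisMap_unitary (injective_of_involutive_update fun y b => ?_)) ρ
    rw [Function.update_of_ne (e.injective.ne (by decide))]
  | toffoli e =>
    refine mass_conj (basisMap_unitary (injective_of_involutive_update fun y b => ?_)) ρ
    rw [Function.update_of_ne (e.injective.ne (by decide)),
      Function.update_of_ne (e.injective.ne (by decide))]
  | measure i => simp [mass, Gate.apply]
  | encrypt e =>
    simp only [Gate.apply]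
    have := mass_smul ((Fintype.card (Bits R) : ℝ)⁻¹) (∑ r, conj (oracleUnitary (E r) e) ρ)
    push_cast at this
    rw [this, mass_sum]
    simp only [mass_conj (oracleUnitary_unitary _ e)]
    simp
  | decrypt e => exact mass_conj (oracleUnitary_unitary D e) ρ

theorem mass_run (C : List (Gate ℓ c W)) (ρ : Op W) : mass (run E D C ρ) = mass ρ := by
  induction C generalizing ρ with
  | nil => rfl
  | cons g C ih => exact (ih _).trans (g.mass_apply E D ρ)

/-- The measured state is the sum of the compressions `P ρ P` to the two values of qubit `i`. -/
theorem posSemidef_measure {ρ : Op W} (hρ : ρ.PosSemidef) (i : W) :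
    Matrix.PosSemidef (fun x y => if x i = y i then ρ x y else 0 : Op W) := by
  have h (b : Bool) := hρ.mul_mul_conjTranspose_same
    (Matrix.diagonal fun x : W → Bool => if x i = b then (1 : ℂ) else 0)
  refine cast (congrArg Matrix.PosSemidef (Matrix.ext fun x y => ?_)) ((h true).add (h false))
  simp only [Matrix.add_apply, Matrix.diagonal_conjTranspose, Matrix.mul_diagonal,
    Matrix.diagonal_mul, Pi.star_apply]
  cases x i <;> cases y i <;> simp

theorem posSemidef_ket (v : W → Bool) : (ket v).PosSemidef := by
  convert Matrix.posSemidef_vecMulVec_self_star (fun x : W → Bool => if x = v then (1 : ℂ) else 0)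
  funext x y
  simp only [ket, Matrix.vecMulVec_apply, Pi.star_apply]
  split_ifs <;> simp_all

theorem mass_ket (v : W → Bool) : mass (ket v) = 1 := by
  have (x : W → Bool) : (ket v x x).re = if x = v then 1 else 0 := by
    simp only [ket]; split_ifs <;> simp_all
  simp [mass, this]

theorem Gate.posSemidef_apply {ρ : Op W} (hρ : ρ.PosSemidef) (g : Gate ℓ c W) :
    (g.apply E D ρ).PosSemidef := by
  have h (U : Op W) : (conj U ρ).PosSemidef := hρ.mul_mul_conjTranspose_same U
  cases g with
  | measure i => exact posSemidef_measure hρ i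
  | encrypt e =>
    refine Matrix.PosSemidef.smul (Matrix.posSemidef_sum _ fun r _ => h _) ?_
    rw [inv_nonneg]
    exact Nat.cast_nonneg _
  | _ => exact h _

theorem posSemidef_run {ρ : Op W} (hρ : ρ.PosSemidef) (C : List (Gate ℓ c W)) :
    (run E D C ρ).PosSemidef := by
  induction C generalizing ρ with
  | nil => exact hρ
  | cons g C ih => exact ih (g.posSemidef_apply E D hρ)

theorem posSemidef_inject {V : Type} [Fintype V] [DecidableEq V] (e : V ↪ W) (z : W → Bool)
    {σ : Op V} (hσ : σ.PosSemidef) : (inject e z σ).PosSemidef := by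
  have := (hσ.submatrix (fun x : W → Bool => x ∘ e)).mul_mul_conjTranspose_same
    (Matrix.diagonal fun x : W → Bool => if x = put e z (x ∘ e) then (1 : ℂ) else 0)
  convert this using 1
  funext x y
  simp only [Matrix.diagonal_conjTranspose, Matrix.mul_diagonal,
    Matrix.diagonal_mul, Pi.star_apply, inject, Matrix.submatrix_apply]
  split_ifs <;> simp

theorem sum_outcomeProb {o : ℕ} (out : Fin o ↪ W) (ρ : Op W) :
    ∑ s, outcomeProb out s ρ = mass ρ := by
  simp only [outcomeProb, mass]
  rw [Finset.sum_comm]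
  simp

theorem outcomeProb_nonneg {o : ℕ} (out : Fin o ↪ W) (s : Bits o) {ρ : Op W}
    (hρ : ρ.PosSemidef) : 0 ≤ outcomeProb out s ρ := by
  refine Finset.sum_nonneg fun x _ => ?_
  split_ifs
  · exact (Complex.le_def.1 (hρ.diag_nonneg (i := x))).1
  · exact le_rfl

/-- A permutation of the basis states permutes the diagonal of the density matrix, so one may
measure before the program and evaluate it on the outcome. Unlike in `conj_basisMap_inject`, the
program may read the wires in the range of `e`. -/
theorem outcomeProb_conj_basisMap_inject {V : Type} [Fintype V] [DecidableEq V] {o : ℕ}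
    (out : Fin o ↪ W) (s : Bits o) {g : (W → Bool) → (W → Bool)} (hg : Function.Injective g)
    (e : V ↪ W) (z : W → Bool) (ρ : Op V) :
    outcomeProb out s (conj (basisMap g) (inject e z ρ)) =
      ∑ p : V → Bool, if (fun i => g (put e z p) (out i)) = s then (ρ p p).re else 0 := by
  have h₁ (x : W → Bool) : conj (basisMap g) (inject e z ρ) (g x) (g x) =
      inject e z ρ x x := by
    simp [conj, Matrix.mul_apply, basisMap, hg.eq_iff]
  rw [outcomeProb, ← (Equiv.ofBijective g (Finite.injective_iff_bijective.1 hg)).sum_comp]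
  simp only [Equiv.ofBijective_apply, h₁]
  have h₂ (x : W → Bool) :
      (if (fun i => g x (out i)) = s then (inject e z ρ x x).re else 0) = if x = put e z (x ∘ e)
        then (if (fun i => g x (out i)) = s then (ρ (x ∘ e) (x ∘ e)).re else 0) else 0 := by
    simp only [inject]
    split_ifs <;> rfl
  rw [Finset.sum_congr rfl fun x _ => h₂ x, sum_put]
  simp

end Linear

theorem outcomeProb_inject {V W : Type} [Fintype V] [DecidableEq V] [Fintype W] [DecidableEq W]
    {o : ℕ} (out : Fin o ↪ V) (s : Bits o) (e : V ↪ W) (z : W → Bool) (ρ : Op V) :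
    outcomeProb (out.trans e) s (inject e z ρ) = outcomeProb out s ρ := by
  have h (x : W → Bool) : (if (fun i => x (out.trans e i)) = s then (inject e z ρ x x).re else 0) =
      if x = put e z (x ∘ e) then
        (if (fun i => (x ∘ e) (out i)) = s then (ρ (x ∘ e) (x ∘ e)).re else 0) else 0 := by
    simp only [inject, Function.Embedding.trans_apply, Function.comp_apply]
    split_ifs <;> rfl
  rw [outcomeProb, Finset.sum_congr rfl fun x _ => h x, sum_put]
  simp [outcomeProb]

namespace TwoStage

open scoped ComplexOrder

variable {ℓ c R o : ℕ} {O I : Type} [Fintype O] [DecidableEq O] [Fintype I] [DecidableEq I]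
  (A : TwoStage ℓ c O I o) (E : Bits R → Bits ℓ → Bits c) (D : Bits c → Bits ℓ)

/-- The probability that the second stage, started in the state `σ` of the memory with
input `v`, outputs `s`. -/
def secondProb (σ : Op (Fin A.mem)) (v : I → Bool) (s : Bits o) : ℝ :=
  outcomeProb A.out s (run E D A.post (tensor (tensor σ (ket v)) (ket fun _ => false)))

theorem sum_firstProb : ∑ t, A.firstProb E D t = 1 := by
  have : mass (run E D A.pre (ket fun _ => false)) = 1 := (mass_run E D _ _).trans (mass_ket _)
  rw [← this]
  simp only [firstProb, firstStage, mass, postState]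
  rw [← Fintype.sum_prod_type', ← (Equiv.sumArrowEquivProdArrow O (Fin A.mem) Bool).symm.sum_comp]
  rfl

theorem posSemidef_firstStage (A : TwoStage ℓ c O I o) (E : Bits R → Bits ℓ → Bits c)
    (D : Bits c → Bits ℓ) (t : O → Bool) : (A.firstStage E D t).PosSemidef :=
  (posSemidef_run E D (posSemidef_ket _) A.pre).submatrix _

theorem prob_nonneg (t : O → Bool) (v : I → Bool) (s : Bits o) : 0 ≤ A.prob E D t v s := by
  refine outcomeProb_nonneg _ _ (posSemidef_run E D ?_ _)
  rw [tensor_ket_ket _ _ _ _ _ _ fun _ => false]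
  exact posSemidef_inject _ _ (A.posSemidef_firstStage E D t)

theorem mass_second (σ : Op (Fin A.mem)) (v : I → Bool) :
    mass (run E D A.post (tensor (tensor σ (ket v)) (ket fun _ => false))) = mass σ := by
  rw [mass_run, tensor_ket_ket _ _ _ _ _ _ fun _ => false, mass_inject]

/-- Trace preservation: whatever its input, the second stage keeps the weight of the outcome `t`.
The probabilities of losing and the bound on simulators come from here. -/
theorem sum_prob (t : O → Bool) (v : I → Bool) :
    ∑ s, A.prob E D t v s = A.firstProb E D t := by
  simp only [prob]
  rw [sum_outcomeProb, mass_second]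
  rfl

end TwoStage

/-! ### Parsing descriptions of circuits -/

section Tokens

variable {ℓ c : ℕ} {V W : Type} [WireName V] [WireName W]

/-- The operation code of a gate. -/
def Gate.code : Gate ℓ c W → ℕ
  | .hadamard _ => 1
  | .tgate _ => 2
  | .not _ => 3
  | .cnot _ => 4
  | .toffoli _ => 5
  | .measure _ => 6
  | .encrypt _ => 7
  | .decrypt _ => 8

/-- The wires of a gate, in order. -/
def Gate.wires : Gate ℓ c W → List W
  | .hadamard i => [i]
  | .tgate i => [i]
  | .not i => [i]
  | .cnot e => [e 0, e 1]
  | .toffoli e => [e 0, e 1, e 2]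
  | .measure i => [i]
  | .encrypt e => List.ofFn (fun i => e (.inl i)) ++ List.ofFn (fun j => e (.inr j))
  | .decrypt e => List.ofFn (fun i => e (.inl i)) ++ List.ofFn (fun j => e (.inr j))

theorem Gate.describe_eq (g : Gate ℓ c W) :
    g.describe = g.code :: g.wires.flatMap WireName.name := by
  cases g <;> simp [describe, code, wires, wireList]

theorem Gate.code_map (e : V ↪ W) (g : Gate ℓ c V) : (g.map e).code = g.code := by
  cases g <;> rfl

theorem Gate.wires_map (e : V ↪ W) (g : Gate ℓ c V) : (g.map e).wires = g.wires.map e := by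
  cases g <;> simp [map, wires, List.map_ofFn, Function.comp_def]

theorem Gate.code_ne_zero (g : Gate ℓ c W) : g.code ≠ 0 := by
  cases g <;> simp [code]

/-- The code and the names of the wires of a gate, the latter marked with `0`. -/
def Gate.tokens (g : Gate ℓ c W) : List (ℕ × List ℕ) :=
  (g.code, []) :: g.wires.map fun w => (0, WireName.name w)

/-- Gate codes are nonzero, so `0` can mark the wire names among the tokens, and relocating a
circuit amounts to renaming the tokens so marked. -/
theorem describe_map (e : V ↪ W) (r : List ℕ → List ℕ)
    (h : ∀ w, WireName.name (e w) = r (WireName.name w)) (C : List (Gate ℓ c V)) :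
    (C.map (Gate.map e)).flatMap Gate.describe =
      (C.flatMap Gate.tokens).flatMap fun τ => if τ.1 = 0 then r τ.2 else [τ.1] := by
  induction C with
  | nil => rfl
  | cons g C ih =>
    simp only [List.map_cons, List.flatMap_cons, List.flatMap_append, ih, Gate.describe_eq,
      Gate.code_map, Gate.wires_map, Gate.tokens, g.code_ne_zero, if_false]
    congr 1
    simp [List.flatMap_map, h]

/-- The number of wires of the gate with code `x`, where `q` is the number of wires of a query. -/
def arity (q x : ℕ) : ℕ :=
  bif decide (x = 4) then 2 else bif decide (x = 5) then 3 else bif decide (x = 7) then q else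
    bif decide (x = 8) then q else 1

theorem Gate.length_wires (g : Gate ℓ c W) : g.wires.length = arity (ℓ + c) g.code := by
  cases g <;> simp [wires, arity, code, Nat.add_comm]

/-- The length of a name that starts with `l`, if its second entry is determined by `l`. -/
def nameLen (α β : ℕ) (l : List ℕ) : ℕ :=
  bif decide (l.headD 0 = 1) then 2 else bif decide (l.tail.headD 0 = 1) then α else β

/-- The length of `nm` is determined by its first two entries. -/
def IsName (α β : ℕ) (nm : List ℕ) : Prop :=
  nm.length = nameLen α β nm ∧ 2 ≤ nm.length ∧ β ≠ 1

/-- The state of the parser: the entries of the current name, the flags that tell whether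
the first and the second circuit are completed, the number of names that the current gate still
lacks, and the tokens read so far. -/
abbrev TokState : Type := List ℕ × Bool × Bool × ℕ × List (Bool × Bool × ℕ × List ℕ)

/-- Read one entry of a description. -/
def tokStep (α β α' β' q : ℕ) (s : TokState) (x : ℕ) : TokState :=
  bif s.2.2.1 || !decide (s.2.2.2.1 = 0) then
    bif decide ((x :: s.1).reverse.length = (bif s.2.1 then nameLen α' β' (x :: s.1).reverse else
        nameLen α β (x :: s.1).reverse)) then
      ([], s.2.1, s.2.2.1, s.2.2.2.1 - 1, (s.2.1, s.2.2.1, 0, (x :: s.1).reverse) :: s.2.2.2.2)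
    else (x :: s.1, s.2)
  else bif decide (x = 0) then ([], true, s.2.1, 0, s.2.2.2.2)
  else ([], s.2.1, s.2.2.1, arity q x, (s.2.1, s.2.2.1, x, []) :: s.2.2.2.2)

/-- Names form a prefix code. Two entries determine the length; a single entry predicts the length 2
or, since the missing second entry reads as `0`, the length `β ≠ 1`, so it is never taken for a
name. -/
theorem nameLen_of_prefix {α β : ℕ} {nm p : List ℕ} (h : p <+: nm) (hp : p ≠ []) (hn : p ≠ nm)
    (hnm : IsName α β nm) : p.length ≠ nameLen α β p := by
  obtain ⟨s, rfl⟩ := h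
  obtain ⟨h₁, h₂, h₃⟩ := hnm
  rcases p with _ | ⟨x, _ | ⟨y, p⟩⟩
  · exact absurd rfl hp
  · simp only [nameLen, List.headD_cons, List.tail_cons, List.headD_nil, List.length_singleton]
    by_cases hx : x = 1 <;> simp [hx, h₃.symm]
  · have h₄ : nameLen α β (x :: y :: p ++ s) = nameLen α β (x :: y :: p) := rfl
    rw [← h₄, ← h₁]
    intro h
    exact hn (by simpa using h)

theorem foldl_tokStep_name (α β α' β' q : ℕ) {b b' : Bool} {r : ℕ} (hr : b' = true ∨ r ≠ 0)
    (out : List (Bool × Bool × ℕ × List ℕ)) {nm : List ℕ}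
    (hnm : bif b then IsName α' β' nm else IsName α β nm) :
    nm.foldl (tokStep α β α' β' q) ([], b, b', r, out) =
      ([], b, b', r - 1, (b, b', 0, nm) :: out) := by
  have hact : (b' || !decide (r = 0)) = true := by
    rcases hr with h | h <;> simp [h]
  have hpre (p : List ℕ) (h : p <+: nm) (hp : p ≠ []) (hn : p ≠ nm) :
      p.length ≠ bif b then nameLen α' β' p else nameLen α β p := by
    cases b
    · exact nameLen_of_prefix h hp hn hnm
    · exact nameLen_of_prefix h hp hn hnm
  have hfull : nm.length = bif b then nameLen α' β' nm else nameLen α β nm := by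
    cases b
    · exact hnm.1
    · exact hnm.1
  have key (s p : List ℕ) (hs : s ≠ []) (h : p ++ s = nm) :
      s.foldl (tokStep α β α' β' q) (p.reverse, b, b', r, out) =
        ([], b, b', r - 1, (b, b', 0, nm) :: out) := by
    induction s generalizing p with
    | nil => exact absurd rfl hs
    | cons x s ih =>
      have hx : (x :: p.reverse).reverse = p ++ [x] := by simp
      rw [List.foldl_cons]
      simp only [tokStep, hact, cond_true, hx]
      by_cases hs' : s = []
      · subst hs'
        rw [h, decide_eq_true hfull]
        rfl
      · rw [decide_eq_false (hpre (p ++ [x]) ⟨s, by simpa using h⟩ (by simp) fun h' => ?_)]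
        · have := ih (p ++ [x]) hs' (by simpa using h)
          simpa using this
        · rw [← h', List.append_cons] at h
          exact hs' (by simpa using h)
  refine key nm [] ?_ rfl
  rintro rfl
  cases b <;> exact absurd hnm.2.1 (by simp)

/-- Inside a circuit the parser counts down the names that the current gate lacks; after the second
circuit, where `b'` is set, it reads names without a count. -/
theorem foldl_tokStep_names (α β α' β' q : ℕ) {b b' : Bool} (l : List (List ℕ)) {r : ℕ}
    (hr : b' = true ∨ l.length ≤ r) (out : List (Bool × Bool × ℕ × List ℕ))
    (hl : ∀ nm ∈ l, bif b then IsName α' β' nm else IsName α β nm) :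
    (l.flatMap id).foldl (tokStep α β α' β' q) ([], b, b', r, out) =
      ([], b, b', r - l.length, (l.map fun nm => (b, b', 0, nm)).reverse ++ out) := by
  induction l generalizing r out with
  | nil => simp
  | cons nm l ih =>
    simp only [List.length_cons] at hr
    rw [List.flatMap_cons, List.foldl_append, id,
      foldl_tokStep_name α β α' β' q (hr.imp_right (by omega)) out (hl nm (by simp)),
      ih (hr.imp_right (by omega)) _ fun nm' h => hl nm' (by simp [h])]
    simp
    omega

theorem foldl_tokStep_circuit (α β α' β' : ℕ) {b : Bool} (C : List (Gate ℓ c W))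
    (out : List (Bool × Bool × ℕ × List ℕ))
    (hW : ∀ w : W, bif b then IsName α' β' (WireName.name w) else IsName α β (WireName.name w)) :
    (C.flatMap Gate.describe).foldl (tokStep α β α' β' (ℓ + c)) ([], b, false, 0, out) =
      ([], b, false, 0, ((C.flatMap Gate.tokens).map fun τ => (b, false, τ)).reverse ++ out) := by
  induction C generalizing out with
  | nil => simp
  | cons g C ih =>
    have h₁ := foldl_tokStep_names α β α' β' (ℓ + c) (b := b) (b' := false)
      (g.wires.map WireName.name) (r := arity (ℓ + c) g.code)
      (Or.inr (by simp [g.length_wires])) ((b, false, g.code, []) :: out)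
      (by simpa using fun w _ => hW w)
    have h₂ : tokStep α β α' β' (ℓ + c) ([], b, false, 0, out) g.code =
        ([], b, false, arity (ℓ + c) g.code, (b, false, g.code, []) :: out) := by
      simp [tokStep, g.code_ne_zero]
    rw [List.flatMap_cons, List.foldl_append, Gate.describe_eq, List.foldl_cons, h₂]
    rw [List.flatMap_map] at h₁
    simp only [id] at h₁
    rw [h₁, ← g.length_wires, List.length_map, Nat.sub_self, ih]
    simp [Gate.tokens, Function.comp_def]

/-- The closing code `0` is unambiguous: it is looked for only between gates, and no gate has this
code. The two leading entries, `mem` and `anc`, are removed beforehand. -/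
theorem foldl_tokStep_describe (α β α' β' : ℕ) {o : ℕ} {O I : Type} [WireName O] [WireName I]
    (A : TwoStage ℓ c O I o) (hO : ∀ w : O ⊕ Fin A.mem, IsName α β (WireName.name w))
    (hI : ∀ w : (Fin A.mem ⊕ I) ⊕ Fin A.anc, IsName α' β' (WireName.name w)) :
    (A.describe.tail.tail.foldl (tokStep α β α' β' (ℓ + c)) ([], false, false, 0, [])).2.2.2.2.reverse
      = (A.pre.flatMap Gate.tokens).map (fun τ => (false, false, τ)) ++
        (A.post.flatMap Gate.tokens).map (fun τ => (true, false, τ)) ++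
        ((List.ofFn A.out).map WireName.name).map fun nm => (true, true, 0, nm) := by
  have h₁ (b : Bool) (out : List (Bool × Bool × ℕ × List ℕ)) :
      tokStep α β α' β' (ℓ + c) ([], b, false, 0, out) 0 = ([], true, b, 0, out) := by
    simp [tokStep]
  have h₂ : A.describe.tail.tail = A.pre.flatMap Gate.describe ++ ([0] ++
      (A.post.flatMap Gate.describe ++ ([0] ++
        ((List.ofFn A.out).map WireName.name).flatMap id))) := by
    simp [TwoStage.describe, wireList, List.flatMap_def]
  rw [h₂, List.foldl_append, foldl_tokStep_circuit _ _ _ _ _ _ (by simpa using hO),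
    List.foldl_append, List.foldl_cons, h₁, List.foldl_nil, List.foldl_append,
    foldl_tokStep_circuit _ _ _ _ _ _ (by simpa using hI), List.foldl_append, List.foldl_cons, h₁,
    List.foldl_nil, foldl_tokStep_names _ _ _ _ _ _ (Or.inl rfl) _ (by simpa using fun i => hI _)]
  simp

end Tokens

namespace PolyFun

variable {α : Type} [Enc α]

@[fun_prop]
theorem or {c d : α → Bool} (hc : PolyFun c) (hd : PolyFun d) : PolyFun fun a => c a || d a :=
  (cond hc (const true) hd).congr fun a => by cases c a <;> rfl

theorem sz_reverse {β : Type} [Enc β] (l : List β) : sz l.reverse = sz l := by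
  induction l with
  | nil => rfl
  | cons x l ih => simp [ih]; omega

@[fun_prop]
theorem nameLen {l : α → List ℕ} (hl : PolyFun l) (p q : ℕ) :
    PolyFun fun a => nameLen p q (l a) := by
  unfold QCCA.nameLen
  fun_prop

@[fun_prop]
theorem arity {q x : α → ℕ} (hq : PolyFun q) (hx : PolyFun x) :
    PolyFun fun a => arity (q a) (x a) := by
  unfold QCCA.arity
  fun_prop

theorem arity_le (q x : ℕ) : QCCA.arity q x ≤ q + 3 := by
  unfold QCCA.arity
  cases decide (x = 4) <;> cases decide (x = 5) <;> cases decide (x = 7) <;>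
    cases decide (x = 8) <;> simp

theorem foldl_tokStep (p p' r r' : ℕ) {q : ℕ → ℕ} (hq : PolyFun q) {d : ℕ → List ℕ}
    (hd : PolyFun d) :
    PolyFun fun n => (d n).foldl (tokStep p p' r r' (q n)) ([], false, false, 0, []) := by
  obtain ⟨u, hu⟩ := hq.sz_le
  obtain ⟨v, hv⟩ := hd.sz_le
  -- A step extends the current name, or moves it into a token, or opens a gate and sets the counter
  -- to at most `q + 3`. The name counts twice both in the buffer and in the list of tokens, so
  -- moving it adds a bounded amount; the constants are generous.
  refine foldl (step := fun n => tokStep p p' r r' (q n)) hd (const _) ?_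
    ⟨8 * u + 8 * v + 100, fun n s x hx => ?_⟩
  · unfold tokStep
    fun_prop
  · have h₁ := hu n
    have h₂ := (QCCA.sz_le_of_mem hx).trans (hv n)
    have h₃ := arity_le (q n) x
    obtain ⟨buf, b, b', k, out⟩ := s
    have h₄ := sz_bool_le b
    have h₅ := sz_bool_le b'
    have h₆ : sz true = 1 := rfl
    simp only [sz_nat] at h₁ h₂
    simp only [tokStep, Polynomial.eval_add, Polynomial.eval_mul, Polynomial.eval_ofNat, cond_eq_ite]
    split_ifs <;> simp [sz_reverse, -List.reverse_cons, h₆] <;> omega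

/-- The pieces of a uniform description of two-stage algorithms are uniform. -/
theorem pieces {ℓ c o : ℕ → ℕ} {O I : ℕ → Type} [∀ n, WireName (O n)] [∀ n, WireName (I n)]
    (A : ∀ n, TwoStage (ℓ n) (c n) (O n) (I n) (o n)) (p p' r r' : ℕ)
    (hO : ∀ n (w : O n ⊕ Fin (A n).mem), IsName p p' (WireName.name w))
    (hI : ∀ n (w : (Fin (A n).mem ⊕ I n) ⊕ Fin (A n).anc), IsName r r' (WireName.name w))
    (hℓ : PolyFun ℓ) (hc : PolyFun c) (hA : PolyFun fun n => (A n).describe) :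
    PolyFun (fun n => (A n).mem) ∧ PolyFun (fun n => (A n).anc) ∧
      PolyFun (fun n => (A n).pre.flatMap Gate.tokens) ∧
      PolyFun (fun n => (A n).post.flatMap Gate.tokens) ∧
      PolyFun (fun n => (List.ofFn (A n).out).map WireName.name) := by
  have h := ((foldl_tokStep p p' r r' (hℓ.add hc) hA.tail.tail).snd.snd.snd.snd.reverse).congr
    fun n => foldl_tokStep_describe p p' r r' (A n) (hO n) (hI n)
  -- The two flags of a token tell the first circuit, the second circuit and the output wires apart.
  have h₁ (b b' : Bool) := flatMap (f := fun (_ : ℕ) (τ : Bool × Bool × ℕ × List ℕ) =>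
    bif bif b then τ.1 else !τ.1 then bif bif b' then τ.2.1 else !τ.2.1 then [τ.2.2] else [] else [])
    h (by fun_prop)
  have e₁ {β γ : Type} (l : List β) : l.flatMap (fun _ => ([] : List γ)) = [] := by simp
  refine ⟨(hA.headD 0).congr fun n => rfl, (hA.tail.headD 0).congr fun n => rfl,
    (h₁ false false).congr fun n => ?_, (h₁ true false).congr fun n => ?_,
    (map (f := fun (_ : ℕ) (τ : ℕ × List ℕ) => τ.2) (h₁ true true) (by fun_prop)).congr fun n => ?_⟩
  all_goals
    simp [List.flatMap_append, List.flatMap_map, Function.comp_def, e₁, -List.map_ofFn]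
  induction List.ofFn (A n).out <;> simp_all

end PolyFun

/-! ### Straight-line classical programs -/

section Programs

variable {ℓ c : ℕ} {V W : Type}

/-- The gates that add `a ∧ ¬b` to `x`, for an instruction `(a, b, x)`. -/
def andNot [DecidableEq W] (τ : W × W × W) : List (Gate ℓ c W) :=
  if h : τ.1 ≠ τ.2.1 ∧ τ.1 ≠ τ.2.2 ∧ τ.2.1 ≠ τ.2.2 then
    [.cnot ⟨![τ.1, τ.2.2], by
        intro i j; fin_cases i <;> fin_cases j <;> simp [h.2.1, h.2.1.symm]⟩,
      .toffoli ⟨![τ.1, τ.2.1, τ.2.2], by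
        intro i j
        fin_cases i <;> fin_cases j <;>
          simp [h.1, h.1.symm, h.2.1, h.2.1.symm, h.2.2, h.2.2.symm]⟩]
  else []

/-- The effect of an instruction on basis states. -/
def instr [DecidableEq W] (y : W → Bool) (τ : W × W × W) : W → Bool :=
  Function.update y τ.2.2 (y τ.2.2 ^^ (y τ.1 && !y τ.2.1))

/-- The effect of a program on basis states. -/
def evalProg [DecidableEq W] (P : List (W × W × W)) (y : W → Bool) : W → Bool := P.foldl instr y

theorem andNot_noDecrypt [DecidableEq W] (τ : W × W × W) (g : Gate ℓ c W) (hg : g ∈ andNot τ) :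
    ¬ g.IsDecrypt := by
  unfold andNot at hg
  split_ifs at hg
  · simp only [List.mem_cons, List.not_mem_nil, or_false] at hg
    rcases hg with rfl | rfl <;> exact not_false
  · cases hg

/-- The description of an instruction with the given names. -/
def instrDescr (τ : List ℕ × List ℕ × List ℕ) : List ℕ :=
  (4 :: τ.1 ++ τ.2.2) ++ (5 :: τ.1 ++ τ.2.1 ++ τ.2.2)

/-- Apply a function to the wires of an instruction. -/
def mapInstr (f : V → W) (τ : V × V × V) : W × W × W := (f τ.1, f τ.2.1, f τ.2.2)

/-- The wires of the instructions have ranks that are at least `L`; the targets have increasing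
ranks between `lo` and `hi`, and the other wires of an instruction have smaller ranks. -/
structure Straight (rk : W → ℕ) (L lo hi : ℕ) (P : List (W × W × W)) : Prop where
  le : lo ≤ hi
  wires : ∀ τ ∈ P, (L ≤ rk τ.1 ∧ L ≤ rk τ.2.1 ∧ rk τ.1 ≠ rk τ.2.1) ∧
    rk τ.1 < rk τ.2.2 ∧ rk τ.2.1 < rk τ.2.2 ∧ lo ≤ rk τ.2.2 ∧ rk τ.2.2 < hi
  order : P.Pairwise fun τ τ' => rk τ.2.2 < rk τ'.2.2

namespace Straight

variable {rk : W → ℕ} {L lo mid hi : ℕ} {P Q : List (W × W × W)}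

theorem nil (h : lo ≤ hi) : Straight rk L lo hi ([] : List (W × W × W)) :=
  ⟨h, by simp, List.Pairwise.nil⟩

theorem singleton {τ : W × W × W} (h : (L ≤ rk τ.1 ∧ L ≤ rk τ.2.1 ∧ rk τ.1 ≠ rk τ.2.1) ∧
    rk τ.1 < rk τ.2.2 ∧ rk τ.2.1 < rk τ.2.2 ∧ lo ≤ rk τ.2.2 ∧ rk τ.2.2 < hi) :
    Straight rk L lo hi [τ] :=
  ⟨by omega, by simpa using h, by simp⟩

theorem append (hP : Straight rk L lo mid P) (hQ : Straight rk L mid hi Q) :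
    Straight rk L lo hi (P ++ Q) := by
  refine ⟨hP.le.trans hQ.le, fun τ hτ => ?_,
    List.pairwise_append.2 ⟨hP.order, hQ.order, fun τ hτ τ' hτ' => ?_⟩⟩
  · have h₁ := hP.le
    have h₂ := hQ.le
    rcases List.mem_append.1 hτ with h | h
    · have := hP.wires τ h
      exact ⟨this.1, by omega⟩
    · have := hQ.wires τ h
      exact ⟨this.1, by omega⟩
  · have h₁ := hP.wires τ hτ
    have h₂ := hQ.wires τ' hτ'
    omega

theorem mono {lo' hi' : ℕ} (hP : Straight rk L lo hi P) (hlo : lo' ≤ lo) (hhi : hi ≤ hi') :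
    Straight rk L lo' hi' P :=
  ⟨hlo.trans (hP.le.trans hhi), fun τ hτ => by
    have := hP.wires τ hτ
    exact ⟨this.1, by omega⟩, hP.order⟩

theorem flatMap_range {f : ℕ → List (W × W × W)} (b : ℕ → ℕ) (n : ℕ)
    (h : ∀ t < n, Straight rk L (b t) (b (t + 1)) (f t)) :
    Straight rk L (b 0) (b n) ((List.range n).flatMap f) := by
  induction n with
  | zero => exact nil le_rfl
  | succ n ih =>
    rw [List.range_succ, List.flatMap_append, List.flatMap_singleton]
    exact (ih fun t ht => h t (by omega)).append (h n (by omega))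

end Straight

section Semantics

variable [Fintype V] [DecidableEq V] [Fintype W] [DecidableEq W]

/-- The ranks keep the three wires of an instruction distinct, so none of the instructions
degenerates to the empty circuit. -/
theorem describe_andNot [WireName W] {rk : W → ℕ} {L lo hi : ℕ} {P : List (W × W × W)}
    (hP : Straight rk L lo hi P) :
    (P.flatMap (andNot (ℓ := ℓ) (c := c))).flatMap Gate.describe =
      (P.map (mapInstr WireName.name)).flatMap instrDescr := by
  rw [List.flatMap_assoc, List.flatMap_map]
  refine List.flatMap_congr fun τ hτ => ?_
  have h := hP.wires τ hτ
  have h₁ : τ.1 ≠ τ.2.1 := fun h' => h.1.2.2 (by rw [h'])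
  have h₂ : τ.1 ≠ τ.2.2 := fun h' => absurd h.2.1 (by rw [h']; omega)
  have h₃ : τ.2.1 ≠ τ.2.2 := fun h' => absurd h.2.2.1 (by rw [h']; omega)
  rw [andNot, dif_pos ⟨h₁, h₂, h₃⟩]
  simp [Gate.describe, wireList, instrDescr, mapInstr]
  rfl

theorem conj_basisMap_conj (f g : (W → Bool) → (W → Bool)) (ρ : Op W) :
    conj (basisMap g) (conj (basisMap f) ρ) = conj (basisMap (g ∘ f)) ρ := by
  have : basisMap g * basisMap f = basisMap (g ∘ f) := by
    funext x y
    simp [Matrix.mul_apply, basisMap]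
  simp only [conj, ← this, Matrix.conjTranspose_mul, Matrix.mul_assoc]

theorem conj_basisMap_id (ρ : Op W) : conj (basisMap id) ρ = ρ := by
  have : (basisMap id : Op W) = 1 := by
    funext x y; simp [basisMap, Matrix.one_apply]
  rw [this, conj]
  simp

variable {R : ℕ} (E : Bits R → Bits ℓ → Bits c) (D : Bits c → Bits ℓ)

/-- The gates add first `a` and then `a ∧ b`, and `a ⊕ (a ∧ b) = a ∧ ¬b`. If `a` and `b` are the
same wire no gates are placed, which is right because `a ∧ ¬a` is false. -/
theorem run_andNot {τ : W × W × W} (h₂ : τ.1 ≠ τ.2.2) (h₃ : τ.2.1 ≠ τ.2.2) (ρ : Op W) :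
    run E D (andNot τ) ρ = conj (basisMap fun y => instr y τ) ρ := by
  by_cases h₁ : τ.1 = τ.2.1
  · have : (fun y => instr y τ) = id := by
      funext y
      simp [instr, h₁]
    rw [this, conj_basisMap_id, andNot, dif_neg (by simp [h₁])]
    rfl
  · rw [andNot, dif_pos ⟨h₁, h₂, h₃⟩]
    simp only [run, List.foldl_cons, List.foldl_nil, Gate.apply]
    rw [conj_basisMap_conj]
    congr 2
    funext y
    change Function.update (Function.update y τ.2.2 (y τ.2.2 ^^ y τ.1)) τ.2.2
      (Function.update y τ.2.2 (y τ.2.2 ^^ y τ.1) τ.2.2 ^^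
        (Function.update y τ.2.2 (y τ.2.2 ^^ y τ.1) τ.1 &&
          Function.update y τ.2.2 (y τ.2.2 ^^ y τ.1) τ.2.1)) = _
    rw [Function.update_idem, Function.update_self, Function.update_of_ne h₂,
      Function.update_of_ne h₃, instr]
    congr 1
    cases y τ.1 <;> cases y τ.2.1 <;> simp

theorem run_prog {P : List (W × W × W)} (hP : ∀ τ ∈ P, τ.1 ≠ τ.2.2 ∧ τ.2.1 ≠ τ.2.2) (ρ : Op W) :
    run E D (P.flatMap andNot) ρ = conj (basisMap (evalProg P)) ρ := by
  induction P generalizing ρ with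
  | nil => exact (conj_basisMap_id ρ).symm
  | cons τ P ih =>
    have h := hP τ (by simp)
    rw [List.flatMap_cons, run_append, run_andNot E D h.1 h.2,
      ih fun τ' h' => hP τ' (by simp [h']), conj_basisMap_conj]
    rfl

theorem injective_evalProg {P : List (W × W × W)}
    (hP : ∀ τ ∈ P, τ.1 ≠ τ.2.2 ∧ τ.2.1 ≠ τ.2.2) : Function.Injective (evalProg P) := by
  induction P with
  | nil => exact Function.injective_id
  | cons τ P ih =>
    have h := hP τ (by simp)
    have h₁ : Function.Injective fun y => instr y τ :=
      injective_of_involutive_update (f := fun y => y τ.1 && !y τ.2.1) fun y b => by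
        rw [Function.update_of_ne h.1, Function.update_of_ne h.2]
    exact (ih fun τ' h' => hP τ' (by simp [h'])).comp h₁

theorem Straight.ne {rk : W → ℕ} {L lo hi : ℕ} {P : List (W × W × W)}
    (hP : Straight rk L lo hi P) (τ : W × W × W) (hτ : τ ∈ P) : τ.1 ≠ τ.2.2 ∧ τ.2.1 ≠ τ.2.2 := by
  have h := hP.wires τ hτ
  exact ⟨fun h' => absurd h.2.1 (by rw [h']; omega), fun h' => absurd h.2.2.1 (by rw [h']; omega)⟩

theorem evalProg_put (e : V ↪ W) (z : W → Bool) (p : V → Bool) {P : List (W × W × W)}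
    (hP : ∀ τ ∈ P, ∀ v, e v ≠ τ.1 ∧ e v ≠ τ.2.1 ∧ e v ≠ τ.2.2) :
    evalProg P (put e z p) = put e (evalProg P z) p := by
  induction P generalizing z with
  | nil => rfl
  | cons τ P ih =>
    have h := hP τ (by simp)
    have : instr (put e z p) τ = put e (instr z τ) p := by
      refine eq_put_iff.2 ⟨?_, fun w hw => ?_⟩
      · funext v
        simp [instr, Function.update_of_ne (h v).2.2]
      · simp only [instr, put_of_forall_ne fun v => (h v).1, put_of_forall_ne fun v => (h v).2.1,
          put_of_forall_ne fun v => (h v).2.2]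
        by_cases hx : w = τ.2.2
        · subst hx; simp
        · simp only [Function.update_of_ne hx, put_of_forall_ne hw]
    change evalProg P (instr (put e z p) τ) = put e (evalProg P (instr z τ)) p
    rw [this, ih _ fun τ' h' => hP τ' (by simp [h'])]

/-- The values computed by a straight-line program satisfy its instructions. -/
theorem Straight.evalProg {rk : W → ℕ} {L lo hi : ℕ} {P : List (W × W × W)}
    (hP : Straight rk L lo hi P) {z : W → Bool} (hz : ∀ w, lo ≤ rk w → rk w < hi → z w = false) :
    (∀ τ ∈ P, evalProg P z τ.2.2 = (evalProg P z τ.1 && !evalProg P z τ.2.1)) ∧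
      ∀ w, (∀ τ ∈ P, τ.2.2 ≠ w) → evalProg P z w = z w := by
  obtain ⟨-, h₁, h₂⟩ := hP
  have hz' : ∀ τ ∈ P, z τ.2.2 = false := fun τ hτ => hz _ (h₁ τ hτ).2.2.2.1 (h₁ τ hτ).2.2.2.2
  clear hz
  induction P generalizing z with
  | nil => exact ⟨by simp, fun w _ => rfl⟩
  | cons τ P ih =>
    rw [List.pairwise_cons] at h₂
    have h₃ := h₁ τ (by simp)
    -- Later targets have larger ranks: the rest of the program changes neither this target nor the
    -- two wires it was computed from.
    have hne (w : W) (hw : rk w ≤ rk τ.2.2) (τ') (hτ' : τ' ∈ P) : τ'.2.2 ≠ w := by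
      rintro rfl
      exact absurd (h₂.1 τ' hτ') (by omega)
    have hx : τ.1 ≠ τ.2.2 := fun h' => absurd h₃.2.1 (by rw [h']; omega)
    have hy : τ.2.1 ≠ τ.2.2 := fun h' => absurd h₃.2.2.1 (by rw [h']; omega)
    have key := ih (z := instr z τ) (fun τ' h' => h₁ τ' (by simp [h'])) h₂.2 fun τ' h' => by
      rw [instr, Function.update_of_ne (hne _ le_rfl τ' h'), hz' τ' (by simp [h'])]
    change (∀ τ' ∈ τ :: P, QCCA.evalProg P (instr z τ) τ'.2.2 =
      (QCCA.evalProg P (instr z τ) τ'.1 && !QCCA.evalProg P (instr z τ) τ'.2.1)) ∧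
      ∀ w, (∀ τ' ∈ τ :: P, τ'.2.2 ≠ w) → QCCA.evalProg P (instr z τ) w = z w
    refine ⟨fun τ' hτ' => ?_, fun w hw => ?_⟩
    · rcases List.mem_cons.1 hτ' with rfl | h
      · rw [key.2 _ (hne _ le_rfl), key.2 _ (hne _ h₃.2.1.le), key.2 _ (hne _ h₃.2.2.1.le)]
        simp only [instr]
        rw [Function.update_self, Function.update_of_ne hx, Function.update_of_ne hy,
          hz' _ (by simp), Bool.false_xor]
      · exact key.1 τ' h
    · rw [key.2 w fun τ' h' => hw τ' (by simp [h']), instr,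
        Function.update_of_ne (hw τ (by simp)).symm]

end Semantics

/-! ### Evaluation of Boolean circuits by programs -/

/-- The wires of a circuit with `a` inputs, given the wires of the inputs and of the gates. -/
def circWire (inp w : ℕ → W) (a j : ℕ) : W := bif decide (j < a) then inp j else w (j - a)

/-- The program that evaluates gate `t` of a circuit. The wire `C t j` holds the bit `(t, j)`
of the circuit, `p t j` tells whether wire `j` makes the conjunction false, and `r t j` holds the
conjunction over the wires before `j`. -/
def gateProg (one zero : W) (inp w : ℕ → W) (C p r : ℕ → ℕ → W) (a t : ℕ) : List (W × W × W) :=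
  ([(one, zero, r t 0)] ++ (List.range (a + t)).flatMap fun j =>
    [(C t j, circWire inp w a j, p t j), (r t j, p t j, r t (j + 1))]) ++ [(one, r t (a + t), w t)]

/-- The program that evaluates a circuit with `G` gates. -/
def circProg (one zero : W) (inp w : ℕ → W) (C p r : ℕ → ℕ → W) (a G : ℕ) : List (W × W × W) :=
  (List.range G).flatMap fun t => gateProg one zero inp w C p r a t

theorem map_circProg (f : V → W) (one zero : V) (inp w : ℕ → V) (C p r : ℕ → ℕ → V) (a G : ℕ) :
    (circProg one zero inp w C p r a G).map (mapInstr f) =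
      circProg (f one) (f zero) (fun j => f (inp j)) (fun t => f (w t)) (fun t j => f (C t j))
        (fun t j => f (p t j)) (fun t j => f (r t j)) a G := by
  have h (j : ℕ) : f (circWire inp w a j) = circWire (fun j => f (inp j)) (fun t => f (w t)) a j := by
    unfold circWire
    cases decide (j < a) <;> rfl
  simp [circProg, gateProg, List.map_flatMap, mapInstr, h]

/-- Gate `t` owns the block of `N` ranks that starts at `B + t * N`: the running conjunctions `r`
sit at even offsets, the tests `p` at odd ones, and the value `w` comes last. So targets increase in
the order of execution, and a gate reads only inputs and earlier blocks. -/
theorem straight_circProg {rk : W → ℕ} {L B N : ℕ} {one zero : W} {inp w : ℕ → W}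
    {C p r : ℕ → ℕ → W} {a G : ℕ} (hone : L ≤ rk one ∧ rk one < B) (hzero : L ≤ rk zero ∧ rk zero < B)
    (hoz : rk one ≠ rk zero) (hinp : ∀ j < a, rk (inp j) < B)
    (hC : ∀ t < G, ∀ j < a + G, L ≤ rk (C t j) ∧ rk (C t j) < B)
    (hCinp : ∀ t < G, ∀ j < a + G, ∀ i < a, rk (C t j) < rk (inp i))
    (hr : ∀ t < G, ∀ j ≤ a + G, rk (r t j) = B + t * N + 2 * j)
    (hp : ∀ t < G, ∀ j < a + G, rk (p t j) = B + t * N + (2 * j + 1))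
    (hw : ∀ t < G, rk (w t) = B + t * N + (N - 1)) (hN : 2 * (a + G) + 3 ≤ N) :
    Straight rk L B (B + G * N) (circProg one zero inp w C p r a G) := by
  have key := Straight.flatMap_range (rk := rk) (L := L)
    (f := fun t => gateProg one zero inp w C p r a t) (fun t => B + t * N) G fun t ht => ?_
  · simpa [circProg] using key
  have hsucc : B + (t + 1) * N = B + t * N + N := by ring
  have hr0 := hr t ht 0 (by omega)
  have hrl := hr t ht (a + t) (by omega)
  have hwt := hw t ht
  have hBt : B ≤ B + t * N := Nat.le_add_right _ _
  generalize hS : B + t * N = S at *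
  refine (Straight.append (mid := S + 2 * (a + t) + 1) (Straight.append (mid := S + 1)
    (Straight.singleton ?_) ?_) (Straight.singleton ?_))
  · dsimp only
    omega
  · have := Straight.flatMap_range (rk := rk) (L := L) (f := fun j =>
      [(C t j, circWire inp w a j, p t j), (r t j, p t j, r t (j + 1))])
      (fun j => S + 2 * j + 1) (a + t) fun j hj => ?_
    · simpa using this
    have h₁ := hr t ht j (by omega)
    have h₂ := hr t ht (j + 1) (by omega)
    have h₃ := hp t ht j (by omega)
    have h₄ := hC t ht j (by omega)
    rw [hS] at h₁ h₂ h₃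
    have h₅ : rk (C t j) < rk (circWire inp w a j) ∧ rk (circWire inp w a j) < S := by
      unfold circWire
      by_cases hja : j < a
      · have := hCinp t ht j (by omega) j hja
        have := hinp j hja
        simp only [hja, decide_true, cond_true]
        omega
      · have h₆ := hw (j - a) (by omega)
        have h₇ : (j - a + 1) * N ≤ t * N := Nat.mul_le_mul_right N (by omega)
        rw [Nat.add_mul, Nat.one_mul] at h₇
        simp only [hja, decide_false, cond_false]
        omega
    exact Straight.append (P := [_]) (mid := S + 2 * j + 2)
      (Straight.singleton (by dsimp only; omega)) (Straight.singleton (by dsimp only; omega))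
  · dsimp only
    omega

/-- The final state of the evaluation of a circuit satisfies the equations of its gates. -/
theorem foldl_boolCircuit_step {a g b : ℕ} (K : BoolCircuit a g b) (l : List (Fin (g + b)))
    (hl : l.Pairwise (· < ·)) (x : Bits (a + (g + b))) :
    (∀ t ∈ l, l.foldl K.step x (Fin.natAdd a t) = !decide (∀ j, j < Fin.natAdd a t →
        K (t, j) = true → l.foldl K.step x j = true)) ∧
      ∀ i, (∀ t ∈ l, Fin.natAdd a t ≠ i) → l.foldl K.step x i = x i := by
  induction l generalizing x with
  | nil => simp
  | cons t l ih =>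
    rw [List.pairwise_cons] at hl
    obtain ⟨h₁, h₂⟩ := ih hl.2 (K.step x t)
    have h₃ (i) (hi : i ≤ Fin.natAdd a t) (t') (ht' : t' ∈ l) : Fin.natAdd a t' ≠ i := by
      rintro rfl
      have := hl.1 t' ht'
      simp only [Fin.le_def, Fin.lt_def, Fin.val_natAdd] at *
      omega
    simp only [List.foldl_cons]
    refine ⟨fun t' ht' => ?_, fun i hi => ?_⟩
    · rcases List.mem_cons.1 ht' with rfl | h
      · rw [h₂ _ (h₃ _ le_rfl)]
        have h₄ (j) (hj : j < Fin.natAdd a t') :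
            l.foldl K.step (K.step x t') j = x j := by
          rw [h₂ j (h₃ j hj.le), BoolCircuit.step, Function.update_of_ne hj.ne]
        have h₅ : (∀ j, j < Fin.natAdd a t' → K (t', j) = true →
            l.foldl K.step (K.step x t') j = true) ↔
            ∀ j, j < Fin.natAdd a t' → K (t', j) = true → x j = true :=
          forall₂_congr fun j hj => by rw [h₄ j hj]
        simp only [h₅]
        rw [BoolCircuit.step, Function.update_self]
      · exact h₁ t' h
    · rw [h₂ i fun t' ht' => hi t' (by simp [ht']), BoolCircuit.step,
        Function.update_of_ne (hi t (by simp)).symm]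

/-- An assignment that satisfies the instructions holds the output of the circuit. -/
theorem eval_of_circProg {a g b : ℕ} (K : BoolCircuit a g b) (x : Bits a) {Z : W → Bool}
    {one zero : W} {inp w : ℕ → W} {C p r : ℕ → ℕ → W}
    (hZ : ∀ τ ∈ circProg one zero inp w C p r a (g + b), Z τ.2.2 = (Z τ.1 && !Z τ.2.1))
    (hone : Z one = true) (hzero : Z zero = false) (hinp : ∀ j : Fin a, Z (inp j) = x j)
    (hC : ∀ i : CircuitIdx a g b, Z (C i.1 i.2) = K i) (i : Fin b) :
    Z (w (g + i)) = K.eval x i := by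
  have hmem (t : ℕ) (ht : t < g + b) (τ) (hτ : τ ∈ gateProg one zero inp w C p r a t) :
      Z τ.2.2 = (Z τ.1 && !Z τ.2.1) := by
    refine hZ τ ?_
    simp only [circProg, List.mem_flatMap, List.mem_range]
    exact ⟨t, ht, hτ⟩
  obtain ⟨h₁, h₂⟩ := foldl_boolCircuit_step K (List.finRange (g + b))
    (List.pairwise_lt_finRange _) (Fin.append x fun _ => false)
  set s := (List.finRange (g + b)).foldl K.step (Fin.append x fun _ => false) with hs
  -- Induction along the topological order: each wire of the circuit is represented with its correct
  -- value.
  have key (n : ℕ) (hn : n < a + (g + b)) : Z (circWire inp w a n) = s ⟨n, hn⟩ := by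
    induction n using Nat.strong_induction_on with
    | _ n ih =>
    by_cases hna : n < a
    · have h₃ := h₂ ⟨n, hn⟩ fun t _ h => by
        have := congrArg Fin.val h
        simp at this
        omega
      rw [h₃]
      have h₄ : (⟨n, hn⟩ : Fin (a + (g + b))) = Fin.castAdd (g + b) ⟨n, hna⟩ := rfl
      rw [h₄, Fin.append_left, ← hinp]
      simp [circWire, hna]
    · obtain ⟨t, rfl⟩ : ∃ t, n = a + t := ⟨n - a, by omega⟩
      have ht : t < g + b := by omega
      have h₃ := h₁ ⟨t, ht⟩ (by simp)
      have h₄ : (⟨a + t, hn⟩ : Fin (a + (g + b))) = Fin.natAdd a ⟨t, ht⟩ := rfl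
      have h₅ : circWire inp w a (a + t) = w t := by simp [circWire]
      rw [h₄, h₃, h₅]
      have e₁ : Z (w t) = (Z one && !Z (r t (a + t))) :=
        hmem t ht (one, r t (a + t), w t) (by simp [gateProg])
      have e₂ : Z (r t 0) = (Z one && !Z zero) :=
        hmem t ht (one, zero, r t 0) (by simp [gateProg])
      have e₃ (j : ℕ) (hj : j < a + t) : Z (p t j) = (Z (C t j) && !Z (circWire inp w a j)) :=
        hmem t ht (C t j, circWire inp w a j, p t j) (by
          simp only [gateProg, List.mem_append, List.mem_flatMap, List.mem_range]
          exact Or.inl (Or.inr ⟨j, hj, by simp⟩))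
      have e₄ (j : ℕ) (hj : j < a + t) : Z (r t (j + 1)) = (Z (r t j) && !Z (p t j)) :=
        hmem t ht (r t j, p t j, r t (j + 1)) (by
          simp only [gateProg, List.mem_append, List.mem_flatMap, List.mem_range]
          exact Or.inl (Or.inr ⟨j, hj, by simp⟩))
      -- `p t j` is set iff wire `j` is selected and false, so `r t k` is the conjunction of the
      -- selected wires before `k`.
      have e₅ (k : ℕ) (hk : k ≤ a + t) : Z (r t k) = true ↔ ∀ j (hj : j < k),
          K (⟨t, ht⟩, ⟨j, by omega⟩) = true → s ⟨j, by omega⟩ = true := by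
        induction k with
        | zero => simp [e₂, hone, hzero]
        | succ k ihk =>
          have e₆ := ih k (by omega) (by omega)
          have e₇ := hC (⟨t, ht⟩, ⟨k, by omega⟩)
          dsimp only at e₇
          rw [e₄ k (by omega), e₃ k (by omega), Bool.and_eq_true, ihk (by omega), e₆, e₇]
          constructor
          · rintro ⟨h, h'⟩ j hj hKj
            rcases Nat.lt_succ_iff_lt_or_eq.1 hj with h'' | rfl
            · exact h j h'' hKj
            · simpa [hKj] using h'
          · intro h
            refine ⟨fun j hj => h j (by omega), ?_⟩
            have := h k (by omega)
            cases h7 : K (⟨t, ht⟩, ⟨k, by omega⟩)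
            · simp
            · simp [this h7]
      rw [e₁, hone, Bool.true_and]
      congr 1
      rw [Bool.eq_iff_iff, e₅ (a + t) le_rfl, decide_eq_true_iff]
      constructor
      · intro h j hj
        exact h j hj
      · intro h j hj
        exact h ⟨j, by omega⟩ hj
  have := key (a + (g + i)) (by omega)
  rw [BoolCircuit.eval, ← hs]
  have h₃ : circWire inp w a (a + (g + i)) = w (g + i) := by simp [circWire]
  rw [h₃] at this
  exact this

end Programs

/-! ### Extensions of two-stage algorithms -/

section Coins

variable {V W : Type} [Fintype V] [DecidableEq V] [Fintype W] [DecidableEq W]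
variable {ℓ c R : ℕ} (E : Bits R → Bits ℓ → Bits c) (D : Bits c → Bits ℓ)

theorem run_not_inject (e : V ↪ W) (z : W → Bool) (i : W) (hi : ∀ v, e v ≠ i) (σ : Op V) :
    run E D [.not i] (inject e z σ) = inject e (Function.update z i (!z i)) σ := by
  refine conj_basisMap_inject (fun p => ?_) σ
  rw [put_of_forall_ne hi]
  refine eq_put_iff.2 ⟨?_, fun w hw => ?_⟩
  · funext v
    simp [Function.update_of_ne (hi v)]
  · by_cases hwi : w = i
    · subst hwi; simp
    · simp [hwi, put_of_forall_ne hw]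

theorem put_snoc {k : ℕ} (w : Fin (k + 1) ↪ W) (z : W → Bool) (u : Bits k) (b : Bool) :
    Function.update (put (Fin.castSuccEmb.trans w) z u) (w (Fin.last k)) b =
      put w z (Fin.snoc (α := fun _ => Bool) u b) := by
  refine eq_put_iff.2 ⟨?_, fun x hx => ?_⟩
  · funext j
    refine Fin.lastCases ?_ (fun j => ?_) j
    · simp
    · have h : w j.castSucc ≠ w (Fin.last k) := w.injective.ne (Fin.castSucc_lt_last j).ne
      rw [Function.comp_apply, Function.update_of_ne h, Fin.snoc_castSucc]
      exact put_apply (Fin.castSuccEmb.trans w) z u j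
  · rw [Function.update_of_ne (hx _).symm,
      put_of_forall_ne (e := Fin.castSuccEmb.trans w) fun j => hx _]

theorem run_coins (e : V ↪ W) (z : W → Bool) {k : ℕ} (w : Fin k ↪ W) (hw : ∀ v j, e v ≠ w j)
    (hz : ∀ j, z (w j) = false) (σ : Op V) :
    run E D ((List.finRange k).flatMap fun j => tossCoin (w j)) (inject e z σ) =
      ∑ u : Bits k, ((((2 : ℝ) ^ k)⁻¹ : ℝ) : ℂ) • inject e (put w z u) σ := by
  induction k with
  | zero =>
    have (u : Bits 0) : put w z u = z :=
      (eq_put_iff.2 ⟨Subsingleton.elim _ _, fun _ _ => rfl⟩).symm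
    simp [run, this]
  | succ k ih =>
    have h₁ := ih (Fin.castSuccEmb.trans w) (fun v j => hw v _) (fun j => hz _)
    rw [List.finRange_succ_last, List.flatMap_append, run_append, List.flatMap_map]
    refine (congrArg _ h₁).trans ?_
    rw [List.flatMap_singleton, run_sum, ← (Fin.snocEquiv fun _ => Bool).sum_comp,
      Fintype.sum_prod_type_right]
    refine Finset.sum_congr rfl fun u _ => ?_
    rw [run_smul, run_tossCoin E D e _ _ (fun v => hw v _), Finset.smul_sum, Finset.smul_sum]
    · refine Finset.sum_congr rfl fun b _ => ?_
      rw [put_snoc, smul_smul]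
      congr 1
      push_cast
      rw [pow_succ, mul_inv]
    · rw [put_of_forall_ne, hz]
      intro j
      exact w.injective.ne (Fin.castSucc_lt_last j).ne

end Coins

namespace TwoStage

variable {ℓ c R o : ℕ} {O I : Type} [Fintype O] [DecidableEq O] [Fintype I] [DecidableEq I]
variable (E : Bits R → Bits ℓ → Bits c) (D : Bits c → Bits ℓ)

theorem secondProb_sum (A : TwoStage ℓ c O I o) {ι : Type*} [Fintype ι] (w : ι → ℝ)
    (σ : ι → Op (Fin A.mem)) (v : I → Bool) (s : Bits o) :
    A.secondProb E D (∑ i, (w i : ℂ) • σ i) v s = ∑ i, w i * A.secondProb E D (σ i) v s := by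
  simp only [secondProb, tensor_ket_ket _ _ _ _ _ _ fun _ => false]
  rw [inject_sum, run_sum, outcomeProb_sum]
  refine Finset.sum_congr rfl fun i _ => ?_
  rw [inject_smul, run_smul, outcomeProb_smul]

theorem secondProb_zero (A : TwoStage ℓ c O I o) (v : I → Bool) (s : Bits o) :
    A.secondProb E D 0 v s = 0 := by
  simpa using secondProb_sum E D A (ι := Empty) (fun _ => 0) (fun _ => 0) v s

theorem firstStage_of_run (A : TwoStage ℓ c O I o) {V ι : Type} [Fintype V] [DecidableEq V]
    [Fintype ι] (w : ι → ℝ) (e : V ↪ Fin A.mem) (z : ι → O ⊕ Fin A.mem → Bool) (σ : ι → Op V)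
    (h : run E D A.pre (ket fun _ => false) =
      ∑ i, (w i : ℂ) • inject (e.trans Function.Embedding.inr) (z i) (σ i)) (T : O → Bool) :
    A.firstStage E D T = ∑ i, (w i : ℂ) •
      if T = z i ∘ Sum.inl then inject e (z i ∘ Sum.inr) (σ i) else 0 := by
  rw [firstStage, h]
  simp only [← postState_inject]
  refine Matrix.ext fun x y => ?_
  simp only [postState, Matrix.sum_apply, Matrix.smul_apply]

/-- If the first stage ends in a mixture of states with a definite output, the sum over outputs in
the game becomes a sum over the components of the mixture. The input and the winning answer may
depend on the output, as they do in the games. -/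
theorem sum_prob_of_run (A : TwoStage ℓ c O I o) {V ι : Type} [Fintype V] [DecidableEq V]
    [Fintype ι] {w : ι → ℝ} {e : V ↪ Fin A.mem} {z : ι → O ⊕ Fin A.mem → Bool} {σ : ι → Op V}
    (h : run E D A.pre (ket fun _ => false) =
      ∑ i, (w i : ℂ) • inject (e.trans Function.Embedding.inr) (z i) (σ i))
    (v : (O → Bool) → I → Bool) (s : (O → Bool) → Bits o) :
    ∑ T, A.prob E D T (v T) (s T) = ∑ i, w i *
      A.secondProb E D (inject e (z i ∘ Sum.inr) (σ i)) (v (z i ∘ Sum.inl)) (s (z i ∘ Sum.inl)) := by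
  have h₁ (T) : A.prob E D T (v T) (s T) = ∑ i, if T = z i ∘ Sum.inl then
      w i * A.secondProb E D (inject e (z i ∘ Sum.inr) (σ i)) (v T) (s T) else 0 := by
    change A.secondProb E D (A.firstStage E D T) (v T) (s T) = _
    rw [firstStage_of_run E D A w e z σ h T, secondProb_sum]
    refine Finset.sum_congr rfl fun i _ => ?_
    split_ifs <;> simp [secondProb_zero]
  rw [Finset.sum_congr rfl fun T _ => h₁ T, Finset.sum_comm]
  simp

/-- Stated with a weight because the bound on simulators is the mean of a function of the template.
-/
theorem sum_firstProb_of_run (A : TwoStage ℓ c O I o) {V ι : Type} [Fintype V] [DecidableEq V]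
    [Fintype ι] {w : ι → ℝ} {e : V ↪ Fin A.mem} {z : ι → O ⊕ Fin A.mem → Bool} {σ : ι → Op V}
    (h : run E D A.pre (ket fun _ => false) =
      ∑ i, (w i : ℂ) • inject (e.trans Function.Embedding.inr) (z i) (σ i))
    (κ : (O → Bool) → ℝ) :
    ∑ T, κ T * A.firstProb E D T = ∑ i, w i * (κ (z i ∘ Sum.inl) * mass (σ i)) := by
  have h₁ (T) : κ T * A.firstProb E D T = ∑ i, if T = z i ∘ Sum.inl then
      w i * (κ T * mass (σ i)) else 0 := by
    rw [firstProb, firstStage_of_run E D A w e z σ h T, mass_sum, Finset.mul_sum]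
    refine Finset.sum_congr rfl fun i _ => ?_
    rw [mass_smul]
    split_ifs
    · rw [mass_inject]; ring
    · simp [mass]
  rw [Finset.sum_congr rfl fun T _ => h₁ T, Finset.sum_comm]
  simp

variable {ℓ' c' o' : ℕ} {O' I' : Type} [Fintype O'] [DecidableEq O'] [Fintype I']
  [DecidableEq I']

theorem run_pre_measure (A : TwoStage ℓ c O I o) {W : Type} [Fintype W] [DecidableEq W]
    (e : O ⊕ Fin A.mem ↪ W) (l : List W) (hl : ∀ o, e (.inl o) ∈ l) (hl' : ∀ m, e (.inr m) ∉ l) :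
    run E D (A.pre.map (Gate.map e) ++ measureAll l) (ket fun _ => false) = ∑ t,
      inject (Function.Embedding.inr.trans e)
        (put (Function.Embedding.inl.trans e) (fun _ => false) t) (A.firstStage E D t) := by
  rw [run_append, ket_eq_inject e, run_map_inject, run_measureAll_inject E D e _ l hl hl']
  rfl

/-- The wires that `e` assigns to `A` must hold what `A` expects when its second stage begins: its
memory, its input `v`, and zeros. It does not matter whether the input wires lie in the memory or in
the input register of `A'`. -/
theorem tensor_inject (A : TwoStage ℓ c O I o) (A' : TwoStage ℓ c O' I' o')
    (eM : Fin A.mem ↪ Fin A'.mem)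
    (e : (Fin A.mem ⊕ I) ⊕ Fin A.anc ↪ (Fin A'.mem ⊕ I') ⊕ Fin A'.anc)
    (z : Fin A'.mem → Bool) (v : I → Bool) (v' : I' → Bool)
    (h₁ : ∀ i, e (.inl (.inl i)) = .inl (.inl (eM i)))
    (h₂ : ∀ i, Sum.elim (Sum.elim z v') (fun _ => false) (e (.inl (.inr i))) = v i)
    (h₃ : ∀ i, Sum.elim (Sum.elim z v') (fun _ => false) (e (.inr i)) = false)
    (σ : Op (Fin A.mem)) :
    tensor (tensor (inject eM z σ) (ket v')) (ket fun _ => false) =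
      inject e (Sum.elim (Sum.elim z v') fun _ => false)
        (tensor (tensor σ (ket v)) (ket fun _ => false)) := by
  rw [tensor_ket_ket _ _ _ _ _ _ z, tensor_ket_ket _ _ _ _ _ _ (z ∘ eM)]
  have h₄ : Sum.elim (Sum.elim (z ∘ eM) v) (fun _ => false) =
      Sum.elim (Sum.elim z v') (fun _ => false) ∘ e := by
    funext x
    rcases x with (i | i) | i
    · rw [Function.comp_apply, h₁]; rfl
    · rw [Function.comp_apply, h₂]; rfl
    · rw [Function.comp_apply, h₃]; rfl
  have h₅ : z = Sum.elim (Sum.elim z v') (fun _ => false) ∘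
      (Function.Embedding.inl.trans Function.Embedding.inl :
        Fin A'.mem ↪ (Fin A'.mem ⊕ I') ⊕ Fin A'.anc) := rfl
  rw [h₄, ← inject_trans]
  nth_rw 2 [h₅]
  rw [← inject_trans]
  congr 1
  ext i
  exact (h₁ i).symm

/-- The second stage of `A`, followed by a program. -/
theorem secondProb_prog (A : TwoStage ℓ c O I o) (A' : TwoStage ℓ c O' I' o')
    (eM : Fin A.mem ↪ Fin A'.mem)
    (e : (Fin A.mem ⊕ I) ⊕ Fin A.anc ↪ (Fin A'.mem ⊕ I') ⊕ Fin A'.anc)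
    (z : Fin A'.mem → Bool) (v : I → Bool) (v' : I' → Bool)
    (h₁ : ∀ i, e (.inl (.inl i)) = .inl (.inl (eM i)))
    (h₂ : ∀ i, Sum.elim (Sum.elim z v') (fun _ => false) (e (.inl (.inr i))) = v i)
    (h₃ : ∀ i, Sum.elim (Sum.elim z v') (fun _ => false) (e (.inr i)) = false)
    {P : List (((Fin A'.mem ⊕ I') ⊕ Fin A'.anc) × ((Fin A'.mem ⊕ I') ⊕ Fin A'.anc) ×
      ((Fin A'.mem ⊕ I') ⊕ Fin A'.anc))}
    (hP : ∀ τ ∈ P, τ.1 ≠ τ.2.2 ∧ τ.2.1 ≠ τ.2.2)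
    (hpost : A'.post = A.post.map (Gate.map e) ++ P.flatMap andNot) (s' : Bits o')
    (Q : Bits o → Prop) [DecidablePred Q]
    (hQ : ∀ y, (∀ w, (∀ x, e x ≠ w) → y w = Sum.elim (Sum.elim z v') (fun _ => false) w) →
      ((fun i => evalProg P y (A'.out i)) = s' ↔ Q fun i => y (e (A.out i))))
    (σ : Op (Fin A.mem)) :
    A'.secondProb E D (inject eM z σ) v' s' =
      ∑ s, if Q s then A.secondProb E D σ v s else 0 := by
  rw [secondProb, tensor_inject A A' eM e z v v' h₁ h₂ h₃, hpost, run_append, run_map_inject,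
    run_prog E D hP, outcomeProb_conj_basisMap_inject _ _ (injective_evalProg hP)]
  simp only [secondProb, outcomeProb]
  set ρ := run E D A.post (tensor (tensor σ (ket v)) (ket fun _ => false))
  have h₄ (s : Bits o) : (if Q s then ∑ x, if (fun i => x (A.out i)) = s then (ρ x x).re else 0
      else 0) = ∑ x, if (fun i => x (A.out i)) = s then if Q s then (ρ x x).re else 0 else 0 := by
    split_ifs <;> simp
  rw [Finset.sum_congr rfl fun s _ => h₄ s, Finset.sum_comm]
  refine Finset.sum_congr rfl fun p _ => ?_
  rw [Finset.sum_ite_eq Finset.univ]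
  -- Given the outcome `p` on the wires of `A`, the rest of the register is a known basis state, so
  -- the answer of the program depends only on the string that `A` outputs.
  have h₅ := hQ (put e (Sum.elim (Sum.elim z v') fun _ => false) p) fun w hw => put_of_forall_ne hw
  simp only [put_apply] at h₅
  simp [h₅]

end TwoStage

/-! ### Averages -/

theorem avg_const {α : Type} [Fintype α] [Nonempty α] (x : ℝ) : avg (fun _ : α => x) = x := by
  rw [avg, Finset.sum_const, Finset.card_univ, nsmul_eq_mul, mul_div_cancel_left₀]
  exact Nat.cast_ne_zero.2 Fintype.card_ne_zero

theorem avg_add {α : Type} [Fintype α] (f g : α → ℝ) :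
    avg (fun a => f a + g a) = avg f + avg g := by
  rw [avg, avg, avg, Finset.sum_add_distrib, add_div]

theorem avg_sub {α : Type} [Fintype α] (f g : α → ℝ) :
    avg (fun a => f a - g a) = avg f - avg g := by
  rw [avg, avg, avg, Finset.sum_sub_distrib, sub_div]

theorem avg_mul {α : Type} [Fintype α] (x : ℝ) (f : α → ℝ) :
    avg (fun a => x * f a) = x * avg f := by
  rw [avg, avg, ← Finset.mul_sum, mul_div_assoc]

theorem avg_sum {α ι : Type} [Fintype α] [Fintype ι] (f : ι → α → ℝ) :
    avg (fun a => ∑ i, f i a) = ∑ i, avg (f i) := by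
  simp only [avg]
  rw [Finset.sum_comm, Finset.sum_div]

theorem avg_comm {α β : Type} [Fintype α] [Fintype β] (f : α → β → ℝ) :
    (avg fun a => avg (f a)) = avg fun b => avg fun a => f a b := by
  simp only [avg, Finset.sum_div]
  rw [Finset.sum_comm]
  refine Finset.sum_congr rfl fun b _ => Finset.sum_congr rfl fun a _ => ?_
  rw [div_right_comm]

theorem avg_mono {α : Type} [Fintype α] {f g : α → ℝ} (h : ∀ a, f a ≤ g a) : avg f ≤ avg g :=
  div_le_div_of_nonneg_right (Finset.sum_le_sum fun a _ => h a) (Nat.cast_nonneg _)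

theorem avg_bool (f : Bool → ℝ) : avg f = (f true + f false) / 2 := by
  simp [avg]

theorem avg_bits (k : ℕ) (f : Bits k → ℝ) : avg f = ∑ u, ((2 : ℝ) ^ k)⁻¹ * f u := by
  rw [avg, ← Finset.mul_sum, div_eq_inv_mul]
  simp

/-! ### Addresses in the memory -/

/-- The memory cell with address `k`. -/
def addr (M k : ℕ) : Fin (M + 1) := ⟨min k M, by omega⟩

theorem val_addr {M k : ℕ} (h : k ≤ M) : (addr M k).val = k := Nat.min_eq_left h

theorem addr_inj {M k l : ℕ} (hk : k ≤ M) (hl : l ≤ M) : addr M k = addr M l ↔ k = l := by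
  rw [Fin.ext_iff, val_addr hk, val_addr hl]

@[fun_prop]
theorem PolyFun.min {α : Type} [Enc α] {f g : α → ℕ} (hf : PolyFun f) (hg : PolyFun g) :
    PolyFun fun a => min (f a) (g a) :=
  (hf.sub (hf.sub hg)).congr fun a => by omega

@[fun_prop]
theorem PolyFun.instrDescr {α : Type} [Enc α] {f : α → List ℕ × List ℕ × List ℕ} (hf : PolyFun f) :
    PolyFun fun a => instrDescr (f a) := by
  unfold QCCA.instrDescr
  fun_prop

section Nots

variable {V W : Type} [Fintype V] [DecidableEq V] [Fintype W] [DecidableEq W]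
variable {ℓ c R : ℕ} (E : Bits R → Bits ℓ → Bits c) (D : Bits c → Bits ℓ)

theorem run_nots_inject (e : V ↪ W) (z : W → Bool) (l : List W) (hl : l.Nodup)
    (he : ∀ v, e v ∉ l) (χ : W → Bool) (hχ : ∀ w, χ w = true ↔ w ∈ l) (σ : Op V) :
    run E D (l.map .not) (inject e z σ) = inject e (fun w => z w ^^ χ w) σ := by
  obtain rfl : χ = fun w => decide (w ∈ l) := by
    funext w
    rw [Bool.eq_iff_iff, hχ, decide_eq_true_iff]
  clear hχ
  induction l generalizing z with
  | nil => simp [run]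
  | cons i l ih =>
    rw [List.nodup_cons] at hl
    change run E D (l.map .not) (run E D [.not i] (inject e z σ)) = _
    rw [run_not_inject E D e z i fun v h => he v (by simp [h]),
      ih _ hl.2 fun v h => he v (by simp [h])]
    congr 1
    funext w
    by_cases hw : w = i
    · subst hw; simp [hl.1]
    · simp [hw]

end Nots

/-- Replaces the fold by the equations of the gates, from which the small circuits of `pairTemplate`
are evaluated by hand. -/
theorem BoolCircuit.exists_wires {a g b : ℕ} (K : BoolCircuit a g b) (x : Bits a) :
    ∃ s : Bits (a + (g + b)), (∀ j, s (Fin.castAdd (g + b) j) = x j) ∧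
      (∀ t, s (Fin.natAdd a t) = !decide (∀ j, j < Fin.natAdd a t → K (t, j) = true → s j = true)) ∧
      ∀ i, K.eval x i = s (Fin.natAdd a (Fin.natAdd g i)) := by
  obtain ⟨h₁, h₂⟩ := foldl_boolCircuit_step K (List.finRange (g + b))
    (List.pairwise_lt_finRange _) (Fin.append x fun _ => false)
  refine ⟨_, fun j => ?_, fun t => h₁ t (by simp), fun i => rfl⟩
  rw [h₂ _ fun t _ h => ?_, Fin.append_left]
  have := congrArg Fin.val h
  simp at this
  omega

/-! ### A semantic security adversary from an indistinguishability adversary -/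

/-- The format of templates for a choice between two messages. -/
abbrev pairFormat (ℓ : ℕ) : TemplateFormat := ⟨1, 0, ℓ, 1, 0, 0⟩

/-- The template that samples one of two messages and asks for its complement. -/
def pairTemplate {ℓ : ℕ} (t : Fin ℓ ⊕ Fin ℓ → Bool) : Template (pairFormat ℓ) ℓ
  | .inl (.inl (p, q)) =>
    if h : p.val = 0 then decide (q.val = 0) else
      if q.val = 0 then t (.inl ⟨p.val - 1, by have := p.isLt; simp only at this; omega⟩) else
        if q.val = 1 then t (.inr ⟨p.val - 1, by have := p.isLt; simp only at this; omega⟩)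
        else false
  | .inl (.inr _) => false
  | .inr (p, q) => decide (p.val = q.val)

/-- One of the two messages in `t`. -/
def choose {ℓ : ℕ} (t : Fin ℓ ⊕ Fin ℓ → Bool) (b : Bool) : Bits ℓ :=
  if b then t ∘ Sum.inr else t ∘ Sum.inl

/-- Wire 0 is the coin and wire 1, the internal gate, its negation. The output gate `i` reads wire 0
if bit `i` of the left message is set and wire 1 if bit `i` of the right one is; its NAND is `(left
∧ ¬u) ∨ (right ∧ u)`, a multiplexer. -/
theorem samp_pairTemplate {ℓ : ℕ} (t : Fin ℓ ⊕ Fin ℓ → Bool) (u : Bits 1) :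
    (pairTemplate t).samp u = choose t (u 0) := by
  obtain ⟨s, h₁, h₂, h₃⟩ := BoolCircuit.exists_wires (a := 1) (g := 1) (b := ℓ)
    (fun i => pairTemplate t (Sum.inl (Sum.inl i))) u
  funext i
  refine (h₃ i).trans ?_
  have e₀ : s ⟨0, by omega⟩ = u 0 := h₁ 0
  have e₁ : s ⟨1, by omega⟩ = !u 0 := by
    refine (h₂ ⟨0, by omega⟩).trans ?_
    congr 1
    rw [Bool.eq_iff_iff, decide_eq_true_iff]
    constructor
    · intro h
      rw [← e₀]
      exact h ⟨0, by omega⟩ (by simp [Fin.lt_def]) (by simp [pairTemplate])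
    · rintro h ⟨j, hj⟩ hj' -
      obtain rfl : j = 0 := by simpa [Fin.lt_def] using hj'
      rw [e₀, h]
  rw [h₂]
  have key : (∀ j, j < Fin.natAdd 1 (Fin.natAdd 1 i) →
      pairTemplate t (Sum.inl (Sum.inl (Fin.natAdd 1 i, j))) = true → s j = true) ↔
      (t (.inl i) = true → u 0 = true) ∧ (t (.inr i) = true → (!u 0) = true) := by
    have hp0 : pairTemplate t (Sum.inl (Sum.inl (Fin.natAdd 1 i, ⟨0, by simp⟩))) = t (.inl i) := by
      simp [pairTemplate]
    have hp1 : pairTemplate t (Sum.inl (Sum.inl (Fin.natAdd 1 i, ⟨1, by simp⟩))) = t (.inr i) := by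
      simp [pairTemplate]
    constructor
    · intro h
      rw [← e₁, ← e₀, ← hp0, ← hp1]
      exact ⟨h _ (by simp [Fin.lt_def]), h _ (by simp [Fin.lt_def])⟩
    · rintro ⟨ha, hb⟩ ⟨j, hj⟩ - hK
      rcases j with _ | _ | j
      · rw [e₀]; exact ha (hp0 ▸ hK)
      · rw [e₁]; exact hb (hp1 ▸ hK)
      · simp [pairTemplate] at hK
  simp only [key, choose]
  cases u 0 <;> cases h : t (.inl i) <;> cases h' : t (.inr i) <;> simp [h, h']

/-- A NAND gate with one selected input negates it. Being injective, the complement identifies the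
message as well as the identity would, with a single layer of gates. -/
theorem f_pairTemplate {ℓ : ℕ} (t : Fin ℓ ⊕ Fin ℓ → Bool) (m : Bits ℓ) :
    (pairTemplate t).f m = fun i => !m i := by
  obtain ⟨s, h₁, h₂, h₃⟩ := BoolCircuit.exists_wires (a := ℓ) (g := 0) (b := ℓ)
    (fun i => pairTemplate t (Sum.inr i)) m
  funext i
  refine (h₃ i).trans ((h₂ _).trans ?_)
  congr 1
  rw [Bool.eq_iff_iff, decide_eq_true_iff]
  constructor
  · intro h
    rw [← h₁]
    exact h _ (Fin.lt_def.2 (by simp only [Fin.val_castAdd, Fin.val_natAdd]; omega))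
      (by simp [pairTemplate])
  · rintro h j - hK
    have : j = Fin.castAdd (0 + ℓ) i := by
      simp only [pairTemplate, decide_eq_true_eq] at hK
      ext
      simpa using hK.symm
    rw [this, h₁, h]

namespace SemOfInd

variable {ℓ c : ℕ}

/-- The largest address. -/
abbrev top (ℓ mem : ℕ) : ℕ := mem + 7 * ℓ + 10

/-- The position in the template that holds bit `i` of message `b`. -/
def pos (ℓ : ℕ) (b : Bool) (i : ℕ) : (pairFormat ℓ).Idx ℓ :=
  .inl (.inl (⟨min (1 + i) ℓ, by dsimp only; omega⟩, ⟨b.toNat, by cases b <;> simp⟩))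

/-- The position in the template that makes `f` read bit `i`. -/
def fpos {ℓ : ℕ} (i : Fin ℓ) : (pairFormat ℓ).Idx ℓ := .inr (⟨i, by simp⟩, ⟨i, by simp; omega⟩)

/-- The position in the template that makes the sampler read its coin. -/
def spos (ℓ : ℕ) : (pairFormat ℓ).Idx ℓ := .inl (.inl (⟨0, by simp⟩, ⟨0, by simp⟩))

/-- The program that copies two messages of length `ℓ`. -/
def copyProg {W : Type} (zero : W) (src tgt : Bool → ℕ → W) (ℓ : ℕ) : List (W × W × W) :=
  (List.range ℓ).flatMap fun i =>
    [(src false i, zero, tgt false i), (src true i, zero, tgt true i)]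

/-- The program that computes the complement of one of two messages, depending on the wire `b`. -/
def selectProg {W : Type} (one b nb : W) (m : Bool → ℕ → W) (w : ℕ → ℕ → W) (ℓ : ℕ) :
    List (W × W × W) :=
  [(one, b, nb)] ++ (List.range ℓ).flatMap fun i =>
    [(b, m true i, w i 0), (nb, m false i, w i 1), (one, w i 0, w i 2), (w i 2, w i 1, w i 3),
      (one, w i 3, w i 4)]

theorem map_copyProg {V W : Type} (f : V → W) (zero : V) (src tgt : Bool → ℕ → V) (ℓ : ℕ) :
    (copyProg zero src tgt ℓ).map (mapInstr f) =
      copyProg (f zero) (fun b i => f (src b i)) (fun b i => f (tgt b i)) ℓ := by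
  simp [copyProg, List.map_flatMap, mapInstr]

theorem map_selectProg {V W : Type} (f : V → W) (one b nb : V) (m : Bool → ℕ → V)
    (w : ℕ → ℕ → V) (ℓ : ℕ) :
    (selectProg one b nb m w ℓ).map (mapInstr f) =
      selectProg (f one) (f b) (f nb) (fun b i => f (m b i)) (fun i j => f (w i j)) ℓ := by
  simp [selectProg, List.map_flatMap, mapInstr]

variable (A : TwoStage ℓ c (Fin ℓ ⊕ Fin ℓ) (Fin c) 1)

/-- The address of bit `i` of the copy of message `b`. -/
abbrev copyAddr (mem : ℕ) (b : Bool) (i : ℕ) : ℕ := mem + 3 + 2 * i + b.toNat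

/-- The addresses of the selection program. -/
abbrev selAddr (ℓ mem i j : ℕ) : ℕ := mem + 4 + 2 * ℓ + 5 * i + j

/-- The wires of the first stage. -/
def preEmb : (Fin ℓ ⊕ Fin ℓ) ⊕ Fin A.mem ↪ (pairFormat ℓ).Idx ℓ ⊕ Fin (top ℓ A.mem + 1) where
  toFun := Sum.elim (Sum.elim (fun i => .inl (pos ℓ false i)) fun i => .inl (pos ℓ true i))
    fun i => .inr (addr _ i)
  inj' := by
    rintro ((i | i) | i) ((j | j) | j) h
    all_goals
      have := i.isLt
      have := j.isLt
      simp [pos, addr, Fin.ext_iff] at h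
    all_goals
      simp only [Sum.inl.injEq, Sum.inr.injEq, Fin.ext_iff]
      have htop : top ℓ A.mem = A.mem + 7 * ℓ + 10 := rfl
      omega

/-- The wires of the second stage. -/
def postEmb : (Fin A.mem ⊕ Fin c) ⊕ Fin A.anc ↪
    (Fin (top ℓ A.mem + 1) ⊕ (Fin 0 ⊕ Fin c)) ⊕ Fin A.anc where
  toFun := Sum.elim (Sum.elim (fun i => .inl (.inl (addr _ i))) fun i => .inl (.inr (.inr i))) .inr
  inj' := by
    rintro ((i | i) | i) ((j | j) | j) h
    all_goals
      have := i.isLt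
      have := j.isLt
      simp [addr, Fin.ext_iff] at h
    all_goals
      simp only [Sum.inl.injEq, Sum.inr.injEq, Fin.ext_iff]
      have htop : top ℓ A.mem = A.mem + 7 * ℓ + 10 := rfl
      omega

/-- The wires that are flipped in the first stage. -/
def flips : List ((pairFormat ℓ).Idx ℓ ⊕ Fin (top ℓ A.mem + 1)) :=
  [.inl (spos ℓ)] ++ ((List.finRange ℓ).map fun i => .inl (fpos i)) ++ [.inr (addr _ (A.mem + 1))]

/-- The program at the end of the first stage. -/
def preProg : List (((pairFormat ℓ).Idx ℓ ⊕ Fin (top ℓ A.mem + 1)) ×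
    ((pairFormat ℓ).Idx ℓ ⊕ Fin (top ℓ A.mem + 1)) ×
    ((pairFormat ℓ).Idx ℓ ⊕ Fin (top ℓ A.mem + 1))) :=
  copyProg (.inr (addr _ (A.mem + 2))) (fun b i => .inl (pos ℓ b i))
    (fun b i => .inr (addr _ (copyAddr A.mem b i))) ℓ

/-- A memory cell in the second stage. -/
abbrev cell (k : ℕ) : (Fin (top ℓ A.mem + 1) ⊕ (Fin 0 ⊕ Fin c)) ⊕ Fin A.anc :=
  .inl (.inl (addr _ k))

/-- The program at the end of the second stage. -/
def postProg : List (((Fin (top ℓ A.mem + 1) ⊕ (Fin 0 ⊕ Fin c)) ⊕ Fin A.anc) ×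
    ((Fin (top ℓ A.mem + 1) ⊕ (Fin 0 ⊕ Fin c)) ⊕ Fin A.anc) ×
    ((Fin (top ℓ A.mem + 1) ⊕ (Fin 0 ⊕ Fin c)) ⊕ Fin A.anc)) :=
  selectProg (cell A (A.mem + 1)) (postEmb A (A.out 0)) (cell A (A.mem + 3 + 2 * ℓ))
    (fun b i => cell A (copyAddr A.mem b i)) (fun i j => cell A (selAddr ℓ A.mem i j)) ℓ

/-- The positions of the two messages. -/
def measured : List ((pairFormat ℓ).Idx ℓ ⊕ Fin (top ℓ A.mem + 1)) :=
  ((List.range ℓ).map fun i => .inl (pos ℓ false i)) ++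
    (List.range ℓ).map fun i => .inl (pos ℓ true i)

/-- The semantic security adversary that runs `A` and outputs the complement of the message
that `A` points to. -/
abbrev adversary : TwoStage ℓ c ((pairFormat ℓ).Idx ℓ) (Fin (pairFormat ℓ).hLen ⊕ Fin c)
    (pairFormat ℓ).fLen where
  mem := top ℓ A.mem + 1
  anc := A.anc
  -- The messages are measured before the rest is done, so that the stage ends in a mixture over
  -- them; copies are kept in the memory, because the second stage has to output one of them.
  pre := A.pre.map (Gate.map (preEmb A)) ++ measureAll (measured A) ++ (flips A).map .not ++
    (preProg A).flatMap andNot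
  post := A.post.map (Gate.map (postEmb A)) ++ (postProg A).flatMap andNot
  out := ⟨fun i => cell A (selAddr ℓ A.mem i 4), fun i j h => by
    have := i.isLt
    have := j.isLt
    simp [addr, Fin.ext_iff] at *
    omega⟩
  post_noDecrypt g hg := by
    rcases List.mem_append.1 hg with h | h
    · obtain ⟨g', h', rfl⟩ := List.mem_map.1 h
      rw [Gate.map_isDecrypt]
      exact A.post_noDecrypt g' h'
    · obtain ⟨τ, -, h'⟩ := List.mem_flatMap.1 h
      exact andNot_noDecrypt τ g h'

/-- Layout of the memory: `A` uses the addresses below `A.mem`; the constants true and false are at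
`A.mem + 1` and `A.mem + 2`; then come the interleaved copies of the two messages, the negated
guess, and five cells for each message bit. With template wires ranked `A.mem`, the lower bound
`A.mem` on ranks says that the memory of `A` is not used. -/
theorem straight_preProg : Straight (Sum.elim (fun _ => A.mem) Fin.val) A.mem (A.mem + 3)
    (A.mem + 3 + 2 * ℓ) (preProg A) := by
  have := Straight.flatMap_range (rk := Sum.elim (fun _ => A.mem) Fin.val) (L := A.mem)
    (f := fun i => [((.inl (pos ℓ false i) : (pairFormat ℓ).Idx ℓ ⊕ Fin (top ℓ A.mem + 1)),
      .inr (addr _ (A.mem + 2)), .inr (addr _ (copyAddr A.mem false i))),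
      (.inl (pos ℓ true i), .inr (addr _ (A.mem + 2)), .inr (addr _ (copyAddr A.mem true i)))])
    (fun i => A.mem + 3 + 2 * i) ℓ fun i hi => ?_
  · simpa [preProg, copyProg] using this
  · refine Straight.append (P := [_]) (mid := A.mem + 3 + 2 * i + 1)
      (Straight.singleton ?_) (Straight.singleton ?_)
    all_goals
      have htop : top ℓ A.mem = A.mem + 7 * ℓ + 10 := rfl
      simp [addr, copyAddr]
      omega

/-- The rank of a wire in the second stage. -/
def postRank : (Fin (top ℓ A.mem + 1) ⊕ (Fin 0 ⊕ Fin c)) ⊕ Fin A.anc → ℕ :=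
  Sum.elim (Sum.elim (fun i => i.val + 1) fun _ => 0) fun _ => 0

theorem postRank_cell {k : ℕ} (hk : k ≤ top ℓ A.mem) : postRank A (cell A k) = k + 1 := by
  simp [postRank, val_addr hk]

/-- Cells are ranked by their address plus one, and all other wires by zero. Wherever the output
wire of `A` lies, it thus ranks below the constants and the copies. -/
theorem postRank_postEmb (x) : postRank A (postEmb A x) ≤ A.mem := by
  rcases x with (i | i) | i
  · have h : postRank A (postEmb A (.inl (.inl i))) = (addr (top ℓ A.mem) i).val + 1 := rfl
    have := i.isLt
    rw [h, val_addr (by simp only [top]; omega)]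
    omega
  · exact Nat.zero_le _
  · exact Nat.zero_le _

theorem straight_postProg : Straight (postRank A) 0 (A.mem + 4 + 2 * ℓ) (top ℓ A.mem + 1)
    (postProg A) := by
  have htop : top ℓ A.mem = A.mem + 7 * ℓ + 10 := rfl
  have hb := postRank_postEmb A (A.out 0)
  have h := Straight.flatMap_range (rk := postRank A) (L := 0)
    (f := fun i => [(postEmb A (A.out 0), cell A (copyAddr A.mem true i),
      cell A (selAddr ℓ A.mem i 0)), (cell A (A.mem + 3 + 2 * ℓ), cell A (copyAddr A.mem false i),
      cell A (selAddr ℓ A.mem i 1)), (cell A (A.mem + 1), cell A (selAddr ℓ A.mem i 0),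
      cell A (selAddr ℓ A.mem i 2)), (cell A (selAddr ℓ A.mem i 2), cell A (selAddr ℓ A.mem i 1),
      cell A (selAddr ℓ A.mem i 3)), (cell A (A.mem + 1), cell A (selAddr ℓ A.mem i 3),
      cell A (selAddr ℓ A.mem i 4))])
    (fun i => A.mem + 5 + 2 * ℓ + 5 * i) ℓ fun i hi => ?_
  · refine Straight.append (mid := A.mem + 5 + 2 * ℓ + 5 * 0) (Straight.singleton ?_)
      (h.mono le_rfl (by omega))
    dsimp only
    rw [postRank_cell A (by omega), postRank_cell A (by omega)]
    omega
  · refine Straight.append (P := [_]) (mid := A.mem + 5 + 2 * ℓ + 5 * i + 1)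
      (Straight.singleton ?_) (Straight.append (P := [_]) (mid := A.mem + 5 + 2 * ℓ + 5 * i + 2)
      (Straight.singleton ?_) (Straight.append (P := [_]) (mid := A.mem + 5 + 2 * ℓ + 5 * i + 3)
      (Straight.singleton ?_) (Straight.append (P := [_]) (mid := A.mem + 5 + 2 * ℓ + 5 * i + 4)
      (Straight.singleton ?_) (Straight.singleton ?_))))
    all_goals
      dsimp only
      simp only [copyAddr, selAddr, Bool.toNat_true, Bool.toNat_false]
      repeat rw [postRank_cell A (by omega)]
      omega

end SemOfInd

/-! ### The winning probability of the semantic security adversary -/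

namespace SemOfInd

section Semantics

variable {ℓ c R : ℕ} (A : TwoStage ℓ c (Fin ℓ ⊕ Fin ℓ) (Fin c) 1)
variable (E : Bits R → Bits ℓ → Bits c) (D : Bits c → Bits ℓ)

/-- The embedding of the memory of `A`. -/
def memEmb : Fin A.mem ↪ Fin (top ℓ A.mem + 1) :=
  ⟨fun i => addr _ i, fun i j h => by
    have := i.isLt
    have := j.isLt
    have htop : top ℓ A.mem = A.mem + 7 * ℓ + 10 := rfl
    rw [addr_inj (by omega) (by omega)] at h
    exact Fin.ext h⟩

open Classical in
/-- The wires outside of the memory of `A` after the flips. -/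
def flipped (t : Fin ℓ ⊕ Fin ℓ → Bool) : (pairFormat ℓ).Idx ℓ ⊕ Fin (top ℓ A.mem + 1) → Bool :=
  fun w => put (Function.Embedding.inl.trans (preEmb A)) (fun _ => false) t w ^^
    decide (w ∈ flips A)

/-- The wires outside of the memory of `A` after the first stage. -/
def final (t : Fin ℓ ⊕ Fin ℓ → Bool) : (pairFormat ℓ).Idx ℓ ⊕ Fin (top ℓ A.mem + 1) → Bool :=
  evalProg (preProg A) (flipped A t)

theorem inr_mem_flips {k : ℕ} (hk : k ≤ top ℓ A.mem) :
    .inr (addr _ k) ∈ flips A ↔ k = A.mem + 1 := by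
  have htop : top ℓ A.mem = A.mem + 7 * ℓ + 10 := rfl
  simp [flips, addr_inj hk (show A.mem + 1 ≤ top ℓ A.mem by omega)]

theorem nodup_flips : (flips A).Nodup := by
  refine List.nodup_append.2 ⟨List.nodup_append.2 ⟨by simp, ?_, ?_⟩, by simp, ?_⟩
  · refine (List.nodup_finRange ℓ).map fun i j h => ?_
    simpa [fpos, Fin.ext_iff] using h
  · simp [spos, fpos]
  · simp

/-- After the measurement, a mixture over the messages `t` remains. The flips and the copying
concern only wires in basis states, so in each component they merely change this basis state, and
the memory of `A` keeps its conditional state. -/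
theorem run_pre : run E D (adversary A).pre (ket fun _ => false) =
    ∑ t, ((1 : ℝ) : ℂ) • inject ((memEmb A).trans Function.Embedding.inr) (final A t)
      (A.firstStage E D t) := by
  have htop : top ℓ A.mem = A.mem + 7 * ℓ + 10 := rfl
  have he : Function.Embedding.inr.trans (preEmb A) =
    (memEmb A).trans Function.Embedding.inr := rfl
  change run E D (A.pre.map (Gate.map (preEmb A)) ++ measureAll (measured A) ++
    (flips A).map .not ++ (preProg A).flatMap andNot) _ = _
  rw [run_append, run_append, A.run_pre_measure E D, run_sum, run_sum]
  · refine Finset.sum_congr rfl fun t _ => ?_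
    rw [run_nots_inject E D _ _ _ (nodup_flips A) ?_ (fun w => @decide (w ∈ flips A)
      (Classical.propDecidable _)) (fun w => by simp), run_prog E D (straight_preProg A).ne, he,
      Complex.ofReal_one, one_smul]
    · refine conj_basisMap_inject (fun p => ?_) _
      refine evalProg_put _ _ _ fun τ hτ i => ?_
      have h := (straight_preProg A).wires τ hτ
      have hi : Sum.elim (fun _ => A.mem) Fin.val
          (((memEmb A).trans Function.Embedding.inr) i : (pairFormat ℓ).Idx ℓ ⊕ _) < A.mem := by
        change (addr (top ℓ A.mem) i).val < A.mem
        have := i.isLt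
        rw [val_addr (by omega)]
        exact this
      refine ⟨?_, ?_, ?_⟩ <;> intro h' <;> rw [h'] at hi <;> omega
    · intro i h
      have := i.isLt
      rw [he] at h
      have := (inr_mem_flips A (show i.val ≤ top ℓ A.mem by omega)).1 h
      omega
  · rintro (i | i)
    · exact List.mem_append_left _ (List.mem_map.2 ⟨i, by simp, rfl⟩)
    · exact List.mem_append_right _ (List.mem_map.2 ⟨i, by simp, rfl⟩)
  · intro i h
    rcases List.mem_append.1 h with h | h <;> obtain ⟨a, -, h⟩ := List.mem_map.1 h <;>
      exact Sum.inl_ne_inr h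

theorem put_inr (t : Fin ℓ ⊕ Fin ℓ → Bool) (k) :
    put (Function.Embedding.inl.trans (preEmb A)) (fun _ => false) t (.inr k) = false := by
  refine put_of_forall_ne ?_
  rintro (i | i) h <;> exact Sum.inl_ne_inr h

theorem put_pos (t : Fin ℓ ⊕ Fin ℓ → Bool) (b : Bool) (i : Fin ℓ) :
    put (Function.Embedding.inl.trans (preEmb A)) (fun _ => false) t (.inl (pos ℓ b i)) =
      choose t b i := by
  cases b
  · exact put_apply (Function.Embedding.inl.trans (preEmb A)) _ t (.inl i)
  · exact put_apply (Function.Embedding.inl.trans (preEmb A)) _ t (.inr i)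

theorem put_of_ne_pos (t : Fin ℓ ⊕ Fin ℓ → Bool) {x : (pairFormat ℓ).Idx ℓ}
    (h : ∀ (b : Bool) (i : Fin ℓ), pos ℓ b i ≠ x) :
    put (Function.Embedding.inl.trans (preEmb A)) (fun _ => false) t (.inl x) = false := by
  refine put_of_forall_ne ?_
  rintro (i | i) h'
  · exact h false i (Sum.inl_injective h')
  · exact h true i (Sum.inl_injective h')

/-- The register of the template holds `pairTemplate t`: the entries that depend on the messages are
the wires on which `A` wrote them, the remaining ones are constants set by the flips. -/
theorem flipped_inl (t : Fin ℓ ⊕ Fin ℓ → Bool) (x : (pairFormat ℓ).Idx ℓ) :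
    flipped A t (.inl x) = pairTemplate t x := by
  rcases x with (⟨⟨p, hp⟩, ⟨q, hq⟩⟩ | ⟨⟨p, hp⟩, q⟩) | ⟨⟨p, hp⟩, ⟨q, hq⟩⟩
  · rcases p with _ | p
    · rw [flipped, put_of_ne_pos]
      · simp [flips, spos, fpos, pairTemplate]
      · intro b i h
        have := i.isLt
        simp [pos, Fin.ext_iff] at h
        omega
    · have hp' : p < ℓ := by simp only at hp; omega
      have hnot : Sum.inl (Sum.inl (Sum.inl (⟨p + 1, hp⟩, ⟨q, hq⟩))) ∉ flips A := by
        simp [flips, spos, fpos]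
      rw [flipped, @decide_eq_false _ (Classical.propDecidable _) hnot, Bool.xor_false]
      rcases q with _ | _ | q
      · have h : (.inl (.inl (⟨p + 1, hp⟩, ⟨0, hq⟩)) : (pairFormat ℓ).Idx ℓ) =
            pos ℓ false (⟨p, hp'⟩ : Fin ℓ) := by
          simp [pos]; omega
        rw [h, put_pos, ← h]
        simp [choose, pairTemplate]
      · have h : (.inl (.inl (⟨p + 1, hp⟩, ⟨1, hq⟩)) : (pairFormat ℓ).Idx ℓ) =
            pos ℓ true (⟨p, hp'⟩ : Fin ℓ) := by
          simp [pos]; omega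
        rw [h, put_pos, ← h]
        simp [choose, pairTemplate]
      · rw [put_of_ne_pos]
        · simp [pairTemplate]
        · intro b i h
          simp [pos, Fin.ext_iff] at h
          cases b <;> simp at h
  · simp at hp
  · rw [flipped, put_of_ne_pos _ _ fun b i h => by simp [pos] at h, Bool.false_xor]
    have hp' : p < ℓ := by simp only at hp; omega
    simp only [flips, spos, pairTemplate]
    congr 1
    simp only [fpos, List.mem_append, List.mem_cons, List.not_mem_nil, List.mem_map,
      List.mem_finRange, true_and, or_false, reduceCtorEq, Sum.inl.injEq, Sum.inr.injEq,
      Prod.mk.injEq, Fin.mk.injEq, false_or, eq_iff_iff]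
    constructor
    · rintro ⟨i, h, h'⟩; omega
    · rintro rfl; exact ⟨⟨p, hp'⟩, rfl, rfl⟩

theorem flipped_addr (t : Fin ℓ ⊕ Fin ℓ → Bool) {k : ℕ} (hk : k ≤ top ℓ A.mem) :
    flipped A t (.inr (addr _ k)) = decide (k = A.mem + 1) := by
  rw [flipped, put_inr, Bool.false_xor]
  simp [inr_mem_flips A hk]

theorem final_spec (t : Fin ℓ ⊕ Fin ℓ → Bool) :
    final A t ∘ Sum.inl = pairTemplate t ∧ final A t (.inr (addr _ (A.mem + 1))) = true ∧
      (∀ b (i : Fin ℓ), final A t (.inr (addr _ (copyAddr A.mem b i))) = choose t b i) ∧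
      ∀ k, A.mem + 3 + 2 * ℓ ≤ k → k ≤ top ℓ A.mem → final A t (.inr (addr _ k)) = false := by
  have htop : top ℓ A.mem = A.mem + 7 * ℓ + 10 := rfl
  have hS := straight_preProg A
  obtain ⟨h₁, h₂⟩ := hS.evalProg (z := flipped A t) fun w h h' => by
    rcases w with x | ⟨k, hk⟩
    · simp at h
    · have := flipped_addr A t (show k ≤ top ℓ A.mem by omega)
      simp only [addr, Nat.min_eq_left (show k ≤ top ℓ A.mem by omega)] at this
      rw [this]
      simp at h
      simp
      omega
  have h₃ (w) (hw : Sum.elim (fun _ => A.mem) Fin.val w < A.mem + 3 ∨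
      A.mem + 3 + 2 * ℓ ≤ Sum.elim (fun _ => A.mem) Fin.val w) :
      final A t w = flipped A t w := by
    refine h₂ w fun τ hτ h => ?_
    have := hS.wires τ hτ
    rw [h] at this
    omega
  have h₄ (k) (hk : k ≤ top ℓ A.mem) (hw : k < A.mem + 3 ∨ A.mem + 3 + 2 * ℓ ≤ k) :
      final A t (.inr (addr _ k)) = decide (k = A.mem + 1) := by
    rw [h₃, flipped_addr A t hk]
    simp only [Sum.elim_inr, val_addr hk]
    exact hw
  have h₅ (x) : final A t (.inl x) = pairTemplate t x := by
    rw [h₃, flipped_inl]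
    simp
  refine ⟨funext h₅, ?_, fun b i => ?_, fun k hk hk' => ?_⟩
  · rw [h₄ _ (by omega) (by omega)]; simp
  -- A copy is the instruction `source ∧ ¬0` with a fresh target.
  · have e : final A t (.inr (addr _ (copyAddr A.mem b i))) =
        (final A t (.inl (pos ℓ b i)) && !final A t (.inr (addr _ (A.mem + 2)))) := by
      refine h₁ (.inl (pos ℓ b i), .inr (addr _ (A.mem + 2)),
        .inr (addr _ (copyAddr A.mem b i))) ?_
      simp only [preProg, copyProg, List.mem_flatMap, List.mem_range]
      exact ⟨i, i.isLt, by cases b <;> simp⟩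
    rw [e, h₄ _ (by omega) (by omega)]
    have := flipped_inl A t (pos ℓ b i)
    have hnot : Sum.inl (pos ℓ b i) ∉ flips A := by
      have := i.isLt
      simp [flips, spos, fpos, pos]
      omega
    rw [flipped, put_pos, @decide_eq_false _ (Classical.propDecidable _) hnot, Bool.xor_false] at this
    rw [h₅, ← this]
    simp
  · rw [h₄ k hk' (by omega)]
    simp
    omega

/-- The answer is the complement of the message selected by the guess of `A`. It is correct iff this
message equals the encrypted one, which also happens for a wrong guess when the two messages agree.
-/
theorem secondProb_adversary (t : Fin ℓ ⊕ Fin ℓ → Bool) (u : Bool) (v : Bits c)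
    (v' : Bits 0) (σ : Op (Fin A.mem)) :
    (adversary A).secondProb E D (inject (memEmb A) (final A t ∘ Sum.inr) σ) (Sum.elim v' v)
        (fun i => !choose t u i) =
      ∑ s : Bits 1, if choose t (s 0) = choose t u then A.secondProb E D σ v s else 0 := by
  have htop : top ℓ A.mem = A.mem + 7 * ℓ + 10 := rfl
  obtain ⟨-, hone, hcopy, hzero⟩ := final_spec A t
  have hS := straight_postProg A
  refine TwoStage.secondProb_prog E D A (adversary A) (memEmb A) (postEmb A) _ v _
    (fun i => rfl) (fun i => rfl) (fun i => rfl) hS.ne rfl _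
    (fun s => choose t (s 0) = choose t u) (fun y hy => ?_) σ
  -- The second stage of `A` leaves these cells alone, since they rank above all wires of `A`.
  have hcell (k) (hk : A.mem ≤ k) (hk' : k ≤ top ℓ A.mem) :
      y (cell A k) = final A t (.inr (addr _ k)) := by
    refine hy _ fun x h => ?_
    have h₁ := postRank_postEmb A x
    rw [h, postRank_cell A hk'] at h₁
    omega
  obtain ⟨h₁, h₂⟩ := hS.evalProg (z := y) fun w h h' => by
    rcases w with (⟨k, hk⟩ | i) | i
    · have : cell A k = .inl (.inl ⟨k, hk⟩) := by
        simp only [cell, addr, Nat.min_eq_left (show k ≤ top ℓ A.mem by omega)]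
      simp only [postRank, Sum.elim_inl] at h
      rw [← this, hcell k (by omega) (by omega), hzero k (by omega) (by omega)]
    · simp [postRank] at h
    · simp [postRank] at h
  set y' := evalProg (postProg A) y with hy'
  have h₃ (w) (hw : postRank A w < A.mem + 4 + 2 * ℓ) : y' w = y w := by
    refine h₂ w fun τ hτ h => ?_
    have := hS.wires τ hτ
    rw [h] at this
    omega
  have e₁ : y' (cell A (A.mem + 1)) = true := by
    rw [h₃ _ (by rw [postRank_cell A (by omega)]; omega), hcell _ (by omega) (by omega), hone]
  have e₂ : y' (postEmb A (A.out 0)) = y (postEmb A (A.out 0)) :=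
    h₃ _ (by have := postRank_postEmb A (A.out 0); omega)
  have e₃ (b) (i : Fin ℓ) : y' (cell A (copyAddr A.mem b i)) = choose t b i := by
    have hb := Bool.toNat_le b
    have := i.isLt
    rw [h₃ _ (by rw [postRank_cell A (by dsimp only [copyAddr]; omega)]; dsimp only [copyAddr]; omega),
      hcell _ (by dsimp only [copyAddr]; omega) (by dsimp only [copyAddr]; omega), hcopy]
  have e₄ : y' (cell A (A.mem + 3 + 2 * ℓ)) = !y (postEmb A (A.out 0)) := by
    have := h₁ (cell A (A.mem + 1), postEmb A (A.out 0), cell A (A.mem + 3 + 2 * ℓ))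
      (by simp [postProg, selectProg])
    dsimp only at this
    rw [this, e₁, e₂, Bool.true_and]
  have hmem (i : Fin ℓ) (τ) (hτ : τ ∈ [(postEmb A (A.out 0), cell A (copyAddr A.mem true i),
      cell A (selAddr ℓ A.mem i 0)), (cell A (A.mem + 3 + 2 * ℓ), cell A (copyAddr A.mem false i),
      cell A (selAddr ℓ A.mem i 1)), (cell A (A.mem + 1), cell A (selAddr ℓ A.mem i 0),
      cell A (selAddr ℓ A.mem i 2)), (cell A (selAddr ℓ A.mem i 2), cell A (selAddr ℓ A.mem i 1),
      cell A (selAddr ℓ A.mem i 3)), (cell A (A.mem + 1), cell A (selAddr ℓ A.mem i 3),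
      cell A (selAddr ℓ A.mem i 4))]) : y' τ.2.2 = (y' τ.1 && !y' τ.2.1) := by
    refine h₁ τ ?_
    simp only [postProg, selectProg, List.mem_append, List.mem_flatMap, List.mem_range]
    exact Or.inr ⟨i, i.isLt, hτ⟩
  -- For the guess `b` the five cells hold `b ∧ ¬m₁`, `¬b ∧ ¬m₀`, the negation of the first, the
  -- conjunction of the negations of both, and its negation, the disjunction of both. The last one
  -- is the complement of the selected bit.
  have e₅ (i : Fin ℓ) : y' (cell A (selAddr ℓ A.mem i 4)) =
      !choose t (y (postEmb A (A.out 0))) i := by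
    have f₀ := hmem i (_, _, cell A (selAddr ℓ A.mem i 0)) (List.mem_cons_self ..)
    have f₁ := hmem i (_, _, cell A (selAddr ℓ A.mem i 1))
      (List.mem_cons_of_mem _ (List.mem_cons_self ..))
    have f₂ := hmem i (_, _, cell A (selAddr ℓ A.mem i 2))
      (List.mem_cons_of_mem _ (List.mem_cons_of_mem _ (List.mem_cons_self ..)))
    have f₃ := hmem i (_, _, cell A (selAddr ℓ A.mem i 3))
      (List.mem_cons_of_mem _ (List.mem_cons_of_mem _ (List.mem_cons_of_mem _
        (List.mem_cons_self ..))))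
    have f₄ := hmem i (_, _, cell A (selAddr ℓ A.mem i 4))
      (List.mem_cons_of_mem _ (List.mem_cons_of_mem _ (List.mem_cons_of_mem _
        (List.mem_cons_of_mem _ (List.mem_cons_self ..)))))
    dsimp only at f₀ f₁ f₂ f₃ f₄
    rw [f₄, f₃, f₂, f₁, f₀, e₁, e₂, e₃, e₃, e₄]
    cases y (postEmb A (A.out 0)) <;> simp
  change (fun i : Fin ℓ => y' (cell A (selAddr ℓ A.mem i 4))) = _ ↔ _
  rw [funext e₅]
  simp only [funext_iff, Bool.not_inj_iff]

/-- The expected success of the semantic security adversary. -/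
theorem sum_prob_adversary (u : Bits 1) (r : Bits R) :
    ∑ T : Template (pairFormat ℓ) ℓ, (adversary A).prob E D T
        (Sum.elim (T.h (T.samp u)) (E r (T.samp u))) (T.f (T.samp u)) =
      ∑ t, ∑ s : Bits 1, if choose t (s 0) = choose t (u 0) then
        A.prob E D t (E r (choose t (u 0))) s else 0 := by
  rw [TwoStage.sum_prob_of_run E D (adversary A) (run_pre A E D)
    (fun T => Sum.elim (Template.h T (Template.samp T u)) (E r (Template.samp T u)))
    (fun T => Template.f T (Template.samp T u))]
  refine Finset.sum_congr rfl fun t _ => ?_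
  rw [(final_spec A t).1, samp_pairTemplate, f_pairTemplate, one_mul, secondProb_adversary]
  rfl

/-- As `κ` is arbitrary, this determines the distribution of the template: it is the image under
`pairTemplate` of that of the messages of `A`. -/
theorem sum_firstProb_adversary (κ : Template (pairFormat ℓ) ℓ → ℝ) :
    ∑ T, κ T * (adversary A).firstProb E D T =
      ∑ t, κ (pairTemplate t) * A.firstProb E D t := by
  rw [TwoStage.sum_firstProb_of_run E D (adversary A) (run_pre A E D) κ]
  refine Finset.sum_congr rfl fun t _ => ?_
  rw [(final_spec A t).1, one_mul]
  rfl

end Semantics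

end SemOfInd

/-! ### Uniformity of the semantic security adversary -/

theorem describe_measureAll {ℓ c : ℕ} {W : Type} [WireName W] (l : List W) :
    (measureAll (ℓ := ℓ) (c := c) l).flatMap Gate.describe =
      l.flatMap fun w => 6 :: WireName.name w := by
  simp [measureAll, List.flatMap_map, Gate.describe]

theorem describe_nots {ℓ c : ℕ} {W : Type} [WireName W] (l : List W) :
    (l.map (Gate.not (ℓ := ℓ) (c := c))).flatMap Gate.describe =
      l.flatMap fun w => 3 :: WireName.name w := by
  simp [List.flatMap_map, Gate.describe]

theorem ofFn_flatMap {β : Type} {n : ℕ} (f : Fin n → List β) (g : ℕ → List β)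
    (h : ∀ i : Fin n, f i = g i) : (List.finRange n).flatMap f = (List.range n).flatMap g := by
  rw [← List.map_coe_finRange_eq_range, List.flatMap_map]
  exact List.flatMap_congr fun i _ => h i

theorem wireList_eq {W : Type} [WireName W] {n : ℕ} (e : Fin n → W) (g : ℕ → List ℕ)
    (h : ∀ i : Fin n, WireName.name (e i) = g i) : wireList e = (List.range n).flatMap g := by
  rw [wireList, List.ofFn_eq_map, List.flatMap_map]
  exact ofFn_flatMap _ _ h

/-- Replace the wires in a list of tokens. -/
theorem PolyFun.retoken {α : Type} [Enc α] {l : α → List (ℕ × List ℕ)} (hl : PolyFun l)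
    {r : α → List ℕ → List ℕ} (hr : PolyFun fun p : α × List ℕ => r p.1 p.2) :
    PolyFun fun a => (l a).flatMap fun τ => if τ.1 = 0 then r a τ.2 else [τ.1] := by
  refine hl.flatMap (f := fun a τ => if τ.1 = 0 then r a τ.2 else [τ.1])
    (PolyFun.ite (c := fun p : α × ℕ × List ℕ => p.2.1 = 0) (by fun_prop) ?_ (by fun_prop))
  exact hr.comp (by fun_prop : PolyFun fun p : α × ℕ × List ℕ => (p.1, p.2.2))

namespace SemOfInd

section Describe

variable {ℓ c : ℕ} (A : TwoStage ℓ c (Fin ℓ ⊕ Fin ℓ) (Fin c) 1)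

/-- The renaming of the wires of the first stage. -/
def preName (nm : List ℕ) : List ℕ :=
  bif decide (nm.headD 0 = 1) then nm else [0, 0, 0, 1 + nm.tail.tail.headD 0, nm.tail.headD 0]

/-- The renaming of the wires of the second stage. -/
def postName (nm : List ℕ) : List ℕ :=
  bif decide (nm.headD 0 = 0) && decide (nm.tail.headD 0 = 1) then
    [0, 1, 1, nm.tail.tail.headD 0] else nm

theorem name_preEmb (w) : WireName.name (preEmb A w) = preName (WireName.name w) := by
  rcases w with (i | i) | i
  · have := i.isLt
    change [0, 0, 0, min (1 + i.val) ℓ, 0] = [0, 0, 0, 1 + i.val, 0]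
    rw [Nat.min_eq_left (by omega)]
  · have := i.isLt
    change [0, 0, 0, min (1 + i.val) ℓ, 1] = [0, 0, 0, 1 + i.val, 1]
    rw [Nat.min_eq_left (by omega)]
  · have := i.isLt
    change [1, min i.val (top ℓ A.mem)] = [1, i.val]
    rw [Nat.min_eq_left (by unfold top; omega)]

theorem name_postEmb (w) : WireName.name (postEmb A w) = postName (WireName.name w) := by
  rcases w with (i | i) | i
  · have := i.isLt
    change [0, 0, min i.val (top ℓ A.mem)] = [0, 0, i.val]
    rw [Nat.min_eq_left (by unfold top; omega)]
  · rfl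
  · rfl

/-- The name of a memory cell in the second stage. -/
def cellName (M k : ℕ) : List ℕ := [0, 0, min k M]

/-- Rewrites the description in terms of `ℓ` and the pieces of the description of `A` alone: the two
sizes, the tokens of the two circuits and the name of the output wire. All of these are
polynomial-time functions of the security parameter. -/
theorem describe_adversary : (adversary A).describe =
    [top ℓ A.mem + 1, A.anc] ++
      ((A.pre.flatMap Gate.tokens).flatMap (fun τ => if τ.1 = 0 then preName τ.2 else [τ.1]) ++
      (((List.range ℓ).flatMap (fun i => [6, 0, 0, 0, min (1 + i) ℓ, 0]) ++
        (List.range ℓ).flatMap (fun i => [6, 0, 0, 0, min (1 + i) ℓ, 1])) ++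
      (([3, 0, 0, 0, 0, 0] ++ (List.range ℓ).flatMap (fun i => [3, 0, 1, i, i]) ++
        [3, 1, min (A.mem + 1) (top ℓ A.mem)]) ++
      (copyProg [1, min (A.mem + 2) (top ℓ A.mem)] (fun b i => [0, 0, 0, min (1 + i) ℓ, b.toNat])
        (fun b i => [1, min (copyAddr A.mem b i) (top ℓ A.mem)]) ℓ).flatMap instrDescr))) ++ [0] ++
      ((A.post.flatMap Gate.tokens).flatMap (fun τ => if τ.1 = 0 then postName τ.2 else [τ.1]) ++
      (selectProg (cellName (top ℓ A.mem) (A.mem + 1))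
        (postName (((List.ofFn A.out).map WireName.name).headD []))
        (cellName (top ℓ A.mem) (A.mem + 3 + 2 * ℓ))
        (fun b i => cellName (top ℓ A.mem) (copyAddr A.mem b i))
        (fun i j => cellName (top ℓ A.mem) (selAddr ℓ A.mem i j)) ℓ).flatMap instrDescr) ++ [0] ++
      (List.range ℓ).flatMap fun i => cellName (top ℓ A.mem) (selAddr ℓ A.mem i 4) := by
  have h₁ := describe_map (preEmb A) preName (name_preEmb A) A.pre
  have h₂ := describe_map (postEmb A) postName (name_postEmb A) A.post
  have h₃ := describe_andNot (ℓ := ℓ) (c := c) (straight_preProg A)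
  have h₄ := describe_andNot (ℓ := ℓ) (c := c) (straight_postProg A)
  have h₅ : (postProg A).map (mapInstr WireName.name) = selectProg
      (cellName (top ℓ A.mem) (A.mem + 1))
      (postName (((List.ofFn A.out).map WireName.name).headD []))
      (cellName (top ℓ A.mem) (A.mem + 3 + 2 * ℓ))
      (fun b i => cellName (top ℓ A.mem) (copyAddr A.mem b i))
      (fun i j => cellName (top ℓ A.mem) (selAddr ℓ A.mem i j)) ℓ := by
    rw [postProg, map_selectProg, name_postEmb]
    rfl
  have h₆ : (measured A).flatMap (fun w => 6 :: WireName.name w) =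
      (List.range ℓ).flatMap (fun i => [6, 0, 0, 0, min (1 + i) ℓ, 0]) ++
        (List.range ℓ).flatMap (fun i => [6, 0, 0, 0, min (1 + i) ℓ, 1]) := by
    rw [measured, List.flatMap_append, List.flatMap_map, List.flatMap_map]
    rfl
  have h₇ : (flips A).flatMap (fun w => 3 :: WireName.name w) =
      [3, 0, 0, 0, 0, 0] ++ (List.range ℓ).flatMap (fun i => [3, 0, 1, i, i]) ++
        [3, 1, min (A.mem + 1) (top ℓ A.mem)] := by
    have := ofFn_flatMap (n := ℓ) (fun a => 3 :: WireName.name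
      (.inl (fpos a) : (pairFormat ℓ).Idx ℓ ⊕ Fin (top ℓ A.mem + 1)))
      (fun i => [3, 0, 1, i, i]) fun i => rfl
    rw [flips, List.flatMap_append, List.flatMap_append, List.flatMap_map, this]
    rfl
  have h₈ := wireList_eq (adversary A).out
    (fun i => cellName (top ℓ A.mem) (selAddr ℓ A.mem i 4)) fun i => rfl
  rw [TwoStage.describe, List.flatMap_append, List.flatMap_append, List.flatMap_append,
    List.flatMap_append, h₁, h₂, h₃, h₄, h₅, describe_measureAll, h₆, describe_nots, h₇, h₈,
    preProg, map_copyProg]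
  simp only [List.append_assoc]
  rfl

end Describe

/-- The names are `[0, 0, i]`, `[0, 1, i]` and `[1, i]`. -/
theorem isName_pre {ℓ m : ℕ} (w : (Fin ℓ ⊕ Fin ℓ) ⊕ Fin m) : IsName 3 3 (WireName.name w) := by
  rcases w with (i | i) | i
  · exact ⟨rfl, Nat.le_add_left 2 1, by decide⟩
  · exact ⟨rfl, Nat.le_add_left 2 1, by decide⟩
  · exact ⟨rfl, le_rfl, by decide⟩

theorem isName_post {c m a : ℕ} (w : (Fin m ⊕ Fin c) ⊕ Fin a) : IsName 3 3 (WireName.name w) := by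
  rcases w with (i | i) | i
  · exact ⟨rfl, Nat.le_add_left 2 1, by decide⟩
  · exact ⟨rfl, Nat.le_add_left 2 1, by decide⟩
  · exact ⟨rfl, le_rfl, by decide⟩

theorem polyFun_describe {ℓ c : ℕ → ℕ} (A : ∀ n, TwoStage (ℓ n) (c n) (Fin (ℓ n) ⊕ Fin (ℓ n))
    (Fin (c n)) 1) (hℓ : PolyFun ℓ) (hc : PolyFun c) (hA : PolyFun fun n => (A n).describe) :
    PolyFun fun n => (pairFormat (ℓ n)).describe ++ (adversary (A n)).describe := by
  obtain ⟨h₁, h₂, h₃, h₄, h₅⟩ := PolyFun.pieces A 3 3 3 3 (fun n w => isName_pre w)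
    (fun n w => isName_post w) hℓ hc hA
  refine PolyFun.congr ?_ fun n => (congrArg _ (describe_adversary (A n))).symm
  have p₁ := h₃.retoken (r := fun _ => preName) (by unfold preName; fun_prop)
  have p₂ := h₄.retoken (r := fun _ => postName) (by unfold postName; fun_prop)
  obtain ⟨mem, hmem⟩ : ∃ f : ℕ → ℕ, ∀ n, (A n).mem = f n := ⟨_, fun n => rfl⟩
  obtain ⟨b, hb⟩ : ∃ f : ℕ → List ℕ, ∀ n,
    postName (((List.ofFn (A n).out).map WireName.name).headD []) = f n := ⟨_, fun n => rfl⟩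
  have h₆ : PolyFun fun n => postName (((List.ofFn (A n).out).map WireName.name).headD []) := by
    unfold postName
    fun_prop
  simp only [hmem, hb] at h₁ h₆ ⊢
  have hr := PolyFun.range hℓ
  have p₃ := hr.flatMap (f := fun n i => [6, 0, 0, 0, min (1 + i) (ℓ n), 0]) (by fun_prop)
  have p₄ := hr.flatMap (f := fun n i => [6, 0, 0, 0, min (1 + i) (ℓ n), 1]) (by fun_prop)
  have p₅ := hr.flatMap (f := fun _ i => [3, 0, 1, i, i]) (by fun_prop)
  have p₆ : PolyFun fun n => copyProg [1, min (mem n + 2) (top (ℓ n) (mem n))]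
      (fun b i => [0, 0, 0, min (1 + i) (ℓ n), b.toNat])
      (fun b i => [1, min (copyAddr (mem n) b i) (top (ℓ n) (mem n))]) (ℓ n) := by
    refine hr.flatMap (f := fun n i => [([0, 0, 0, min (1 + i) (ℓ n), 0],
      [1, min (mem n + 2) (mem n + 7 * ℓ n + 10)],
      [1, min (mem n + 3 + 2 * i + 0) (mem n + 7 * ℓ n + 10)]),
      ([0, 0, 0, min (1 + i) (ℓ n), 1], [1, min (mem n + 2) (mem n + 7 * ℓ n + 10)],
      [1, min (mem n + 3 + 2 * i + 1) (mem n + 7 * ℓ n + 10)])]) ?_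
    fun_prop
  have p₇ := p₆.flatMap (f := fun _ => instrDescr) (by fun_prop)
  have p₈ : PolyFun fun n => selectProg (cellName (top (ℓ n) (mem n)) (mem n + 1)) (b n)
        (cellName (top (ℓ n) (mem n)) (mem n + 3 + 2 * ℓ n))
        (fun b i => cellName (top (ℓ n) (mem n)) (copyAddr (mem n) b i))
        (fun i j => cellName (top (ℓ n) (mem n)) (selAddr (ℓ n) (mem n) i j)) (ℓ n) := by
    have q (x : ℕ × ℕ → ℕ) (hx : PolyFun x) :
        PolyFun fun p : ℕ × ℕ => cellName (mem p.1 + 7 * ℓ p.1 + 10) (x p) := by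
      unfold cellName
      fun_prop
    have q' (x : ℕ → ℕ) (hx : PolyFun x) :
        PolyFun fun n : ℕ => cellName (mem n + 7 * ℓ n + 10) (x n) := by
      unfold cellName
      fun_prop
    have q₀ (j : ℕ) := q (fun p => mem p.1 + 4 + 2 * ℓ p.1 + 5 * p.2 + j) (by fun_prop)
    have q₁ (j : ℕ) := q (fun p => mem p.1 + 3 + 2 * p.2 + j) (by fun_prop)
    have q₂ := q (fun p => mem p.1 + 3 + 2 * ℓ p.1) (by fun_prop)
    have q₃ := q (fun p => mem p.1 + 1) (by fun_prop)
    have q₄ := q' (fun n => mem n + 3 + 2 * ℓ n) (by fun_prop)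
    have q₅ := q' (fun n => mem n + 1) (by fun_prop)
    have q₆ : PolyFun fun p : ℕ × ℕ => b p.1 := h₆.comp (by fun_prop)
    have hnil : PolyFun fun _ : ℕ × ℕ => ([] : List (List ℕ × List ℕ × List ℕ)) := by fun_prop
    exact PolyFun.append ((q₅.mk (h₆.mk q₄)).cons (by fun_prop)) (hr.flatMap
      (f := fun n i => [(b n, _, _), (_, _, _), (_, _, _), (_, _, _), (_, _, _)])
      ((q₆.mk ((q₁ 1).mk (q₀ 0))).cons ((q₂.mk ((q₁ 0).mk (q₀ 1))).cons
        ((q₃.mk ((q₀ 0).mk (q₀ 2))).cons (((q₀ 2).mk ((q₀ 1).mk (q₀ 3))).cons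
        ((q₃.mk ((q₀ 3).mk (q₀ 4))).cons hnil))))))
  have p₉ := p₈.flatMap (f := fun _ => instrDescr) (by fun_prop)
  have p₁₀ : PolyFun fun n => (List.range (ℓ n)).flatMap fun i =>
      cellName (top (ℓ n) (mem n)) (selAddr (ℓ n) (mem n) i 4) :=
    hr.flatMap (f := fun n i => [0, 0, min (mem n + 4 + 2 * ℓ n + 5 * i + 4)
      (mem n + 7 * ℓ n + 10)]) (by fun_prop)
  simp only [TemplateFormat.describe]
  unfold top at *
  fun_prop

end SemOfInd

/-! ### Semantic security implies indistinguishability -/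

/-- Whether the two plaintexts of a template with a single coin have the same target value. -/
def pairWeight {ℓ : ℕ} (T : Template (pairFormat ℓ) ℓ) : ℝ :=
  if T.f (T.samp fun _ => false) = T.f (T.samp fun _ => true) then 1 else 1 / 2

theorem pairWeight_pairTemplate {ℓ : ℕ} (t : Fin ℓ ⊕ Fin ℓ → Bool) :
    pairWeight (pairTemplate t) = if choose t false = choose t true then 1 else 1 / 2 := by
  rw [pairWeight]
  simp only [samp_pairTemplate, f_pairTemplate]
  congr 1
  simp only [funext_iff, Bool.not_inj_iff]

theorem avg_bits_one (f : Bits 1 → ℝ) :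
    avg f = (f (fun _ => true) + f fun _ => false) / 2 := by
  rw [avg_bits, ← (Equiv.funUnique (Fin 1) Bool).symm.sum_comp, Fintype.sum_bool]
  have h (b : Bool) : (Equiv.funUnique (Fin 1) Bool).symm b = fun _ => b := rfl
  rw [h, h]
  ring

theorem sum_bits_one (f : Bits 1 → ℝ) :
    ∑ s, f s = f (fun _ => true) + f fun _ => false := by
  rw [← (Equiv.funUnique (Fin 1) Bool).symm.sum_comp, Fintype.sum_bool]
  rfl

section Bounds

variable {ℓ c R : ℕ} (E : Bits R → Bits ℓ → Bits c) (D : Bits c → Bits ℓ)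

/-- The simulator sees the template and a string of length zero, so its output does not depend on
the coin. If the two target values differ, hitting one and hitting the other are disjoint events,
and averaging over the coin gives at most one half. -/
theorem sim_le_pairWeight (T : Template (pairFormat ℓ) ℓ)
    (B : TwoStage ℓ c ((pairFormat ℓ).Idx ℓ) (Fin 0) ℓ) :
    (avg fun u : Bits 1 => B.prob E D T (T.h (T.samp u)) (T.f (T.samp u))) ≤
      pairWeight T * B.firstProb E D T := by
  have h (v v' : Fin 0 → Bool) : v = v' := Subsingleton.elim _ _
  have hsum := B.sum_prob E D T (T.h (T.samp fun _ => false))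
  have hle (s : Bits ℓ) : B.prob E D T (T.h (T.samp fun _ => false)) s ≤ B.firstProb E D T := by
    rw [← hsum]
    exact Finset.single_le_sum (fun s _ => B.prob_nonneg E D T _ s) (Finset.mem_univ s)
  rw [avg_bits_one, h (T.h (T.samp fun _ => true)) (T.h (T.samp fun _ => false)), pairWeight]
  split_ifs with heq
  · have h₁ := hle (T.f (T.samp fun _ => false))
    rw [← heq]
    linarith
  · have h₂ : B.prob E D T (T.h (T.samp fun _ => false)) (T.f (T.samp fun _ => false)) +
        B.prob E D T (T.h (T.samp fun _ => false)) (T.f (T.samp fun _ => true)) ≤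
          B.firstProb E D T := by
      rw [← hsum, ← Finset.sum_pair heq]
      exact Finset.sum_le_univ_sum_of_nonneg fun s => B.prob_nonneg E D T _ s
    linarith

/-- The identity holds separately for each pair `t` of messages. If the messages differ, the new
adversary wins iff `A` guesses the coin, and the weight is one half. If they agree, it always wins,
which the weight 1 cancels, while `A` wins with probability exactly one half. -/
theorem ind_eq_real (A : TwoStage ℓ c (Fin ℓ ⊕ Fin ℓ) (Fin c) 1) :
    (avg fun b : Bool => ∑ t, avg fun r : Bits R =>
        A.prob E D t (E r (choose t b)) (fun _ => b)) - 1 / 2 =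
      (∑ T : Template (pairFormat ℓ) ℓ, avg fun u : Bits 1 => avg fun r : Bits R =>
        (SemOfInd.adversary A).prob E D T (Sum.elim (T.h (T.samp u)) (E r (T.samp u)))
          (T.f (T.samp u))) -
      ∑ T, pairWeight T * (SemOfInd.adversary A).firstProb E D T := by
  have h₁ : (∑ T : Template (pairFormat ℓ) ℓ, avg fun u : Bits 1 => avg fun r : Bits R =>
        (SemOfInd.adversary A).prob E D T (Sum.elim (T.h (T.samp u)) (E r (T.samp u)))
          (T.f (T.samp u))) =
      ∑ t, avg fun u : Bits 1 => avg fun r : Bits R =>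
        ∑ s : Bits 1, if choose t (s 0) = choose t (u 0) then
          A.prob E D t (E r (choose t (u 0))) s else 0 := by
    simp only [← avg_sum]
    congr 1
    funext u
    congr 1
    funext r
    exact SemOfInd.sum_prob_adversary A E D u r
  rw [h₁, SemOfInd.sum_firstProb_adversary, ← A.sum_firstProb E D, avg_sum, Finset.sum_div,
    ← Finset.sum_sub_distrib, ← Finset.sum_sub_distrib]
  refine Finset.sum_congr rfl fun t _ => ?_
  -- The two possible guesses exhaust the probability of `t`, whichever message is encrypted.
  have h₂ (b : Bool) : (avg fun r : Bits R => A.prob E D t (E r (choose t b)) fun _ => true) +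
      (avg fun r : Bits R => A.prob E D t (E r (choose t b)) fun _ => false) =
        A.firstProb E D t := by
    rw [← avg_add]
    have h₃ (r : Bits R) : ((A.prob E D t (E r (choose t b)) fun _ => true) +
        A.prob E D t (E r (choose t b)) fun _ => false) = A.firstProb E D t := by
      rw [← sum_bits_one, A.sum_prob]
    simp only [h₃, avg_const]
  have h₃ := h₂ true
  have h₄ := h₂ false
  simp only [pairWeight_pairTemplate, avg_bool, avg_bits_one, sum_bits_one]
  by_cases h : choose t false = choose t true
  · simp only [h, if_true, avg_add] at h₃ h₄ ⊢
    linarith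
  · simp only [h, Ne.symm h, if_true, if_false, add_zero, zero_add]
    linarith

end Bounds

namespace Scheme

variable (S : Scheme)

/-- The advantage of `A` is the real success probability minus the mean of `pairWeight`. The same
mean, taken for the simulator, bounds its success, so the advantage is at most the gap between the
real and the simulated game. -/
theorem ind_of_sem (h : S.SEM_QCCA1) : S.IND_QCCA1 := by
  intro A hA
  obtain ⟨B, -, hB, hε⟩ := h (fun n => pairFormat (S.msgLen n))
    (fun n => SemOfInd.adversary (A n)) (PolyUniform.iff_polyFun.2
      (SemOfInd.polyFun_describe A
        ((PolyFun.headD (PolyUniform.iff_polyFun.1 S.msgLen_poly) 0).congr fun n => rfl)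
        ((PolyFun.headD (PolyUniform.iff_polyFun.1 S.ctLen_poly) 0).congr fun n => rfl)
        (PolyUniform.iff_polyFun.1 hA)))
  refine ⟨_, hε, fun n => ?_⟩
  have h₁ : S.indWinProb (A n) - 1 / 2 = S.semRealWinProb (SemOfInd.adversary (A n)) -
      ∑ T, pairWeight T * S.outputProb (SemOfInd.adversary (A n)) T := by
    have h₂ := fun z : Bits (S.keyCoins n) => ind_eq_real (S.enc n (S.keyGen n z))
      (S.dec n (S.keyGen n z)) (A n)
    have h₃ := congrArg avg (funext h₂)
    rw [avg_sub, avg_sub, avg_const, avg_sum (fun T (z : Bits (S.keyCoins n)) => pairWeight T * _)]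
      at h₃
    simp only [avg_mul] at h₃
    exact h₃
  have h₂ : S.semSimWinProb (B n) ≤ ∑ T, pairWeight T * S.outputProb (B n) T := by
    have h₃ : ∑ T, pairWeight T * S.outputProb (B n) T = avg fun z : Bits (S.keyCoins n) =>
        ∑ T, pairWeight T * (B n).firstProb (S.enc n (S.keyGen n z)) (S.dec n (S.keyGen n z)) T := by
      rw [avg_sum (fun T (z : Bits (S.keyCoins n)) => pairWeight T * _)]
      simp only [avg_mul]
      rfl
    rw [h₃]
    exact avg_mono fun z => Finset.sum_le_sum fun T _ => sim_le_pairWeight _ _ T (B n)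
  -- Adversary and simulator output identically distributed templates, so the two means of
  -- `pairWeight` agree.
  simp only [hB] at h₁
  have := le_abs_self (S.semRealWinProb (SemOfInd.adversary (A n)) - S.semSimWinProb (B n))
  linarith

end Scheme

/-! ### A simulator from a semantic security adversary -/

theorem tensor_inject_mem {A I B A' : Type} [Fintype A] [DecidableEq A] [Fintype I]
    [DecidableEq I] [Fintype B] [DecidableEq B] [Fintype A'] [DecidableEq A'] (e : A' ↪ A)
    (z : A → Bool) (v : I → Bool) (z' : B → Bool) (σ : Op A') :
    tensor (tensor (inject e z σ) (ket v)) (ket z') =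
      inject (e.trans (Function.Embedding.inl.trans Function.Embedding.inl))
        (Sum.elim (Sum.elim z v) z') σ := by
  rw [tensor_ket_ket _ _ _ _ _ _ z, inject_trans e (Function.Embedding.inl.trans
    Function.Embedding.inl)]
  rfl

theorem postState_inject_sumMap {O M M' : Type} [Fintype O] [DecidableEq O] [Fintype M]
    [DecidableEq M] [Fintype M'] [DecidableEq M'] (e : M ↪ M') (t : O → Bool)
    (z : O ⊕ M' → Bool) (ρ : Op (O ⊕ M)) :
    postState t (inject ((Function.Embedding.refl O).sumMap e) z ρ) =
      inject e (z ∘ Sum.inr) (postState t ρ) := by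
  have key (x : M' → Bool) : Sum.elim t x = put ((Function.Embedding.refl O).sumMap e) z
      (Sum.elim t x ∘ ((Function.Embedding.refl O).sumMap e)) ↔
      x = put e (z ∘ Sum.inr) (x ∘ e) := by
    simp only [eq_put_self_iff]
    constructor
    · intro h w hw
      refine h (.inr w) ?_
      rintro (o | v) h'
      · exact Sum.inl_ne_inr h'
      · exact hw v (Sum.inr_injective h')
    · rintro h (o | w) hw
      · exact absurd rfl (hw (.inl o))
      · exact h w fun v hv => hw (.inr v) (congrArg Sum.inr hv)
  have h (x : M' → Bool) : Sum.elim t x ∘ ((Function.Embedding.refl O).sumMap e) =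
      Sum.elim t (x ∘ e) := by
    funext w
    cases w <;> rfl
  funext x y
  simp only [postState, inject, key]
  simp only [h]

namespace SimOfSem

section

variable {ℓ c o k : ℕ} {O : Type} [Fintype O] [DecidableEq O]
variable (A : TwoStage ℓ c O (Fin k ⊕ Fin c) o)

/-- The embedding of the memory. -/
def memEmb : Fin A.mem ↪ Fin (A.mem + (ℓ + c)) := Fin.castAddEmb _

/-- The wires of the second stage. -/
def postEmb : (Fin A.mem ⊕ (Fin k ⊕ Fin c)) ⊕ Fin A.anc ↪
    (Fin (A.mem + (ℓ + c)) ⊕ Fin k) ⊕ Fin A.anc where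
  toFun := Sum.elim (Sum.elim (fun i => .inl (.inl (Fin.castAdd _ i)))
    (Sum.elim (fun i => .inl (.inr i)) fun j => .inl (.inl (Fin.natAdd _ (Fin.natAdd _ j))))) .inr
  inj' := by
    rintro ((i | i | i) | i) ((j | j | j) | j) h
    all_goals
      simp [Fin.ext_iff] at h
    all_goals
      simp only [Sum.inl.injEq, Sum.inr.injEq, Fin.ext_iff]
      omega

/-- The wires of the query. -/
def queryEmb : Fin ℓ ⊕ Fin c ↪ (Fin (A.mem + (ℓ + c)) ⊕ Fin k) ⊕ Fin A.anc where
  toFun x := .inl (.inl (Fin.natAdd _ (finSumFinEquiv x)))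
  inj' x y h := by
    have h' : (finSumFinEquiv x).val = (finSumFinEquiv y).val := by
      simpa [Fin.ext_iff] using h
    exact finSumFinEquiv.injective (Fin.ext h')

/-- The simulator that runs `A` on an encryption of zero. -/
abbrev simulator : TwoStage ℓ c O (Fin k) o where
  mem := A.mem + (ℓ + c)
  anc := A.anc
  pre := A.pre.map (Gate.map ((Function.Embedding.refl O).sumMap (memEmb A)))
  post := [.encrypt (queryEmb A)] ++ A.post.map (Gate.map (postEmb A))
  out := A.out.trans (postEmb A)
  post_noDecrypt g hg := by
    rcases List.mem_append.1 hg with h | h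
    · rw [List.mem_singleton.1 h]
      exact not_false
    · obtain ⟨g', h', rfl⟩ := List.mem_map.1 h
      rw [Gate.map_isDecrypt]
      exact A.post_noDecrypt g' h'

variable {R : ℕ} (E : Bits R → Bits ℓ → Bits c) (D : Bits c → Bits ℓ)

theorem firstStage_simulator (t : O → Bool) :
    (simulator A).firstStage E D t = inject (memEmb A) (fun _ => false) (A.firstStage E D t) := by
  rw [TwoStage.firstStage, ket_eq_inject ((Function.Embedding.refl O).sumMap (memEmb A)),
    run_map_inject, postState_inject_sumMap]
  rfl

/-- The first stage is that of `A` on a larger memory, so the distribution of templates is preserved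
exactly. -/
theorem firstProb_simulator (t : O → Bool) :
    (simulator A).firstProb E D t = A.firstProb E D t := by
  rw [TwoStage.firstProb, firstStage_simulator, mass_inject]
  rfl

/-- The memory of the simulator with the ciphertext `v`. -/
def withCiphertext (v : Bits c) : Bits (A.mem + (ℓ + c)) :=
  Fin.append (fun _ => false) (Fin.append (fun _ => false) v)

/-- The query wires are unused zeros, so the oracle is asked for the zero message, and the response
wires, zero as well, receive the ciphertext itself. These memory wires then act as the challenge. -/
theorem oracleUnitary_query (F : Bits ℓ → Bits c) (v : Bits k) (σ : Op (Fin A.mem)) :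
    conj (oracleUnitary F (queryEmb A)) (tensor (tensor
        (inject (memEmb A) (fun _ => false) σ) (ket v)) (ket fun _ => false)) =
      tensor (tensor (inject (memEmb A) (withCiphertext A (F fun _ => false)) σ) (ket v))
        (ket fun _ => false) := by
  rw [tensor_inject_mem, tensor_inject_mem]
  refine conj_basisMap_inject (fun p => ?_) σ
  set e : Fin A.mem ↪ (Fin (A.mem + (ℓ + c)) ⊕ Fin k) ⊕ Fin A.anc :=
    (memEmb A).trans (Function.Embedding.inl.trans Function.Embedding.inl) with he
  set z : (Fin (A.mem + (ℓ + c)) ⊕ Fin k) ⊕ Fin A.anc → Bool :=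
    Sum.elim (Sum.elim (fun _ => false) v) fun _ => false with hz
  have hne (i : Fin A.mem) (x : Fin (ℓ + c)) : e i ≠ .inl (.inl (Fin.natAdd _ x)) := by
    intro h
    have := congrArg Fin.val (Sum.inl_injective (Sum.inl_injective h))
    simp [memEmb] at this
    omega
  have hput (x : Fin (ℓ + c)) : put e z p (.inl (.inl (Fin.natAdd _ x))) = false := by
    rw [put_of_forall_ne fun i => hne i x]
    rfl
  have hq : (fun i => put e z p (queryEmb A (.inl i))) = fun _ => false :=
    funext fun i => hput _
  rw [hq]
  refine eq_put_iff.2 ⟨?_, fun w hw => ?_⟩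
  · funext i
    have : ¬ ∃ j : Fin c, queryEmb A (.inr j) = e i ∧ F (fun _ => false) j = true := by
      rintro ⟨j, hj, -⟩
      exact hne i _ hj.symm
    rw [Function.comp_apply, decide_eq_false this, Bool.xor_false, put_apply]
  · rcases w with (w | w) | w
    · revert hw
      refine Fin.addCases (fun i => ?_) (fun x => ?_) w
      · intro h
        exact absurd rfl (h i)
      · intro h
        rw [hput, Bool.false_xor]
        change _ = withCiphertext A _ (Fin.natAdd _ x)
        rw [withCiphertext, Fin.append_right]
        refine Fin.addCases (fun i => ?_) (fun j => ?_) x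
        · rw [Fin.append_left]
          refine decide_eq_false ?_
          rintro ⟨j, hj, -⟩
          have hj' : A.mem + (ℓ + j.val) = A.mem + i.val :=
            congrArg Fin.val (Sum.inl_injective (Sum.inl_injective hj))
          have := i.isLt
          omega
        · rw [Fin.append_right, Bool.eq_iff_iff, decide_eq_true_iff]
          constructor
          · rintro ⟨j', hj', h⟩
            have h' : A.mem + (ℓ + j'.val) = A.mem + (ℓ + j.val) :=
              congrArg Fin.val (Sum.inl_injective (Sum.inl_injective hj'))
            have : j' = j := Fin.ext (by omega)
            rwa [← this]
          · intro h
            exact ⟨j, rfl, h⟩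
    · have : ¬ ∃ j : Fin c, queryEmb A (.inr j) = .inl (.inr w) ∧
          F (fun _ => false) j = true := by
        rintro ⟨j, hj, -⟩
        exact Sum.inl_ne_inr (Sum.inl_injective hj)
      rw [decide_eq_false this, Bool.xor_false, put_of_forall_ne hw]
      rfl
    · have : ¬ ∃ j : Fin c, queryEmb A (.inr j) = .inr w ∧ F (fun _ => false) j = true := by
        rintro ⟨j, hj, -⟩
        exact Sum.inl_ne_inr hj
      rw [decide_eq_false this, Bool.xor_false, put_of_forall_ne hw]
      rfl

/-- The query uses fresh coins, so afterwards the state is the uniform mixture over `r` of states in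
which `A` faces an encryption of zero with coins `r`. The ciphertext wires of `A` are relocated to
the response wires, and what follows is a run of `A`. -/
theorem prob_simulator (t : O → Bool) (v : Bits k) (s : Bits o) :
    (simulator A).prob E D t v s =
      avg fun r => A.prob E D t (Sum.elim v (E r fun _ => false)) s := by
  have h (r : Bits R) := TwoStage.tensor_inject A (simulator A) (memEmb A) (postEmb A)
    (withCiphertext A (E r fun _ => false)) (Sum.elim v (E r fun _ => false)) v (fun i => rfl)
    (by
      rintro (i | j)
      · rfl
      · change withCiphertext A _ (Fin.natAdd _ (Fin.natAdd _ j)) = _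
        rw [withCiphertext, Fin.append_right, Fin.append_right]
        rfl) (fun i => rfl) (A.firstStage E D t)
  rw [TwoStage.prob, firstStage_simulator, run_append]
  have h₁ : run E D [.encrypt (queryEmb A)] (tensor (tensor (inject (memEmb A) (fun _ => false)
      (A.firstStage E D t)) (ket v)) (ket fun _ => false)) = ∑ r : Bits R,
      (((Fintype.card (Bits R) : ℝ)⁻¹ : ℝ) : ℂ) •
      inject (postEmb A) (Sum.elim (Sum.elim (withCiphertext A (E r fun _ => false)) v)
        fun _ => false) (tensor (tensor (A.firstStage E D t)
          (ket (Sum.elim v (E r fun _ => false)))) (ket fun _ => false)) := by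
    change (Fintype.card (Bits R) : ℂ)⁻¹ • ∑ r : Bits R, conj (oracleUnitary (E r) (queryEmb A)) _ = _
    rw [Finset.smul_sum]
    refine Finset.sum_congr rfl fun r _ => ?_
    rw [oracleUnitary_query, h r]
    push_cast
    rfl
  rw [h₁, run_sum, outcomeProb_sum, avg, Finset.sum_div]
  refine Finset.sum_congr rfl fun r _ => ?_
  rw [run_smul, outcomeProb_smul, run_map_inject, outcomeProb_inject, div_eq_inv_mul]
  rfl

end

/-! ### Uniformity of the simulator -/

section Describe

variable {ℓ c : ℕ} {φ : TemplateFormat}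
variable (A : TwoStage ℓ c (φ.Idx ℓ) (Fin φ.hLen ⊕ Fin c) φ.fLen)

/-- The renaming of the wires of the second stage. -/
def postName (m : ℕ) (nm : List ℕ) : List ℕ :=
  bif decide (nm.headD 0 = 0) && decide (nm.tail.headD 0 = 1) then
    bif decide (nm.tail.tail.headD 0 = 0) then [0, 1, nm.tail.tail.tail.headD 0]
    else [0, 0, m + nm.tail.tail.tail.headD 0]
  else nm

theorem name_postEmb (w) :
    WireName.name (postEmb A w) = postName (A.mem + ℓ) (WireName.name w) := by
  rcases w with (i | i | i) | i
  · rfl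
  · rfl
  · change [0, 0, A.mem + (ℓ + i.val)] = [0, 0, A.mem + ℓ + i.val]
    rw [Nat.add_assoc]
  · rfl

theorem describe_simulator : (simulator A).describe =
    [A.mem + (ℓ + c), A.anc] ++
      (A.pre.flatMap Gate.tokens).flatMap (fun τ => if τ.1 = 0 then τ.2 else [τ.1]) ++ [0] ++
      (7 :: ((List.range ℓ).flatMap (fun i => [0, 0, A.mem + i]) ++
        (List.range c).flatMap fun i => [0, 0, A.mem + (ℓ + i)]) ++
      (A.post.flatMap Gate.tokens).flatMap
        fun τ => if τ.1 = 0 then postName (A.mem + ℓ) τ.2 else [τ.1]) ++ [0] ++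
      ((List.ofFn A.out).map WireName.name).flatMap (postName (A.mem + ℓ)) := by
  -- Template wires are kept and memory wires retain their index, so no name changes in the first
  -- stage.
  have h₁ := describe_map ((Function.Embedding.refl _).sumMap (memEmb A)) (fun nm => nm)
    (by rintro (w | w) <;> rfl) A.pre
  have h₂ := describe_map (postEmb A) (postName (A.mem + ℓ)) (name_postEmb A) A.post
  have h₃ : wireList (simulator A).out =
      ((List.ofFn A.out).map WireName.name).flatMap (postName (A.mem + ℓ)) := by
    have h : List.ofFn (simulator A).out = (List.ofFn A.out).map (postEmb A) := by
      rw [List.map_ofFn]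
      rfl
    rw [wireList, h, List.flatMap_map, List.flatMap_map]
    exact List.flatMap_congr fun w _ => name_postEmb A w
  have h₄ := wireList_eq (fun i => queryEmb A (.inl i)) (fun i => [0, 0, A.mem + i]) fun i => rfl
  have h₅ := wireList_eq (fun i => queryEmb A (.inr i)) (fun i => [0, 0, A.mem + (ℓ + i)])
    fun i => rfl
  rw [TwoStage.describe, h₁, List.flatMap_append, h₂, h₃, List.flatMap_singleton, Gate.describe,
    h₄, h₅]

end Describe

/-- A second entry 1 belongs to the circuit for `f`, one level less deep in the sum of positions;
hence the lengths 4 and 5. -/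
theorem isName_pre {ℓ m : ℕ} {φ : TemplateFormat} (w : φ.Idx ℓ ⊕ Fin m) :
    IsName 4 5 (WireName.name w) := by
  rcases w with ((i | i) | i) | i
  · exact ⟨rfl, Nat.le_add_left 2 3, by decide⟩
  · exact ⟨rfl, Nat.le_add_left 2 3, by decide⟩
  · exact ⟨rfl, Nat.le_add_left 2 2, by decide⟩
  · exact ⟨rfl, le_rfl, by decide⟩

theorem isName_post {c m a k : ℕ} (w : (Fin m ⊕ (Fin k ⊕ Fin c)) ⊕ Fin a) :
    IsName 4 3 (WireName.name w) := by
  rcases w with (i | i | i) | i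
  · exact ⟨rfl, Nat.le_add_left 2 1, by decide⟩
  · exact ⟨rfl, Nat.le_add_left 2 2, by decide⟩
  · exact ⟨rfl, Nat.le_add_left 2 2, by decide⟩
  · exact ⟨rfl, le_rfl, by decide⟩

/-- The pieces of a uniform description of semantic security adversaries. -/
theorem polyFun_pieces {ℓ c : ℕ → ℕ} (φ : ℕ → TemplateFormat)
    (A : ∀ n, TwoStage (ℓ n) (c n) ((φ n).Idx (ℓ n)) (Fin (φ n).hLen ⊕ Fin (c n)) (φ n).fLen)
    (hℓ : PolyFun ℓ) (hc : PolyFun c)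
    (hA : PolyFun fun n => (φ n).describe ++ (A n).describe) :
    (PolyFun (fun n => (φ n).coins) ∧ PolyFun (fun n => (φ n).hLen) ∧
      PolyFun (fun n => (φ n).fLen) ∧ PolyFun (fun n => (φ n).sampGates) ∧
      PolyFun (fun n => (φ n).hGates) ∧ PolyFun (fun n => (φ n).fGates)) ∧
      PolyFun (fun n => (A n).mem) ∧ PolyFun (fun n => (A n).anc) ∧
      PolyFun (fun n => (A n).pre.flatMap Gate.tokens) ∧
      PolyFun (fun n => (A n).post.flatMap Gate.tokens) ∧
      PolyFun (fun n => (List.ofFn (A n).out).map WireName.name) := by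
  have h₂ := hA.tail
  have h₃ := h₂.tail
  have h₄ := h₃.tail
  have h₅ := h₄.tail
  have h₆ := h₅.tail
  exact ⟨⟨hA.headD 0, h₂.headD 0, h₃.headD 0, h₄.headD 0, h₅.headD 0, h₆.headD 0⟩,
    PolyFun.pieces A 4 5 4 3 (fun n w => isName_pre w) (fun n w => isName_post w) hℓ hc h₆.tail⟩

theorem polyFun_describe {ℓ c : ℕ → ℕ} (φ : ℕ → TemplateFormat)
    (A : ∀ n, TwoStage (ℓ n) (c n) ((φ n).Idx (ℓ n)) (Fin (φ n).hLen ⊕ Fin (c n)) (φ n).fLen)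
    (hℓ : PolyFun ℓ) (hc : PolyFun c)
    (hA : PolyFun fun n => (φ n).describe ++ (A n).describe) :
    PolyFun fun n => (φ n).describe ++ (simulator (A n)).describe := by
  obtain ⟨⟨k₁, k₂, k₃, k₄, k₅, k₆⟩, h₁, h₂, h₃, h₄, h₅⟩ := polyFun_pieces φ A hℓ hc hA
  refine PolyFun.congr ?_ fun n => (congrArg _ (describe_simulator (A n))).symm
  obtain ⟨mem, hmem⟩ : ∃ f : ℕ → ℕ, ∀ n, (A n).mem = f n := ⟨_, fun n => rfl⟩
  simp only [hmem] at h₁ ⊢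
  have hp : PolyFun fun p : ℕ × List ℕ => postName (mem p.1 + ℓ p.1) p.2 := by
    unfold postName; fun_prop
  have p₁ := h₃.retoken (r := fun _ nm => nm) (by fun_prop)
  have p₂ := h₄.retoken (r := fun n => postName (mem n + ℓ n)) hp
  have p₃ := h₅.flatMap (f := fun n => postName (mem n + ℓ n)) hp
  have p₄ := (PolyFun.range hℓ).flatMap (f := fun n i => [0, 0, mem n + i]) (by fun_prop)
  have p₅ := (PolyFun.range hc).flatMap (f := fun n i => [0, 0, mem n + (ℓ n + i)]) (by fun_prop)
  simp only [TemplateFormat.describe]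
  fun_prop

end SimOfSem

/-! ### Programs on a memory arranged in squares -/

/-- The address of cell `(t, j)` in the square `r` of side `N`. -/
def loc (N r t j : ℕ) : ℕ := r * (N * N) + (t * N + j)

theorem le_loc {N k r : ℕ} (hr : k ≤ r) (t j : ℕ) : k * (N * N) ≤ loc N r t j :=
  (Nat.mul_le_mul_right _ hr).trans (Nat.le_add_right _ _)

theorem loc_lt {N k r t j : ℕ} (hr : r < k) (ht : t < N) (hj : j < N) :
    loc N r t j < k * (N * N) := by
  have h₁ : (r + 1) * (N * N) ≤ k * (N * N) := Nat.mul_le_mul_right _ hr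
  have h₂ : (t + 1) * N ≤ N * N := Nat.mul_le_mul_right _ ht
  rw [Nat.add_mul] at h₁ h₂
  unfold loc
  omega

/-- The position within a square is written in base `N`, with digits `t` and `j`. -/
theorem loc_inj {N r t j r' t' j' : ℕ} (ht : t < N) (hj : j < N) (ht' : t' < N) (hj' : j' < N)
    (h : loc N r t j = loc N r' t' j') : r = r' ∧ t = t' ∧ j = j' := by
  have h₁ : r = r' := by
    by_contra hne
    rcases Nat.lt_or_gt_of_ne hne with hlt | hlt
    · have := loc_lt hlt ht hj
      have := le_loc (N := N) le_rfl t' j' (r := r')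
      omega
    · have := loc_lt hlt ht' hj'
      have := le_loc (N := N) le_rfl t j (r := r)
      omega
  subst h₁
  have h₂ : t * N + j = t' * N + j' := by simpa [loc] using h
  have h₃ : t = t' := by
    by_contra hne
    rcases Nat.lt_or_gt_of_ne hne with hlt | hlt
    · have := Nat.mul_le_mul_right N hlt
      rw [Nat.succ_mul] at this
      omega
    · have := Nat.mul_le_mul_right N hlt
      rw [Nat.succ_mul] at this
      omega
  subst h₃
  exact ⟨rfl, rfl, by omega⟩

section Programs

variable {V W : Type}

/-- The program that evaluates the circuit in the square `k` of the memory `x`, in the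
square `k + 5`; the cells `0` and `1` of the square `5` hold true and false. -/
def squareProg (x : ℕ → W) (N k : ℕ) (inp : ℕ → W) (a G : ℕ) : List (W × W × W) :=
  circProg (x (loc N 5 0 0)) (x (loc N 5 0 1)) inp (fun t => x (loc N (k + 5) t (N - 1)))
    (fun t j => x (loc N k t j)) (fun t j => x (loc N (k + 5) t (2 * j + 1)))
    (fun t j => x (loc N (k + 5) t (2 * j))) a G

theorem map_squareProg (f : V → W) (x : ℕ → V) (N k : ℕ) (inp : ℕ → V) (a G : ℕ) :
    (squareProg x N k inp a G).map (mapInstr f) =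
      squareProg (fun i => f (x i)) N k (fun j => f (inp j)) a G :=
  map_circProg ..

/-- Row `t` of the square `k + 5` serves as the block of gate `t`. Ranks are addresses, so the
programs for consecutive squares can be appended; the inputs lie above the template and below the
square that is being filled. -/
theorem straight_squareProg {rk : W → ℕ} {x : ℕ → W} {N k : ℕ} {inp : ℕ → W} {a G : ℕ}
    (hx : ∀ i < 11 * (N * N), rk (x i) = i) (hk : 1 ≤ k) (hk' : k ≤ 3) (hN : 2 * (a + G) + 3 ≤ N)
    (hinp : ∀ j < a, 4 * (N * N) ≤ rk (inp j) ∧ rk (inp j) < (k + 5) * (N * N)) :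
    Straight rk (N * N) ((k + 5) * (N * N)) ((k + 6) * (N * N)) (squareProg x N k inp a G) := by
  have hloc {r t j : ℕ} (hr : r < 11) (ht : t < N) (hj : j < N) :
      rk (x (loc N r t j)) = loc N r t j := hx _ (loc_lt hr ht hj)
  have hC {t j : ℕ} (ht : t < G) (hj : j < a + G) :
      N * N ≤ rk (x (loc N k t j)) ∧ rk (x (loc N k t j)) < 4 * (N * N) := by
    rw [hloc (by omega) (by omega) (by omega)]
    have := le_loc (N := N) hk t j
    exact ⟨by omega, loc_lt (by omega) (by omega) (by omega)⟩
  have h₄ : 6 * (N * N) ≤ (k + 5) * (N * N) := Nat.mul_le_mul_right _ (by omega)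
  refine (straight_circProg (B := (k + 5) * (N * N)) (N := N) ?_ ?_ ?_ (fun j hj => (hinp j hj).2)
    (fun t ht j hj => ?_) (fun t ht j hj i hi => ?_) (fun t ht j hj => ?_) (fun t ht j hj => ?_)
    (fun t ht => ?_) hN).mono le_rfl ?_
  · rw [hloc (by omega) (by omega) (by omega)]
    have := le_loc (N := N) (show 1 ≤ 5 by omega) 0 0
    have := loc_lt (N := N) (show 5 < 6 by omega) (show 0 < N by omega) (show 0 < N by omega)
    omega
  · rw [hloc (by omega) (by omega) (by omega)]
    have := le_loc (N := N) (show 1 ≤ 5 by omega) 0 1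
    have := loc_lt (N := N) (show 5 < 6 by omega) (show 0 < N by omega) (show 1 < N by omega)
    omega
  · rw [hloc (by omega) (by omega) (by omega), hloc (by omega) (by omega) (by omega)]
    simp [loc]
  · have := hC ht hj
    omega
  · have := hC ht hj
    have := hinp i hi
    omega
  · rw [hloc (by omega) (by omega) (by omega), loc, Nat.add_assoc]
  · rw [hloc (by omega) (by omega) (by omega), loc, Nat.add_assoc]
  · rw [hloc (by omega) (by omega) (by omega), loc, Nat.add_assoc]
  · have : G * N ≤ N * N := Nat.mul_le_mul_right N (by omega)
    rw [Nat.add_mul k 6, Nat.add_mul k 5]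
    omega

/-- The program that compares two strings. The wire `w i 3` tells whether they agree below `i`. -/
def compareProg (one zero : W) (s f : ℕ → W) (w : ℕ → ℕ → W) (y : W) (k : ℕ) :
    List (W × W × W) :=
  [(one, zero, w 0 3)] ++ ((List.range k).flatMap fun i =>
    [(s i, f i, w (i + 1) 0), (f i, s i, w (i + 1) 1), (w i 3, w (i + 1) 0, w (i + 1) 2),
      (w (i + 1) 2, w (i + 1) 1, w (i + 1) 3)]) ++ [(one, w k 3, y)]

theorem map_compareProg (g : V → W) (one zero : V) (s f : ℕ → V) (w : ℕ → ℕ → V) (y : V) (k : ℕ) :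
    (compareProg one zero s f w y k).map (mapInstr g) = compareProg (g one) (g zero)
      (fun i => g (s i)) (fun i => g (f i)) (fun i j => g (w i j)) (g y) k := by
  simp [compareProg, List.map_flatMap, mapInstr]

/-- `s ∧ ¬f` and `f ∧ ¬s` detect a difference in either direction, and the running verdict drops as
soon as one of them is set. Both the verdict and its negation are kept, one for each of the two
adversaries. -/
theorem compareProg_spec {Z : W → Bool} {one zero : W} {s f : ℕ → W} {w : ℕ → ℕ → W} {y : W}
    {k : ℕ} (hZ : ∀ τ ∈ compareProg one zero s f w y k, Z τ.2.2 = (Z τ.1 && !Z τ.2.1))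
    (hone : Z one = true) (hzero : Z zero = false) :
    Z (w k 3) = decide (∀ i < k, Z (s i) = Z (f i)) ∧
      Z y = !decide (∀ i < k, Z (s i) = Z (f i)) := by
  have hmem (i : ℕ) (hi : i < k) (τ) (hτ : τ ∈ [(s i, f i, w (i + 1) 0), (f i, s i, w (i + 1) 1),
      (w i 3, w (i + 1) 0, w (i + 1) 2), (w (i + 1) 2, w (i + 1) 1, w (i + 1) 3)]) :
      Z τ.2.2 = (Z τ.1 && !Z τ.2.1) := by
    refine hZ τ ?_
    simp only [compareProg, List.mem_append, List.mem_flatMap, List.mem_range]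
    exact Or.inl (Or.inr ⟨i, hi, hτ⟩)
  have key (i : ℕ) (hi : i ≤ k) : Z (w i 3) = decide (∀ j < i, Z (s j) = Z (f j)) := by
    induction i with
    | zero =>
      have := hZ (one, zero, w 0 3) (by simp [compareProg])
      simp [this, hone, hzero]
    | succ i ih =>
      have f₀ := hmem i hi (_, _, w (i + 1) 0) (List.mem_cons_self ..)
      have f₁ := hmem i hi (_, _, w (i + 1) 1) (List.mem_cons_of_mem _ (List.mem_cons_self ..))
      have f₂ := hmem i hi (_, _, w (i + 1) 2)
        (List.mem_cons_of_mem _ (List.mem_cons_of_mem _ (List.mem_cons_self ..)))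
      have f₃ := hmem i hi (_, _, w (i + 1) 3) (List.mem_cons_of_mem _ (List.mem_cons_of_mem _
        (List.mem_cons_of_mem _ (List.mem_cons_self ..))))
      dsimp only at f₀ f₁ f₂ f₃
      rw [f₃, f₂, f₁, f₀, ih (by omega), Bool.eq_iff_iff]
      simp only [Nat.lt_succ_iff_lt_or_eq, or_imp, forall_and, forall_eq]
      cases Z (s i) <;> cases Z (f i) <;> simp
  have hy := hZ (one, w k 3, y) (by simp [compareProg])
  dsimp only at hy
  rw [hy, hone, key k le_rfl]
  exact ⟨rfl, rfl⟩

theorem straight_compareProg {rk : W → ℕ} {one zero : W} {s f : ℕ → W} {w : ℕ → ℕ → W} {y : W}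
    {k B N hi : ℕ} (hone : rk one < B) (hzero : rk zero < B) (hoz : rk one ≠ rk zero)
    (hs : ∀ i < k, rk (s i) < B ∧ rk (f i) < B ∧ rk (s i) ≠ rk (f i)) (hN : 4 ≤ N)
    (hw : ∀ i ≤ k, ∀ j < 4, rk (w i j) = B + i * N + j)
    (hy : B + (k + 1) * N ≤ rk y ∧ rk y < hi) :
    Straight rk 0 B hi (compareProg one zero s f w y k) := by
  have h := Straight.flatMap_range (rk := rk) (L := 0) (f := fun i =>
    [(s i, f i, w (i + 1) 0), (f i, s i, w (i + 1) 1), (w i 3, w (i + 1) 0, w (i + 1) 2),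
      (w (i + 1) 2, w (i + 1) 1, w (i + 1) 3)]) (fun i => B + (i + 1) * N) k fun i hi => ?_
  · have h₁ := hw 0 (by omega) 3 (by omega)
    have h₂ := hw k le_rfl 3 (by omega)
    have h₃ : (k + 1) * N = k * N + N := Nat.succ_mul k N
    have h₄ : (0 + 1) * N = N := by ring
    rw [h₄] at h
    refine Straight.append (mid := B + (k + 1) * N) (Straight.append (mid := B + N)
      (Straight.singleton ?_) h) (Straight.singleton ?_)
    · dsimp only
      omega
    · dsimp only
      omega
  · have h₀ := hw i (by omega) 3 (by omega)
    have h₁ := hw (i + 1) (by omega) 0 (by omega)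
    have h₂ := hw (i + 1) (by omega) 1 (by omega)
    have h₃ := hw (i + 1) (by omega) 2 (by omega)
    have h₄ := hw (i + 1) (by omega) 3 (by omega)
    have h₅ := hs i hi
    have h₆ : (i + 1) * N = i * N + N := Nat.succ_mul i N
    have h₇ : (i + 1 + 1) * N = i * N + N + N := by ring
    refine Straight.append (P := [_]) (mid := B + (i + 1) * N + 1)
      (Straight.singleton ?_) (Straight.append (P := [_]) (mid := B + (i + 1) * N + 2)
      (Straight.singleton ?_) (Straight.append (P := [_]) (mid := B + (i + 1) * N + 3)
      (Straight.singleton ?_) (Straight.singleton ?_)))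
    all_goals
      dsimp only
      omega

end Programs

/-! ### An indistinguishability adversary from a semantic security adversary -/

namespace IndOfSem

/-- The side of the squares. -/
abbrev side (φ : TemplateFormat) (ℓ mem : ℕ) : ℕ :=
  mem + 2 * (φ.coins + φ.hLen + φ.fLen + φ.sampGates + φ.hGates + φ.fGates + 2 * ℓ) + 4

/-- The largest address. -/
abbrev top (N : ℕ) : ℕ := 11 * (N * N)

section

variable {ℓ c : ℕ} {φ : TemplateFormat}
variable (A : TwoStage ℓ c (φ.Idx ℓ) (Fin φ.hLen ⊕ Fin c) φ.fLen)

/-- The side of the squares for `A`. -/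
abbrev sd : ℕ := side φ ℓ A.mem

/-- The wires of the first stage. -/
abbrev PreWire : Type := (Fin ℓ ⊕ Fin ℓ) ⊕ Fin (top (sd A) + 1)

/-- The wires of the second stage. -/
abbrev PostWire : Type := (Fin (top (sd A) + 1) ⊕ Fin c) ⊕ Fin A.anc

/-- A memory cell in the first stage. -/
abbrev preCell (k : ℕ) : PreWire A := .inr (addr _ k)

/-- A memory cell in the second stage. -/
abbrev postCell (k : ℕ) : PostWire A := .inl (.inl (addr _ k))

/-- The memory consists of eleven squares of this side: the memory of `A` (0), the circuits for the
sampler, `h` and `f` (1 to 3), the coins (4), the constants (5), the evaluations of the three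
circuits (6 to 8), the comparison (9) and its negated result (10). The side leaves room for `A.mem`
cells in a row and for the block `2 * (a + G) + 3` of each gate. -/
theorem sd_eq : sd A = A.mem + 2 * (φ.coins + φ.hLen + φ.fLen + φ.sampGates + φ.hGates +
    φ.fGates + 2 * ℓ) + 4 := rfl

theorem cell_inj {r t j r' t' j' : ℕ} (hr : r < 11) (ht : t < sd A) (hj : j < sd A) (hr' : r' < 11)
    (ht' : t' < sd A) (hj' : j' < sd A)
    (h : addr (top (sd A)) (loc (sd A) r t j) = addr (top (sd A)) (loc (sd A) r' t' j')) :
    r = r' ∧ t = t' ∧ j = j' :=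
  loc_inj ht hj ht' hj' ((addr_inj (loc_lt hr ht hj).le (loc_lt hr' ht' hj').le).1 h)

/-- The embedding of the wires of `A` in the first stage. -/
def preEmb : φ.Idx ℓ ⊕ Fin A.mem ↪ PreWire A where
  toFun := Sum.elim (Sum.elim (Sum.elim (fun p => preCell A (loc (sd A) 1 p.1 p.2))
    fun p => preCell A (loc (sd A) 2 p.1 p.2)) fun p => preCell A (loc (sd A) 3 p.1 p.2))
    fun i => preCell A (loc (sd A) 0 0 i)
  inj' := by
    rintro (((⟨i, i'⟩ | ⟨i, i'⟩) | ⟨i, i'⟩) | i) (((⟨j, j'⟩ | ⟨j, j'⟩) | ⟨j, j'⟩) | j) h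
    all_goals
      have := i.isLt
      have := j.isLt
      try have := i'.isLt
      try have := j'.isLt
      have h' := cell_inj A (by omega) (by have := sd_eq A; omega) (by have := sd_eq A; omega)
        (by omega) (by have := sd_eq A; omega) (by have := sd_eq A; omega)
        (Sum.inr_injective h)
      try dsimp only at h'
      simp only [Sum.inl.injEq, Sum.inr.injEq, Prod.mk.injEq, Fin.ext_iff, reduceCtorEq]
      omega

/-- The embedding of the wires of `A` in the second stage. -/
def postEmb : (Fin A.mem ⊕ (Fin φ.hLen ⊕ Fin c)) ⊕ Fin A.anc ↪ PostWire A where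
  toFun := Sum.elim (Sum.elim (fun i => postCell A (loc (sd A) 0 0 i)) (Sum.elim
    (fun i => postCell A (loc (sd A) 7 (φ.hGates + i) (sd A - 1))) fun j => .inl (.inr j))) .inr
  inj' := by
    rintro ((i | i | i) | i) ((j | j | j) | j) h
    all_goals
      have := i.isLt
      have := j.isLt
      first
        | (cases h; done)
        | (cases h; rfl)
        | have h' := cell_inj A (by omega) (by have := sd_eq A; omega)
            (by have := sd_eq A; omega) (by omega) (by have := sd_eq A; omega)
            (by have := sd_eq A; omega) (Sum.inl_injective (Sum.inl_injective h))
          simp only [Sum.inl.injEq, Sum.inr.injEq, Fin.ext_iff, reduceCtorEq]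
          omega

/-- The wires of the sampled message. -/
abbrev sampCell (i : ℕ) : PreWire A := preCell A (loc (sd A) 6 (φ.sampGates + i) (sd A - 1))

/-- The evaluation of the three circuits of the template. -/
def evalCircuits : List (PreWire A × PreWire A × PreWire A) :=
  squareProg (preCell A) (sd A) 1 (fun j => preCell A (loc (sd A) 4 0 j)) φ.coins
      (φ.sampGates + ℓ) ++
    (squareProg (preCell A) (sd A) 2 (sampCell A) ℓ (φ.hGates + φ.hLen) ++
      squareProg (preCell A) (sd A) 3 (sampCell A) ℓ (φ.fGates + φ.fLen))

/-- The output of the sampled message. -/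
def copyMessage : List (PreWire A × PreWire A × PreWire A) :=
  (List.finRange ℓ).map fun i : Fin ℓ => (sampCell A i, preCell A (loc (sd A) 5 0 1), .inl (.inr i))

/-- The positions of the template. -/
def measured : List (PreWire A) :=
  (List.range (3 * (sd A * sd A))).map fun k => preCell A (sd A * sd A + k)

/-- The wires of the coins. -/
def coinEmb : Fin φ.coins ↪ PreWire A :=
  ⟨fun j => preCell A (loc (sd A) 4 0 j), fun i j h => by
    have := i.isLt
    have := j.isLt
    have h' := cell_inj A (by omega) (by have := sd_eq A; omega) (by have := sd_eq A; omega)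
      (by omega) (by have := sd_eq A; omega) (by have := sd_eq A; omega) (Sum.inr_injective h)
    exact Fin.ext h'.2.2⟩

/-- The wires of the string output by `A`. -/
def guess (i : ℕ) : PostWire A :=
  if h : i < φ.fLen then postEmb A (A.out ⟨i, h⟩) else postCell A 0

/-- The comparison of the output of `A` with the target value. -/
def postProg : List (PostWire A × PostWire A × PostWire A) :=
  compareProg (postCell A (loc (sd A) 5 0 0)) (postCell A (loc (sd A) 5 0 1)) (guess A)
    (fun i => postCell A (loc (sd A) 8 (φ.fGates + i) (sd A - 1)))
    (fun i j => postCell A (loc (sd A) 9 i j)) (postCell A (loc (sd A) 10 0 0)) φ.fLen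

/-- The indistinguishability adversary that outputs the messages zero and `m`, where `m` is
sampled from the template output by `A`, and then tells whether `A` wins (or, if `fl`, whether
`A` loses). -/
abbrev adversary (fl : Bool) : TwoStage ℓ c (Fin ℓ ⊕ Fin ℓ) (Fin c) 1 where
  mem := top (sd A) + 1
  anc := A.anc
  -- The template is measured first; then the coins are tossed and the three circuits evaluated. The
  -- wires of the first message are never used, so it is zero.
  pre := A.pre.map (Gate.map (preEmb A)) ++ measureAll (measured A) ++
    [.not (preCell A (loc (sd A) 5 0 0))] ++
    ((List.finRange φ.coins).flatMap fun j => tossCoin (coinEmb A j)) ++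
    (evalCircuits A ++ copyMessage A).flatMap andNot
  post := A.post.map (Gate.map (postEmb A)) ++ (postProg A).flatMap andNot
  out := ⟨fun _ => postCell A (bif fl then loc (sd A) 10 0 0 else loc (sd A) 9 φ.fLen 3),
    fun i j _ => Subsingleton.elim i j⟩
  post_noDecrypt g hg := by
    rcases List.mem_append.1 hg with h | h
    · obtain ⟨g', h', rfl⟩ := List.mem_map.1 h
      rw [Gate.map_isDecrypt]
      exact A.post_noDecrypt g' h'
    · obtain ⟨τ, -, h'⟩ := List.mem_flatMap.1 h
      exact andNot_noDecrypt τ g h'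

/-- The rank of a wire in the first stage. -/
def preRank : PreWire A → ℕ := Sum.elim (Sum.elim (fun _ => 0) fun i => top (sd A) + 1 + i) Fin.val

/-- The rank of a wire in the second stage. -/
def postRank : PostWire A → ℕ := Sum.elim (Sum.elim (fun i => i.val + 1) fun _ => 0) fun _ => 0

theorem preRank_cell {r t j : ℕ} (hr : r < 11) (ht : t < sd A) (hj : j < sd A) :
    preRank A (preCell A (loc (sd A) r t j)) = loc (sd A) r t j :=
  val_addr (loc_lt hr ht hj).le

theorem postRank_cell {r t j : ℕ} (hr : r < 11) (ht : t < sd A) (hj : j < sd A) :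
    postRank A (postCell A (loc (sd A) r t j)) = loc (sd A) r t j + 1 :=
  congrArg (· + 1) (val_addr (loc_lt hr ht hj).le)

theorem straight_evalCircuits : Straight (preRank A) (sd A * sd A) (6 * (sd A * sd A))
    (9 * (sd A * sd A)) (evalCircuits A) := by
  have hx (i) (hi : i < 11 * (sd A * sd A)) : preRank A (preCell A i) = i := val_addr hi.le
  have h₁ (j) (hj : j < φ.coins) := preRank_cell A (show 4 < 11 by omega)
    (show 0 < sd A by have := sd_eq A; omega) (show j < sd A by have := sd_eq A; omega)
  have h₂ (j) (hj : j < ℓ) : 6 * (sd A * sd A) ≤ preRank A (sampCell A j) ∧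
      preRank A (sampCell A j) < 7 * (sd A * sd A) := by
    have h₃ : φ.sampGates + j < sd A := by have := sd_eq A; omega
    have h₄ : sd A - 1 < sd A := by have := sd_eq A; omega
    rw [preRank_cell A (by omega) h₃ h₄]
    exact ⟨le_loc le_rfl _ _, loc_lt (by omega) h₃ h₄⟩
  refine Straight.append (straight_squareProg hx (by omega) (by omega)
    (by have := sd_eq A; omega) fun j hj => ?_)
    (Straight.append (straight_squareProg hx (by omega) (by omega) (by have := sd_eq A; omega)
    fun j hj => ?_) (straight_squareProg hx (by omega) (by omega) (by have := sd_eq A; omega)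
    fun j hj => ?_))
  · rw [h₁ j hj]
    exact ⟨le_loc le_rfl _ _, loc_lt (by omega) (by have := sd_eq A; omega)
      (by have := sd_eq A; omega)⟩
  · have := h₂ j hj
    omega
  · have := h₂ j hj
    omega

theorem straight_copyMessage : Straight (preRank A) (sd A * sd A) (top (sd A) + 1)
    (top (sd A) + 1 + ℓ) (copyMessage A) := by
  refine ⟨by omega, fun τ hτ => ?_, ?_⟩
  · obtain ⟨i, -, rfl⟩ := List.mem_map.1 hτ
    have h₃ : φ.sampGates + i.val < sd A := by have := i.isLt; have := sd_eq A; omega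
    have h₄ : sd A - 1 < sd A := by have := sd_eq A; omega
    have h₅ : 0 < sd A := by have := sd_eq A; omega
    have h₆ : 1 < sd A := by have := sd_eq A; omega
    have h₇ : preRank A (.inl (.inr i)) = top (sd A) + 1 + i := rfl
    dsimp only
    rw [h₇, preRank_cell A (by omega) h₃ h₄, preRank_cell A (by omega) h₅ h₆]
    have := le_loc (N := sd A) (show 6 ≤ 6 by omega) (φ.sampGates + i) (sd A - 1)
    have := loc_lt (show 6 < 7 by omega) h₃ h₄
    have := le_loc (N := sd A) (show 5 ≤ 5 by omega) 0 1
    have := loc_lt (show 5 < 6 by omega) h₅ h₆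
    have := i.isLt
    have htop : top (sd A) = 11 * (sd A * sd A) := rfl
    omega
  · refine List.pairwise_map.2 ((List.pairwise_lt_finRange ℓ).imp fun {i j} h => ?_)
    exact Nat.add_lt_add_left h _

theorem straight_preProg : Straight (preRank A) (sd A * sd A) (6 * (sd A * sd A))
    (top (sd A) + 1 + ℓ) (evalCircuits A ++ copyMessage A) :=
  (straight_evalCircuits A).append ((straight_copyMessage A).mono (by
    have htop : top (sd A) = 11 * (sd A * sd A) := rfl
    omega) le_rfl)

/-- The highest wires of `A` are those of its input `h m`, which are the output cells of the second
circuit in square 7. The targets and the comparison lie above them. -/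
theorem postRank_postEmb (x) : postRank A (postEmb A x) ≤ 8 * (sd A * sd A) := by
  rcases x with (i | i | i) | i
  · change postRank A (postCell A _) ≤ _
    have h₁ : i.val < sd A := by have := i.isLt; have := sd_eq A; omega
    have h₂ : 0 < sd A := by omega
    rw [postRank_cell A (by omega) h₂ h₁]
    exact loc_lt (by omega) h₂ h₁
  · change postRank A (postCell A _) ≤ _
    have h₁ : φ.hGates + i.val < sd A := by have := i.isLt; have := sd_eq A; omega
    have h₂ : sd A - 1 < sd A := by omega
    rw [postRank_cell A (by omega) h₁ h₂]
    exact loc_lt (by omega) h₁ h₂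
  · exact Nat.zero_le _
  · exact Nat.zero_le _

theorem straight_postProg : Straight (postRank A) 0 (9 * (sd A * sd A) + 1) (top (sd A) + 1)
    (postProg A) := by
  have h₀ : 0 < sd A := by have := sd_eq A; omega
  have h₁ : 1 < sd A := by have := sd_eq A; omega
  have hone := loc_lt (show 5 < 6 by omega) h₀ h₀
  have hzero := loc_lt (show 5 < 6 by omega) h₀ h₁
  refine straight_compareProg (N := sd A) ?_ ?_ ?_ (fun i hi => ?_) (by have := sd_eq A; omega)
    (fun i hi j hj => ?_) ?_
  · rw [postRank_cell A (by omega) h₀ h₀]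
    omega
  · rw [postRank_cell A (by omega) h₀ h₁]
    omega
  · rw [postRank_cell A (by omega) h₀ h₀, postRank_cell A (by omega) h₀ h₁]
    simp [loc]
  · have h₂ : φ.fGates + i < sd A := by have := sd_eq A; omega
    have h₃ : sd A - 1 < sd A := by omega
    rw [postRank_cell A (by omega) h₂ h₃, guess, dif_pos hi]
    have := postRank_postEmb A (A.out ⟨i, hi⟩)
    have := loc_lt (show 8 < 9 by omega) h₂ h₃
    have := le_loc (N := sd A) (show 8 ≤ 8 by omega) (φ.fGates + i) (sd A - 1)
    omega
  · rw [postRank_cell A (by omega) (by have := sd_eq A; omega) (by have := sd_eq A; omega), loc]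
    omega
  · rw [postRank_cell A (by omega) h₀ h₀]
    have h₂ : (φ.fLen + 1) * sd A ≤ sd A * sd A :=
      Nat.mul_le_mul_right _ (by have := sd_eq A; omega)
    have := le_loc (N := sd A) (show 10 ≤ 10 by omega) 0 0
    have := loc_lt (show 10 < 11 by omega) h₀ h₀
    have htop : top (sd A) = 11 * (sd A * sd A) := rfl
    omega

end

end IndOfSem

/-! ### The winning probability of the indistinguishability adversary -/

namespace IndOfSem

section Semantics

variable {ℓ c R : ℕ} {φ : TemplateFormat}
variable (A : TwoStage ℓ c (φ.Idx ℓ) (Fin φ.hLen ⊕ Fin c) φ.fLen)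
variable (E : Bits R → Bits ℓ → Bits c) (D : Bits c → Bits ℓ)

/-- The embedding of the memory of `A`. -/
def memEmb : Fin A.mem ↪ Fin (top (sd A) + 1) :=
  ⟨fun i => addr _ (loc (sd A) 0 0 i), fun i j h =>
    Sum.inr_injective ((preEmb A).injective (a₁ := .inr i) (a₂ := .inr j) (congrArg Sum.inr h))⟩

/-- The wires outside of the memory of `A` before the evaluation of the circuits. -/
def start (t : Template φ ℓ) (u : Bits φ.coins) : PreWire A → Bool :=
  put (coinEmb A) (Function.update (put (Function.Embedding.inl.trans (preEmb A))
    (fun _ => false) t) (preCell A (loc (sd A) 5 0 0)) true) u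

/-- The wires outside of the memory of `A` after the first stage. -/
def final (t : Template φ ℓ) (u : Bits φ.coins) : PreWire A → Bool :=
  evalProg (evalCircuits A ++ copyMessage A) (start A t u)

theorem preRank_coinEmb (j) : 4 * (sd A * sd A) ≤ preRank A (coinEmb A j) ∧
    preRank A (coinEmb A j) < 5 * (sd A * sd A) := by
  have h₁ : j.val < sd A := by have := j.isLt; have := sd_eq A; omega
  have h₂ : 0 < sd A := by omega
  change _ ≤ preRank A (preCell A _) ∧ preRank A (preCell A _) < _
  rw [preRank_cell A (by omega) h₂ h₁]
  exact ⟨le_loc le_rfl _ _, loc_lt (by omega) h₂ h₁⟩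

theorem preRank_one : 5 * (sd A * sd A) = preRank A (preCell A (loc (sd A) 5 0 0)) := by
  have h₀ : 0 < sd A := by have := sd_eq A; omega
  rw [preRank_cell A (by omega) h₀ h₀]
  simp [loc]

theorem preRank_inr (i) : preRank A (preEmb A (.inr i)) < sd A * sd A := by
  have h₁ : i.val < sd A := by have := i.isLt; have := sd_eq A; omega
  have h₂ : 0 < sd A := by omega
  change preRank A (preCell A _) < _
  rw [preRank_cell A (by omega) h₂ h₁]
  have := loc_lt (show 0 < 1 by omega) h₂ h₁
  omega

theorem preEmb_inl (x) : ∃ r t j, 1 ≤ r ∧ r < 4 ∧ t < sd A ∧ j < sd A ∧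
    preEmb A (.inl x) = preCell A (loc (sd A) r t j) := by
  have := sd_eq A
  rcases x with (⟨t, j⟩ | ⟨t, j⟩) | ⟨t, j⟩
  · exact ⟨1, t, j, by omega, by omega, by omega, by omega, rfl⟩
  · exact ⟨2, t, j, by omega, by omega, by omega, by omega, rfl⟩
  · exact ⟨3, t, j, by omega, by omega, by omega, by omega, rfl⟩

theorem preRank_inl (x) : sd A * sd A ≤ preRank A (preEmb A (.inl x)) ∧
    preRank A (preEmb A (.inl x)) < 4 * (sd A * sd A) := by
  obtain ⟨r, t, j, hr, hr', ht, hj, h⟩ := preEmb_inl A x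
  rw [h, preRank_cell A (by omega) ht hj]
  have := le_loc (N := sd A) hr t j
  exact ⟨by omega, loc_lt hr' ht hj⟩

/-- The state is a mixture over the measured templates and the tossed coins; given both, the
evaluation is deterministic and does not touch the memory of `A`. -/
theorem run_pre (fl : Bool) : run E D (adversary A fl).pre (ket fun _ => false) =
    ∑ p : Template φ ℓ × Bits φ.coins, ((((2 : ℝ) ^ φ.coins)⁻¹ : ℝ) : ℂ) •
      inject ((memEmb A).trans Function.Embedding.inr) (final A p.1 p.2) (A.firstStage E D p.1) := by
  have he : Function.Embedding.inr.trans (preEmb A) =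
    (memEmb A).trans Function.Embedding.inr := rfl
  have hrk (i) : preRank A (((memEmb A).trans Function.Embedding.inr : Fin A.mem ↪ PreWire A) i) <
      sd A * sd A := preRank_inr A i
  change run E D (A.pre.map (Gate.map (preEmb A)) ++ measureAll (measured A) ++
    [.not (preCell A (loc (sd A) 5 0 0))] ++
    ((List.finRange φ.coins).flatMap fun j => tossCoin (coinEmb A j)) ++
    (evalCircuits A ++ copyMessage A).flatMap andNot) _ = _
  rw [run_append, run_append, run_append, A.run_pre_measure E D, run_sum, run_sum, run_sum,
    Fintype.sum_prod_type]
  · refine Finset.sum_congr rfl fun t _ => ?_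
    have h₁ : put (Function.Embedding.inl.trans (preEmb A)) (fun _ => false) t
        (preCell A (loc (sd A) 5 0 0)) = false := by
      refine put_of_forall_ne fun x h => ?_
      have := preRank_inl A x
      have h' := preRank_one A
      rw [← h] at h'
      change _ = preRank A (preEmb A (.inl x)) at h'
      omega
    rw [he, run_not_inject E D, h₁, Bool.not_false, run_coins E D, run_sum]
    · refine Finset.sum_congr rfl fun u _ => ?_
      rw [run_smul, run_prog E D (straight_preProg A).ne]
      congr 1
      refine conj_basisMap_inject (fun p => ?_) _
      refine evalProg_put _ _ _ fun τ hτ i => ?_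
      have h := (straight_preProg A).wires τ hτ
      have hi := hrk i
      refine ⟨?_, ?_, ?_⟩ <;> intro h' <;> rw [h'] at hi <;> omega
    · intro i j h
      have := hrk i
      have := preRank_coinEmb A j
      rw [h] at *
      omega
    · intro j
      have := preRank_coinEmb A j
      have h₂ := preRank_one A
      rw [Function.update_of_ne fun h => by rw [← h] at h₂; omega]
      refine put_of_forall_ne fun x h => ?_
      have := preRank_inl A x
      have h₃ : preRank A (preEmb A (.inl x)) = _ := congrArg (preRank A) h
      omega
    · intro i h
      have := hrk i
      have h₂ := preRank_one A
      rw [← h] at h₂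
      omega
  -- The squares 1 to 3 are measured entirely. They contain all positions of the template, and their
  -- other cells are zero.
  · intro x
    obtain ⟨r, t, j, hr, hr', ht, hj, h⟩ := preEmb_inl A x
    have h₁ := le_loc (N := sd A) hr t j
    have h₂ := loc_lt hr' ht hj
    refine List.mem_map.2 ⟨loc (sd A) r t j - sd A * sd A, List.mem_range.2 (by omega), ?_⟩
    rw [h, Nat.add_sub_cancel' (by omega)]
  · intro i h
    obtain ⟨k, hk, h⟩ := List.mem_map.1 h
    have h₁ := preRank_inr A i
    have h₂ := List.mem_range.1 hk
    rw [← h] at h₁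
    change (addr (top (sd A)) _).val < _ at h₁
    rw [val_addr (by dsimp only [top]; omega)] at h₁
    omega

theorem start_of_rank (t : Template φ ℓ) (u : Bits φ.coins) {w : PreWire A}
    (hw : 5 * (sd A * sd A) < preRank A w) : start A t u w = false := by
  rw [start, put_of_forall_ne, Function.update_of_ne, put_of_forall_ne]
  · intro x h
    have := preRank_inl A x
    rw [← h] at hw
    change _ < preRank A (preEmb A (.inl x)) at hw
    omega
  · intro h
    have := preRank_one A
    rw [← h] at this
    omega
  · intro j h
    have := preRank_coinEmb A j
    rw [h] at this
    omega

theorem start_inl (t : Template φ ℓ) (u : Bits φ.coins) (x) : start A t u (.inl x) = false := by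
  rw [start, put_of_forall_ne, Function.update_of_ne Sum.inl_ne_inr, put_of_forall_ne]
  · rintro ((i | i) | i) h <;> exact Sum.inr_ne_inl h
  · intro j h
    exact Sum.inr_ne_inl h

theorem start_preEmb (t : Template φ ℓ) (u : Bits φ.coins) (x) :
    start A t u (preEmb A (.inl x)) = t x := by
  have := preRank_inl A x
  rw [start, put_of_forall_ne, Function.update_of_ne]
  · exact put_apply (Function.Embedding.inl.trans (preEmb A)) _ t x
  · intro h
    have := preRank_one A
    rw [← h] at this
    omega
  · intro j h
    have := preRank_coinEmb A j
    rw [h] at this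
    omega

theorem start_one (t : Template φ ℓ) (u : Bits φ.coins) :
    start A t u (preCell A (loc (sd A) 5 0 0)) = true := by
  rw [start, put_of_forall_ne, Function.update_self]
  intro j h
  have := preRank_coinEmb A j
  have := preRank_one A
  rw [← h] at this
  omega

/-- As the programs are single-assignment, the final state satisfies all instructions at once. The
three evaluations are then read off in turn, the sampler first because its output is the input of
the other two. -/
theorem final_spec (t : Template φ ℓ) (u : Bits φ.coins) :
    final A t u ∘ Sum.inl = Sum.elim (fun _ => false) (t.samp u) ∧
    final A t u (preCell A (loc (sd A) 5 0 0)) = true ∧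
    final A t u (preCell A (loc (sd A) 5 0 1)) = false ∧
    (∀ i : Fin φ.hLen, final A t u (preCell A (loc (sd A) 7 (φ.hGates + i) (sd A - 1))) =
      t.h (t.samp u) i) ∧
    (∀ i : Fin φ.fLen, final A t u (preCell A (loc (sd A) 8 (φ.fGates + i) (sd A - 1))) =
      t.f (t.samp u) i) ∧
    ∀ k, 9 * (sd A * sd A) ≤ k → k ≤ top (sd A) → final A t u (preCell A k) = false := by
  have hsd := sd_eq A
  have h₀ : 0 < sd A := by omega
  have h₀' : 1 < sd A := by omega
  have hzero : preRank A (preCell A (loc (sd A) 5 0 1)) = 5 * (sd A * sd A) + 1 := by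
    rw [preRank_cell A (by omega) h₀ h₀']
    simp [loc]
  have hsq : 1 < sd A * sd A := Nat.one_lt_mul_iff.2 ⟨h₀, h₀, Or.inl h₀'⟩
  have hone := preRank_one A
  obtain ⟨h₁, h₂⟩ := (straight_preProg A).evalProg (z := start A t u) fun w h h' =>
    start_of_rank A t u (by omega)
  -- Only the squares 6 to 8 and the second message are ever written.
  have h₃ (w) (hw : preRank A w < 6 * (sd A * sd A) ∨
      9 * (sd A * sd A) ≤ preRank A w ∧ preRank A w < top (sd A) + 1) :
      final A t u w = start A t u w := by
    refine h₂ w fun τ hτ h => ?_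
    rcases List.mem_append.1 hτ with hτ | hτ
    · have := (straight_evalCircuits A).wires τ hτ
      rw [h] at this
      omega
    · have := (straight_copyMessage A).wires τ hτ
      rw [h] at this
      have htop : top (sd A) = 11 * (sd A * sd A) := rfl
      omega
  have e₁ : final A t u (preCell A (loc (sd A) 5 0 0)) = true := by
    rw [h₃ _ (Or.inl (by omega)), start_one]
  have e₂ : final A t u (preCell A (loc (sd A) 5 0 1)) = false := by
    rw [h₃ _ (Or.inl (by omega)), start_of_rank A t u (by omega)]
  have e₃ (x) : final A t u (preEmb A (.inl x)) = t x := by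
    have := preRank_inl A x
    rw [h₃ _ (Or.inl (by omega)), start_preEmb]
  have e₄ (j) : final A t u (coinEmb A j) = u j := by
    have := preRank_coinEmb A j
    rw [h₃ _ (Or.inl (by omega))]
    exact put_apply ..
  have e₅ (i : Fin ℓ) : final A t u (sampCell A i) = t.samp u i :=
    eval_of_circProg (fun i => t (.inl (.inl i))) u (fun τ hτ => h₁ τ (List.mem_append_left _
      (List.mem_append_left _ hτ))) e₁ e₂ e₄ (fun p => e₃ (.inl (.inl p))) i
  have e₆ (i : Fin φ.hLen) := eval_of_circProg (fun i => t (.inl (.inr i))) (t.samp u)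
    (fun τ hτ => h₁ τ (List.mem_append_left _ (List.mem_append_right _
      (List.mem_append_left _ hτ)))) e₁ e₂ e₅ (fun p => e₃ (.inl (.inr p))) i
  have e₇ (i : Fin φ.fLen) := eval_of_circProg (fun i => t (.inr i)) (t.samp u)
    (fun τ hτ => h₁ τ (List.mem_append_left _ (List.mem_append_right _
      (List.mem_append_right _ hτ)))) e₁ e₂ e₅ (fun p => e₃ (.inr p)) i
  refine ⟨?_, e₁, e₂, e₆, e₇, fun k hk hk' => ?_⟩
  · funext x
    rcases x with x | x
    · change final A t u (.inl (.inl x)) = false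
      rw [h₃ _ (Or.inl (by simp only [preRank, Sum.elim_inl]; omega)), start_inl]
    · have := h₁ (sampCell A x, preCell A (loc (sd A) 5 0 1), .inl (.inr x))
        (List.mem_append_right _ (List.mem_map.2 ⟨x, List.mem_finRange x, rfl⟩))
      refine this.trans ?_
      change (final A t u (sampCell A x) && !final A t u (preCell A (loc (sd A) 5 0 1))) = _
      rw [e₂, e₅, Bool.not_false, Bool.and_true]
      rfl
  · have hrk : preRank A (preCell A k) = k := val_addr hk'
    rw [h₃ _ (Or.inr (by omega)), start_of_rank A t u (by omega)]

/-- The output wire holds the verdict of the comparison, negated if `fl` is set, so the answer is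
`b` for exactly the strings `s` in the sum. -/
theorem secondProb_adversary (fl b : Bool) (t : Template φ ℓ) (u : Bits φ.coins) (v : Bits c)
    (σ : Op (Fin A.mem)) :
    (adversary A fl).secondProb E D (inject (memEmb A) (final A t u ∘ Sum.inr) σ) v (fun _ => b) =
      ∑ s : Bits φ.fLen, if (decide (s = t.f (t.samp u)) ^^ fl) = b then
        A.secondProb E D σ (Sum.elim (t.h (t.samp u)) v) s else 0 := by
  have hsd := sd_eq A
  have h₀ : 0 < sd A := by omega
  have h₀' : 1 < sd A := by omega
  obtain ⟨-, hone, hzero, hh, hf, hfree⟩ := final_spec A t u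
  have hS := straight_postProg A
  refine TwoStage.secondProb_prog E D A (adversary A fl) (memEmb A) (postEmb A) _
    (Sum.elim (t.h (t.samp u)) v) _
    (fun i => rfl) (by rintro (i | i); exacts [hh i, rfl]) (fun i => rfl) hS.ne rfl _
    (fun s => (decide (s = t.f (t.samp u)) ^^ fl) = b) (fun y hy => ?_) σ
  -- The second stage of `A` may change its memory in square 0 and its input wires in square 7, but
  -- neither the constants and targets in the squares 5 and 8 nor the free squares 9 and 10.
  have hcell (k) (hk : 9 * (sd A * sd A) ≤ k ∨ ∃ r t j, (r = 5 ∨ r = 8) ∧ t < sd A ∧ j < sd A ∧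
      k = loc (sd A) r t j) (hk' : k ≤ top (sd A)) :
      y (postCell A k) = final A t u (preCell A k) := by
    refine hy _ ?_
    rintro ((x | x | x) | x) h
    · have h := Sum.inl_injective (Sum.inl_injective h)
      have hx : x.val < sd A := by have := x.isLt; omega
      rcases hk with hk | ⟨r, t, j, hr, ht, hj, rfl⟩
      · have := loc_lt (show 0 < 9 by omega) h₀ hx
        have := (addr_inj (loc_lt (by omega) h₀ hx).le hk').1 h
        omega
      · have := cell_inj A (by omega) h₀ hx (by omega) ht hj h
        omega
    · have h := Sum.inl_injective (Sum.inl_injective h)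
      have hx : φ.hGates + x.val < sd A := by have := x.isLt; omega
      have hx' : sd A - 1 < sd A := by omega
      rcases hk with hk | ⟨r, t, j, hr, ht, hj, rfl⟩
      · have := loc_lt (show 7 < 9 by omega) hx hx'
        have := (addr_inj (loc_lt (by omega) hx hx').le hk').1 h
        omega
      · have := cell_inj A (by omega) hx hx' (by omega) ht hj h
        omega
    · exact Sum.inr_ne_inl (Sum.inl_injective h)
    · exact Sum.inr_ne_inl h
  obtain ⟨h₁, h₂⟩ := hS.evalProg (z := y) fun w h h' => by
    rcases w with (⟨k, hk⟩ | i) | i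
    · have : postCell A k = .inl (.inl ⟨k, hk⟩) := by
        simp only [postCell, addr, Nat.min_eq_left (show k ≤ top (sd A) by omega)]
      simp only [postRank, Sum.elim_inl] at h
      rw [← this, hcell k (Or.inl (by omega)) (by omega), hfree k (by omega) (by omega)]
    · simp [postRank] at h
    · simp [postRank] at h
  set y' := evalProg (postProg A) y with hy'
  have h₃ (w) (hw : postRank A w < 9 * (sd A * sd A) + 1) : y' w = y w := by
    refine h₂ w fun τ hτ h => ?_
    have := hS.wires τ hτ
    rw [h] at this
    omega
  have hlow {r t j} (hr : r = 5 ∨ r = 8) (ht : t < sd A) (hj : j < sd A) :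
      y' (postCell A (loc (sd A) r t j)) = y (postCell A (loc (sd A) r t j)) := by
    refine h₃ _ ?_
    rw [postRank_cell A (by omega) ht hj]
    have := loc_lt (show r < 9 by omega) ht hj
    omega
  have hcell' {r t' j} (hr : r = 5 ∨ r = 8) (ht : t' < sd A) (hj : j < sd A) :
      y' (postCell A (loc (sd A) r t' j)) = final A t u (preCell A (loc (sd A) r t' j)) := by
    rw [hlow hr ht hj, hcell _ (Or.inr ⟨r, t', j, hr, ht, hj, rfl⟩) (loc_lt (by omega) ht hj).le]
  obtain ⟨e₁, e₂⟩ := compareProg_spec h₁ ((hcell' (by omega) h₀ h₀).trans hone)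
    ((hcell' (by omega) h₀ h₀').trans hzero)
  have e₃ : (∀ i < φ.fLen, y' (guess A i) =
      y' (postCell A (loc (sd A) 8 (φ.fGates + i) (sd A - 1)))) ↔
      (fun i => y (postEmb A (A.out i))) = t.f (t.samp u) := by
    rw [funext_iff, Fin.forall_iff]
    refine forall₂_congr fun i hi => ?_
    have := postRank_postEmb A (A.out ⟨i, hi⟩)
    rw [hcell' (by omega) (by omega) (by omega), guess, dif_pos hi, h₃ _ (by omega),
      ← hf ⟨i, hi⟩]
  rw [decide_eq_decide.2 e₃] at e₁ e₂
  have e₄ : y' ((adversary A fl).out 0) =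
      (decide ((fun i => y (postEmb A (A.out i))) = t.f (t.samp u)) ^^ fl) := by
    cases fl
    · rw [Bool.xor_false, ← e₁]
      rfl
    · rw [Bool.xor_true, ← e₂]
      rfl
  rw [← e₄]
  exact ⟨fun h => congrFun h 0, fun h => funext fun i => h⟩

/-- One of the two messages that the adversary outputs. -/
theorem choose_final (t : Template φ ℓ) (u : Bits φ.coins) (b : Bool) :
    choose (final A t u ∘ Sum.inl) b = if b then t.samp u else fun _ => false := by
  rw [(final_spec A t u).1]
  cases b <;> rfl

/-- The probability that `A` wins, when the ciphertext is an encryption of the message, or of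
zero if `b` is false. -/
def winProb (b : Bool) : ℝ := ∑ t : Template φ ℓ, avg fun u : Bits φ.coins => avg fun r : Bits R =>
  A.prob E D t (Sum.elim (t.h (t.samp u)) (E r (if b then t.samp u else fun _ => false)))
    (t.f (t.samp u))

/-- The answer is the verdict xor `fl`, so it is right iff the verdict equals `b ^^ fl`: to make the
answer right, `A` has to hit the target value in one case and to miss it in the other. -/
theorem sum_prob_adversary (fl b : Bool) :
    (∑ T, avg fun r : Bits R => (adversary A fl).prob E D T (E r (choose T b)) fun _ => b) =
      if (b ^^ fl) = true then winProb A E D b else 1 - winProb A E D b := by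
  have h₁ (r : Bits R) : (∑ T, (adversary A fl).prob E D T (E r (choose T b)) fun _ => b) =
      ∑ t : Template φ ℓ, avg fun u : Bits φ.coins => if (b ^^ fl) = true then
        A.prob E D t (Sum.elim (t.h (t.samp u)) (E r (if b then t.samp u else fun _ => false)))
          (t.f (t.samp u)) else A.firstProb E D t -
        A.prob E D t (Sum.elim (t.h (t.samp u)) (E r (if b then t.samp u else fun _ => false)))
          (t.f (t.samp u)) := by
    rw [TwoStage.sum_prob_of_run E D (adversary A fl) (run_pre A E D fl)
      (fun T => E r (choose T b)) (fun T _ => b), Fintype.sum_prod_type]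
    refine Finset.sum_congr rfl fun t _ => ?_
    rw [avg_bits]
    refine Finset.sum_congr rfl fun u _ => ?_
    rw [secondProb_adversary, choose_final]
    congr 1
    set v := E r (if b then t.samp u else fun _ => false)
    have h₂ := A.sum_prob E D t (Sum.elim (t.h (t.samp u)) v)
    change (∑ s, if (decide (s = t.f (t.samp u)) ^^ fl) = b then
      A.prob E D t (Sum.elim (t.h (t.samp u)) v) s else 0) = _
    -- The answers of `A` split into the target value and all others, on which the verdict is
    -- negative.
    rw [← h₂, ← Finset.sum_erase_eq_sub (Finset.mem_univ (t.f (t.samp u))),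
      ← Finset.add_sum_erase _ _ (Finset.mem_univ (t.f (t.samp u)))]
    have h₃ (s) (hs : s ∈ Finset.univ.erase (t.f (t.samp u))) :
        (decide (s = t.f (t.samp u)) ^^ fl) = fl := by
      rw [decide_eq_false (Finset.ne_of_mem_erase hs), Bool.false_xor]
    rw [Finset.sum_congr rfl fun s hs => by rw [h₃ s hs]]
    cases b <;> cases fl <;> simp
  rw [← avg_sum, funext h₁]
  by_cases hb : (b ^^ fl) = true
  · simp only [if_pos hb]
    rw [avg_sum, winProb]
    refine Finset.sum_congr rfl fun t _ => ?_
    rw [avg_comm]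
  · simp only [if_neg hb]
    rw [avg_sum, winProb, ← A.sum_firstProb E D, ← Finset.sum_sub_distrib]
    refine Finset.sum_congr rfl fun t _ => ?_
    rw [avg_comm]
    simp only [avg_sub, avg_const]

end Semantics

end IndOfSem

/-! ### Uniformity of the indistinguishability adversary -/

theorem PolyFun.getD {α β : Type} [Enc α] [Enc β] {l : α → List β} {i : α → ℕ} (hl : PolyFun l)
    (hi : PolyFun i) (d : β) : PolyFun fun a => (l a).getD (i a) d := by
  obtain ⟨p, hp⟩ := hl.sz_le
  have hsz (l : List β) (k : ℕ) : sz (List.tail^[k] l) ≤ sz l := by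
    induction k with
    | zero => exact le_rfl
    | succ k ih =>
      rw [Function.iterate_succ_apply']
      refine le_trans ?_ ih
      cases List.tail^[k] l <;> simp
      omega
  have key (l : List β) (k : ℕ) : (List.tail^[k] l).headD d = l.getD k d := by
    induction k generalizing l with
    | zero => cases l <;> rfl
    | succ k ih =>
      rw [Function.iterate_succ_apply, ih]
      cases l <;> rfl
  exact ((PolyFun.iterate (step := fun _ l => List.tail l) hi hl (by fun_prop)
    ⟨p, fun a k _ => (hsz (l a) k).trans (hp a)⟩).headD d).congr fun a => key _ _

@[fun_prop]
theorem PolyFun.loc {α : Type} [Enc α] {N r t j : α → ℕ} (hN : PolyFun N) (hr : PolyFun r)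
    (ht : PolyFun t) (hj : PolyFun j) : PolyFun fun a => loc (N a) (r a) (t a) (j a) := by
  unfold QCCA.loc
  fun_prop

theorem PolyFun.squareProg {N a G : ℕ → ℕ} {x inp : ℕ → ℕ → List ℕ} (k : ℕ) (hN : PolyFun N)
    (ha : PolyFun a) (hG : PolyFun G) (hx : PolyFun fun p : ℕ × ℕ => x p.1 p.2)
    (hinp : PolyFun fun p : ℕ × ℕ => inp p.1 p.2) :
    PolyFun fun n => squareProg (x n) (N n) k (inp n) (a n) (G n) := by
  have q₂ (f : ℕ × ℕ → ℕ) (hf : PolyFun f) : PolyFun fun p : ℕ × ℕ => x p.1 (f p) :=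
    hx.comp (by fun_prop : PolyFun fun p : ℕ × ℕ => (p.1, f p))
  have q₃ (f : (ℕ × ℕ) × ℕ → ℕ) (hf : PolyFun f) :
      PolyFun fun p : (ℕ × ℕ) × ℕ => x p.1.1 (f p) :=
    hx.comp (by fun_prop : PolyFun fun p : (ℕ × ℕ) × ℕ => (p.1.1, f p))
  have hw : PolyFun fun p : (ℕ × ℕ) × ℕ => circWire (inp p.1.1)
      (fun t => x p.1.1 (QCCA.loc (N p.1.1) (k + 5) t (N p.1.1 - 1))) (a p.1.1) p.2 := by
    unfold circWire
    refine PolyFun.cond (by fun_prop) (hinp.comp (by fun_prop : PolyFun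
      fun p : (ℕ × ℕ) × ℕ => (p.1.1, p.2))) (q₃ _ (by fun_prop))
  have p₁ : PolyFun fun p : ℕ × ℕ => (List.range (a p.1 + p.2)).flatMap fun j =>
      [(x p.1 (QCCA.loc (N p.1) k p.2 j), circWire (inp p.1)
          (fun t => x p.1 (QCCA.loc (N p.1) (k + 5) t (N p.1 - 1))) (a p.1) j,
          x p.1 (QCCA.loc (N p.1) (k + 5) p.2 (2 * j + 1))),
        (x p.1 (QCCA.loc (N p.1) (k + 5) p.2 (2 * j)),
          x p.1 (QCCA.loc (N p.1) (k + 5) p.2 (2 * j + 1)),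
          x p.1 (QCCA.loc (N p.1) (k + 5) p.2 (2 * (j + 1))))] := by
    refine PolyFun.flatMap (f := fun (p : ℕ × ℕ) j => [(x p.1 (QCCA.loc (N p.1) k p.2 j), _, _),
      (_, _, _)]) (by fun_prop) (PolyFun.cons ((q₃ _ ?_).mk (hw.mk (q₃ _ ?_)))
      (PolyFun.cons ((q₃ _ ?_).mk ((q₃ _ ?_).mk (q₃ _ ?_))) (PolyFun.const [])))
    all_goals fun_prop
  have p₂ : PolyFun fun p : ℕ × ℕ => [(x p.1 (QCCA.loc (N p.1) 5 0 0),
      x p.1 (QCCA.loc (N p.1) 5 0 1), x p.1 (QCCA.loc (N p.1) (k + 5) p.2 (2 * 0)))] := by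
    refine PolyFun.cons ((q₂ _ ?_).mk ((q₂ _ ?_).mk (q₂ _ ?_))) (PolyFun.const [])
    all_goals fun_prop
  have p₃ : PolyFun fun p : ℕ × ℕ => [(x p.1 (QCCA.loc (N p.1) 5 0 0),
      x p.1 (QCCA.loc (N p.1) (k + 5) p.2 (2 * (a p.1 + p.2))),
      x p.1 (QCCA.loc (N p.1) (k + 5) p.2 (N p.1 - 1)))] := by
    refine PolyFun.cons ((q₂ _ ?_).mk ((q₂ _ ?_).mk (q₂ _ ?_))) (PolyFun.const [])
    all_goals fun_prop
  exact (PolyFun.range hG).flatMap (f := fun n t => _ ++ _ ++ _) ((p₂.append p₁).append p₃)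

theorem PolyFun.compareProg {k : ℕ → ℕ} {one zero y : ℕ → List ℕ} {s f : ℕ → ℕ → List ℕ}
    {w : ℕ → ℕ → ℕ → List ℕ} (hone : PolyFun one) (hzero : PolyFun zero) (hy : PolyFun y)
    (hk : PolyFun k) (hs : PolyFun fun p : ℕ × ℕ => s p.1 p.2)
    (hf : PolyFun fun p : ℕ × ℕ => f p.1 p.2)
    (hw : PolyFun fun p : ℕ × ℕ × ℕ => w p.1 p.2.1 p.2.2) :
    PolyFun fun n => compareProg (one n) (zero n) (s n) (f n) (w n) (y n) (k n) := by
  have q₁ (i : ℕ → ℕ) (hi : PolyFun i) (j : ℕ) : PolyFun fun n => w n (i n) j :=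
    hw.comp (by fun_prop : PolyFun fun n : ℕ => (n, i n, j))
  have q₂ (i : ℕ × ℕ → ℕ) (hi : PolyFun i) (j : ℕ) : PolyFun fun p : ℕ × ℕ => w p.1 (i p) j :=
    hw.comp (by fun_prop : PolyFun fun p : ℕ × ℕ => (p.1, i p, j))
  have h₁ := q₂ (fun p => p.2) (by fun_prop) 3
  have h₂ (j : ℕ) := q₂ (fun p => p.2 + 1) (by fun_prop) j
  refine PolyFun.append (PolyFun.append (PolyFun.cons (hone.mk (hzero.mk (q₁ (fun _ => 0)
    (by fun_prop) 3))) (PolyFun.const [])) (PolyFun.flatMap (f := fun n i =>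
      [(_, _, _), (_, _, _), (_, _, _), (_, _, _)]) (by fun_prop) ?_))
    (PolyFun.cons (hone.mk ((q₁ k hk 3).mk hy)) (PolyFun.const []))
  exact (hs.mk (hf.mk (h₂ 0))).cons ((hf.mk (hs.mk (h₂ 1))).cons ((h₁.mk ((h₂ 0).mk (h₂ 2))).cons
    (((h₂ 2).mk ((h₂ 1).mk (h₂ 3))).cons (PolyFun.const []))))

namespace IndOfSem

/-- The name of a memory cell in the first stage. -/
def preCellName (N k : ℕ) : List ℕ := [1, min k (top N)]

/-- The name of a memory cell in the second stage. -/
def postCellName (N k : ℕ) : List ℕ := [0, 0, min k (top N)]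

/-- The renaming of the wires of the first stage. -/
def preName (N : ℕ) (nm : List ℕ) : List ℕ :=
  bif decide (nm.headD 0 = 1) then preCellName N (loc N 0 0 (nm.tail.headD 0)) else
    bif decide (nm.tail.headD 0 = 1) then
      preCellName N (loc N 3 (nm.tail.tail.headD 0) (nm.tail.tail.tail.headD 0)) else
      preCellName N (loc N (1 + nm.tail.tail.headD 0) (nm.tail.tail.tail.headD 0)
        (nm.tail.tail.tail.tail.headD 0))

/-- The renaming of the wires of the second stage. -/
def postName (N g : ℕ) (nm : List ℕ) : List ℕ :=
  bif decide (nm.headD 0 = 1) then nm else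
    bif decide (nm.tail.headD 0 = 0) then postCellName N (loc N 0 0 (nm.tail.tail.headD 0)) else
      bif decide (nm.tail.tail.headD 0 = 0) then
        postCellName N (loc N 7 (g + nm.tail.tail.tail.headD 0) (N - 1)) else
        [0, 1, nm.tail.tail.tail.headD 0]

section Describe

variable {ℓ c : ℕ} {φ : TemplateFormat}
variable (A : TwoStage ℓ c (φ.Idx ℓ) (Fin φ.hLen ⊕ Fin c) φ.fLen)

theorem name_preEmb (w) : WireName.name (preEmb A w) = preName (sd A) (WireName.name w) := by
  rcases w with ((i | i) | i) | i <;> rfl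

theorem name_postEmb (w) :
    WireName.name (postEmb A w) = postName (sd A) φ.hGates (WireName.name w) := by
  rcases w with (i | i | i) | i <;> rfl

theorem name_guess (i : ℕ) : WireName.name (guess A i) =
    (((List.ofFn A.out).map WireName.name).map (postName (sd A) φ.hGates)).getD i [0, 0, 0] := by
  by_cases hi : i < φ.fLen
  · rw [guess, dif_pos hi, name_postEmb, List.getD_eq_getElem _ _ (by simpa using hi)]
    simp
  · rw [guess, dif_neg hi, List.getD_eq_default _ _ (by simpa using hi)]
    change [0, 0, min 0 (top (sd A))] = _
    rw [Nat.zero_min]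

/-- Again the description is expressed by the pieces of that of `A`. The arrangement in squares
makes every address a polynomial expression in the side and the indices of a cell. -/
theorem describe_adversary (fl : Bool) : (adversary A fl).describe =
    [top (sd A) + 1, A.anc] ++
      ((A.pre.flatMap Gate.tokens).flatMap
        (fun τ => if τ.1 = 0 then preName (sd A) τ.2 else [τ.1]) ++
      ((List.range (3 * (sd A * sd A))).flatMap
        (fun k => 6 :: preCellName (sd A) (sd A * sd A + k)) ++
      ((3 :: preCellName (sd A) (loc (sd A) 5 0 0)) ++
      ((List.range φ.coins).flatMap (fun j => (1 :: preCellName (sd A) (loc (sd A) 4 0 j)) ++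
        (6 :: preCellName (sd A) (loc (sd A) 4 0 j))) ++
      ((squareProg (preCellName (sd A)) (sd A) 1 (fun j => preCellName (sd A) (loc (sd A) 4 0 j))
          φ.coins (φ.sampGates + ℓ)).flatMap instrDescr ++
      ((squareProg (preCellName (sd A)) (sd A) 2
          (fun j => preCellName (sd A) (loc (sd A) 6 (φ.sampGates + j) (sd A - 1)))
          ℓ (φ.hGates + φ.hLen)).flatMap instrDescr ++
      ((squareProg (preCellName (sd A)) (sd A) 3
          (fun j => preCellName (sd A) (loc (sd A) 6 (φ.sampGates + j) (sd A - 1)))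
          ℓ (φ.fGates + φ.fLen)).flatMap instrDescr ++
      (List.range ℓ).flatMap fun i => instrDescr
        (preCellName (sd A) (loc (sd A) 6 (φ.sampGates + i) (sd A - 1)),
          preCellName (sd A) (loc (sd A) 5 0 1), [0, 1, i])))))))) ++ [0] ++
      ((A.post.flatMap Gate.tokens).flatMap
        (fun τ => if τ.1 = 0 then postName (sd A) φ.hGates τ.2 else [τ.1]) ++
      (compareProg (postCellName (sd A) (loc (sd A) 5 0 0)) (postCellName (sd A) (loc (sd A) 5 0 1))
        (fun i => (((List.ofFn A.out).map WireName.name).map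
          (postName (sd A) φ.hGates)).getD i [0, 0, 0])
        (fun i => postCellName (sd A) (loc (sd A) 8 (φ.fGates + i) (sd A - 1)))
        (fun i j => postCellName (sd A) (loc (sd A) 9 i j))
        (postCellName (sd A) (loc (sd A) 10 0 0)) φ.fLen).flatMap instrDescr) ++ [0] ++
      postCellName (sd A) (bif fl then loc (sd A) 10 0 0 else loc (sd A) 9 φ.fLen 3) := by
  have h₁ := describe_map (preEmb A) (preName (sd A)) (name_preEmb A) A.pre
  have h₂ := describe_map (postEmb A) (postName (sd A) φ.hGates) (name_postEmb A) A.post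
  have h₃ := describe_andNot (ℓ := ℓ) (c := c) (straight_preProg A)
  have h₄ := describe_andNot (ℓ := ℓ) (c := c) (straight_postProg A)
  have h₅ : (measured A).flatMap (fun w => 6 :: WireName.name w) =
      (List.range (3 * (sd A * sd A))).flatMap
        (fun k => 6 :: preCellName (sd A) (sd A * sd A + k)) := by
    rw [measured, List.flatMap_map]
    rfl
  have h₆ : (((List.finRange φ.coins).flatMap fun j => tossCoin (coinEmb A j)).flatMap
      (Gate.describe (ℓ := ℓ) (c := c))) = (List.range φ.coins).flatMap
        (fun j => (1 :: preCellName (sd A) (loc (sd A) 4 0 j)) ++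
          (6 :: preCellName (sd A) (loc (sd A) 4 0 j))) := by
    rw [List.flatMap_assoc]
    exact ofFn_flatMap _ _ fun j => rfl
  have h₇ : ((copyMessage A).map (mapInstr WireName.name)).flatMap instrDescr =
      (List.range ℓ).flatMap fun i => instrDescr
        (preCellName (sd A) (loc (sd A) 6 (φ.sampGates + i) (sd A - 1)),
          preCellName (sd A) (loc (sd A) 5 0 1), [0, 1, i]) := by
    rw [copyMessage, List.flatMap_map, List.flatMap_map]
    exact ofFn_flatMap _ _ fun j => rfl
  have h₈ : wireList (adversary A fl).out =
      postCellName (sd A) (bif fl then loc (sd A) 10 0 0 else loc (sd A) 9 φ.fLen 3) := by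
    rw [wireList_eq _ (fun _ => postCellName (sd A)
      (bif fl then loc (sd A) 10 0 0 else loc (sd A) 9 φ.fLen 3)) fun i => rfl]
    exact List.append_nil _
  rw [TwoStage.describe, List.flatMap_append, h₃, List.flatMap_append, List.flatMap_append,
    List.flatMap_append, h₁, List.flatMap_append, h₂, h₄, describe_measureAll, h₅, h₆, h₈,
    List.map_append, List.flatMap_append, h₇, evalCircuits, List.map_append, List.map_append,
    map_squareProg, map_squareProg, map_squareProg, List.flatMap_append, List.flatMap_append,
    postProg, map_compareProg, funext (name_guess A)]
  simp only [List.append_assoc]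
  rfl

end Describe

set_option maxHeartbeats 1000000 in
theorem polyFun_describe {ℓ c : ℕ → ℕ} (φ : ℕ → TemplateFormat)
    (A : ∀ n, TwoStage (ℓ n) (c n) ((φ n).Idx (ℓ n)) (Fin (φ n).hLen ⊕ Fin (c n)) (φ n).fLen)
    (fl : Bool) (hℓ : PolyFun ℓ) (hc : PolyFun c)
    (hA : PolyFun fun n => (φ n).describe ++ (A n).describe) :
    PolyFun fun n => (adversary (A n) fl).describe := by
  obtain ⟨⟨k₁, k₂, k₃, k₄, k₅, k₆⟩, h₁, h₂, h₃, h₄, h₅⟩ := SimOfSem.polyFun_pieces φ A hℓ hc hA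
  refine PolyFun.congr ?_ fun n => (describe_adversary (A n) fl).symm
  have hN : PolyFun fun n => sd (A n) := by
    obtain ⟨mem, hmem⟩ : ∃ f : ℕ → ℕ, ∀ n, (A n).mem = f n := ⟨_, fun n => rfl⟩
    simp only [hmem] at h₁
    refine PolyFun.congr (f := fun n => mem n + 2 * ((φ n).coins + (φ n).hLen + (φ n).fLen +
      (φ n).sampGates + (φ n).hGates + (φ n).fGates + 2 * ℓ n) + 4) (by fun_prop) fun n => ?_
    rw [sd_eq, hmem]
  obtain ⟨N, hN'⟩ : ∃ f : ℕ → ℕ, ∀ n, sd (A n) = f n := ⟨_, fun n => rfl⟩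
  simp only [hN'] at hN ⊢
  have hpc : PolyFun fun p : ℕ × ℕ => preCellName (N p.1) p.2 := by
    unfold preCellName top
    fun_prop
  have hqc : PolyFun fun p : ℕ × ℕ => postCellName (N p.1) p.2 := by
    unfold postCellName top
    fun_prop
  have hpc₁ (f : ℕ → ℕ) (hf : PolyFun f) : PolyFun fun n => preCellName (N n) (f n) :=
    hpc.comp (by fun_prop : PolyFun fun n : ℕ => (n, f n))
  have hqc₁ (f : ℕ → ℕ) (hf : PolyFun f) : PolyFun fun n => postCellName (N n) (f n) :=
    hqc.comp (by fun_prop : PolyFun fun n : ℕ => (n, f n))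
  have hpc₂ (f : ℕ × ℕ → ℕ) (hf : PolyFun f) :
      PolyFun fun p : ℕ × ℕ => preCellName (N p.1) (f p) :=
    hpc.comp (by fun_prop : PolyFun fun p : ℕ × ℕ => (p.1, f p))
  have hqc₂ (f : ℕ × ℕ → ℕ) (hf : PolyFun f) :
      PolyFun fun p : ℕ × ℕ => postCellName (N p.1) (f p) :=
    hqc.comp (by fun_prop : PolyFun fun p : ℕ × ℕ => (p.1, f p))
  have hpre : PolyFun fun p : ℕ × List ℕ => preName (N p.1) p.2 := by
    unfold preName preCellName top
    fun_prop
  have hpost : PolyFun fun p : ℕ × List ℕ => postName (N p.1) (φ p.1).hGates p.2 := by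
    obtain ⟨g, hg⟩ : ∃ f : ℕ → ℕ, ∀ n, (φ n).hGates = f n := ⟨_, fun n => rfl⟩
    simp only [hg] at k₅ ⊢
    unfold postName postCellName top
    fun_prop
  have p₁ := h₃.retoken (r := fun n => preName (N n)) hpre
  have p₂ := h₄.retoken (r := fun n => postName (N n) (φ n).hGates) hpost
  have p₃ := (PolyFun.range (n := fun n => 3 * (N n * N n)) (by fun_prop)).flatMap
    (f := fun n k => 6 :: preCellName (N n) (N n * N n + k))
    (PolyFun.cons (by fun_prop) (hpc₂ _ (by fun_prop)))
  have hcoin := hpc₂ (fun p => loc (N p.1) 4 0 p.2) (by fun_prop)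
  have p₄ := (PolyFun.range k₁).flatMap (f := fun n j =>
    (1 :: preCellName (N n) (loc (N n) 4 0 j)) ++ (6 :: preCellName (N n) (loc (N n) 4 0 j)))
    (by fun_prop)
  have hsamp : PolyFun fun p : ℕ × ℕ =>
      preCellName (N p.1) (loc (N p.1) 6 ((φ p.1).sampGates + p.2) (N p.1 - 1)) := by
    obtain ⟨g, hg⟩ : ∃ f : ℕ → ℕ, ∀ n, (φ n).sampGates = f n := ⟨_, fun n => rfl⟩
    simp only [hg] at k₄ ⊢
    exact hpc₂ _ (by fun_prop)
  have p₅ := (PolyFun.squareProg (x := fun n => preCellName (N n))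
    (inp := fun n j => preCellName (N n) (loc (N n) 4 0 j)) 1 hN k₁ (k₄.add hℓ) hpc hcoin).flatMap
    (f := fun _ => instrDescr) (by fun_prop)
  have p₆ := (PolyFun.squareProg (x := fun n => preCellName (N n)) (inp := fun n j =>
    preCellName (N n) (loc (N n) 6 ((φ n).sampGates + j) (N n - 1))) 2 hN hℓ (k₅.add k₂) hpc hsamp).flatMap
    (f := fun _ => instrDescr) (by fun_prop)
  have p₇ := (PolyFun.squareProg (x := fun n => preCellName (N n)) (inp := fun n j =>
    preCellName (N n) (loc (N n) 6 ((φ n).sampGates + j) (N n - 1))) 3 hN hℓ (k₆.add k₃) hpc hsamp).flatMap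
    (f := fun _ => instrDescr) (by fun_prop)
  have hz := hpc₂ (fun p => loc (N p.1) 5 0 1) (by fun_prop)
  have p₈ := (PolyFun.range hℓ).flatMap (f := fun n i => instrDescr
    (preCellName (N n) (loc (N n) 6 ((φ n).sampGates + i) (N n - 1)),
      preCellName (N n) (loc (N n) 5 0 1), [0, 1, i])) (by fun_prop)
  have hguess : PolyFun fun p : ℕ × ℕ => (((List.ofFn (A p.1).out).map WireName.name).map
      (postName (N p.1) (φ p.1).hGates)).getD p.2 [0, 0, 0] :=
    PolyFun.getD ((h₅.map (f := fun n => postName (N n) (φ n).hGates) hpost).comp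
      (PolyFun.fst PolyFun.id)) (by fun_prop) _
  have htarget : PolyFun fun p : ℕ × ℕ =>
      postCellName (N p.1) (loc (N p.1) 8 ((φ p.1).fGates + p.2) (N p.1 - 1)) := by
    obtain ⟨g, hg⟩ : ∃ f : ℕ → ℕ, ∀ n, (φ n).fGates = f n := ⟨_, fun n => rfl⟩
    simp only [hg] at k₆ ⊢
    exact hqc₂ _ (by fun_prop)
  have p₉ := (PolyFun.compareProg (s := fun n i => (((List.ofFn (A n).out).map WireName.name).map
      (postName (N n) (φ n).hGates)).getD i [0, 0, 0])
    (f := fun n i => postCellName (N n) (loc (N n) 8 ((φ n).fGates + i) (N n - 1)))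
    (w := fun n i j => postCellName (N n) (loc (N n) 9 i j))
    (hqc₁ (fun n => loc (N n) 5 0 0) (by fun_prop)) (hqc₁ (fun n => loc (N n) 5 0 1) (by fun_prop))
    (hqc₁ (fun n => loc (N n) 10 0 0) (by fun_prop)) k₃ hguess htarget
    (hqc.comp (by fun_prop : PolyFun fun p : ℕ × ℕ × ℕ => (p.1, loc (N p.1) 9 p.2.1 p.2.2)))).flatMap
    (f := fun _ => instrDescr) (by fun_prop)
  have p₁₀ := hqc₁ (fun n => bif fl then loc (N n) 10 0 0 else loc (N n) 9 (φ n).fLen 3)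
    (by fun_prop)
  have p₁₁ := hpc₁ (fun n => loc (N n) 5 0 0) (by fun_prop)
  unfold top
  fun_prop

end IndOfSem

/-! ### Indistinguishability implies semantic security -/

theorem Negligible.abs {ε : ℕ → ℝ} (h : Negligible ε) : Negligible fun n => |ε n| :=
  Asymptotics.SuperpolynomialDecay.trans_abs_le h fun n => (abs_abs (ε n)).le

namespace Scheme

variable (S : Scheme)

/-- For `b = 1` the challenge encrypts the sampled message, as in the real game; for `b = 0` it
encrypts zero, which by `prob_simulator` is the game of the simulator. A right answer means that `A`
wins in one case and loses in the other, so the mean over `b` is `1/2` plus or minus half the gap.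
-/
theorem indWinProb_adversary {n : ℕ} {φ : TemplateFormat} (A : S.SemAdversary n φ) (fl : Bool) :
    S.indWinProb (IndOfSem.adversary A fl) = 1 / 2 + (if fl then -1 else 1) *
      ((S.semRealWinProb A - S.semSimWinProb (SimOfSem.simulator A)) / 2) := by
  have h₁ (z : Bits (S.keyCoins n)) := IndOfSem.sum_prob_adversary A (S.enc n (S.keyGen n z))
    (S.dec n (S.keyGen n z)) fl
  have h₂ : S.indWinProb (IndOfSem.adversary A fl) = avg fun z : Bits (S.keyCoins n) =>
      avg fun b : Bool => if (b ^^ fl) = true then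
        IndOfSem.winProb A (S.enc n (S.keyGen n z)) (S.dec n (S.keyGen n z)) b else
        1 - IndOfSem.winProb A (S.enc n (S.keyGen n z)) (S.dec n (S.keyGen n z)) b := by
    exact congrArg avg (funext fun z => congrArg avg (funext fun b => h₁ z b))
  have h₃ : S.semRealWinProb A = avg fun z : Bits (S.keyCoins n) =>
      IndOfSem.winProb A (S.enc n (S.keyGen n z)) (S.dec n (S.keyGen n z)) true := rfl
  have h₄ : S.semSimWinProb (SimOfSem.simulator A) = avg fun z : Bits (S.keyCoins n) =>
      IndOfSem.winProb A (S.enc n (S.keyGen n z)) (S.dec n (S.keyGen n z)) false := by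
    simp only [semSimWinProb, SimOfSem.prob_simulator]
    rfl
  have h₅ (f g : Bits (S.keyCoins n) → ℝ) (x : ℝ) : 1 / 2 + x * ((avg f - avg g) / 2) =
      avg fun z => 1 / 2 + x / 2 * (f z - g z) := by
    rw [avg_add, avg_const, avg_mul, avg_sub]
    ring
  rw [h₂, h₃, h₄, h₅]
  congr 1
  funext z
  rw [avg_bool]
  cases fl <;> simp <;> ring

theorem sem_of_ind (h : S.IND_QCCA1) : S.SEM_QCCA1 := by
  intro φ A hA
  have hℓ : PolyFun S.msgLen :=
    (PolyFun.headD (PolyUniform.iff_polyFun.1 S.msgLen_poly) 0).congr fun n => rfl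
  have hc : PolyFun S.ctLen :=
    (PolyFun.headD (PolyUniform.iff_polyFun.1 S.ctLen_poly) 0).congr fun n => rfl
  have hA' := PolyUniform.iff_polyFun.1 hA
  refine ⟨fun n => SimOfSem.simulator (A n), PolyUniform.iff_polyFun.2
    (SimOfSem.polyFun_describe φ A hℓ hc hA'), fun n t => ?_, ?_⟩
  · simp only [outputProb, SimOfSem.firstProb_simulator]
  -- Security bounds a winning probability from above only, so each sign of the gap needs its own
  -- adversary.
  · obtain ⟨ε, hε, hle⟩ := h (fun n => IndOfSem.adversary (A n) false) (PolyUniform.iff_polyFun.2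
      (IndOfSem.polyFun_describe φ A false hℓ hc hA'))
    obtain ⟨δ, hδ, hle'⟩ := h (fun n => IndOfSem.adversary (A n) true) (PolyUniform.iff_polyFun.2
      (IndOfSem.polyFun_describe φ A true hℓ hc hA'))
    -- The factor 2 undoes the halving of the gap. The sum of absolute values dominates both bounds,
    -- which need not be nonnegative themselves.
    refine ((hε.abs.add hδ.abs).const_mul 2).trans_abs_le fun n => ?_
    have h₁ := hle n
    have h₂ := hle' n
    rw [indWinProb_adversary] at h₁ h₂
    simp only [Bool.false_eq_true, if_false, if_true] at h₁ h₂
    have h₃ := le_abs_self (ε n)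
    have h₄ := le_abs_self (δ n)
    have h₅ := abs_nonneg (ε n)
    have h₆ := abs_nonneg (δ n)
    refine le_trans ?_ (le_abs_self _)
    rw [abs_abs, abs_le]
    simp only [Pi.add_apply]
    constructor <;> linarith

end Scheme

end QCCA

end

theorem mainTheorem9 (S : QCCA.Scheme) : S.IND_QCCA1 ↔ S.SEM_QCCA1 :=
  ⟨S.sem_of_ind, S.ind_of_sem⟩
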